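/- **Model.** A *pixel* is a point of $\mathbb Z^2$; two pixels are adjacent if they have distance $1$, and they form a diagonal pair if both coordinates differ by exactly $1$. A *polyomino* is a finite nonempty connected set $P\subset\mathbb Z^2$ of tiles such that any two tiles of $P$ that form a diagonal pair have a common neighbour in $P$. Its boundary $\partial P$ is the set of tiles of $P$ that are adjacent to, or form a diagonal pair with, a pixel not in $P$. Its bounding box $R(P)$ is the smallest axis-parallel rectangle of pixels containing $P$, with height $h$ and width $w$. A *robot* is a deterministic finite automaton. In each step its state and the state (empty/occupied) of its current pixel determine either that it terminates, or its new state, the new state of the current pixel, and a direction up, down, left or right in which it moves by one pixel. Started on a tile of $P$, its *number of steps* is the number of steps until termination; its number of *auxiliary tiles* is the maximum number of tiles on the grid at any time minus $|P|$; its *additional space* is the number of visited pixels outside $R(P)$. The string $S(P)$ over $\{0,1,\sqcup\}$ is $S_1\sqcup S_2\sqcup S_3$, where $S_1$ and $S_2$ are $h$ and $w$ in binary (most significant bit first) and $S_3=b_1\dots b_{wh}$ with $b_i=1$ if and only if the $i$-th pixel of $R(P)$ belongs to $P$; here the pixels of $R(P)$ are listed in decreasing lexicographic order with the $y$-coordinate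 having priority over the $x$-coordinate. A *Turing machine* $M$ has finitely many states, one two-way infinite tape, and a finite alphabet containing $0$, $1$ and the blank $\sqcup$; in each step it moves its head by one cell or writes one symbol. It *transforms* a string $x$ into a string $y$ if, started with its head on the first letter of $x$ on an otherwise blank tape, it halts with $y$ written somewhere on an otherwise blank tape. Its number of steps until halting is $T_{TM}$. Its additional space $S_{TM}$ is the number of cells that it uses in addition to merely reading its input: the visited cells outside the input, and the cells of the input whose content it changes at some time. **Theorem.** For every Turing machine $M$ there are a robot $\mathcal R$ and a constant $C$, both depending only on $M$, such that the following holds for all polyominoes $P_1,P_2$ with $|P_1|=|P_2|=N$. If $M$ transforms $S(P_1)$ into $S(P_2)$, with $T_{TM}$ steps and additional space $S_{TM}$ on the input $S(P_1)$, then $\mathcal R$, started on any tile of $P_1$, terminates with the set of tiles being a translate of $P_2$. It uses at most $C\,(|\partial P_1|+|\partial P_2|+S_{TM})$ auxiliary tiles, at most $C\,(N^4+T_{TM})$ steps, and additional space $A$ with $N^2+S_{TM}\le C\,A$ and $A\le C\,(N^2+S_{TM})$, that is, $O(|\partial P_1|+|\partial P_2|+S_{TM})$ auxiliary tiles, $O(N^4+T_{TM})$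 steps and $\Theta(N^2+S_{TM})$ additional space. -/

import Mathlib

namespace TileRobot

/-! ### Pixels and polyominoes -/

/-- A pixel of the infinite square grid, as `(x, y)`. -/
abbrev Pixel : Type := ℤ × ℤ

/-- The grid graph on `ℤ²`: pixels are joined when they are at unit distance. -/
def grid : SimpleGraph Pixel where
  Adj p q := |p.1 - q.1| + |p.2 - q.2| = 1
  symm := ⟨fun p q h => by
    rw [abs_sub_comm q.1 p.1, abs_sub_comm q.2 p.2]; exact h⟩
  loopless := ⟨fun p h => by simp at h⟩

/-- Two pixels that touch in a corner only. -/
def DiagonalPair (p q : Pixel) : Prop := |p.1 - q.1| = 1 ∧ |p.2 - q.2| = 1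

/-- A polyomino: a finite, nonempty, connected set of tiles in which any two diagonally touching
tiles have a common neighbouring tile. (`Connected` includes nonemptiness; the field `nonempty`
only makes it available directly.) -/
structure Polyomino where
  tiles : Finset Pixel
  nonempty : tiles.Nonempty
  connected : (grid.induce (tiles : Set Pixel)).Connected
  diagonal : ∀ p ∈ tiles, ∀ q ∈ tiles, DiagonalPair p q →
    ∃ r ∈ tiles, grid.Adj r p ∧ grid.Adj r q

namespace Polyomino

variable (P : Polyomino)

open Classical in
/-- The boundary `∂P`: the tiles that are adjacent to, or form a diagonal pair with, an empty
pixel. -/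
noncomputable def boundary : Finset Pixel :=
  P.tiles.filter fun p => ∃ q, q ∉ P.tiles ∧ (grid.Adj p q ∨ DiagonalPair p q)

def xMin : ℤ := P.tiles.inf' P.nonempty Prod.fst
def xMax : ℤ := P.tiles.sup' P.nonempty Prod.fst
def yMin : ℤ := P.tiles.inf' P.nonempty Prod.snd
def yMax : ℤ := P.tiles.sup' P.nonempty Prod.snd

/-- The number of columns of the smallest enclosing rectangle. -/
def width : ℕ := (P.xMax - P.xMin + 1).toNat

/-- The number of rows of the smallest enclosing rectangle. -/
def height : ℕ := (P.yMax - P.yMin + 1).toNat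

/-- The set of pixels of the smallest enclosing axis-parallel rectangle. -/
noncomputable def box : Finset Pixel := Finset.Icc (P.xMin, P.yMin) (P.xMax, P.yMax)

/-- The occupancy bits of the pixels of the smallest enclosing rectangle, in decreasing
lexicographic order, `y` having priority over `x`: rows from top to bottom, and each row from
right to left. -/
def bitmap : List Bool :=
  (List.range P.height).flatMap fun j =>
    (List.range P.width).map fun i => decide ((P.xMax - (i : ℤ), P.yMax - (j : ℤ)) ∈ P.tiles)

/-- Binary representation of a natural number, most significant bit first. -/
def binary (n : ℕ) : List Bool := n.bits.reverse

/-- The string `S(P) = S₁ ⊔ S₂ ⊔ S₃`: height in binary, width in binary, bitmap. The letters `1`,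
`0` and `⊔` are `some true`, `some false` and `none`. -/
def encode : List (Option Bool) :=
  (binary P.height).map some ++ none :: (binary P.width).map some ++ none :: P.bitmap.map some

/-- `A` is a translate of the polyomino `P`. -/
def IsTranslate (A : Finset Pixel) : Prop :=
  ∃ v : Pixel, A = P.tiles.image (fun p => p + v)

end Polyomino

/-! ### Runs of deterministic machines -/

section Run

variable {σ : Type*}

/-- The configuration after `n` steps from `a`; a halted configuration (`step` gives `none`)
is kept. -/
def runFor (step : σ → Option σ) (a : σ) (n : ℕ) : σ := (fun c => (step c).getD c)^[n] a

/-- Started in `a`, the machine terminates after exactly `t` steps. -/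
def HaltsIn (step : σ → Option σ) (a : σ) (t : ℕ) : Prop :=
  IsLeast {n | step (runFor step a n) = none} t

end Run

/-! ### Turing machines (single two-way infinite tape) -/

section TM

open Turing

variable {Γ Λ : Type*} [Inhabited Γ] [Inhabited Λ]

/-- A configuration of a Turing machine together with the absolute position of its head. -/
abbrev TMConfig (Γ Λ : Type*) [Inhabited Γ] [Inhabited Λ] := TM0.Cfg Γ Λ × ℤ

/-- The change of the head position that a statement causes. -/
def headShift : TM0.Stmt Γ → ℤ
  | .move .left => -1
  | .move .right => 1
  | .write _ => 0

/-- One step of `M`, recording the absolute head position. -/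
def tmStep (M : TM0.Machine Γ Λ) (c : TMConfig Γ Λ) : Option (TMConfig Γ Λ) :=
  (M c.1.q c.1.Tape.head).bind fun s =>
    (TM0.step M c.1).map fun c' => (c', c.2 + headShift s.2)

/-- Initial configuration: the input `x` stands on the cells `0, …, |x| - 1`, all other cells are
blank, and the head is on cell `0`. -/
def tmInit (x : List Γ) : TMConfig Γ Λ := (TM0.init x, 0)

/-- The content of the tape cell with absolute position `i`. -/
def cell (c : TMConfig Γ Λ) (i : ℤ) : Γ := c.1.Tape.nth (i - c.2)

/-- `M` transforms the string `x` into the string `y` in exactly `t` steps: on input `x` it halts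
after `t` steps, and then the inscription of the tape is `y` (anywhere on the tape), with blanks
everywhere else. -/
def TransformsIn (M : TM0.Machine Γ Λ) (x y : List Γ) (t : ℕ) : Prop :=
  HaltsIn (tmStep M) (tmInit x) t ∧
    ∃ k : ℤ, ∀ i : ℤ,
      cell (runFor (tmStep M) (tmInit x) t) (k + i) = cell (tmInit y : TMConfig Γ Λ) i

open Classical in
/-- The cells that `M`, run for `t` steps on input `x`, uses in addition to reading its input: the
visited cells that lie outside the input, and the visited cells of the input whose content is
changed at some time. Input cells that are only read do not count. -/
noncomputable def additionalCells (M : TM0.Machine Γ Λ) (x : List Γ) (t : ℕ) : Finset ℤ :=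
  ((Finset.range (t + 1)).image fun n => (runFor (tmStep M) (tmInit x) n).2).filter fun i =>
    ¬ (0 ≤ i ∧ i < x.length) ∨
      ∃ n ≤ t, cell (runFor (tmStep M) (tmInit x) n) i ≠ cell (tmInit x : TMConfig Γ Λ) i

/-- The additional space used by `M` during `t` steps on input `x`. -/
noncomputable def tmAdditionalSpace (M : TM0.Machine Γ Λ) (x : List Γ) (t : ℕ) : ℕ :=
  (additionalCells M x t).card

end TM

/-! ### The robot -/

/-- The direction of a move of the robot. -/
inductive Direction
  | up | down | left | right

/-- The pixel reached from `p` by one step in a direction. -/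
def Direction.move : Direction → Pixel → Pixel
  | .up, p => (p.1, p.2 + 1)
  | .down, p => (p.1, p.2 - 1)
  | .left, p => (p.1 - 1, p.2)
  | .right, p => (p.1 + 1, p.2)

/-- A robot with state set `Q`: from its state and the state of the current pixel (`true` for
occupied) it computes its new state, the new state of the current pixel and the direction of its
move; `none` means that it terminates. -/
structure Robot (Q : Type*) where
  start : Q
  δ : Q → Bool → Option (Q × Bool × Direction)

/-- State and location of the robot, and the set of occupied pixels. -/
structure RobotConfig (Q : Type*) where
  state : Q
  pos : Pixel
  tiles : Finset Pixel

namespace Robot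

variable {Q : Type*} (R : Robot Q)

/-- One look-compute-move step. -/
def step (c : RobotConfig Q) : Option (RobotConfig Q) :=
  (R.δ c.state (decide (c.pos ∈ c.tiles))).map fun r =>
    { state := r.1
      pos := r.2.2.move c.pos
      tiles := if r.2.1 then insert c.pos c.tiles else c.tiles.erase c.pos }

/-- The robot in its start state on pixel `s`, on the given polyomino. -/
def init (P : Polyomino) (s : Pixel) : RobotConfig Q := ⟨R.start, s, P.tiles⟩

/-- The configuration after `n` steps. -/
def config (P : Polyomino) (s : Pixel) (n : ℕ) : RobotConfig Q := runFor R.step (R.init P s) n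

/-- Tile complexity of the first `t` steps: the maximum number of tiles on the grid minus the
number of tiles of the input polyomino. -/
def auxiliaryTiles (P : Polyomino) (s : Pixel) (t : ℕ) : ℕ :=
  ((Finset.range (t + 1)).sup fun n => (R.config P s n).tiles.card) - P.tiles.card

/-- Space complexity of the first `t` steps: the number of visited pixels outside the bounding box
of the input polyomino. -/
noncomputable def additionalSpace (P : Polyomino) (s : Pixel) (t : ℕ) : ℕ :=
  (((Finset.range (t + 1)).image fun n => (R.config P s n).pos) \ P.box).card

end Robot

end TileRobot

open TileRobot

namespace TileRobot

/-! ### Finite controls and their composition -/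

/-! The robot turns part of the plane into a tape and runs the Turing machine there. A tape cell is
a column of constant height in a horizontal strip above the polyomino. A blank cell is an empty
column; any other symbol is a single tile whose height in the column encodes the symbol (`Rep`). The
bit 0 is stored as a blank cell, so the bitmap of a polyomino occupies exactly as many tiles as the
polyomino has (`Polyomino.cnt_bitmap`), however large the bounding box is.

Finding the bounding box: a rectangle around the starting tile is delimited by four marks. A mark is
a 2×2 block with two diagonal tiles and no common neighbour, which is exactly the pattern that
cannot occur in a polyomino, so marks can be recognized; the four overwritten blocks are kept in the
finite control. A side is pushed outward while the line next to it contains a tile. When all four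
lines are clear, connectedness shows that the rectangle is the bounding box (`growBox_spec`).

Reading: the pixels of the box are scanned in the order of the bitmap. A tile that is read is
removed, and a one is appended to the tape, so the total number of tiles stays |P₁| plus the digits
of two binary counters and a constant. The counters for width and height stand to the left of the
home cell. In the end the tape, read from left to right, is the string S(P₁) (`readAll_spec`,
`map_letterOf_tape`).

Simulating: the tape cells of the Turing machine are input cells that still have their initial
content, or flagged cells; a flagged cell counts in the additional space of the machine (`SimInv`).
So there are at most S_TM + 2 further nonblank cells (`SimInv.wt_le`). Afterwards the tape is
normalized to the width and the bitmap of P₂ (`SimInv.normalize`).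

Building: the bits are popped from the right end of the tape and written above the strip, rows from
below and each row from left to right. Again tiles are only exchanged between the tape and the
polyomino (`build_spec`).

Resources: width and height are at most |∂P| (`Polyomino.width_le`, `Polyomino.height_le`), which
gives the bound on auxiliary tiles. There are at most N² pixels to read and to write, and each costs
O(N²) steps. The robot stays in surroundings of size O(N²), a strip of length O(N² + S_TM) and the
building site. For the lower bound on space, the strip alone may be too short, so the robot also
walks through a triangle with one row per tile; and each additional cell of the Turing machine
leaves a tile in the strip, hence a visited pixel outside the box.

The robot is composed from finite controls. `Spec` is total correctness with an invariant, the
running time and the set of visited positions; the invariant bounds the region and the number of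
tiles. `compile_spec` carries such statements from the tape to the strip, and `Mach.Trace.robot`
from controls to robots. -/

/-- A finite control that reads letters of `A`, writes letters of `A`, moves in directions of `D`
and finally returns a value of type `α`. -/
structure Mach (A D α : Type) where
  Q : Type
  fin : Finite Q
  start : Q
  δ : Q → A → α ⊕ (Q × A × D)

/-- Random access memory whose cells are the positions; `go` moves between positions. -/
class Arena (Pos Mem : Type) (A D : outParam Type) where
  get : Mem → Pos → A
  set : Mem → Pos → A → Mem
  go : D → Pos → Pos
  set_get : ∀ m p, set m p (get m p) = m

@[ext] structure World (Pos Mem : Type) where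
  pos : Pos
  mem : Mem

namespace World
variable {Pos Mem A D : Type} [Arena Pos Mem A D]

def cur (w : World Pos Mem) : A := Arena.get w.mem w.pos

def act (w : World Pos Mem) (s : A) (d : D) : World Pos Mem :=
  ⟨Arena.go (Mem := Mem) (A := A) d w.pos, Arena.set w.mem w.pos s⟩

end World

namespace Mach

section Combinators
variable {A D α β σ : Type}

/-- Return a value at once. -/
def ret (a : α) : Mach A D α := ⟨Unit, inferInstance, (), fun _ _ => .inl a⟩

/-- Return the letter of the current cell. -/
def look : Mach A D A := ⟨Unit, inferInstance, (), fun _ s => .inl s⟩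

/-- Write a letter and move. -/
def act (s : A) (d : D) : Mach A D Unit :=
  ⟨Bool, inferInstance, false, fun q _ => if q then .inl () else .inr (true, s, d)⟩

/-- Move and keep the letter. -/
def mv (d : D) : Mach A D Unit :=
  ⟨Bool, inferInstance, false, fun q s => if q then .inl () else .inr (true, s, d)⟩

/-- The values that a control can return. -/
def outputs (m : Mach A D α) : Set α := {a | ∃ q s, m.δ q s = .inl a}

instance [Finite A] (m : Mach A D α) : Finite m.outputs := by
  have := m.fin
  have h : m.outputs = Sum.inl ⁻¹' Set.range fun x : m.Q × A => m.δ x.1 x.2 := by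
    ext a; simp [outputs]
  rw [h]
  exact (Set.finite_range _).preimage Sum.inl_injective.injOn

/-- Sequential composition. -/
def bind' [Finite A] (m : Mach A D α) (k : α → Mach A D β) : Mach A D β where
  -- Only values that `m` can return are indices, so the state set is finite even if `α` is
  -- infinite.
  Q := m.Q ⊕ (Σ a : m.outputs, (k a).Q)
  fin := by
    have := m.fin
    have := fun a => (k a).fin
    infer_instance
  start := .inl m.start
  δ := fun q s => match q with
    | .inl q => match h : m.δ q s with
      -- Returning takes no step: `k a` acts at once on the letter on which `m` has returned.
      | .inl a => ((k a).δ (k a).start s).map id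
          (fun x => (.inr ⟨⟨a, q, s, h⟩, x.1⟩, x.2))
      | .inr x => .inr (.inl x.1, x.2)
    | .inr ⟨a, q⟩ => ((k a).δ q s).map id (fun x => (.inr ⟨a, x.1⟩, x.2))

instance [Finite A] : Monad (Mach A D) where
  pure := ret
  bind := bind'

/-- Repeat `body`, as long as it returns a new loop state together with a letter to write and a
direction to move in. -/
def iter [Finite σ] (body : σ → Mach A D ((σ × A × D) ⊕ β)) (a : σ) : Mach A D β where
  Q := Σ a : σ, (body a).Q
  fin := by
    have := fun a => (body a).fin
    infer_instance
  start := ⟨a, (body a).start⟩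
  δ := fun q s => match (body q.1).δ q.2 s with
    -- Each round ends with a genuine step. A body that could return without moving might be
    -- restarted forever in one transition, and `δ` would not be well defined.
    | .inl (.inl x) => .inr (⟨x.1, (body x.1).start⟩, x.2)
    | .inl (.inr b) => .inl b
    | .inr x => .inr (⟨q.1, x.1⟩, x.2)

/-- Move at least once in direction `d`, until the letter satisfies `p`. -/
def seek [Finite A] (p : A → Bool) (d : D) : Mach A D Unit := do
  mv d
  iter (fun _ : Unit => do
    let s ← look
    match p s with
    | true => pure (.inr ())
    | false => pure (.inl ((), s, d))) ()

end Combinators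

/-! ### Runs -/

section Runs
variable {Pos Mem A D α β σ : Type} [Arena Pos Mem A D]

/-- A run from a state of the control: the list of all worlds before the last one, the returned
value, and the last world. -/
inductive Trace (m : Mach A D α) :
    m.Q → World Pos Mem → List (World Pos Mem) → α → World Pos Mem → Prop
  | done {q w a} : m.δ q w.cur = .inl a → Trace m q w [] a w
  | step {q w q' s d tr a w'} : m.δ q w.cur = .inr (q', s, d) →
      Trace m q' (w.act s d) tr a w' → Trace m q w (w :: tr) a w'

/-- Started in a world `w` with the invariant `I`, the control returns, `I` holds all the time, and
`Post` holds for the value, the last world, the number of steps and the set of the positions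
visited before the last step. -/
def Spec (I : World Pos Mem → Prop) (m : Mach A D α) (w : World Pos Mem)
    (Post : α → World Pos Mem → ℕ → Set Pos → Prop) : Prop :=
  I w → ∃ tr a w', Trace m m.start w tr a w' ∧ (∀ x ∈ tr, I x) ∧ I w' ∧
    Post a w' tr.length {p | ∃ x ∈ tr, x.pos = p}

variable {I J : World Pos Mem → Prop} {w : World Pos Mem}

theorem Spec.mono {m : Mach A D α} {Post Post' : α → World Pos Mem → ℕ → Set Pos → Prop}
    (h : Spec I m w Post) (hP : ∀ a w' t U, I w' → Post a w' t U → Post' a w' t U) :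
    Spec I m w Post' := fun hw => by
  obtain ⟨tr, a, w', h1, h2, h3, h4⟩ := h hw
  exact ⟨tr, a, w', h1, h2, h3, hP _ _ _ _ h3 h4⟩

theorem Spec.mono_inv {m : Mach A D α} {Post : α → World Pos Mem → ℕ → Set Pos → Prop}
    (hI : I w) (hJ : ∀ w, I w → J w) (h : Spec I m w Post) :
    Spec J m w Post := fun _ => by
  obtain ⟨tr, a, w', h1, h2, h3, h4⟩ := h hI
  exact ⟨tr, a, w', h1, fun x hx => hJ _ (h2 x hx), hJ _ h3, h4⟩

theorem Spec.ret {a : α} {Post : α → World Pos Mem → ℕ → Set Pos → Prop}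
    (h : Post a w 0 ∅) : Spec I (Mach.ret a : Mach A D α) w Post := fun hw =>
  ⟨[], a, w, .done rfl, by simp, hw, by simpa using h⟩

theorem Spec.pure [Finite A] {a : α} {Post : α → World Pos Mem → ℕ → Set Pos → Prop}
    (h : Post a w 0 ∅) : Spec I (pure a : Mach A D α) w Post := Spec.ret h

theorem Spec.look {Post : A → World Pos Mem → ℕ → Set Pos → Prop}
    (h : Post w.cur w 0 ∅) : Spec I (Mach.look : Mach A D A) w Post := fun hw =>
  ⟨[], w.cur, w, .done rfl, by simp, hw, by simpa using h⟩

theorem Spec.act {s : A} {d : D} {Post : Unit → World Pos Mem → ℕ → Set Pos → Prop}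
    (hI : I (w.act s d)) (h : Post () (w.act s d) 1 {w.pos}) :
    Spec I (Mach.act s d : Mach A D Unit) w Post := fun hw =>
  ⟨[w], (), w.act s d, .step (q' := true) rfl (.done rfl), by simpa using hw, hI, by
    have e : {p | ∃ x ∈ [w], x.pos = p} = {w.pos} := by ext; simp [eq_comm]
    rw [e]; exact h⟩

theorem World.act_cur (w : World Pos Mem) (d : D) :
    w.act w.cur d = ⟨Arena.go (Mem := Mem) (A := A) d w.pos, w.mem⟩ := by
  simp [World.act, World.cur, Arena.set_get]

theorem Spec.mv {d : D} {Post : Unit → World Pos Mem → ℕ → Set Pos → Prop}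
    (hI : I ⟨Arena.go (Mem := Mem) (A := A) d w.pos, w.mem⟩)
    (h : Post () ⟨Arena.go (Mem := Mem) (A := A) d w.pos, w.mem⟩ 1 {w.pos}) :
    Spec I (Mach.mv d : Mach A D Unit) w Post := fun hw => by
  rw [← World.act_cur] at h hI
  exact ⟨[w], (), w.act w.cur d, .step (q' := true) rfl (.done rfl), by simpa using hw, hI, by
    have e : {p | ∃ x ∈ [w], x.pos = p} = {w.pos} := by ext; simp [eq_comm]
    rw [e]; exact h⟩

theorem Trace.bind_right [Finite A] {m : Mach A D α} {k : α → Mach A D β} {a : m.outputs}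
    {q : (k a).Q} {tr : List (World Pos Mem)} {b : β} {w' : World Pos Mem}
    (h : Trace (k a) q w tr b w') : Trace (m >>= k) (.inr ⟨a, q⟩) w tr b w' := by
  induction h with
  | done h => exact .done (by simp [Bind.bind, bind', h])
  | step h _ ih => exact .step (by simp only [Bind.bind, bind', h]; rfl) ih

/-- The configuration in which `m` returns is also the first configuration of `k a`, in the same
world. Hence the two lists of worlds are simply concatenated. -/
theorem Trace.bind [Finite A] {m : Mach A D α} {k : α → Mach A D β} {q : m.Q}
    {tr tr' : List (World Pos Mem)} {a : α} {b : β} {w' w'' : World Pos Mem}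
    (h : Trace m q w tr a w') (h' : Trace (k a) (k a).start w' tr' b w'') :
    Trace (m >>= k) (.inl q) w (tr ++ tr') b w'' := by
  induction h with
  | @done q w a h =>
    have key : ((m >>= k : Mach A D β).δ (.inl q) w.cur) = ((k a).δ (k a).start w.cur).map id
          (fun x => (.inr ⟨⟨a, q, w.cur, h⟩, x.1⟩, x.2)) := by
      simp only [Bind.bind, bind']
      split
      · rename_i h1; rw [h] at h1; cases h1; rfl
      · rename_i h1; rw [h] at h1; cases h1
    cases h' with
    | done h2 => exact .done (by rw [key, h2]; rfl)
    | step h2 h3 => exact .step (by rw [key, h2]; rfl) (Trace.bind_right h3)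
  | @step q w q' s d tr a w' h _ ih =>
    refine .step ?_ (ih h')
    simp only [Bind.bind, bind']
    split
    · rename_i h1; rw [h] at h1; cases h1
    · rename_i h1; rw [h] at h1; cases h1; rfl

/-- Postconditions are nested in the style of weakest preconditions: the continuation is analysed in
the world where `m` has ended, times add up, and visited sets are united. -/
theorem Spec.bind [Finite A] {m : Mach A D α} {k : α → Mach A D β}
    {Post : β → World Pos Mem → ℕ → Set Pos → Prop}
    (h : Spec I m w fun a w' t U =>
      Spec I (k a) w' fun b w'' t' U' => Post b w'' (t + t') (U ∪ U')) :
    Spec I (m >>= k) w Post := fun hw => by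
  obtain ⟨tr, a, w', h1, h2, h3, h4⟩ := h hw
  obtain ⟨tr', b, w'', h1', h2', h3', h4'⟩ := h4 h3
  refine ⟨tr ++ tr', b, w'', h1.bind h1', ?_, h3', ?_⟩
  · intro x hx
    rcases List.mem_append.1 hx with hx | hx
    exacts [h2 x hx, h2' x hx]
  · convert h4' using 1
    · simp
    · ext p; simp only [List.mem_append, Set.mem_ofPred_eq, Set.mem_union]
      constructor
      · rintro ⟨x, hx | hx, rfl⟩
        exacts [.inl ⟨x, hx, rfl⟩, .inr ⟨x, hx, rfl⟩]
      · rintro (⟨x, hx, rfl⟩ | ⟨x, hx, rfl⟩)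
        exacts [⟨x, .inl hx, rfl⟩, ⟨x, .inr hx, rfl⟩]

theorem Trace.iter_done [Finite σ] {body : σ → Mach A D ((σ × A × D) ⊕ β)} {a a₀ : σ}
    {q : (body a).Q} {tr : List (World Pos Mem)} {r : (σ × A × D) ⊕ β} {b : β}
    {w' : World Pos Mem} (h : Trace (body a) q w tr r w') (hr : r = .inr b) :
    Trace (iter body a₀) ⟨a, q⟩ w tr b w' := by
  induction h with
  | done h => exact .done (by simp [iter, h, hr])
  | step h _ ih => exact .step (by simp only [iter, h]) (ih hr)

theorem Trace.iter_loop [Finite σ] {body : σ → Mach A D ((σ × A × D) ⊕ β)} {a a' a₀ : σ}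
    {q : (body a).Q} {tr tr' : List (World Pos Mem)} {r : (σ × A × D) ⊕ β} {s : A} {d : D} {b : β}
    {w' w'' : World Pos Mem} (h : Trace (body a) q w tr r w') (hr : r = .inl (a', s, d))
    (h' : Trace (iter body a₀) ⟨a', (body a').start⟩ (w'.act s d) tr' b w'') :
    Trace (iter body a₀) ⟨a, q⟩ w (tr ++ w' :: tr') b w'' := by
  induction h with
  | done h => exact .step (by simp only [iter, h, hr]) h'
  | step h _ ih => exact .step (by simp only [iter, h]) (ih hr h')

/-- The initial loop state enters only the start state, not the transitions. -/
theorem Trace.iter_start [Finite σ] {body : σ → Mach A D ((σ × A × D) ⊕ β)} {a₀ a₁ : σ}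
    {q : (iter body a₀).Q} {tr : List (World Pos Mem)} {b : β}
    {w' : World Pos Mem} (h : Trace (iter body a₀) q w tr b w') :
    Trace (iter body a₁) q w tr b w' := by
  induction h with
  | done h => exact .done h
  | step h _ ih => exact .step h ih

/-- Unfolds a single round. Termination is left to the user, who applies it inside an induction on
some variant. -/
theorem Spec.iter [Finite σ] {body : σ → Mach A D ((σ × A × D) ⊕ β)} {a : σ}
    {Post : β → World Pos Mem → ℕ → Set Pos → Prop}
    (h : Spec I (body a) w fun r w' t U => match r with
      | .inr b => Post b w' t U
      | .inl (a', s, d) => I (w'.act s d) ∧ Spec I (Mach.iter body a') (w'.act s d)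
          fun b w'' t' U' => Post b w'' (t + 1 + t') (insert w'.pos U ∪ U')) :
    Spec I (Mach.iter body a) w Post := fun hw => by
  obtain ⟨tr, r, w', h1, h2, h3, h4⟩ := h hw
  match r, h1, h4 with
  | .inr b, h1, h4 => exact ⟨tr, b, w', h1.iter_done rfl, h2, h3, h4⟩
  | .inl (a', s, d), h1, h4 =>
    obtain ⟨hI, h4⟩ := h4
    obtain ⟨tr', b, w'', h1', h2', h3', h4'⟩ := h4 hI
    refine ⟨tr ++ w' :: tr', b, w'', h1.iter_loop rfl h1'.iter_start, ?_, h3', ?_⟩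
    · intro x hx
      rcases List.mem_append.1 hx with hx | hx
      · exact h2 x hx
      · rcases List.mem_cons.1 hx with rfl | hx
        exacts [h3, h2' x hx]
    · convert h4' using 1
      · simp; omega
      · ext p
        simp only [List.mem_append, List.mem_cons, Set.mem_ofPred_eq, Set.mem_union,
          Set.mem_insert_iff]
        constructor
        · rintro ⟨x, hx | rfl | hx, rfl⟩
          exacts [.inl (.inr ⟨x, hx, rfl⟩), .inl (.inl rfl), .inr ⟨x, hx, rfl⟩]
        · rintro ((rfl | ⟨x, hx, rfl⟩) | ⟨x, hx, rfl⟩)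
          exacts [⟨w', .inr (.inl rfl), rfl⟩, ⟨x, .inl hx, rfl⟩, ⟨x, .inr (.inr hx), rfl⟩]

/-- Seeking along a path `f 0 = w.pos, f 1, …, f n` whose first letter satisfying `p` is the one
of `f n`. -/
theorem Spec.seek [Finite A] {p : A → Bool} {d : D} (n : ℕ) (f : ℕ → Pos) (hn : 0 < n)
    (h0 : f 0 = w.pos) (hf : ∀ i < n, Arena.go (Mem := Mem) (A := A) d (f i) = f (i + 1))
    (hp : ∀ i, 0 < i → i < n → p (Arena.get w.mem (f i)) = false)
    (hpn : p (Arena.get w.mem (f n)) = true) (hI : ∀ i, 0 < i → i ≤ n → I ⟨f i, w.mem⟩)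
    {Post : Unit → World Pos Mem → ℕ → Set Pos → Prop}
    (h : Post () ⟨f n, w.mem⟩ n (f '' Set.Iio n)) :
    Spec I (Mach.seek p d : Mach A D Unit) w Post := by
  -- Induction on the number `k` of positions that are left on the path.
  have key : ∀ k i, i + k = n → 0 < i →
      Spec I (Mach.iter (fun _ : Unit => do
        let s ← (Mach.look : Mach A D A)
        match p s with
        | true => Pure.pure (.inr ())
        | false => Pure.pure (.inl ((), s, d))) ()) ⟨f i, w.mem⟩
        fun b w' t U => w' = ⟨f n, w.mem⟩ ∧ i + t = n ∧ U = f '' Set.Ico i n := by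
    intro k
    induction k with
    | zero =>
      intro i hi h0
      obtain rfl : i = n := by omega
      refine Spec.iter (Spec.bind (Spec.look ?_))
      simp only [World.cur, hpn]
      exact Spec.pure (by simp)
    | succ k ih =>
      intro i hi h0
      refine Spec.iter (Spec.bind (Spec.look ?_))
      simp only [World.cur, hp i h0 (by omega)]
      refine Spec.pure ?_
      simp only [World.act, Arena.set_get, hf i (by omega)]
      refine ⟨hI _ (by omega) (by omega), (ih (i + 1) (by omega) (by omega)).mono ?_⟩
      rintro _ w' t U - ⟨h1, h2, h3⟩
      refine ⟨h1, by omega, ?_⟩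
      subst h3
      ext x
      simp only [Set.mem_union, Set.mem_insert_iff, Set.mem_empty_iff_false, or_false,
        Set.mem_image, Set.mem_Ico]
      constructor
      · rintro (rfl | ⟨j, hj, rfl⟩)
        exacts [⟨i, by omega, rfl⟩, ⟨j, by omega, rfl⟩]
      · rintro ⟨j, hj, rfl⟩
        by_cases hji : j = i
        · subst hji; simp
        · exact .inr ⟨j, by omega, rfl⟩
  refine Spec.bind (Spec.mv ?_ ?_)
  · rw [← h0, hf 0 hn]; exact hI 1 one_pos hn
  · rw [← h0, hf 0 hn]
    refine (key (n - 1) 1 (by omega) one_pos).mono ?_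
    rintro _ w' t U - ⟨rfl, h2, rfl⟩
    have e : {f 0} ∪ f '' Set.Ico 1 n = f '' Set.Iio n := by
      ext x
      simp only [Set.mem_union, Set.mem_singleton_iff, Set.mem_image, Set.mem_Ico, Set.mem_Iio]
      constructor
      · rintro (rfl | ⟨j, hj, rfl⟩)
        exacts [⟨0, hn, rfl⟩, ⟨j, by omega, rfl⟩]
      · rintro ⟨j, hj, rfl⟩
        by_cases hj0 : j = 0
        · subst hj0; exact .inl rfl
        · exact .inr ⟨j, by omega, rfl⟩
    rw [e, h2]; exact h

end Runs
end Mach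
end TileRobot

namespace TileRobot
open Mach

/-! ### The robot on the grid -/

instance : Arena Pixel (Finset Pixel) Bool Direction where
  get T p := decide (p ∈ T)
  set T p b := if b then insert p T else T.erase p
  go := Direction.move
  set_get T p := by by_cases h : p ∈ T <;> simp [h]

/-- The invariant that the robot is in a rectangle and that there are at most `K` tiles. -/
def Box (x₀ x₁ y₀ y₁ : ℤ) (K : ℕ) (w : World Pixel (Finset Pixel)) : Prop :=
  x₀ ≤ w.pos.1 ∧ w.pos.1 ≤ x₁ ∧ y₀ ≤ w.pos.2 ∧ w.pos.2 ≤ y₁ ∧ w.mem.card ≤ K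

theorem Box.mk {x₀ x₁ y₀ y₁ : ℤ} {K : ℕ} {x y : ℤ} {T : Finset Pixel}
    (h : x₀ ≤ x ∧ x ≤ x₁ ∧ y₀ ≤ y ∧ y ≤ y₁ ∧ T.card ≤ K) : Box x₀ x₁ y₀ y₁ K ⟨(x, y), T⟩ := h

/-! ### Rules for single moves and straight searches on the grid. -/

namespace Mach
namespace Spec

variable {I : World Pixel (Finset Pixel) → Prop} {x y : ℤ} {T : Finset Pixel}

theorem lookTrue {Post : Bool → World Pixel (Finset Pixel) → ℕ → Set Pixel → Prop}
    (hT : (x, y) ∈ T) (h : Post true ⟨(x, y), T⟩ 0 ∅) :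
    Spec I (Mach.look : Mach Bool Direction Bool) ⟨(x, y), T⟩ Post :=
  Spec.look (by simpa [World.cur, Arena.get, hT] using h)

theorem lookFalse {Post : Bool → World Pixel (Finset Pixel) → ℕ → Set Pixel → Prop}
    (hT : (x, y) ∉ T) (h : Post false ⟨(x, y), T⟩ 0 ∅) :
    Spec I (Mach.look : Mach Bool Direction Bool) ⟨(x, y), T⟩ Post :=
  Spec.look (by simpa [World.cur, Arena.get, hT] using h)

theorem lookDecide {Post : Bool → World Pixel (Finset Pixel) → ℕ → Set Pixel → Prop}
    {p : Pixel} (h : Post (decide (p ∈ T)) ⟨p, T⟩ 0 ∅) :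
    Spec I (Mach.look : Mach Bool Direction Bool) ⟨p, T⟩ Post :=
  Spec.look (by simpa [World.cur, Arena.get] using h)

variable {Post : Unit → World Pixel (Finset Pixel) → ℕ → Set Pixel → Prop}

theorem move {d : Direction} {p : Pixel} (hI : I ⟨d.move p, T⟩) (h : Post () ⟨d.move p, T⟩ 1 {p}) :
    Spec I (Mach.mv d : Mach Bool Direction Unit) ⟨p, T⟩ Post := Spec.mv hI h

/-- The new tile set is passed on only by its membership condition and its cardinality. Long
programs then leave goals about coordinates and numbers, not about nested insertions and deletions.
-/
theorem put {d : Direction} (hT : (x, y) ∉ T)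
    (h : ∀ T' : Finset Pixel, (∀ u v, (u, v) ∈ T' ↔ u = x ∧ v = y ∨ (u, v) ∈ T) →
      T'.card = T.card + 1 → I ⟨d.move (x, y), T'⟩ ∧ Post () ⟨d.move (x, y), T'⟩ 1 {(x, y)}) :
    Spec I (Mach.act true d : Mach Bool Direction Unit) ⟨(x, y), T⟩ Post :=
  have := h (insert (x, y) T) (by simp) (by simp [hT])
  Spec.act this.1 this.2

theorem erase {d : Direction} (hT : (x, y) ∈ T)
    (h : ∀ T' : Finset Pixel, (∀ u v, (u, v) ∈ T' ↔ ¬ (u = x ∧ v = y) ∧ (u, v) ∈ T) →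
      T'.card + 1 = T.card → I ⟨d.move (x, y), T'⟩ ∧ Post () ⟨d.move (x, y), T'⟩ 1 {(x, y)}) :
    Spec I (Mach.act false d : Mach Bool Direction Unit) ⟨(x, y), T⟩ Post :=
  have := h (T.erase (x, y)) (by simp) (Finset.card_erase_add_one hT)
  Spec.act this.1 this.2

theorem keep {d : Direction} {b : Bool} {p : Pixel} (hT : decide (p ∈ T) = b)
    (hI : I ⟨d.move p, T⟩) (h : Post () ⟨d.move p, T⟩ 1 {p}) :
    Spec I (Mach.act b d : Mach Bool Direction Unit) ⟨p, T⟩ Post := by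
  have e : (⟨p, T⟩ : World Pixel (Finset Pixel)).act b d = ⟨d.move p, T⟩ := by
    subst hT; exact World.act_cur _ _
  exact Spec.act (by rwa [e]) (by rwa [e])

/-- The new coordinate is a variable with an equation, so that positions stay in a normal form
chosen by the caller instead of growing into sums. -/
theorem moveRight {x' : ℤ} (e : x' = x + 1) (hI : I ⟨(x', y), T⟩)
    (h : Post () ⟨(x', y), T⟩ 1 {(x, y)}) :
    Spec I (Mach.mv .right : Mach Bool Direction Unit) ⟨(x, y), T⟩ Post := by
  subst e; exact move hI h

theorem putRight {x' : ℤ} (hT : (x, y) ∉ T) (e : x' = x + 1)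
    (h : ∀ T' : Finset Pixel, (∀ u v, (u, v) ∈ T' ↔ u = x ∧ v = y ∨ (u, v) ∈ T) →
      T'.card = T.card + 1 → I ⟨(x', y), T'⟩ ∧ Post () ⟨(x', y), T'⟩ 1 {(x, y)}) :
    Spec I (Mach.act true .right : Mach Bool Direction Unit) ⟨(x, y), T⟩ Post := by
  subst e; exact put hT h

theorem eraseRight {x' : ℤ} (hT : (x, y) ∈ T) (e : x' = x + 1)
    (h : ∀ T' : Finset Pixel, (∀ u v, (u, v) ∈ T' ↔ ¬ (u = x ∧ v = y) ∧ (u, v) ∈ T) →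
      T'.card + 1 = T.card → I ⟨(x', y), T'⟩ ∧ Post () ⟨(x', y), T'⟩ 1 {(x, y)}) :
    Spec I (Mach.act false .right : Mach Bool Direction Unit) ⟨(x, y), T⟩ Post := by
  subst e; exact erase hT h

theorem moveLeft {x' : ℤ} (e : x' = x - 1) (hI : I ⟨(x', y), T⟩)
    (h : Post () ⟨(x', y), T⟩ 1 {(x, y)}) :
    Spec I (Mach.mv .left : Mach Bool Direction Unit) ⟨(x, y), T⟩ Post := by
  subst e; exact move hI h

theorem putLeft {x' : ℤ} (hT : (x, y) ∉ T) (e : x' = x - 1)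
    (h : ∀ T' : Finset Pixel, (∀ u v, (u, v) ∈ T' ↔ u = x ∧ v = y ∨ (u, v) ∈ T) →
      T'.card = T.card + 1 → I ⟨(x', y), T'⟩ ∧ Post () ⟨(x', y), T'⟩ 1 {(x, y)}) :
    Spec I (Mach.act true .left : Mach Bool Direction Unit) ⟨(x, y), T⟩ Post := by
  subst e; exact put hT h

theorem eraseLeft {x' : ℤ} (hT : (x, y) ∈ T) (e : x' = x - 1)
    (h : ∀ T' : Finset Pixel, (∀ u v, (u, v) ∈ T' ↔ ¬ (u = x ∧ v = y) ∧ (u, v) ∈ T) →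
      T'.card + 1 = T.card → I ⟨(x', y), T'⟩ ∧ Post () ⟨(x', y), T'⟩ 1 {(x, y)}) :
    Spec I (Mach.act false .left : Mach Bool Direction Unit) ⟨(x, y), T⟩ Post := by
  subst e; exact erase hT h

theorem moveUp {y' : ℤ} (e : y' = y + 1) (hI : I ⟨(x, y'), T⟩)
    (h : Post () ⟨(x, y'), T⟩ 1 {(x, y)}) :
    Spec I (Mach.mv .up : Mach Bool Direction Unit) ⟨(x, y), T⟩ Post := by
  subst e; exact move hI h

theorem putUp {y' : ℤ} (hT : (x, y) ∉ T) (e : y' = y + 1)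
    (h : ∀ T' : Finset Pixel, (∀ u v, (u, v) ∈ T' ↔ u = x ∧ v = y ∨ (u, v) ∈ T) →
      T'.card = T.card + 1 → I ⟨(x, y'), T'⟩ ∧ Post () ⟨(x, y'), T'⟩ 1 {(x, y)}) :
    Spec I (Mach.act true .up : Mach Bool Direction Unit) ⟨(x, y), T⟩ Post := by
  subst e; exact put hT h

theorem eraseUp {y' : ℤ} (hT : (x, y) ∈ T) (e : y' = y + 1)
    (h : ∀ T' : Finset Pixel, (∀ u v, (u, v) ∈ T' ↔ ¬ (u = x ∧ v = y) ∧ (u, v) ∈ T) →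
      T'.card + 1 = T.card → I ⟨(x, y'), T'⟩ ∧ Post () ⟨(x, y'), T'⟩ 1 {(x, y)}) :
    Spec I (Mach.act false .up : Mach Bool Direction Unit) ⟨(x, y), T⟩ Post := by
  subst e; exact erase hT h

theorem moveDown {y' : ℤ} (e : y' = y - 1) (hI : I ⟨(x, y'), T⟩)
    (h : Post () ⟨(x, y'), T⟩ 1 {(x, y)}) :
    Spec I (Mach.mv .down : Mach Bool Direction Unit) ⟨(x, y), T⟩ Post := by
  subst e; exact move hI h

theorem putDown {y' : ℤ} (hT : (x, y) ∉ T) (e : y' = y - 1)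
    (h : ∀ T' : Finset Pixel, (∀ u v, (u, v) ∈ T' ↔ u = x ∧ v = y ∨ (u, v) ∈ T) →
      T'.card = T.card + 1 → I ⟨(x, y'), T'⟩ ∧ Post () ⟨(x, y'), T'⟩ 1 {(x, y)}) :
    Spec I (Mach.act true .down : Mach Bool Direction Unit) ⟨(x, y), T⟩ Post := by
  subst e; exact put hT h

theorem eraseDown {y' : ℤ} (hT : (x, y) ∈ T) (e : y' = y - 1)
    (h : ∀ T' : Finset Pixel, (∀ u v, (u, v) ∈ T' ↔ ¬ (u = x ∧ v = y) ∧ (u, v) ∈ T) →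
      T'.card + 1 = T.card → I ⟨(x, y'), T'⟩ ∧ Post () ⟨(x, y'), T'⟩ 1 {(x, y)}) :
    Spec I (Mach.act false .down : Mach Bool Direction Unit) ⟨(x, y), T⟩ Post := by
  subst e; exact erase hT h

/-- The visited segment is recorded exactly, since such a search sweeps each row of the triangle
that yields the lower bound on space. -/
theorem seekRight (x' : ℤ) (hlt : x < x') (hT : ∀ u, x < u → u < x' → (u, y) ∉ T)
    (hT' : (x', y) ∈ T) (hI : ∀ u, x < u → u ≤ x' → I ⟨(u, y), T⟩)
    (h : Post () ⟨(x', y), T⟩ (x' - x).toNat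
      {p | x ≤ p.1 ∧ p.1 < x' ∧ p.2 = y}) :
    Spec I (Mach.seek id .right : Mach Bool Direction Unit) ⟨(x, y), T⟩ Post := by
  have e : x + (((x' - x).toNat : ℕ) : ℤ) = x' := by omega
  refine Spec.seek (x' - x).toNat (fun i : ℕ => (x + (i : ℤ), y)) (by omega) (by simp) ?_ ?_ ?_ ?_ ?_
  · intro i _
    refine Prod.ext ?_ ?_ <;> simp [Arena.go, Direction.move] <;> ring
  · intro i h0 hi; simpa [Arena.get] using hT _ (by omega) (by omega)
  · simpa only [Arena.get, e, id, decide_eq_true_eq] using hT'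
  · intro i h0 hi; exact hI _ (by omega) (by omega)
  · convert h using 1
    · simp only [e]
    · ext p
      simp only [Set.mem_image, Set.mem_Iio, Set.mem_ofPred_eq]
      constructor
      · rintro ⟨i, hi, rfl⟩
        dsimp only
        omega
      · rintro hp
        exact ⟨(p.1 - x).toNat, by omega, Prod.ext (by dsimp only; omega) (by dsimp only; omega)⟩

theorem seekLeft (x' : ℤ) (hlt : x' < x) (hT : ∀ u, x' < u → u < x → (u, y) ∉ T)
    (hT' : (x', y) ∈ T) (hI : ∀ u, x' ≤ u → u < x → I ⟨(u, y), T⟩)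
    (h : Post () ⟨(x', y), T⟩ (x - x').toNat
      {p | x' < p.1 ∧ p.1 ≤ x ∧ p.2 = y}) :
    Spec I (Mach.seek id .left : Mach Bool Direction Unit) ⟨(x, y), T⟩ Post := by
  have e : x - (((x - x').toNat : ℕ) : ℤ) = x' := by omega
  refine Spec.seek (x - x').toNat (fun i : ℕ => (x - (i : ℤ), y)) (by omega) (by simp) ?_ ?_ ?_ ?_ ?_
  · intro i _
    refine Prod.ext ?_ ?_ <;> simp [Arena.go, Direction.move] <;> ring
  · intro i h0 hi; simpa [Arena.get] using hT _ (by omega) (by omega)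
  · simpa only [Arena.get, e, id, decide_eq_true_eq] using hT'
  · intro i h0 hi; exact hI _ (by omega) (by omega)
  · convert h using 1
    · simp only [e]
    · ext p
      simp only [Set.mem_image, Set.mem_Iio, Set.mem_ofPred_eq]
      constructor
      · rintro ⟨i, hi, rfl⟩
        dsimp only
        omega
      · rintro hp
        exact ⟨(x - p.1).toNat, by omega, Prod.ext (by dsimp only; omega) (by dsimp only; omega)⟩

theorem seekUp (y' : ℤ) (hlt : y < y') (hT : ∀ u, y < u → u < y' → (x, u) ∉ T)
    (hT' : (x, y') ∈ T) (hI : ∀ u, y < u → u ≤ y' → I ⟨(x, u), T⟩)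
    (h : Post () ⟨(x, y'), T⟩ (y' - y).toNat
      {p | y ≤ p.2 ∧ p.2 < y' ∧ p.1 = x}) :
    Spec I (Mach.seek id .up : Mach Bool Direction Unit) ⟨(x, y), T⟩ Post := by
  have e : y + (((y' - y).toNat : ℕ) : ℤ) = y' := by omega
  refine Spec.seek (y' - y).toNat (fun i : ℕ => (x, y + (i : ℤ))) (by omega) (by simp) ?_ ?_ ?_ ?_ ?_
  · intro i _
    refine Prod.ext ?_ ?_ <;> simp [Arena.go, Direction.move] <;> ring
  · intro i h0 hi; simpa [Arena.get] using hT _ (by omega) (by omega)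
  · simpa only [Arena.get, e, id, decide_eq_true_eq] using hT'
  · intro i h0 hi; exact hI _ (by omega) (by omega)
  · convert h using 1
    · simp only [e]
    · ext p
      simp only [Set.mem_image, Set.mem_Iio, Set.mem_ofPred_eq]
      constructor
      · rintro ⟨i, hi, rfl⟩
        dsimp only
        omega
      · rintro hp
        exact ⟨(p.2 - y).toNat, by omega, Prod.ext (by dsimp only; omega) (by dsimp only; omega)⟩

theorem seekDown (y' : ℤ) (hlt : y' < y) (hT : ∀ u, y' < u → u < y → (x, u) ∉ T)
    (hT' : (x, y') ∈ T) (hI : ∀ u, y' ≤ u → u < y → I ⟨(x, u), T⟩)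
    (h : Post () ⟨(x, y'), T⟩ (y - y').toNat
      {p | y' < p.2 ∧ p.2 ≤ y ∧ p.1 = x}) :
    Spec I (Mach.seek id .down : Mach Bool Direction Unit) ⟨(x, y), T⟩ Post := by
  have e : y - (((y - y').toNat : ℕ) : ℤ) = y' := by omega
  refine Spec.seek (y - y').toNat (fun i : ℕ => (x, y - (i : ℤ))) (by omega) (by simp) ?_ ?_ ?_ ?_ ?_
  · intro i _
    refine Prod.ext ?_ ?_ <;> simp [Arena.go, Direction.move] <;> ring
  · intro i h0 hi; simpa [Arena.get] using hT _ (by omega) (by omega)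
  · simpa only [Arena.get, e, id, decide_eq_true_eq] using hT'
  · intro i h0 hi; exact hI _ (by omega) (by omega)
  · convert h using 1
    · simp only [e]
    · ext p
      simp only [Set.mem_image, Set.mem_Iio, Set.mem_ofPred_eq]
      constructor
      · rintro ⟨i, hi, rfl⟩
        dsimp only
        omega
      · rintro hp
        exact ⟨(y - p.2).toNat, by omega, Prod.ext (by dsimp only; omega) (by dsimp only; omega)⟩

end Spec
end Mach
end TileRobot

namespace TileRobot
namespace Polyomino

/-! ### Elementary facts about polyominoes -/

variable (P : Polyomino)

theorem le_of_mem {u v : ℤ} (h : (u, v) ∈ P.tiles) :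
    P.xMin ≤ u ∧ u ≤ P.xMax ∧ P.yMin ≤ v ∧ v ≤ P.yMax :=
  ⟨Finset.inf'_le Prod.fst h, Finset.le_sup' Prod.fst h, Finset.inf'_le Prod.snd h,
    Finset.le_sup' Prod.snd h⟩

theorem exists_xMin : ∃ v, (P.xMin, v) ∈ P.tiles := by
  obtain ⟨⟨u, v⟩, h, e⟩ := P.tiles.exists_mem_eq_inf' P.nonempty Prod.fst
  exact ⟨v, by rw [xMin, e]; exact h⟩

theorem exists_xMax : ∃ v, (P.xMax, v) ∈ P.tiles := by
  obtain ⟨⟨u, v⟩, h, e⟩ := P.tiles.exists_mem_eq_sup' P.nonempty Prod.fst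
  exact ⟨v, by rw [xMax, e]; exact h⟩

theorem exists_yMin : ∃ u, (u, P.yMin) ∈ P.tiles := by
  obtain ⟨⟨u, v⟩, h, e⟩ := P.tiles.exists_mem_eq_inf' P.nonempty Prod.snd
  exact ⟨u, by rw [yMin, e]; exact h⟩

theorem exists_yMax : ∃ u, (u, P.yMax) ∈ P.tiles := by
  obtain ⟨⟨u, v⟩, h, e⟩ := P.tiles.exists_mem_eq_sup' P.nonempty Prod.snd
  exact ⟨u, by rw [yMax, e]; exact h⟩

theorem xMin_le : P.xMin ≤ P.xMax := by
  obtain ⟨v, h⟩ := P.exists_xMin; exact (P.le_of_mem h).2.1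

theorem yMin_le : P.yMin ≤ P.yMax := by
  obtain ⟨v, h⟩ := P.exists_yMin; exact (P.le_of_mem h).2.2.2

theorem width_eq : (P.width : ℤ) = P.xMax - P.xMin + 1 := by
  have := P.xMin_le; unfold width; omega

theorem height_eq : (P.height : ℤ) = P.yMax - P.yMin + 1 := by
  have := P.yMin_le; unfold height; omega

theorem width_pos : 0 < P.width := by have := P.xMin_le; have := P.width_eq; omega

theorem height_pos : 0 < P.height := by have := P.yMin_le; have := P.height_eq; omega

/-- A property of one tile that passes to adjacent tiles holds for all tiles. -/
theorem induction_adj {p : Pixel → Prop} {s : Pixel} (hs : s ∈ P.tiles) (h0 : p s)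
    (h : ∀ q ∈ P.tiles, ∀ r ∈ P.tiles, grid.Adj q r → p q → p r) :
    ∀ q ∈ P.tiles, p q := by
  intro q hq
  have := P.connected.preconnected ⟨s, hs⟩ ⟨q, hq⟩
  rw [SimpleGraph.reachable_iff_reflTransGen] at this
  have key : ∀ x, Relation.ReflTransGen (grid.induce (P.tiles : Set Pixel)).Adj ⟨s, hs⟩ x →
      p x.1 := by
    intro x hx
    induction hx with
    | refl => exact h0
    | @tail y z _ hyz ih => exact h y.1 y.2 z.1 z.2 hyz ih
  exact key _ this

theorem adj_iff {u v u' v' : ℤ} : grid.Adj (u, v) (u', v') ↔ |u - u'| + |v - v'| = 1 := Iff.rfl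

/-- A rectangle that contains a tile, and whose neighbouring lines are empty, contains all tiles. -/
theorem subset_of_clear {a b c e : ℤ} {s : Pixel} (hs : s ∈ P.tiles)
    (hs' : a ≤ s.1 ∧ s.1 ≤ b ∧ c ≤ s.2 ∧ s.2 ≤ e)
    (h1 : ∀ u, a ≤ u → u ≤ b → (u, c - 1) ∉ P.tiles) (h2 : ∀ u, a ≤ u → u ≤ b → (u, e + 1) ∉ P.tiles)
    (h3 : ∀ v, c ≤ v → v ≤ e → (a - 1, v) ∉ P.tiles)
    (h4 : ∀ v, c ≤ v → v ≤ e → (b + 1, v) ∉ P.tiles) :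
    a ≤ P.xMin ∧ P.xMax ≤ b ∧ c ≤ P.yMin ∧ P.yMax ≤ e := by
  have key := P.induction_adj (p := fun q => a ≤ q.1 ∧ q.1 ≤ b ∧ c ≤ q.2 ∧ q.2 ≤ e) hs hs' ?_
  · obtain ⟨_, k1⟩ := P.exists_xMin
    obtain ⟨_, k2⟩ := P.exists_xMax
    obtain ⟨_, k3⟩ := P.exists_yMin
    obtain ⟨_, k4⟩ := P.exists_yMax
    exact ⟨(key _ k1).1, (key _ k2).2.1, (key _ k3).2.2.1, (key _ k4).2.2.2⟩
  · rintro ⟨u, v⟩ hq ⟨u', v'⟩ hr hadj ⟨k1, k2, k3, k4⟩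
    rw [adj_iff] at hadj
    dsimp only at k1 k2 k3 k4 ⊢
    by_contra hcon
    have : (u' = u ∧ v' = c - 1) ∨ (u' = u ∧ v' = e + 1) ∨ (v' = v ∧ u' = a - 1) ∨
        (v' = v ∧ u' = b + 1) := by grind
    rcases this with ⟨rfl, rfl⟩ | ⟨rfl, rfl⟩ | ⟨rfl, rfl⟩ | ⟨rfl, rfl⟩
    exacts [h1 _ k1 k2 hr, h2 _ k1 k2 hr, h3 _ k3 k4 hr, h4 _ k3 k4 hr]

/-- The forbidden pattern: two diagonally touching tiles without common neighbouring tile. -/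
theorem not_pattern {u v : ℤ} (h1 : (u, v) ∈ P.tiles) (h2 : (u + 1, v) ∉ P.tiles)
    (h3 : (u + 1, v + 1) ∈ P.tiles) (h4 : (u, v + 1) ∉ P.tiles) : False := by
  obtain ⟨⟨u', v'⟩, hr, k1, k2⟩ := P.diagonal _ h1 _ h3 ⟨by simp, by simp⟩
  rw [adj_iff] at k1 k2
  have : (u' = u + 1 ∧ v' = v) ∨ (u' = u ∧ v' = v + 1) := by grind
  rcases this with ⟨rfl, rfl⟩ | ⟨rfl, rfl⟩
  exacts [h2 hr, h4 hr]

/-- An adjacency changes the column by at most one, so it cannot jump over an empty column. By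
connectedness all tiles would lie to the left of it, against the tile in column `xMax`. -/
theorem exists_column {u : ℤ} (h1 : P.xMin ≤ u) (h2 : u ≤ P.xMax) : ∃ v, (u, v) ∈ P.tiles := by
  by_contra! hcon
  obtain ⟨v, hv⟩ := P.exists_xMin
  have key := P.induction_adj (p := fun q => q.1 < u) hv
    (lt_of_le_of_ne h1 fun h => hcon v (h ▸ hv)) ?_
  · obtain ⟨v, hv⟩ := P.exists_xMax
    have := key _ hv
    dsimp only at this; omega
  · rintro ⟨u', v'⟩ hq ⟨u'', v''⟩ hr hadj hlt
    rw [adj_iff] at hadj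
    dsimp only at hlt ⊢
    have : u'' ≠ u := fun h => hcon v'' (h ▸ hr)
    grind

theorem exists_row {v : ℤ} (h1 : P.yMin ≤ v) (h2 : v ≤ P.yMax) : ∃ u, (u, v) ∈ P.tiles := by
  by_contra! hcon
  obtain ⟨u, hu⟩ := P.exists_yMin
  have key := P.induction_adj (p := fun q => q.2 < v) hu
    (lt_of_le_of_ne h1 fun h => hcon u (h ▸ hu)) ?_
  · obtain ⟨u, hu⟩ := P.exists_yMax
    have := key _ hu
    dsimp only at this; omega
  · rintro ⟨u', v'⟩ hq ⟨u'', v''⟩ hr hadj hlt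
    rw [adj_iff] at hadj
    dsimp only at hlt ⊢
    have : v'' ≠ v := fun h => hcon u'' (h ▸ hr)
    grind

/-- Otherwise one could climb from a tile forever, beyond `yMax`. -/
theorem exists_top {u : ℤ} (h1 : P.xMin ≤ u) (h2 : u ≤ P.xMax) :
    ∃ v, (u, v) ∈ P.tiles ∧ (u, v + 1) ∉ P.tiles := by
  obtain ⟨v, hv⟩ := P.exists_column h1 h2
  by_contra! hcon
  have : ∀ n : ℕ, (u, v + n) ∈ P.tiles := by
    intro n
    induction n with
    | zero => simpa using hv
    | succ n ih => have := hcon _ ih; rwa [add_assoc] at this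
  have h3 := this (P.yMax - v + 1).toNat
  have h4 := P.le_of_mem h3
  have h5 := P.le_of_mem hv
  omega

theorem exists_end {v : ℤ} (h1 : P.yMin ≤ v) (h2 : v ≤ P.yMax) :
    ∃ u, (u, v) ∈ P.tiles ∧ (u + 1, v) ∉ P.tiles := by
  obtain ⟨u, hu⟩ := P.exists_row h1 h2
  by_contra! hcon
  have : ∀ n : ℕ, (u + n, v) ∈ P.tiles := by
    intro n
    induction n with
    | zero => simpa using hu
    | succ n ih => have := hcon _ ih; rwa [add_assoc] at this
  have h3 := this (P.xMax - u + 1).toNat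
  have h4 := P.le_of_mem h3
  have h5 := P.le_of_mem hu
  omega

/-- Each column of the box contributes a boundary tile of its own, namely one with an empty pixel
above it. This pays for everything whose size is linear in the width. -/
theorem width_le : P.width ≤ P.boundary.card := by
  choose! f hf hf' using fun (u : ℤ) (h : P.xMin ≤ u ∧ u ≤ P.xMax) => P.exists_top h.1 h.2
  have : (Finset.Icc P.xMin P.xMax).card ≤ P.boundary.card := by
    refine Finset.card_le_card_of_injOn (fun u => (u, f u)) ?_ ?_
    · intro u hu
      have hu := Finset.mem_Icc.1 (Finset.mem_coe.1 hu)
      simp only [boundary, Finset.coe_filter, Set.mem_ofPred_eq]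
      exact ⟨hf u hu, (u, f u + 1), hf' u hu, .inl (by simp [grid])⟩
    · intro u _ u' _ h; exact congrArg Prod.fst h
  have h := P.width_eq
  simp only [Int.card_Icc] at this
  omega

theorem height_le : P.height ≤ P.boundary.card := by
  choose! f hf hf' using fun (v : ℤ) (h : P.yMin ≤ v ∧ v ≤ P.yMax) => P.exists_end h.1 h.2
  have : (Finset.Icc P.yMin P.yMax).card ≤ P.boundary.card := by
    refine Finset.card_le_card_of_injOn (fun v => (f v, v)) ?_ ?_
    · intro u hu
      have hu := Finset.mem_Icc.1 (Finset.mem_coe.1 hu)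
      simp only [boundary, Finset.coe_filter, Set.mem_ofPred_eq]
      exact ⟨hf u hu, (f u + 1, u), hf' u hu, .inl (by simp [grid])⟩
    · intro u _ u' _ h; exact congrArg Prod.snd h
  have h := P.height_eq
  simp only [Int.card_Icc] at this
  omega

theorem boundary_le : P.boundary.card ≤ P.tiles.card := by
  classical
  unfold boundary; exact Finset.card_le_card (Finset.filter_subset _ _)

end Polyomino
end TileRobot

namespace TileRobot
open Mach

/-! ### Marking the corners of a growing rectangle -/

abbrev GMach (α : Type) := Mach Bool Direction α

namespace Direction

def rotL : Direction → Direction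
  | right => up | up => left | left => down | down => right

def rotR : Direction → Direction
  | right => down | down => left | left => up | up => right

def opp : Direction → Direction
  | right => left | left => right | up => down | down => up

instance : DecidableEq Direction := fun a b => by
  cases a <;> cases b <;> first | exact isTrue rfl | exact isFalse (by intro h; cases h)

instance : Finite Direction :=
  Set.finite_univ_iff.1 <| ((Set.finite_singleton down).insert left |>.insert right |>.insert up).subset
    (by intro d _; cases d <;> simp)

end Direction

/-- The contents of the pixels `(x, y)`, `(x + 1, y)`, `(x + 1, y + 1)`, `(x, y + 1)`. -/
abbrev Block := Bool × Bool × Bool × Bool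

/-- The mark with corner `(x, y)`. -/
def MarkAt (T : Finset Pixel) (x y : ℤ) : Prop :=
  (x, y) ∈ T ∧ (x + 1, y) ∉ T ∧ (x + 1, y + 1) ∈ T ∧ (x, y + 1) ∉ T

def BlockAt (T : Finset Pixel) (x y : ℤ) : Block :=
  (decide ((x, y) ∈ T), decide ((x + 1, y) ∈ T), decide ((x + 1, y + 1) ∈ T),
    decide ((x, y + 1) ∈ T))

/-- Test for a mark at the current pixel. -/
def isMark : GMach Bool := do
  let b0 ← look
  mv .right
  let b1 ← look
  mv .up
  let b2 ← look
  mv .left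
  let b3 ← look
  mv .down
  pure (b0 && !b1 && b2 && !b3)

/-- Write a block. -/
def writeBlock (c : Block) : GMach Unit := do
  act c.1 .right
  act c.2.1 .up
  act c.2.2.1 .left
  act c.2.2.2 .down

/-- Read a block. -/
def readBlock : GMach Block := do
  let b0 ← look
  mv .right
  let b1 ← look
  mv .up
  let b2 ← look
  mv .left
  let b3 ← look
  mv .down
  pure (b0, b1, b2, b3)

def markBlock : Block := (true, false, true, false)

/-- Restore a marked block, and mark the next block in direction `n`. -/
def shiftMark (c : Block) (n : Direction) : GMach Block := do
  writeBlock c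
  mv n
  let c' ← readBlock
  writeBlock markBlock
  pure c'

/-- Walk from a marked corner in direction `d` to the next marked corner, looking for tiles on the
parallel line to the left. -/
def scanSide (d : Direction) : GMach Bool := do
  -- Two moves lead from the mark to the first pixel opposite the rectangle.
  mv d
  mv d
  iter (fun found : Bool => do
    mv d.rotL
    let b ← look
    mv d.rotR
    mv d
    mv d
    -- The mark is looked for two pixels ahead, so the inspection ends opposite the last pixel of
    -- the rectangle. If there is no mark, one step back gives the next position.
    let k ← isMark
    match k with
    | true => pure (.inr (found || b))
    | false => do
      let s ← look
      pure (.inl (found || b, s, d.opp))) false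

/-- Walk back from one marked corner to the other one. -/
def backSide (d : Direction) : GMach Unit :=
  iter (fun _ : Unit => do
    let k ← isMark
    match k with
    | true => pure (.inr ())
    | false => do
      let s ← look
      pure (.inl ((), s, d.opp))) ()

/-- Shift both marks of a side outward. -/
def expandSide (d : Direction) (c0 c1 : Block) : GMach (Block × Block) := do
  let c1' ← shiftMark c1 d.rotR
  mv d.rotL
  -- Near the shifted mark, a block may mix pixels of the mark and of the polyomino and look like a
  -- mark; therefore two pixels are skipped before the search begins.
  mv d.opp
  mv d.opp
  backSide d
  let c0' ← shiftMark c0 d.rotR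
  pure (c0', c1')

/-! ### Reading and writing blocks of four pixels. -/

section BlockSpecs

variable {I : World Pixel (Finset Pixel) → Prop} {x y : ℤ} {T : Finset Pixel}

theorem Box.isMark_spec {x₀ x₁ y₀ y₁ : ℤ} {K : ℕ} (hx : x₀ ≤ x ∧ x + 1 ≤ x₁)
    (hy : y₀ ≤ y ∧ y + 1 ≤ y₁) (hK : T.card ≤ K)
    {Post : Bool → World Pixel (Finset Pixel) → ℕ → Set Pixel → Prop}
    (h : ∀ U, ∀ b : Bool, (b = true ↔ MarkAt T x y) → Post b ⟨(x, y), T⟩ 4 U) :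
    Spec (Box x₀ x₁ y₀ y₁ K) isMark ⟨(x, y), T⟩ Post := by
  refine .bind (.lookDecide ?_)
  refine .bind (.moveRight rfl (.mk (by omega)) ?_)
  refine .bind (.lookDecide ?_)
  refine .bind (.moveUp rfl (.mk (by omega)) ?_)
  refine .bind (.lookDecide ?_)
  refine .bind (.moveLeft (x' := x) (by omega) (.mk (by omega)) ?_)
  refine .bind (.lookDecide ?_)
  refine .bind (.moveDown (y' := y) (by omega) (.mk (by omega)) ?_)
  refine .pure (h _ _ ?_)
  simp [MarkAt]; tauto

theorem Box.readBlock_spec {x₀ x₁ y₀ y₁ : ℤ} {K : ℕ} (hx : x₀ ≤ x ∧ x + 1 ≤ x₁)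
    (hy : y₀ ≤ y ∧ y + 1 ≤ y₁) (hK : T.card ≤ K)
    {Post : Block → World Pixel (Finset Pixel) → ℕ → Set Pixel → Prop}
    (h : ∀ U, Post (BlockAt T x y) ⟨(x, y), T⟩ 4 U) :
    Spec (Box x₀ x₁ y₀ y₁ K) readBlock ⟨(x, y), T⟩ Post := by
  refine .bind (.lookDecide ?_)
  refine .bind (.moveRight rfl (.mk (by omega)) ?_)
  refine .bind (.lookDecide ?_)
  refine .bind (.moveUp rfl (.mk (by omega)) ?_)
  refine .bind (.lookDecide ?_)
  refine .bind (.moveLeft (x' := x) (by omega) (.mk (by omega)) ?_)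
  refine .bind (.lookDecide ?_)
  refine .bind (.moveDown (y' := y) (by omega) (.mk (by omega)) ?_)
  exact .pure (h _)

theorem Mach.Spec.write {d : Direction} {b : Bool} {p : Pixel}
    {Post : Unit → World Pixel (Finset Pixel) → ℕ → Set Pixel → Prop}
    (h : ∀ T' : Finset Pixel, (∀ q, q ∈ T' ↔ if q = p then b = true else q ∈ T) →
      T'.card ≤ T.card + 1 → I ⟨d.move p, T'⟩ ∧ Post () ⟨d.move p, T'⟩ 1 {p}) :
    Spec I (Mach.act b d : Mach Bool Direction Unit) ⟨p, T⟩ Post := by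
  have := h (if b then insert p T else T.erase p) ?_ ?_
  · exact Spec.act this.1 this.2
  · intro q; cases b <;> by_cases hq : q = p <;> simp [hq]
  · cases b
    · exact (Finset.card_erase_le).trans (by omega)
    · exact Finset.card_insert_le _ _

theorem Box.writeBlock_spec {x₀ x₁ y₀ y₁ : ℤ} {K : ℕ} (hx : x₀ ≤ x ∧ x + 1 ≤ x₁)
    (hy : y₀ ≤ y ∧ y + 1 ≤ y₁) (hK : T.card + 4 ≤ K) (c : Block)
    {Post : Unit → World Pixel (Finset Pixel) → ℕ → Set Pixel → Prop}
    (h : ∀ U, ∀ T' : Finset Pixel, BlockAt T' x y = c →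
      (∀ u v, ¬ (x ≤ u ∧ u ≤ x + 1 ∧ y ≤ v ∧ v ≤ y + 1) → ((u, v) ∈ T' ↔ (u, v) ∈ T)) →
      T'.card ≤ T.card + 4 → Post () ⟨(x, y), T'⟩ 4 U) :
    Spec (Box x₀ x₁ y₀ y₁ K) (writeBlock c) ⟨(x, y), T⟩ Post := by
  obtain ⟨c0, c1, c2, c3⟩ := c
  refine .bind (.write fun T1 h1 k1 => ⟨.mk (by dsimp only [Direction.move]; omega), ?_⟩)
  refine .bind (.write fun T2 h2 k2 => ⟨.mk (by dsimp only [Direction.move]; omega), ?_⟩)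
  refine .bind (.write fun T3 h3 k3 => ⟨.mk (by dsimp only [Direction.move]; omega), ?_⟩)
  refine .write fun T4 h4 k4 => ?_
  have e : Direction.down.move (Direction.left.move (Direction.up.move (Direction.right.move
    (x, y)))) = (x, y) := by simp [Direction.move]
  rw [e]
  refine ⟨.mk (by omega), h _ _ ?_ ?_ (by omega)⟩
  · simp [BlockAt, h1, h2, h3, h4, Direction.move]
  · intro u v huv
    simp only [h1, h2, h3, h4, Direction.move, Prod.mk.injEq]
    grind

end BlockSpecs

/-! ### Polyominoes overlaid by marks. -/

def MarkPix (p : Pixel) (u v : ℤ) : Prop := u = p.1 ∧ v = p.2 ∨ u = p.1 + 1 ∧ v = p.2 + 1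

def BlockPix (p : Pixel) (u v : ℤ) : Prop := p.1 ≤ u ∧ u ≤ p.1 + 1 ∧ p.2 ≤ v ∧ v ≤ p.2 + 1

/-- `T` arises from `P` by marking the blocks `A d`. -/
def Overlay (P : Finset Pixel) (A : Direction → Pixel) (T : Finset Pixel) : Prop :=
  ∀ u v, (u, v) ∈ T ↔ (∃ d, MarkPix (A d) u v) ∨ ((u, v) ∈ P ∧ ∀ d, ¬ BlockPix (A d) u v)

/-- The blocks of two positions are disjoint. -/
def Far (p q : Pixel) : Prop :=
  p.1 + 2 ≤ q.1 ∨ q.1 + 2 ≤ p.1 ∨ p.2 + 2 ≤ q.2 ∨ q.2 + 2 ≤ p.2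

theorem Far.not_block {p q : Pixel} (h : Far p q) {u v : ℤ} (h' : BlockPix p u v) :
    ¬ BlockPix q u v := by
  unfold Far BlockPix at *; omega

theorem MarkPix.block {p : Pixel} {u v : ℤ} (h : MarkPix p u v) : BlockPix p u v := by
  unfold MarkPix BlockPix at *; omega

/-- Each of the four marks contributes at most two tiles. -/
theorem Overlay.card_le {P T : Finset Pixel} {A : Direction → Pixel} (h : Overlay P A T) :
    T.card ≤ P.card + 8 := by
  classical
  have : T ⊆ P ∪ ({A .up, A .down, A .left, A .right, A .up + (1, 1), A .down + (1, 1),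
      A .left + (1, 1), A .right + (1, 1)} : Finset Pixel) := by
    rintro ⟨u, v⟩ huv
    rw [h] at huv
    rcases huv with ⟨d, hd⟩ | ⟨hP, _⟩
    · refine Finset.mem_union_right _ ?_
      have : (u, v) = A d ∨ (u, v) = A d + (1, 1) := by
        rcases hd with ⟨h1, h2⟩ | ⟨h1, h2⟩
        · exact .inl (Prod.ext h1 h2)
        · exact .inr (Prod.ext h1 h2)
      rcases this with e | e <;> rw [e] <;> cases d <;> simp
    · exact Finset.mem_union_left _ hP
  refine (Finset.card_le_card this).trans ((Finset.card_union_le _ _).trans ?_)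
  gcongr
  exact (Finset.card_insert_le _ _).trans (Nat.succ_le_succ ((Finset.card_insert_le _ _).trans
    (Nat.succ_le_succ Finset.card_le_six)))

theorem blockAt_congr {T P : Finset Pixel} {x y : ℤ} (h : BlockAt T x y = BlockAt P x y) {u v : ℤ}
    (huv : BlockPix (x, y) u v) : (u, v) ∈ T ↔ (u, v) ∈ P := by
  simp only [BlockAt, Prod.mk.injEq, decide_eq_decide] at h
  obtain ⟨h1, h2, h3, h4⟩ := h
  have : u = x ∧ v = y ∨ u = x + 1 ∧ v = y ∨ u = x + 1 ∧ v = y + 1 ∨ u = x ∧ v = y + 1 := by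
    unfold BlockPix at huv; dsimp only at huv; omega
  rcases this with ⟨rfl, rfl⟩ | ⟨rfl, rfl⟩ | ⟨rfl, rfl⟩ | ⟨rfl, rfl⟩ <;> assumption

theorem blockAt_mark {T : Finset Pixel} {x y : ℤ} (h : BlockAt T x y = markBlock) {u v : ℤ}
    (huv : BlockPix (x, y) u v) : (u, v) ∈ T ↔ MarkPix (x, y) u v := by
  simp only [BlockAt, markBlock, Prod.mk.injEq, decide_eq_true_eq, decide_eq_false_iff_not] at h
  obtain ⟨h1, h2, h3, h4⟩ := h
  have : u = x ∧ v = y ∨ u = x + 1 ∧ v = y ∨ u = x + 1 ∧ v = y + 1 ∨ u = x ∧ v = y + 1 := by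
    unfold BlockPix at huv; dsimp only at huv; omega
  rcases this with ⟨rfl, rfl⟩ | ⟨rfl, rfl⟩ | ⟨rfl, rfl⟩ | ⟨rfl, rfl⟩ <;> simp [*, MarkPix]

theorem blockAt_ext {T P : Finset Pixel} {x y : ℤ}
    (h : ∀ u v, BlockPix (x, y) u v → ((u, v) ∈ T ↔ (u, v) ∈ P)) : BlockAt T x y = BlockAt P x y := by
  simp only [BlockAt, Prod.mk.injEq, decide_eq_decide]
  refine ⟨h _ _ ?_, h _ _ ?_, h _ _ ?_, h _ _ ?_⟩ <;> simp [BlockPix]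

/-- `T` arises from `P` by marking the blocks `A d` with `S d`. -/
def OverlayOn (P : Finset Pixel) (A : Direction → Pixel) (S : Direction → Prop)
    (T : Finset Pixel) : Prop :=
  ∀ u v, (u, v) ∈ T ↔ (∃ d, S d ∧ MarkPix (A d) u v) ∨
    ((u, v) ∈ P ∧ ∀ d, S d → ¬ BlockPix (A d) u v)

/-- Reading a block that is not overlapped by marks, and marking it. -/
theorem OverlayOn.mark {P T T' : Finset Pixel} {A : Direction → Pixel} {S : Direction → Prop}
    {k : Direction} {x y : ℤ} (hA : ∀ j, S j → Far (A j) (x, y)) (hk : A k = (x, y))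
    (hT : OverlayOn P A S T) (h1 : BlockAt T' x y = markBlock)
    (h2 : ∀ u v, ¬ BlockPix (x, y) u v → ((u, v) ∈ T' ↔ (u, v) ∈ T)) :
    BlockAt T x y = BlockAt P x y ∧ OverlayOn P A (fun d => d = k ∨ S d) T' := by
  constructor
  · refine blockAt_ext fun u v huv => ?_
    rw [hT]
    constructor
    · rintro (⟨d, hd, hm⟩ | h)
      · exact absurd huv ((hA d hd).not_block hm.block)
      · exact h.1
    · exact fun h => .inr ⟨h, fun d hd hb => (hA d hd).not_block hb huv⟩
  · intro u v
    by_cases huv : BlockPix (x, y) u v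
    · rw [blockAt_mark h1 huv]
      constructor
      · exact fun h => .inl ⟨k, .inl rfl, hk ▸ h⟩
      · rintro (⟨d, rfl | e, hd⟩ | ⟨_, h⟩)
        · exact hk ▸ hd
        · exact absurd huv ((hA d e).not_block hd.block)
        · exact absurd huv (hk ▸ h k (.inl rfl))
    · rw [h2 u v huv, hT]
      refine or_congr ⟨?_, ?_⟩ (and_congr Iff.rfl ⟨?_, ?_⟩)
      · rintro ⟨d, e, hd⟩; exact ⟨d, .inr e, hd⟩
      · rintro ⟨d, rfl | e, hd⟩
        · exact absurd (hk ▸ hd).block huv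
        · exact ⟨d, e, hd⟩
      · rintro h d (rfl | e)
        · exact hk ▸ huv
        · exact h d e
      · intro h d e; exact h d (.inr e)

/-- As the other marks do not meet the block, restoring it removes the mark `k` and nothing else. -/
theorem Overlay.unmark {P T T' : Finset Pixel} {A : Direction → Pixel} {k : Direction} {x y : ℤ}
    (hA : ∀ j, j ≠ k → Far (A j) (x, y)) (hk : A k = (x, y)) (hT : Overlay P A T)
    (h1 : BlockAt T' x y = BlockAt P x y)
    (h2 : ∀ u v, ¬ BlockPix (x, y) u v → ((u, v) ∈ T' ↔ (u, v) ∈ T)) (u v : ℤ) :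
    (u, v) ∈ T' ↔ (∃ d, d ≠ k ∧ MarkPix (A d) u v) ∨
      ((u, v) ∈ P ∧ ∀ d, d ≠ k → ¬ BlockPix (A d) u v) := by
  by_cases huv : BlockPix (x, y) u v
  · rw [blockAt_congr h1 huv]
    constructor
    · exact fun h => .inr ⟨h, fun d hd hb => (hA d hd).not_block hb huv⟩
    · rintro (⟨d, hd, hm⟩ | h)
      · exact absurd huv ((hA d hd).not_block hm.block)
      · exact h.1
  · rw [h2 u v huv, hT u v]
    refine or_congr ⟨?_, ?_⟩ (and_congr Iff.rfl ⟨?_, ?_⟩)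
    · rintro ⟨d, hd⟩
      refine ⟨d, ?_, hd⟩
      rintro rfl; rw [hk] at hd; exact huv hd.block
    · rintro ⟨d, e, hd⟩; exact ⟨d, hd⟩
    · intro h d _; exact h d
    · intro h d
      by_cases e : d = k
      · subst e; rw [hk]; exact huv
      · exact h d e

/-- The old and the new block overlap. The old one is restored first, so the block read next shows
the polyomino itself. In `hK`, 8 tiles are for the marks and 4 for each of the two blocks being
written. -/
theorem shiftMark_spec {P T : Finset Pixel} {A : Direction → Pixel} {k : Direction} {x y x' y' : ℤ}
    {n : Direction} (hn : n.move (x, y) = (x', y')) (hA : ∀ j, j ≠ k → Far (A j) (x, y))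
    (hA' : ∀ j, j ≠ k → Far (A j) (x', y')) (hk : A k = (x, y)) (hT : Overlay P A T)
    {x₀ x₁ y₀ y₁ : ℤ} {K : ℕ} (hK : P.card + 16 ≤ K) (hx : x₀ ≤ x ∧ x + 1 ≤ x₁)
    (hy : y₀ ≤ y ∧ y + 1 ≤ y₁) (hx' : x₀ ≤ x' ∧ x' + 1 ≤ x₁) (hy' : y₀ ≤ y' ∧ y' + 1 ≤ y₁)
    {Post : Block → World Pixel (Finset Pixel) → ℕ → Set Pixel → Prop}
    (h : ∀ U T', Overlay P (Function.update A k (x', y')) T' →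
      Post (BlockAt P x' y') ⟨(x', y'), T'⟩ 13 U) :
    Spec (Box x₀ x₁ y₀ y₁ K) (shiftMark (BlockAt P x y) n) ⟨(x, y), T⟩ Post := by
  have := hT.card_le
  refine .bind (Box.writeBlock_spec hx hy (by omega) _ fun U1 T1 h1 k1 c1 => ?_)
  refine .bind (.move ?_ ?_) <;> rw [hn]
  · exact .mk (by omega)
  refine .bind (Box.readBlock_spec hx' hy' (by omega) fun U2 => ?_)
  refine .bind (Box.writeBlock_spec hx' hy' (by omega) _ fun U3 T2 h2 k2 c2 => ?_)
  -- While the mark `k` is absent, its position is irrelevant and may already be replaced by the new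
  -- one.
  have hU : OverlayOn P (Function.update A k (x', y')) (· ≠ k) T1 := by
    intro u v
    rw [Overlay.unmark hA hk hT h1 k1]
    refine or_congr (exists_congr fun d => and_congr_right fun e => ?_)
      (and_congr Iff.rfl (forall_congr' fun d => imp_congr_right fun e => ?_)) <;>
    rw [Function.update_of_ne e]
  obtain ⟨e, hO⟩ := OverlayOn.mark (k := k)
    (fun j e => by rw [Function.update_of_ne e]; exact hA' j e) (by simp) hU h2 k2
  replace hO : Overlay P (Function.update A k (x', y')) T2 := fun u v => by
    rw [hO]; simp [em]
  rw [e]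
  exact .pure (h _ _ hO)

/-- Walking along a side with positions `f 0, …, f n` towards the mark at `f n`. -/
theorem scanSide_spec {d : Direction} {T : Finset Pixel} {x₀ x₁ y₀ y₁ : ℤ} {K : ℕ}
    (f : ℕ → Pixel) (n : ℕ) (hn : 4 ≤ n) (hf : ∀ i, d.move (f i) = f (i + 1))
    (hm : ∀ i, 4 ≤ i → i < n → ¬ MarkAt T (f i).1 (f i).2) (hmn : MarkAt T (f n).1 (f n).2)
    (hK : T.card ≤ K)
    (hI : ∀ i ≤ n, x₀ + 1 ≤ (f i).1 ∧ (f i).1 + 1 ≤ x₁ ∧ y₀ + 1 ≤ (f i).2 ∧ (f i).2 + 1 ≤ y₁)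
    {Post : Bool → World Pixel (Finset Pixel) → ℕ → Set Pixel → Prop}
    (h : ∀ U t, ∀ b : Bool, (b = true ↔ ∃ i, 2 ≤ i ∧ i + 2 ≤ n ∧ d.rotL.move (f i) ∈ T) →
      t ≤ 12 * n → Post b ⟨f n, T⟩ t U) :
    Spec (Box x₀ x₁ y₀ y₁ K) (scanSide d) ⟨f 0, T⟩ Post := by
  have hB : ∀ i ≤ n, Box x₀ x₁ y₀ y₁ K ⟨f i, T⟩ := fun i hi => by
    obtain ⟨h1, h2, h3, h4⟩ := hI i hi
    exact ⟨by dsimp only; omega, by dsimp only; omega, by dsimp only; omega, by dsimp only; omega,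
      hK⟩
  have hB' : ∀ i ≤ n, Box x₀ x₁ y₀ y₁ K ⟨d.rotL.move (f i), T⟩ := fun i hi => by
    obtain ⟨h1, h2, h3, h4⟩ := hI i hi
    cases d <;> exact ⟨by simp only [Direction.rotL, Direction.move]; omega,
      by simp only [Direction.rotL, Direction.move]; omega,
      by simp only [Direction.rotL, Direction.move]; omega,
      by simp only [Direction.rotL, Direction.move]; omega, hK⟩
  have hback : ∀ p, d.rotR.move (d.rotL.move p) = p := by
    rintro ⟨u, v⟩; cases d <;> simp [Direction.rotL, Direction.rotR, Direction.move]
  have hopp : ∀ p, d.opp.move (d.move p) = p := by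
    rintro ⟨u, v⟩; cases d <;> simp [Direction.opp, Direction.move]
  refine .bind (.move (by rw [hf]; exact hB _ (by omega)) ?_)
  rw [hf]
  refine .bind (.move (by rw [hf]; exact hB _ (by omega)) ?_)
  rw [hf]
  -- Induction on the number `r` of rounds that follow the current one; `found` summarizes the
  -- pixels inspected before position `i`.
  have key : ∀ r i, i + 2 + r = n → 2 ≤ i → ∀ found : Bool,
      (found = true ↔ ∃ j, 2 ≤ j ∧ j < i ∧ d.rotL.move (f j) ∈ T) →
      Spec (Box x₀ x₁ y₀ y₁ K) (iter (fun found : Bool => do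
        mv d.rotL
        let b ← look
        mv d.rotR
        mv d
        mv d
        let k ← isMark
        match k with
        | true => pure (.inr (found || b))
        | false => do
          let s ← look
          pure (.inl (found || b, s, d.opp))) found : GMach Bool) ⟨f i, T⟩
        fun b w t U => w = ⟨f n, T⟩ ∧
          (b = true ↔ ∃ i, 2 ≤ i ∧ i + 2 ≤ n ∧ d.rotL.move (f i) ∈ T) ∧ t ≤ 9 * (r + 1) := by
    intro r
    induction r with
    | zero =>
      intro i hi h2 found hfound
      refine .iter ?_
      refine .bind (.move (hB' _ (by omega)) ?_)
      refine .bind (.lookDecide ?_)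
      refine .bind (.move (by rw [hback]; exact hB _ (by omega)) ?_)
      rw [hback]
      refine .bind (.move (by rw [hf]; exact hB _ (by omega)) ?_)
      rw [hf]
      refine .bind (.move (by rw [hf]; exact hB _ (by omega)) ?_)
      rw [hf]
      obtain ⟨k1, k2, k3, k4⟩ := hI (i + 1 + 1) (by omega)
      refine .bind (Box.isMark_spec (by omega) (by omega) hK fun U b hb => ?_)
      have e : i + 1 + 1 = n := by omega
      rw [e] at hb
      obtain rfl : b = true := hb.2 hmn
      refine .pure ⟨by rw [e], ?_, by omega⟩
      simp only [Bool.or_eq_true, decide_eq_true_eq, hfound]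
      constructor
      · rintro (⟨j, h1, h2, h3⟩ | h)
        exacts [⟨j, h1, by omega, h3⟩, ⟨i, h2, by omega, h⟩]
      · rintro ⟨j, h1, h2, h3⟩
        by_cases hj : j = i
        · subst hj; exact .inr h3
        · exact .inl ⟨j, h1, by omega, h3⟩
    | succ r ih =>
      intro i hi h2 found hfound
      refine .iter ?_
      refine .bind (.move (hB' _ (by omega)) ?_)
      refine .bind (.lookDecide ?_)
      refine .bind (.move (by rw [hback]; exact hB _ (by omega)) ?_)
      rw [hback]
      refine .bind (.move (by rw [hf]; exact hB _ (by omega)) ?_)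
      rw [hf]
      refine .bind (.move (by rw [hf]; exact hB _ (by omega)) ?_)
      rw [hf]
      obtain ⟨k1, k2, k3, k4⟩ := hI (i + 1 + 1) (by omega)
      refine .bind (Box.isMark_spec (by omega) (by omega) hK fun U b hb => ?_)
      obtain rfl : b = false := by
        have := hm (i + 1 + 1) (by omega) (by omega)
        rw [← hb] at this; simpa using this
      refine .bind (.look (.pure ?_))
      dsimp only
      rw [World.act_cur]
      have e : Arena.go (Mem := Finset Pixel) (A := Bool) d.opp (f (i + 1 + 1)) = f (i + 1) := by
        rw [← hf]; exact hopp _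
      refine ⟨by rw [e]; exact hB _ (by omega), ?_⟩
      rw [e]
      refine (ih (i + 1) (by omega) (by omega) _ ?_).mono ?_
      · simp only [Bool.or_eq_true, decide_eq_true_eq, hfound]
        constructor
        · rintro (⟨j, h1, h2, h3⟩ | h)
          exacts [⟨j, h1, by omega, h3⟩, ⟨i, h2, by omega, h⟩]
        · rintro ⟨j, h1, h2, h3⟩
          by_cases hj : j = i
          · subst hj; exact .inr h3
          · exact .inl ⟨j, h1, by omega, h3⟩
      · rintro b w t U - ⟨h1, h2, h3⟩
        exact ⟨h1, h2, by omega⟩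
  refine (key (n - 4) 2 (by omega) le_rfl false ?_).mono ?_
  · simp; intro x h1 h2; omega
  · rintro b w t U - ⟨rfl, h2, h3⟩
    exact h _ _ _ h2 (by omega)

/-- Walking back along positions `f n, …, f 0` to the mark at `f 0`. -/
theorem backSide_spec {d : Direction} {T : Finset Pixel} {x₀ x₁ y₀ y₁ : ℤ} {K : ℕ}
    (f : ℕ → Pixel) (n : ℕ) (hf : ∀ i, d.move (f i) = f (i + 1))
    (hm : ∀ i, 0 < i → i ≤ n → ¬ MarkAt T (f i).1 (f i).2) (hm0 : MarkAt T (f 0).1 (f 0).2)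
    (hK : T.card ≤ K)
    (hI : ∀ i ≤ n, x₀ + 1 ≤ (f i).1 ∧ (f i).1 + 1 ≤ x₁ ∧ y₀ + 1 ≤ (f i).2 ∧ (f i).2 + 1 ≤ y₁)
    {Post : Unit → World Pixel (Finset Pixel) → ℕ → Set Pixel → Prop}
    (h : ∀ U t, t ≤ 5 * (n + 1) → Post () ⟨f 0, T⟩ t U) :
    Spec (Box x₀ x₁ y₀ y₁ K) (backSide d) ⟨f n, T⟩ Post := by
  have hB : ∀ i ≤ n, Box x₀ x₁ y₀ y₁ K ⟨f i, T⟩ := fun i hi => by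
    obtain ⟨h1, h2, h3, h4⟩ := hI i hi
    exact ⟨by dsimp only; omega, by dsimp only; omega, by dsimp only; omega, by dsimp only; omega,
      hK⟩
  have hopp : ∀ p, d.opp.move (d.move p) = p := by
    rintro ⟨u, v⟩; cases d <;> simp [Direction.opp, Direction.move]
  have key : ∀ i ≤ n, Spec (Box x₀ x₁ y₀ y₁ K) (backSide d) ⟨f i, T⟩
        fun _ w t _ => w = ⟨f 0, T⟩ ∧ t ≤ 5 * (i + 1) := by
    intro i
    induction i with
    | zero =>
      intro hi
      refine .iter ?_
      obtain ⟨k1, k2, k3, k4⟩ := hI 0 (by omega)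
      refine .bind (Box.isMark_spec (by omega) (by omega) hK fun U b hb => ?_)
      obtain rfl : b = true := hb.2 hm0
      exact .pure ⟨rfl, by omega⟩
    | succ i ih =>
      intro hi
      refine .iter ?_
      obtain ⟨k1, k2, k3, k4⟩ := hI (i + 1) (by omega)
      refine .bind (Box.isMark_spec (by omega) (by omega) hK fun U b hb => ?_)
      obtain rfl : b = false := by
        have := hm (i + 1) (by omega) (by omega)
        rw [← hb] at this; simpa using this
      refine .bind (.look (.pure ?_))
      dsimp only
      rw [World.act_cur]
      have e : Arena.go (Mem := Finset Pixel) (A := Bool) d.opp (f (i + 1)) = f i := by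
        rw [← hf]; exact hopp _
      refine ⟨by rw [e]; exact hB _ (by omega), ?_⟩
      rw [e]
      refine (ih (by omega)).mono ?_
      rintro b w t U - ⟨h1, h3⟩
      exact ⟨h1, by omega⟩
  refine (key n le_rfl).mono ?_
  rintro b w t U - ⟨rfl, h3⟩
  exact h _ _ h3


/-! ### Rectangles with marked corners. -/

/-- The rectangle `[a, b] × [c, e]`. -/
structure Rect where
  (a b c e : ℤ)

namespace Rect

/-- The position of the mark where the side with walking direction `d` starts. -/
def corner (B : Rect) : Direction → Pixel
  | .right => (B.a - 2, B.c - 2)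
  | .up => (B.b + 2, B.c - 2)
  | .left => (B.b + 2, B.e + 2)
  | .down => (B.a - 2, B.e + 2)

/-- The number of steps from one mark to the next one. -/
def len (B : Rect) : Direction → ℕ
  | .right | .left => (B.b - B.a + 4).toNat
  | .up | .down => (B.e - B.c + 4).toNat

/-- The positions from one mark to the next one. -/
def path (B : Rect) (d : Direction) (i : ℕ) : Pixel :=
  match d with
  | .right => (B.a - 2 + i, B.c - 2)
  | .up => (B.b + 2, B.c - 2 + i)
  | .left => (B.b + 2 - i, B.e + 2)
  | .down => (B.a - 2, B.e + 2 - i)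

/-- Shift a side by one outward. -/
def grow (B : Rect) : Direction → Rect
  | .right => { B with c := B.c - 1 }
  | .up => { B with b := B.b + 1 }
  | .left => { B with e := B.e + 1 }
  | .down => { B with a := B.a - 1 }

variable {B : Rect} {P T : Finset Pixel}

theorem path_move (d : Direction) (i : ℕ) : d.move (B.path d i) = B.path d (i + 1) := by
  cases d <;> simp [path, Direction.move] <;> ring

theorem path_zero (d : Direction) : B.path d 0 = B.corner d := by
  cases d <;> simp [path, corner]

theorem len_cast (h1 : B.a ≤ B.b) (h2 : B.c ≤ B.e) (d : Direction) :
    (B.len d : ℤ) = match d with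
      | .right | .left => B.b - B.a + 4
      | .up | .down => B.e - B.c + 4 := by
  cases d <;> simp only [len] <;> omega

theorem path_len (h1 : B.a ≤ B.b) (h2 : B.c ≤ B.e) (d : Direction) :
    B.path d (B.len d) = B.corner d.rotL := by
  cases d <;> simp [path, corner, len, Direction.rotL] <;> omega

theorem corner_far (h1 : B.a ≤ B.b) (h2 : B.c ≤ B.e) {d d' : Direction} (h : d ≠ d') :
    Far (B.corner d) (B.corner d') := by
  cases d <;> cases d' <;> first | exact absurd rfl h | (simp only [corner, Far]; omega)

end Rect

/-- The four positions are pairwise far from each other. -/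
def Spread (A : Direction → Pixel) : Prop := ∀ d d', d ≠ d' → Far (A d) (A d')

theorem Overlay.markAt {P T : Finset Pixel} {A : Direction → Pixel} (h : Overlay P A T)
    (hA : Spread A) (k : Direction) : MarkAt T (A k).1 (A k).2 := by
  have key : ∀ u v, BlockPix (A k) u v → ((u, v) ∈ T ↔ MarkPix (A k) u v) := by
    intro u v huv
    rw [h]
    constructor
    · rintro (⟨d, hd⟩ | ⟨_, h⟩)
      · by_cases e : d = k
        · exact e ▸ hd
        · exact absurd huv ((hA d k e).not_block hd.block)
      · exact absurd huv (h k)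
    · exact fun h => .inl ⟨k, h⟩
  refine ⟨(key _ _ ?_).2 ?_, fun h => ?_, (key _ _ ?_).2 ?_, fun h => ?_⟩
  · simp [BlockPix]
  · simp [MarkPix]
  · have := (key _ _ (by simp [BlockPix])).1 h; simp [MarkPix] at this
  · simp [BlockPix]
  · simp [MarkPix]
  · have := (key _ _ (by simp [BlockPix])).1 h; simp [MarkPix] at this

/-- No other mark on the lines through the marks. -/
theorem Overlay.not_markAt {P : Polyomino} {T : Finset Pixel} {A : Direction → Pixel}
    (h : Overlay P.tiles A T) (hA : Spread A) {x y : ℤ}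
    (hq : ∀ d, Far (A d) (x, y) ∨ ((A d).1 = x ∧ ((A d).2 = y + 1 ∨ (A d).2 = y - 1)) ∨
      ((A d).2 = y ∧ ((A d).1 = x + 1 ∨ (A d).1 = x - 1))) : ¬ MarkAt T x y := by
  rintro ⟨h1, h2, h3, h4⟩
  -- Far from all marks the block shows the polyomino, where the diagonal condition forbids the
  -- pattern.
  by_cases hf : ∀ d, Far (A d) (x, y)
  · have key : ∀ u v, BlockPix (x, y) u v → ((u, v) ∈ T ↔ (u, v) ∈ P.tiles) := by
      intro u v huv
      rw [h]
      constructor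
      · rintro (⟨d, hd⟩ | h)
        · exact absurd huv ((hf d).not_block hd.block)
        · exact h.1
      · exact fun h => .inr ⟨h, fun d hd => (hf d).not_block hd huv⟩
    rw [key _ _ (by simp [BlockPix])] at h1 h2 h3 h4
    exact P.not_pattern h1 h2 h3 h4
  -- A block displaced by one pixel from a mark shares two pixels with it. The pattern is a
  -- checkerboard, so the two would need opposite contents there.
  · obtain ⟨d, hd⟩ := not_forall.1 hf
    have hm := h.markAt hA d
    obtain ⟨k1, k2, k3, k4⟩ := hm
    rcases (hq d).resolve_left hd with ⟨e, e' | e'⟩ | ⟨e, e' | e'⟩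
    · rw [e, e'] at k1; exact h4 k1
    · rw [e, e'] at k4; exact k4 (by simpa using h1)
    · rw [e, e'] at k1; exact h2 k1
    · rw [e, e'] at k2; exact k2 (by simpa using h1)

section Grow

variable {P : Polyomino} {T : Finset Pixel} {B : Rect} {x₀ x₁ y₀ y₁ : ℤ} {K : ℕ}

/-- The line next to a side of the rectangle. -/
def Rect.Clear (B : Rect) (P : Finset Pixel) : Direction → Prop
  | .right => ∀ u, B.a ≤ u → u ≤ B.b → (u, B.c - 1) ∉ P
  | .up => ∀ v, B.c ≤ v → v ≤ B.e → (B.b + 1, v) ∉ P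
  | .left => ∀ u, B.a ≤ u → u ≤ B.b → (u, B.e + 1) ∉ P
  | .down => ∀ v, B.c ≤ v → v ≤ B.e → (B.a - 1, v) ∉ P

/-- The inspected pixels lie in the columns or rows of the rectangle, which the marks avoid, so
looking at `T` is as good as looking at the polyomino. -/
theorem Overlay.clear_iff (h : Overlay P.tiles B.corner T) (h1 : B.a ≤ B.b) (h2 : B.c ≤ B.e)
    (d : Direction) : B.Clear P.tiles d ↔
      ¬ ∃ i, 2 ≤ i ∧ i + 2 ≤ B.len d ∧ d.rotL.move (B.path d i) ∈ T := by
  have key : ∀ u v, (B.a ≤ u ∧ u ≤ B.b ∨ B.c ≤ v ∧ v ≤ B.e) → ((u, v) ∈ T ↔ (u, v) ∈ P.tiles) := by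
    intro u v huv
    have : ∀ d, ¬ BlockPix (B.corner d) u v := by
      intro d; cases d <;> simp only [Rect.corner, BlockPix] <;> omega
    rw [h]
    exact ⟨fun h => h.elim (fun ⟨d, hd⟩ => absurd hd.block (this d)) And.left,
      fun h => .inr ⟨h, this⟩⟩
  push Not
  cases d <;> simp only [Rect.Clear, Rect.len, Rect.path, Direction.rotL, Direction.move]
  · constructor
    · intro hc i hi hi'
      rw [key _ _ (by omega)]
      convert hc (B.c - 2 + i) (by omega) (by omega) using 3; ring
    · intro hc v hv hv'
      have := hc (v - B.c + 2).toNat (by omega) (by omega)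
      rw [key _ _ (by omega)] at this
      convert this using 3 <;> omega
  · constructor
    · intro hc i hi hi'
      rw [key _ _ (by omega)]
      convert hc (B.e + 2 - i) (by omega) (by omega) using 3; ring
    · intro hc v hv hv'
      have := hc (B.e - v + 2).toNat (by omega) (by omega)
      rw [key _ _ (by omega)] at this
      convert this using 3 <;> omega
  · constructor
    · intro hc i hi hi'
      rw [key _ _ (by omega)]
      convert hc (B.b + 2 - i) (by omega) (by omega) using 3; ring
    · intro hc v hv hv'
      have := hc (B.b - v + 2).toNat (by omega) (by omega)
      rw [key _ _ (by omega)] at this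
      convert this using 3 <;> omega
  · constructor
    · intro hc i hi hi'
      rw [key _ _ (by omega)]
      convert hc (B.a - 2 + i) (by omega) (by omega) using 3; ring
    · intro hc v hv hv'
      have := hc (v - B.a + 2).toNat (by omega) (by omega)
      rw [key _ _ (by omega)] at this
      convert this using 3 <;> omega

theorem Rect.scan (h : Overlay P.tiles B.corner T) (h1 : B.a ≤ B.b) (h2 : B.c ≤ B.e)
    (d : Direction) (hK : T.card ≤ K) (hx : x₀ + 5 ≤ B.a ∧ B.b + 5 ≤ x₁)
    (hy : y₀ + 5 ≤ B.c ∧ B.e + 5 ≤ y₁)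
    {Post : Bool → World Pixel (Finset Pixel) → ℕ → Set Pixel → Prop}
    (hP : ∀ U t, ∀ b : Bool, (b = false ↔ B.Clear P.tiles d) →
      t ≤ 12 * B.len d → Post b ⟨B.corner d.rotL, T⟩ t U) :
    Spec (Box x₀ x₁ y₀ y₁ K) (scanSide d) ⟨B.corner d, T⟩ Post := by
  have hS : Spread B.corner := fun _ _ => Rect.corner_far h1 h2
  rw [← Rect.path_zero]
  refine scanSide_spec (B.path d) (B.len d) ?_ (Rect.path_move d) ?_ ?_ hK ?_ ?_
  · cases d <;> simp only [Rect.len] <;> omega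
  · intro i hi hi'
    refine h.not_markAt hS fun d' => ?_
    have hl := Rect.len_cast h1 h2 d
    cases d <;> cases d' <;> simp only [Rect.path, Rect.corner, Far, true_and] at hl ⊢ <;> omega
  · rw [Rect.path_len h1 h2]
    exact h.markAt hS _
  · intro i hi
    have hl := Rect.len_cast h1 h2 d
    cases d <;> simp only [Rect.path] at * <;> omega
  · intro U t b hb ht
    rw [Rect.path_len h1 h2]
    refine hP _ _ _ ?_ ht
    rw [h.clear_iff h1 h2, ← hb]; simp

/-- The mark at the end of the side is shifted first, because the robot stands there after the scan;
then the robot walks back along the old line to the other mark of the side. This return explains the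
term `5 * B.len d`. -/
theorem Rect.expand (h : Overlay P.tiles B.corner T) (h1 : B.a ≤ B.b) (h2 : B.c ≤ B.e)
    (d : Direction) (hK : P.tiles.card + 16 ≤ K) (hx : x₀ + 6 ≤ B.a ∧ B.b + 6 ≤ x₁)
    (hy : y₀ + 6 ≤ B.c ∧ B.e + 6 ≤ y₁)
    {Post : Block × Block → World Pixel (Finset Pixel) → ℕ → Set Pixel → Prop}
    (hP : ∀ U t T', Overlay P.tiles (B.grow d).corner T' → t ≤ 5 * B.len d + 50 →
      Post (BlockAt P.tiles ((B.grow d).corner d).1 ((B.grow d).corner d).2,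
        BlockAt P.tiles ((B.grow d).corner d.rotL).1 ((B.grow d).corner d.rotL).2)
        ⟨(B.grow d).corner d, T'⟩ t U) :
    Spec (Box x₀ x₁ y₀ y₁ K) (expandSide d
      (BlockAt P.tiles (B.corner d).1 (B.corner d).2)
      (BlockAt P.tiles (B.corner d.rotL).1 (B.corner d.rotL).2)) ⟨B.corner d.rotL, T⟩ Post := by
  have hlen : 4 ≤ B.len d := by cases d <;> simp only [Rect.len] <;> omega
  have e1 : d.rotR.move (B.corner d.rotL) = (B.grow d).corner d.rotL := by
    cases d <;> simp [Rect.corner, Rect.grow, Direction.rotL, Direction.rotR, Direction.move] <;> ring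
  have e0 : d.rotR.move (B.corner d) = (B.grow d).corner d := by
    cases d <;> simp [Rect.corner, Rect.grow, Direction.rotL, Direction.rotR, Direction.move] <;> ring
  have hopp : ∀ p, d.opp.move (d.move p) = p := by
    rintro ⟨u, v⟩; cases d <;> simp [Direction.opp, Direction.move]
  have hback : ∀ p, d.rotL.move (d.rotR.move p) = p := by
    rintro ⟨u, v⟩; cases d <;> simp [Direction.rotL, Direction.rotR, Direction.move]
  -- Pushing one side outward moves exactly its two end marks.
  have hA2 : Function.update (Function.update B.corner d.rotL ((B.grow d).corner d.rotL)) d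
      ((B.grow d).corner d) = (B.grow d).corner := by
    funext d'
    cases d <;> cases d' <;> simp [Function.update, Direction.rotL, Rect.corner, Rect.grow]
  -- Between the two shifts the marks do not form a rectangle, but their blocks must still be
  -- disjoint.
  have hS1 : Spread (Function.update B.corner d.rotL ((B.grow d).corner d.rotL)) := by
    intro d1 d2 hd
    cases d <;> cases d1 <;> cases d2 <;> first | exact absurd rfl hd |
      (simp [Function.update, Direction.rotL, Rect.corner, Rect.grow, Far]; omega)
  have hI : ∀ d', x₀ + 3 ≤ (B.corner d').1 ∧ (B.corner d').1 + 3 ≤ x₁ ∧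
      y₀ + 3 ≤ (B.corner d').2 ∧ (B.corner d').2 + 3 ≤ y₁ := by
    intro d'; cases d' <;> simp only [Rect.corner] <;> omega
  have hI' : ∀ d', x₀ + 2 ≤ ((B.grow d).corner d').1 ∧ ((B.grow d).corner d').1 + 2 ≤ x₁ ∧
      y₀ + 2 ≤ ((B.grow d).corner d').2 ∧ ((B.grow d).corner d').2 + 2 ≤ y₁ := by
    intro d'; cases d <;> cases d' <;> simp only [Rect.corner, Rect.grow] <;> omega
  have hne : d ≠ d.rotL := by cases d <;> simp [Direction.rotL]
  obtain ⟨i1, i2, i3, i4⟩ := hI d.rotL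
  obtain ⟨i1', i2', i3', i4'⟩ := hI' d.rotL
  obtain ⟨j1, j2, j3, j4⟩ := hI d
  obtain ⟨j1', j2', j3', j4'⟩ := hI' d
  have hp : ∀ i ≤ B.len d, x₀ + 3 ≤ (B.path d i).1 ∧ (B.path d i).1 + 3 ≤ x₁ ∧
      y₀ + 3 ≤ (B.path d i).2 ∧ (B.path d i).2 + 3 ≤ y₁ := by
    intro i hi
    have hl := Rect.len_cast h1 h2 d
    cases d <;> simp only [Rect.path] at * <;> omega
  refine .bind (shiftMark_spec (k := d.rotL) (x := (B.corner d.rotL).1)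
    (y := (B.corner d.rotL).2) (x' := ((B.grow d).corner d.rotL).1)
    (y' := ((B.grow d).corner d.rotL).2) e1 ?_ ?_ rfl h hK ⟨by omega, by omega⟩
    ⟨by omega, by omega⟩ ⟨by omega, by omega⟩ ⟨by omega, by omega⟩ fun U1 T1 hT1 => ?_)
  · intro j hj; exact Rect.corner_far h1 h2 hj
  · intro j hj
    have := hS1 j _ hj
    rwa [Function.update_of_ne hj, Function.update_self] at this
  have hc1 := hT1.card_le
  have eL : B.corner d.rotL = B.path d (B.len d - 2 + 1 + 1) := by
    rw [← Rect.path_len h1 h2]; congr 1; omega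
  have hpI : ∀ i ≤ B.len d, Box x₀ x₁ y₀ y₁ K ⟨B.path d i, T1⟩ := fun i hi => by
    obtain ⟨k1, k2, k3, k4⟩ := hp i hi
    exact ⟨by dsimp only; omega, by dsimp only; omega, by dsimp only; omega, by dsimp only; omega,
      by dsimp only; omega⟩
  have ew : (⟨(((B.grow d).corner d.rotL).1, ((B.grow d).corner d.rotL).2), T1⟩ :
    World Pixel (Finset Pixel)) = ⟨d.rotR.move (B.path d (B.len d - 2 + 1 + 1)), T1⟩ := by
    rw [← eL, e1]
  rw [ew]
  refine .bind (.move (by rw [hback]; exact hpI _ (by omega)) ?_)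
  rw [hback, ← Rect.path_move]
  refine .bind (.move (by rw [hopp]; exact hpI _ (by omega)) ?_)
  rw [hopp, ← Rect.path_move]
  refine .bind (.move (by rw [hopp]; exact hpI _ (by omega)) ?_)
  rw [hopp]
  have e00 : Function.update B.corner d.rotL ((B.grow d).corner d.rotL) d = B.corner d :=
    Function.update_of_ne hne _ _
  refine .bind (backSide_spec (B.path d) (B.len d - 2) (Rect.path_move d) ?_ ?_ (by omega) ?_ ?_)
  · intro i hi hi'
    refine hT1.not_markAt hS1 fun d' => ?_
    have hl := Rect.len_cast h1 h2 d
    cases d <;> cases d' <;>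
      simp only [Function.update_apply, Direction.rotL, Rect.path, Rect.corner, Rect.grow, Far,
        reduceCtorEq, if_true, if_false, true_and] at hl ⊢ <;> omega
  · rw [Rect.path_zero, ← e00]
    exact hT1.markAt hS1 d
  · intro i hi
    have := hp i (by omega); omega
  intro U2 t2 ht2
  rw [Rect.path_zero]
  refine .bind (shiftMark_spec (k := d) (x := (B.corner d).1)
    (y := (B.corner d).2) (x' := ((B.grow d).corner d).1)
    (y' := ((B.grow d).corner d).2) e0 ?_ ?_ e00 hT1 hK ⟨by omega, by omega⟩
    ⟨by omega, by omega⟩ ⟨by omega, by omega⟩ ⟨by omega, by omega⟩ fun U3 T2 hT2 => ?_)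
  · intro j hj
    have := hS1 j _ hj; rwa [e00] at this
  · intro j hj
    clear ew eL hI hp hpI hP
    cases d <;> cases j <;> first | exact absurd rfl hj |
      (simp [Function.update, Direction.rotL, Rect.corner, Rect.grow, Far]; omega)
  refine .pure (hP _ _ _ ?_ ?_)
  · rw [← hA2]; exact hT2
  · omega

end Grow
end TileRobot

/-! ### Growing the rectangle to the bounding box. -/

namespace TileRobot
open Mach

/-- Read and mark a block. -/
def placeMark : GMach Block := do
  let c ← readBlock
  writeBlock markBlock
  pure c

/-- Enlarge the rectangle, as long as some neighbouring line contains a tile. The loop state holds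
the side to scan, the number of successive clear sides so far (up to 3), and the original contents
of the marked blocks. -/
def growLoop (st : Direction × Fin 4 × (Direction → Block)) : GMach Unit :=
  iter (fun st : Direction × Fin 4 × (Direction → Block) => do
    let found ← scanSide st.1
    match found with
    | true => do
      let r ← expandSide st.1 (st.2.2 st.1) (st.2.2 st.1.rotL)
      -- A detour to the neighbouring pixel and back, because a round of `iter` has to end with a
      -- move.
      mv st.1
      let s ← look
      pure (.inl ((st.1, 0, Function.update (Function.update st.2.2 st.1.rotL r.2) st.1 r.1), s,
        st.1.opp))
    -- Stopping only after the side `.down` makes the robot end at the lower left mark, a fixed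
    -- place for what follows.
    | false => match decide (st.2.1 = 3 ∧ st.1 = .down) with
      | true => pure (.inr ())
      | false => do
        mv st.1
        let s ← look
        pure (.inl ((st.1.rotL, if st.2.1 = 3 then 3 else st.2.1 + 1, st.2.2), s, st.1.opp))) st

def cornerBlocks (c0 c1 c2 c3 : Block) : Direction → Block
  | .right => c0
  | .up => c1
  | .left => c2
  | .down => c3

/-- Mark the corners around a tile. -/
def markCorners : GMach (Direction → Block) := do
  mv .left
  mv .left
  mv .down
  mv .down
  let c0 ← placeMark
  mv .right
  mv .right
  mv .right
  mv .right
  let c1 ← placeMark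
  mv .up
  mv .up
  mv .up
  mv .up
  let c2 ← placeMark
  mv .left
  mv .left
  mv .left
  mv .left
  let c3 ← placeMark
  mv .down
  mv .down
  mv .down
  mv .down
  pure (cornerBlocks c0 c1 c2 c3)

/-- Starting on a tile, mark the corners around the bounding box. -/
def growBox : GMach Unit := do
  let f ← markCorners
  growLoop (.right, 0, f)

def Polyomino.rect (P : Polyomino) : Rect := ⟨P.xMin, P.xMax, P.yMin, P.yMax⟩

namespace Direction

def rank : Direction → ℕ
  | right => 4 | up => 3 | left => 2 | down => 1

end Direction

section
variable {P : Polyomino} {x₀ x₁ y₀ y₁ : ℤ} {K : ℕ}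

/-- The part of the loop variant that is reset when the rectangle grows. -/
def growRank (d : Direction) (k : Fin 4) : ℕ := if k = 3 then d.rank else 8 - k

/-- This is why the deficit of the rectangle has weight 9 in the loop variant: growing lowers the
deficit by one, and the rank cannot rise by more than 8. -/
theorem growRank_le (d : Direction) (k : Fin 4) : growRank d k ≤ 8 := by
  unfold growRank; split
  · cases d <;> simp [Direction.rank]
  · omega

/-- A side is pushed outward only if the line it reaches contains a tile, so the rectangle never
leaves the bounding box. -/
theorem Rect.grow_subset {B : Rect} (h : P.xMin ≤ B.a ∧ B.b ≤ P.xMax ∧ P.yMin ≤ B.c ∧ B.e ≤ P.yMax)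
    {d : Direction} (hd : ¬ B.Clear P.tiles d) :
    P.xMin ≤ (B.grow d).a ∧ (B.grow d).b ≤ P.xMax ∧ P.yMin ≤ (B.grow d).c ∧
      (B.grow d).e ≤ P.yMax := by
  cases d <;> simp only [Rect.Clear, not_forall, not_not] at hd <;>
    obtain ⟨u, _, _, hu⟩ := hd <;> have := P.le_of_mem hu <;> simp only [Rect.grow] <;> omega

/-- The rectangle always lies inside the bounding box and contains the starting tile, and the `k`
sides scanned most recently are clear with respect to the present rectangle. The variant `μ` bounds
the number of further rounds, and each round costs one scan and at most one shift of a side. -/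
theorem growLoop_spec (hK : P.tiles.card + 16 ≤ K) (hx : x₀ + 6 ≤ P.xMin ∧ P.xMax + 6 ≤ x₁)
    (hy : y₀ + 6 ≤ P.yMin ∧ P.yMax + 6 ≤ y₁) {s : Pixel} (hs : s ∈ P.tiles) :
    ∀ (μ : ℕ) (B : Rect) (d : Direction) (k : Fin 4) (T : Finset Pixel),
    (P.xMin ≤ B.a ∧ B.b ≤ P.xMax ∧ P.yMin ≤ B.c ∧ B.e ≤ P.yMax) →
    (B.a ≤ s.1 ∧ s.1 ≤ B.b ∧ B.c ≤ s.2 ∧ s.2 ≤ B.e) →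
    Overlay P.tiles B.corner T →
    (1 ≤ k → B.Clear P.tiles d.rotR) → (2 ≤ k → B.Clear P.tiles d.rotR.rotR) →
    (3 ≤ k → B.Clear P.tiles d.rotR.rotR.rotR) →
    9 * (P.xMax - P.xMin - (B.b - B.a) + (P.yMax - P.yMin - (B.e - B.c))) + growRank d k = μ →
    Spec (Box x₀ x₁ y₀ y₁ K)
      (growLoop (d, k, fun d => BlockAt P.tiles (B.corner d).1 (B.corner d).2)) ⟨B.corner d, T⟩
      fun _ w t _ => w.pos = P.rect.corner .right ∧ Overlay P.tiles P.rect.corner w.mem ∧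
        t ≤ (μ + 1) * (17 * (P.width + P.height + 4) + 60) := by
  intro μ
  have hw := P.width_eq
  have hh := P.height_eq
  induction μ using Nat.strong_induction_on with
  | _ μ ih =>
  intro B d k T hB hsB hT hk1 hk2 hk3 hμ
  have h1 : B.a ≤ B.b := by omega
  have h2 : B.c ≤ B.e := by omega
  have hlen : B.len d ≤ P.width + P.height + 4 := by
    have := Rect.len_cast h1 h2 d
    cases d <;> simp only at this <;> omega
  have hopp : ∀ p, d.opp.move (d.move p) = p := by
    rintro ⟨u, v⟩; cases d <;> simp [Direction.opp, Direction.move]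
  have hrot : d.rotL.rotR = d := by cases d <;> rfl
  have hc := hT.card_le
  refine .iter (.bind (Rect.scan hT h1 h2 d (by omega) (by omega) (by omega) fun U1 t1 b hb ht1 => ?_))
  cases b with
  | true =>
    have hncl : ¬ B.Clear P.tiles d := by rw [← hb]; simp
    refine .bind (Rect.expand hT h1 h2 d hK (by omega) (by omega) fun U2 t2 T2 hT2 ht2 => ?_)
    have hsub := Rect.grow_subset hB hncl
    have hsB' : (B.grow d).a ≤ s.1 ∧ s.1 ≤ (B.grow d).b ∧ (B.grow d).c ≤ s.2 ∧
        s.2 ≤ (B.grow d).e := by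
      cases d <;> simp only [Rect.grow] <;> omega
    have hc2 := hT2.card_le
    have hI : Box x₀ x₁ y₀ y₁ K ⟨(B.grow d).corner d, T2⟩ ∧
        Box x₀ x₁ y₀ y₁ K ⟨d.move ((B.grow d).corner d), T2⟩ := by
      unfold Box
      cases d <;> simp only [Rect.corner, Rect.grow, Direction.move] at * <;> omega
    refine .bind (.move hI.2 (.bind (.look (.pure ?_))))
    dsimp only
    rw [World.act_cur]
    have e : Arena.go (Mem := Finset Pixel) (A := Bool) d.opp (d.move ((B.grow d).corner d)) =
      (B.grow d).corner d := hopp _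
    refine ⟨by rw [e]; exact hI.1, ?_⟩
    rw [e]
    have ef : Function.update (Function.update
        (fun d => BlockAt P.tiles (B.corner d).1 (B.corner d).2) d.rotL
        (BlockAt P.tiles ((B.grow d).corner d.rotL).1 ((B.grow d).corner d.rotL).2)) d
        (BlockAt P.tiles ((B.grow d).corner d).1 ((B.grow d).corner d).2) =
        fun d' => BlockAt P.tiles ((B.grow d).corner d').1 ((B.grow d).corner d').2 := by
      funext d'
      simp only [Function.update_apply]
      cases d <;> cases d' <;> simp [Direction.rotL, Rect.corner, Rect.grow]
    rw [ef]
    have hr := growRank_le d 0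
    -- The rectangle gains one row or column, which outweighs the reset of `growRank`.
    have hμ' : 9 * (P.xMax - P.xMin - ((B.grow d).b - (B.grow d).a) +
        (P.yMax - P.yMin - ((B.grow d).e - (B.grow d).c))) =
        9 * (P.xMax - P.xMin - (B.b - B.a) + (P.yMax - P.yMin - (B.e - B.c))) - 9 := by
      cases d <;> simp only [Rect.grow] <;> ring
    refine (ih (9 * (P.xMax - P.xMin - ((B.grow d).b - (B.grow d).a) +
        (P.yMax - P.yMin - ((B.grow d).e - (B.grow d).c))) + growRank d 0).toNat (by omega)
      (B.grow d) d 0 T2 hsub hsB' hT2 (by simp) (by simp) (by simp) (by omega)).mono ?_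
    rintro _ w t U - ⟨h1, h2, h3⟩
    refine ⟨h1, h2, ?_⟩
    have : (9 * (P.xMax - P.xMin - ((B.grow d).b - (B.grow d).a) +
        (P.yMax - P.yMin - ((B.grow d).e - (B.grow d).c))) + growRank d 0).toNat + 1 ≤ μ := by omega
    have h4 := Nat.mul_le_mul_right (17 * (P.width + P.height + 4) + 60) this
    have h5 : (μ + 1) * (17 * (P.width + P.height + 4) + 60) =
      μ * (17 * (P.width + P.height + 4) + 60) + (17 * (P.width + P.height + 4) + 60) := by ring
    omega
  | false =>
    have hcl : B.Clear P.tiles d := hb.1 rfl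
    by_cases hend : k = 3 ∧ d = .down
    · obtain ⟨rfl, rfl⟩ := hend
      simp only [decide_true, and_self]
      refine .pure ?_
      have k1 := hk1 (by decide)
      have k2 := hk2 (by decide)
      have k3 := hk3 (by decide)
      simp only [Direction.rotR] at k1 k2 k3
      -- Now all four neighbouring lines are clear. Connectedness puts every tile into the
      -- rectangle, and `hB` is the converse inclusion.
      have := P.subset_of_clear hs hsB k3 k1 hcl k2
      have e : B = P.rect := by
        cases B; simp only [Polyomino.rect, Rect.mk.injEq] at *; omega
      subst e
      refine ⟨rfl, hT, ?_⟩
      have h5 : (μ + 1) * (17 * (P.width + P.height + 4) + 60) =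
        μ * (17 * (P.width + P.height + 4) + 60) + (17 * (P.width + P.height + 4) + 60) := by ring
      have := Nat.zero_le (μ * (17 * (P.width + P.height + 4) + 60))
      omega
    · simp only [hend, decide_false]
      have hI : Box x₀ x₁ y₀ y₁ K ⟨B.corner d.rotL, T⟩ ∧
          Box x₀ x₁ y₀ y₁ K ⟨d.move (B.corner d.rotL), T⟩ := by
        unfold Box
        cases d <;> simp only [Rect.corner, Direction.rotL, Direction.move] at * <;> omega
      refine .bind (.move hI.2 (.bind (.look (.pure ?_))))
      dsimp only
      rw [World.act_cur]
      have e : Arena.go (Mem := Finset Pixel) (A := Bool) d.opp (d.move (B.corner d.rotL)) =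
        B.corner d.rotL := hopp _
      refine ⟨by rw [e]; exact hI.1, ?_⟩
      rw [e]
      have hr : growRank d.rotL (if k = 3 then 3 else k + 1) < growRank d k := by
        clear hk1 hk2 hk3 hμ
        revert hend
        fin_cases k <;> cases d <;> decide
      refine (ih (9 * (P.xMax - P.xMin - (B.b - B.a) + (P.yMax - P.yMin - (B.e - B.c))) +
          growRank d.rotL (if k = 3 then 3 else k + 1)).toNat (by omega)
        B d.rotL _ T hB hsB hT ?_ ?_ ?_ (by omega)).mono ?_
      · intro _; rwa [hrot]
      · intro h; rw [hrot]; exact hk1 (by revert h; clear * -; revert k; decide)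
      · intro h; rw [hrot]; exact hk2 (by revert h; clear * -; revert k; decide)
      rintro _ w t U - ⟨h1, h2, h3⟩
      refine ⟨h1, h2, ?_⟩
      have : (9 * (P.xMax - P.xMin - (B.b - B.a) + (P.yMax - P.yMin - (B.e - B.c))) +
          growRank d.rotL (if k = 3 then 3 else k + 1)).toNat + 1 ≤ μ := by omega
      have h4 := Nat.mul_le_mul_right (17 * (P.width + P.height + 4) + 60) this
      have h5 : (μ + 1) * (17 * (P.width + P.height + 4) + 60) =
        μ * (17 * (P.width + P.height + 4) + 60) + (17 * (P.width + P.height + 4) + 60) := by ring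
      omega

theorem placeMark_spec {P : Finset Pixel} {T : Finset Pixel} {A : Direction → Pixel}
    {S : Direction → Prop} {k : Direction} {x y : ℤ} (hA : ∀ j, S j → Far (A j) (x, y))
    (hk : A k = (x, y)) (hT : OverlayOn P A S T) (hK : T.card + 4 ≤ K)
    (hx : x₀ ≤ x ∧ x + 1 ≤ x₁) (hy : y₀ ≤ y ∧ y + 1 ≤ y₁)
    {Post : Block → World Pixel (Finset Pixel) → ℕ → Set Pixel → Prop}
    (h : ∀ U T', OverlayOn P A (fun d => d = k ∨ S d) T' → T'.card ≤ T.card + 4 →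
      Post (BlockAt P x y) ⟨(x, y), T'⟩ 8 U) :
    Spec (Box x₀ x₁ y₀ y₁ K) placeMark ⟨(x, y), T⟩ Post := by
  refine .bind (Box.readBlock_spec hx hy (by omega) fun U2 => ?_)
  refine .bind (Box.writeBlock_spec hx hy (by omega) _ fun U3 T2 h2 k2 c2 => ?_)
  obtain ⟨e, hO⟩ := OverlayOn.mark hA hk hT h2 k2
  rw [e]
  exact .pure (h _ _ hO c2)

theorem growBox_time {w h t z : ℕ} (hz : z + 1 ≤ 9 * (w + h) + 11)
    (ht : t ≤ (z + 1) * (17 * (w + h + 4) + 60)) :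
    t + 60 ≤ (9 * (w + h) + 12) * (17 * (w + h + 4) + 60) := by
  have h1 := ht.trans (Nat.mul_le_mul_right _ hz)
  have h2 : (9 * (w + h) + 12) * (17 * (w + h + 4) + 60) =
    (9 * (w + h) + 11) * (17 * (w + h + 4) + 60) + (17 * (w + h + 4) + 60) := by ring
  rw [h2]
  exact Nat.add_le_add h1 (Nat.le_add_left _ _)

/-- Every new mark is far from those already placed, so each block read before marking shows the
polyomino. The corners of a one-pixel rectangle are four steps apart. -/
theorem markCorners_spec (hK : P.tiles.card + 16 ≤ K) (hx : x₀ + 6 ≤ P.xMin ∧ P.xMax + 6 ≤ x₁)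
    (hy : y₀ + 6 ≤ P.yMin ∧ P.yMax + 6 ≤ y₁) {x y : ℤ} (hs : (x, y) ∈ P.tiles)
    {Post : (Direction → Block) → World Pixel (Finset Pixel) → ℕ → Set Pixel → Prop}
    (h : ∀ U T, Overlay P.tiles (Rect.corner ⟨x, x, y, y⟩) T →
      Post (fun d => BlockAt P.tiles (Rect.corner ⟨x, x, y, y⟩ d).1 (Rect.corner ⟨x, x, y, y⟩ d).2)
        ⟨Rect.corner ⟨x, x, y, y⟩ .right, T⟩ 52 U) :
    Spec (Box x₀ x₁ y₀ y₁ K) markCorners ⟨(x, y), P.tiles⟩ Post := by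
  have hb := P.le_of_mem hs
  have hS : Spread (Rect.corner ⟨x, x, y, y⟩) := fun _ _ => Rect.corner_far le_rfl le_rfl
  have h0 : OverlayOn P.tiles (Rect.corner ⟨x, x, y, y⟩) (fun _ => False) P.tiles := by
    intro u v; simp
  refine .bind (.moveLeft rfl (.mk (by omega)) ?_)
  refine .bind (.moveLeft (x' := x - 2) (by omega) (.mk (by omega)) ?_)
  refine .bind (.moveDown rfl (.mk (by omega)) ?_)
  refine .bind (.moveDown (y' := y - 2) (by omega) (.mk (by omega)) ?_)
  refine .bind (placeMark_spec (k := .right) (by simp) rfl h0 (by omega) (by omega) (by omega)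
    fun U1 T1 h1 c1 => ?_)
  refine .bind (.moveRight rfl (.mk (by omega)) ?_)
  refine .bind (.moveRight rfl (.mk (by omega)) ?_)
  refine .bind (.moveRight rfl (.mk (by omega)) ?_)
  refine .bind (.moveRight (x' := x + 2) (by omega) (.mk (by omega)) ?_)
  refine .bind (placeMark_spec (k := .up) ?_ rfl h1 (by omega) (by omega) (by omega)
    fun U2 T2 h2 c2 => ?_)
  · rintro j (rfl | h)
    exacts [hS _ .up (by simp), h.elim]
  refine .bind (.moveUp rfl (.mk (by omega)) ?_)
  refine .bind (.moveUp rfl (.mk (by omega)) ?_)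
  refine .bind (.moveUp rfl (.mk (by omega)) ?_)
  refine .bind (.moveUp (y' := y + 2) (by omega) (.mk (by omega)) ?_)
  refine .bind (placeMark_spec (k := .left) ?_ rfl h2 (by omega) (by omega) (by omega)
    fun U3 T3 h3 c3 => ?_)
  · rintro j (rfl | rfl | h)
    exacts [hS _ .left (by simp), hS _ .left (by simp), h.elim]
  refine .bind (.moveLeft rfl (.mk (by omega)) ?_)
  refine .bind (.moveLeft rfl (.mk (by omega)) ?_)
  refine .bind (.moveLeft rfl (.mk (by omega)) ?_)
  refine .bind (.moveLeft (x' := x - 2) (by omega) (.mk (by omega)) ?_)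
  refine .bind (placeMark_spec (k := .down) ?_ rfl h3 (by omega) (by omega) (by omega)
    fun U4 T4 h4 c4 => ?_)
  · rintro j (rfl | rfl | rfl | h)
    exacts [hS _ .down (by simp), hS _ .down (by simp), hS _ .down (by simp), h.elim]
  have hO : Overlay P.tiles (Rect.corner ⟨x, x, y, y⟩) T4 := by
    intro u v
    have e : ∀ d : Direction, d = .down ∨ d = .left ∨ d = .up ∨ d = .right ∨ False := by
      intro d; cases d <;> simp
    rw [h4]; simp only [e, true_and, true_imp_iff]
  have c5 := hO.card_le
  refine .bind (.moveDown rfl (.mk (by omega)) ?_)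
  refine .bind (.moveDown rfl (.mk (by omega)) ?_)
  refine .bind (.moveDown rfl (.mk (by omega)) ?_)
  refine .bind (.moveDown (y' := y - 2) (by omega) (.mk (by omega)) ?_)
  have ef : cornerBlocks (BlockAt P.tiles (x - 2) (y - 2)) (BlockAt P.tiles (x + 2) (y - 2))
      (BlockAt P.tiles (x + 2) (y + 2)) (BlockAt P.tiles (x - 2) (y + 2)) = fun d =>
      BlockAt P.tiles (Rect.corner ⟨x, x, y, y⟩ d).1 (Rect.corner ⟨x, x, y, y⟩ d).2 := by
    funext d; cases d <;> rfl
  rw [ef]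
  exact .pure (h _ _ hO)

theorem growBox_spec (hK : P.tiles.card + 16 ≤ K) (hx : x₀ + 6 ≤ P.xMin ∧ P.xMax + 6 ≤ x₁)
    (hy : y₀ + 6 ≤ P.yMin ∧ P.yMax + 6 ≤ y₁) {s : Pixel} (hs : s ∈ P.tiles) :
    Spec (Box x₀ x₁ y₀ y₁ K) growBox ⟨s, P.tiles⟩
      fun _ w t _ => w.pos = P.rect.corner .right ∧ Overlay P.tiles P.rect.corner w.mem ∧
        t ≤ (9 * (P.width + P.height) + 12) * (17 * (P.width + P.height + 4) + 60) := by
  obtain ⟨x, y⟩ := s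
  have hb := P.le_of_mem hs
  have hw := P.width_eq
  have hh := P.height_eq
  refine .bind (markCorners_spec hK hx hy hs fun U T4 hO => ?_)
  have hr := growRank_le .right 0
  have key := growLoop_spec hK hx hy hs (9 * (P.xMax - P.xMin - (x - x) +
    (P.yMax - P.yMin - (y - y))) + growRank .right 0).toNat ⟨x, x, y, y⟩ .right 0 T4 hb
    ⟨le_rfl, le_rfl, le_rfl, le_rfl⟩ hO (by simp) (by simp) (by simp) (by dsimp only; omega)
  refine key.mono ?_
  rintro _ w t U - ⟨h1, h2, h3⟩
  refine ⟨h1, h2, ?_⟩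
  have h4 := growBox_time (by omega) h3
  clear * - h4
  generalize (9 * (P.width + P.height) + 12) * (17 * (P.width + P.height + 4) + 60) = z at h4 ⊢
  omega

end

/-! ### Tape machines -/

section Tape
variable {S : Type}

/-- The two-way infinite tape with an optional symbol in each cell; `true` moves to the right. -/
instance : Arena ℤ (ℤ → Option S) (Option S) Bool where
  get f c := f c
  set f c s := Function.update f c s
  go b c := if b then c + 1 else c - 1
  set_get f c := Function.update_eq_self c f

abbrev TMach (S α : Type) := Mach (Option S) Bool α

abbrev TWorld (S : Type) := World ℤ (ℤ → Option S)

/-- The tape with head on cell `c`, the cells from `c` on containing `R`, and those to the left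
of `c` containing `L`, from right to left. -/
def tw (c : ℤ) (L R : List (Option S)) : TWorld S :=
  ⟨c, fun u => if u < c then L.getD (c - 1 - u).toNat none else R.getD (u - c).toNat none⟩

@[simp] theorem tw_pos (c : ℤ) (L R : List (Option S)) : (tw c L R).pos = c := rfl

/-- Cutting the tape at another place does not change its content; thus a head move only transfers a
cell from one list to the other. -/
theorem tw_shift (c c' : ℤ) (L R : List (Option S)) (s : Option S) (h : c' = c + 1) :
    (tw c L (s :: R)).mem = (tw c' (s :: L) R).mem := by
  subst h
  funext u
  simp only [tw]
  rcases lt_trichotomy u c with h | rfl | h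
  · rw [if_pos h, if_pos (by omega)]
    obtain ⟨i, hi⟩ := Int.eq_ofNat_of_zero_le (a := c - 1 - u) (by omega)
    rw [show c + 1 - 1 - u = ((i + 1 : ℕ) : ℤ) by push_cast; omega, hi]
    simp
  · simp
  · rw [if_neg (by omega), if_neg (by omega)]
    obtain ⟨i, hi⟩ := Int.eq_ofNat_of_zero_le (a := u - (c + 1)) (by omega)
    rw [show u - c = ((i + 1 : ℕ) : ℤ) by push_cast; omega, hi]
    simp

theorem tw_nil_right (c : ℤ) (L : List (Option S)) : tw c L [] = tw c L [none] := by
  refine World.ext rfl (funext fun u => ?_)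
  simp only [tw]
  split
  · rfl
  · rcases (u - c).toNat with _ | i <;> simp

theorem tw_nil_left (c : ℤ) (R : List (Option S)) : tw c [] R = tw c [none] R := by
  refine World.ext rfl (funext fun u => ?_)
  simp only [tw]
  split
  · rcases (c - 1 - u).toNat with _ | i <;> simp
  · rfl

theorem tw_replicate_left (c : ℤ) (L R : List (Option S)) (k : ℕ) :
    tw c (L ++ List.replicate k none) R = tw c L R := by
  refine World.ext rfl (funext fun u => ?_)
  simp only [tw]
  split
  · generalize (c - 1 - u).toNat = i
    rw [List.getD_eq_getElem?_getD, List.getD_eq_getElem?_getD, List.getElem?_append]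
    split
    · rfl
    · rename_i h
      rw [List.getElem?_replicate, List.getElem?_eq_none (l := L) (by omega)]
      split <;> rfl
  · rfl

theorem tw_get (c : ℤ) (L R : List (Option S)) (s : Option S) :
    (tw c L (s :: R)).cur = s := by
  simp [World.cur, Arena.get, tw]

theorem tw_update (c : ℤ) (L R : List (Option S)) (s s' : Option S) :
    Function.update (tw c L (s :: R)).mem c s' = (tw c L (s' :: R)).mem := by
  funext u
  simp only [tw, Function.update_apply]
  split
  · subst u; simp
  · split
    · rfl
    · obtain ⟨i, hi⟩ := Int.eq_ofNat_of_zero_le (a := u - c - 1) (by omega)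
      rw [show u - c = ((i + 1 : ℕ) : ℤ) by push_cast; omega]
      simp

theorem tw_act_right (c c' : ℤ) (h : c' = c + 1) (L R : List (Option S)) (s s' : Option S) :
    (tw c L (s :: R)).act s' true = tw c' (s' :: L) R := by
  refine World.ext (by simp [World.act, Arena.go, tw, h]) ?_
  rw [← tw_shift c c' L R s' h, ← tw_update c L R s s']
  rfl

theorem tw_act_left (c c' : ℤ) (h : c' = c - 1) (L R : List (Option S)) (x s s' : Option S) :
    (tw c (x :: L) (s :: R)).act s' false = tw c' L (x :: s' :: R) := by
  refine World.ext (by simp [World.act, Arena.go, tw, h]) ?_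
  rw [tw_shift c' c L (s' :: R) x (by omega), ← tw_update c (x :: L) R s s']
  rfl

/-- The number of cells that are not empty. -/
noncomputable def wt (f : ℤ → Option S) : ℕ := {u | f u ≠ none}.ncard

def cnt (L : List (Option S)) : ℕ := L.countP Option.isSome

@[simp] theorem cnt_nil : cnt ([] : List (Option S)) = 0 := rfl
@[simp] theorem cnt_none (L : List (Option S)) : cnt (none :: L) = cnt L := by simp [cnt]
@[simp] theorem cnt_some (s : S) (L : List (Option S)) : cnt (some s :: L) = cnt L + 1 := by
  simp [cnt]
@[simp] theorem cnt_append (L L' : List (Option S)) : cnt (L ++ L') = cnt L + cnt L' := by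
  simp [cnt]
@[simp] theorem cnt_reverse (L : List (Option S)) : cnt L.reverse = cnt L := by simp [cnt]
@[simp] theorem cnt_replicate (k : ℕ) : cnt (List.replicate k (none : Option S)) = 0 := by
  simp [cnt, List.countP_replicate]
theorem cnt_le_length (L : List (Option S)) : cnt L ≤ L.length := List.countP_le_length
theorem cnt_cons_le (s : Option S) (L : List (Option S)) : cnt (s :: L) ≤ cnt L + 1 := by
  cases s <;> simp

theorem tw_nil_nil (c : ℤ) : (tw c [] [] : TWorld S).mem = fun _ => none := by
  funext u; simp [tw]

theorem wt_update {f : ℤ → Option S} (hf : {u | f u ≠ none}.Finite) {c : ℤ} (hc : f c = none)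
    (s : S) : wt (Function.update f c (some s)) = wt f + 1 := by
  unfold wt
  rw [← Set.ncard_insert_of_notMem (a := c) (by simpa using hc) hf]
  congr 1
  ext u
  by_cases h : u = c <;> simp [h, Function.update_apply]

/-- The cut is moved to the left until the left list is empty; then the cells of the right list are
counted one by one. -/
theorem tw_finite_wt (c : ℤ) (L R : List (Option S)) :
    {u | (tw c L R).mem u ≠ none}.Finite ∧ wt (tw c L R).mem = cnt L + cnt R := by
  induction L generalizing c R with
  | cons x L ih =>
    rw [← tw_shift (c - 1) c L R x (by omega)]
    obtain ⟨h1, h2⟩ := ih (c - 1) (x :: R)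
    refine ⟨h1, h2.trans ?_⟩
    cases x <;> simp <;> omega
  | nil =>
    induction R generalizing c with
    | nil =>
      rw [tw_nil_nil]
      simp [wt]
    | cons x R ih =>
      have h0 : (tw c [] (none :: R)).mem = (tw (c + 1) [] R).mem := by
        rw [tw_shift c (c + 1) _ _ _ rfl, ← tw_nil_left]
      obtain ⟨h1, h2⟩ := ih (c + 1)
      rw [← h0] at h1 h2
      cases x with
      | none => exact ⟨h1, by simpa using h2⟩
      | some s =>
        have hc : (tw c [] (none :: R)).mem c = none := by simp [tw]
        rw [← tw_update c [] R none (some s)]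
        constructor
        · refine (h1.insert c).subset ?_
          intro u hu
          by_cases h : u = c
          · exact .inl h
          · exact .inr (by simpa [Function.update_apply, h] using hu)
        · rw [wt_update h1 hc, h2]; simp

/-- The invariant that the head is between `l` and `r`, and at most `K` cells are not empty. -/
def TBox (l r : ℤ) (K : ℕ) (w : TWorld S) : Prop :=
  l ≤ w.pos ∧ w.pos ≤ r ∧ wt w.mem ≤ K

theorem TBox.mk {l r : ℤ} {K : ℕ} {c : ℤ} {L R : List (Option S)}
    (h : l ≤ c ∧ c ≤ r ∧ cnt L + cnt R ≤ K) : TBox l r K (tw c L R) :=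
  ⟨h.1, h.2.1, by rw [(tw_finite_wt c L R).2]; exact h.2.2⟩

namespace Mach
namespace Spec

variable {I : TWorld S → Prop} {c : ℤ} {L R : List (Option S)} {s : Option S}

theorem tlook {Post : Option S → TWorld S → ℕ → Set ℤ → Prop} (h : Post s (tw c L (s :: R)) 0 ∅) :
    Spec I (Mach.look : TMach S (Option S)) (tw c L (s :: R)) Post :=
  Spec.look (by rwa [tw_get])

variable {Post : Unit → TWorld S → ℕ → Set ℤ → Prop}

theorem writeRight {s' : Option S} {c' : ℤ} (e : c' = c + 1) (hI : I (tw c' (s' :: L) R))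
    (h : Post () (tw c' (s' :: L) R) 1 {c}) :
    Spec I (Mach.act s' true : TMach S Unit) (tw c L (s :: R)) Post :=
  Spec.act (by rwa [tw_act_right c c' e]) (by rw [tw_act_right c c' e]; exact h)

theorem writeLeft {s' x : Option S} {c' : ℤ} (e : c' = c - 1) (hI : I (tw c' L (x :: s' :: R)))
    (h : Post () (tw c' L (x :: s' :: R)) 1 {c}) :
    Spec I (Mach.act s' false : TMach S Unit) (tw c (x :: L) (s :: R)) Post :=
  Spec.act (by rwa [tw_act_left c c' e]) (by rw [tw_act_left c c' e]; exact h)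

theorem goRight {c' : ℤ} (e : c' = c + 1) (hI : I (tw c' (s :: L) R))
    (h : Post () (tw c' (s :: L) R) 1 {c}) :
    Spec I (Mach.mv true : TMach S Unit) (tw c L (s :: R)) Post := by
  have e' := World.act_cur (tw c L (s :: R)) true
  rw [tw_get, tw_act_right c c' e] at e'
  exact Spec.mv (by rwa [← e']) (by rw [← e']; exact h)

theorem goLeft {x : Option S} {c' : ℤ} (e : c' = c - 1) (hI : I (tw c' L (x :: s :: R)))
    (h : Post () (tw c' L (x :: s :: R)) 1 {c}) :
    Spec I (Mach.mv false : TMach S Unit) (tw c (x :: L) (s :: R)) Post := by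
  have e' := World.act_cur (tw c (x :: L) (s :: R)) false
  rw [tw_get, tw_act_left c c' e] at e'
  exact Spec.mv (by rwa [← e']) (by rw [← e']; exact h)

end Spec
end Mach

theorem tw_shift_append (c c' : ℤ) (L A R : List (Option S)) (h : c' = c + A.length) :
    (tw c L (A ++ R)).mem = (tw c' (A.reverse ++ L) R).mem := by
  induction A generalizing c L with
  | nil => simp at h; subst h; rfl
  | cons x A ih =>
    rw [List.cons_append, tw_shift c (c + 1) _ _ _ rfl,
      ih (c + 1) (x :: L) (by simp at h; omega)]
    simp

theorem tw_mem_add (c : ℤ) (L R : List (Option S)) (i : ℕ) :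
    (tw c L R).mem (c + i) = R.getD i none := by
  simp [tw]

theorem Mach.Spec.seekTapeRight [Finite S] {l r : ℤ} {K : ℕ} {c : ℤ} {L A R : List (Option S)}
    {s q : Option S} {p : Option S → Bool} (c' : ℤ) (hA : ∀ a ∈ A, p a = false) (hq : p q = true)
    (e : c' = c + A.length + 1) (hl : l ≤ c) (hr : c' ≤ r) (hK : cnt L + cnt (s :: (A ++ q :: R)) ≤ K)
    {Post : Unit → TWorld S → ℕ → Set ℤ → Prop}
    (h : ∀ U, Post () (tw c' (A.reverse ++ s :: L) (q :: R)) (A.length + 1) U) :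
    Spec (TBox l r K) (Mach.seek p true : TMach S Unit) (tw c L (s :: (A ++ q :: R))) Post := by
  have hm : (tw c L (s :: (A ++ q :: R))).mem = (tw c' (A.reverse ++ s :: L) (q :: R)).mem := by
    have := tw_shift_append c c' L (s :: A) (q :: R) (by simp; omega)
    simpa using this
  refine Spec.seek (A.length + 1) (fun i => c + (i : ℤ)) (by omega) (by simp [tw]) ?_ ?_ ?_ ?_ ?_
  · intro i _; simp [Arena.go]; ring
  · intro i h0 hi
    simp only [Arena.get, tw_mem_add]
    obtain ⟨j, rfl⟩ : ∃ j, i = j + 1 := ⟨i - 1, by omega⟩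
    have hj : j < A.length := by omega
    simp only [List.getD_cons_succ]
    rw [List.getD_append _ _ _ _ hj, List.getD_eq_getElem _ _ hj]
    exact hA _ (List.getElem_mem _)
  · simp only [Arena.get, tw_mem_add, List.getD_cons_succ]
    rw [List.getD_append_right _ _ _ _ le_rfl]; simpa using hq
  · intro i h0 hi
    refine ⟨by dsimp only; omega, by dsimp only; omega, ?_⟩
    dsimp only; rw [(tw_finite_wt c _ _).2]; exact hK
  · have : (⟨c + ((A.length + 1 : ℕ) : ℤ), (tw c L (s :: (A ++ q :: R))).mem⟩ : TWorld S) =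
        tw c' (A.reverse ++ s :: L) (q :: R) :=
      World.ext (by simp [tw, e]; ring) hm
    rw [this]; exact h _

theorem Mach.Spec.seekTapeLeft [Finite S] {l r : ℤ} {K : ℕ} {c : ℤ} {L A R : List (Option S)}
    {s q : Option S} {p : Option S → Bool} (c' : ℤ) (hA : ∀ a ∈ A, p a = false) (hq : p q = true)
    (e : c' = c - A.length - 1) (hl : l ≤ c') (hr : c ≤ r)
    (hK : cnt (A ++ q :: L) + cnt (s :: R) ≤ K)
    {Post : Unit → TWorld S → ℕ → Set ℤ → Prop}
    (h : ∀ U, Post () (tw c' L (q :: (A.reverse ++ s :: R))) (A.length + 1) U) :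
    Spec (TBox l r K) (Mach.seek p false : TMach S Unit) (tw c (A ++ q :: L) (s :: R)) Post := by
  have hm : (tw c (A ++ q :: L) (s :: R)).mem = (tw c' L (q :: (A.reverse ++ s :: R))).mem := by
    have := tw_shift_append c' c L (q :: A.reverse) (s :: R) (by simp; omega)
    simpa using this.symm
  have hg : ∀ i : ℕ, i ≤ A.length → (tw c (A ++ q :: L) (s :: R)).mem (c - ((i + 1 : ℕ) : ℤ)) =
      (A ++ q :: L).getD i none := by
    intro i hi
    simp only [tw]
    rw [if_pos (by omega), show c - 1 - (c - ((i + 1 : ℕ) : ℤ)) = (i : ℤ) by push_cast; ring]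
    simp
  refine Spec.seek (A.length + 1) (fun i => c - (i : ℤ)) (by omega) (by simp [tw]) ?_ ?_ ?_ ?_ ?_
  · intro i _; simp [Arena.go]; ring
  · intro i h0 hi
    obtain ⟨j, rfl⟩ : ∃ j, i = j + 1 := ⟨i - 1, by omega⟩
    have hj : j < A.length := by omega
    simp only [Arena.get, hg j hj.le]
    rw [List.getD_append _ _ _ _ hj, List.getD_eq_getElem _ _ hj]
    exact hA _ (List.getElem_mem _)
  · simp only [Arena.get, hg _ le_rfl]
    rw [List.getD_append_right _ _ _ _ le_rfl]; simpa using hq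
  · intro i h0 hi
    refine ⟨by dsimp only; omega, by dsimp only; omega, ?_⟩
    dsimp only; rw [(tw_finite_wt c _ _).2]; exact hK
  · have : (⟨c - ((A.length + 1 : ℕ) : ℤ), (tw c (A ++ q :: L) (s :: R)).mem⟩ : TWorld S) =
        tw c' L (q :: (A.reverse ++ s :: R)) :=
      World.ext (by simp [tw, e]; ring) hm
    rw [this]; exact h _

end Tape

/-! ### Tapes as strips of the grid -/

section Compile
variable {S : Type}

/-- `n` steps in direction `d`. -/
def walk (d : Direction) : ℕ → GMach Unit
  | 0 => pure ()
  | n + 1 => do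
    mv d
    walk d n

/-- Read `n` pixels upwards. -/
def readUp : ℕ → GMach (List Bool)
  | 0 => pure []
  | n + 1 => do
    let b ← look
    mv .up
    let l ← readUp n
    pure (b :: l)

/-- Write a list of letters downwards. -/
def writeDown : List Bool → GMach Unit
  | [] => pure ()
  | b :: l => do
    act b .down
    writeDown l

/-- The column that represents a letter. -/
def column (code : S → ℕ) (m : ℕ) (a : Option S) : List Bool :=
  (List.range m).map fun i => decide (a.map code = some i)

/-- The direction on the grid of a direction on the tape. -/
def toDir (b : Bool) : Direction := if b then .right else .left

/-- The robot that simulates a tape machine, from the state `q`, on a strip of height `m`. -/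
noncomputable def compileFrom (code : S → ℕ) (m : ℕ) {α : Type} (p : TMach S α) (q : p.Q) :
    GMach α :=
  haveI := p.fin
  iter (fun q : p.Q => do
    let l ← readUp m
    -- Decoding by `Function.invFun` is legitimate because `column` is injective; lists that are no
    -- columns are never read.
    match p.δ q (Function.invFun (column code m) l) with
    | .inl a => do
      walk .down m
      pure (.inr a)
    | .inr (q', s, d) => do
      mv .down
      writeDown (column code m s).reverse
      mv .up
      -- The last step of the round moves to the neighbouring column and must write something, so
      -- the content of the current pixel is written back.
      let b ← look
      pure (.inl (q', b, toDir d))) q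

/-- The robot that simulates a tape machine on a strip of height `m`. -/
noncomputable def compile (code : S → ℕ) (m : ℕ) {α : Type} (p : TMach S α) : GMach α :=
  compileFrom code m p p.start

/-- The rows `Y, …, Y + m - 1` of `T` represent the tape `f`, and the other rows are `G`. -/
def Rep (code : S → ℕ) (m : ℕ) (Y : ℤ) (T : Finset Pixel) (f : ℤ → Option S)
    (G : ℤ → ℤ → Prop) : Prop :=
  ∀ u v, (u, v) ∈ T ↔ if Y ≤ v ∧ v < Y + m then ∃ s, f u = some s ∧ v = Y + code s else G u v

variable {code : S → ℕ} {m : ℕ} {Y : ℤ} {T T' : Finset Pixel} {f f' : ℤ → Option S}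
  {G : ℤ → ℤ → Prop}

theorem column_injective (hm : ∀ s, code s < m) (hc : code.Injective) :
    (column code m).Injective := by
  intro a b h
  simp only [column, List.map_inj_left, List.mem_range, decide_eq_decide] at h
  cases a with
  | some s =>
    have := (h (code s) (hm s)).1 rfl
    cases b with
    | none => simp at this
    | some t => simp at this; rw [hc this]
  | none =>
    cases b with
    | none => rfl
    | some t => have := (h (code t) (hm t)).2 rfl; simp at this

/-- The column of a nonblank cell contains exactly one tile, and that of a blank cell none. Tiles in
the strip are therefore nonblank cells, whatever the number of symbols. -/
theorem Rep.card_eq_add (hm : ∀ s, code s < m) (h : Rep code m Y T f G) :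
    {u | f u ≠ none}.Finite ∧
    T.card = wt f + (T.filter fun p => ¬ (Y ≤ p.2 ∧ p.2 < Y + m)).card := by
  have hb : {u | f u ≠ none} = ((T.filter fun p => Y ≤ p.2 ∧ p.2 < Y + m).image Prod.fst : Set ℤ) := by
    ext u
    simp only [Set.mem_ofPred_eq, Finset.coe_image, Set.mem_image, Finset.mem_coe,
      Finset.mem_filter, Prod.exists, exists_and_right, exists_eq_right]
    constructor
    · intro hu
      obtain ⟨s, hs⟩ := Option.ne_none_iff_exists'.1 hu
      have := hm s
      refine ⟨Y + code s, ?_, by omega⟩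
      rw [h, if_pos (by omega)]
      exact ⟨s, hs, rfl⟩
    · rintro ⟨v, hv, hv'⟩
      rw [h, if_pos hv'] at hv
      obtain ⟨s, hs, -⟩ := hv
      simp [hs]
  constructor
  · rw [hb]; exact Finset.finite_toSet _
  · rw [wt, hb, Set.ncard_coe_finset, Finset.card_image_of_injOn,
      Finset.card_filter_add_card_filter_not]
    rintro ⟨u, v⟩ h1 ⟨u', v'⟩ h2 (rfl : u = u')
    simp only [Finset.coe_filter, Set.mem_ofPred_eq] at h1 h2
    have h1' := (h _ _).1 h1.1
    have h2' := (h _ _).1 h2.1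
    rw [if_pos h1.2] at h1'
    rw [if_pos h2.2] at h2'
    obtain ⟨s, hs, rfl⟩ := h1'
    obtain ⟨s', hs', rfl⟩ := h2'
    rw [hs] at hs'; cases hs'; rfl

theorem Rep.card_eq (hm : ∀ s, code s < m) (h : Rep code m Y T f G) (h' : Rep code m Y T' f' G) :
    T'.card + wt f = T.card + wt f' := by
  rw [(h.card_eq_add hm).2, (h'.card_eq_add hm).2]
  have : (T.filter fun p => ¬ (Y ≤ p.2 ∧ p.2 < Y + m)) =
      T'.filter fun p => ¬ (Y ≤ p.2 ∧ p.2 < Y + m) := by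
    ext ⟨u, v⟩
    simp only [Finset.mem_filter]
    refine and_congr_left fun hv => ?_
    rw [h, h', if_neg hv, if_neg hv]
  rw [this]; omega

section Columns
variable {x₀ x₁ y₀ y₁ : ℤ} {K : ℕ} {c v : ℤ}

theorem walk_down_spec {Post : Unit → World Pixel (Finset Pixel) → ℕ → Set Pixel → Prop} (n : ℕ)
    (hc : x₀ ≤ c ∧ c ≤ x₁) (hv : y₀ ≤ v - n ∧ v ≤ y₁) (hK : T.card ≤ K)
    (h : ∀ U, Post () ⟨(c, v - n), T⟩ n U) :
    Spec (Box x₀ x₁ y₀ y₁ K) (walk .down n) ⟨(c, v), T⟩ Post := by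
  induction n generalizing v Post with
  | zero => exact .pure (by simpa using h ∅)
  | succ n ih =>
    push_cast at hv
    refine .bind (.moveDown rfl (.mk (by omega)) (ih (by omega) fun U => ?_))
    have := h ({(c, v)} ∪ U)
    rwa [show v - ((n + 1 : ℕ) : ℤ) = v - 1 - n by push_cast; ring, Nat.add_comm n 1] at this

theorem walk_up_spec {Post : Unit → World Pixel (Finset Pixel) → ℕ → Set Pixel → Prop} (n : ℕ)
    (hc : x₀ ≤ c ∧ c ≤ x₁) (hv : y₀ ≤ v ∧ v + n ≤ y₁) (hK : T.card ≤ K)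
    (h : ∀ U, Post () ⟨(c, v + n), T⟩ n U) :
    Spec (Box x₀ x₁ y₀ y₁ K) (walk .up n) ⟨(c, v), T⟩ Post := by
  induction n generalizing v Post with
  | zero => exact .pure (by simpa using h ∅)
  | succ n ih =>
    push_cast at hv
    refine .bind (.moveUp rfl (.mk (by omega)) (ih (by omega) fun U => ?_))
    have := h ({(c, v)} ∪ U)
    rwa [show v + ((n + 1 : ℕ) : ℤ) = v + 1 + n by push_cast; ring, Nat.add_comm n 1] at this

theorem readUp_spec {Post : List Bool → World Pixel (Finset Pixel) → ℕ → Set Pixel → Prop} (n : ℕ)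
    (hc : x₀ ≤ c ∧ c ≤ x₁) (hv : y₀ ≤ v ∧ v + n ≤ y₁) (hK : T.card ≤ K)
    (h : ∀ U, Post ((List.range n).map fun i : ℕ => decide ((c, v + (i : ℤ)) ∈ T))
      ⟨(c, v + n), T⟩ n U) :
    Spec (Box x₀ x₁ y₀ y₁ K) (readUp n) ⟨(c, v), T⟩ Post := by
  induction n generalizing v Post with
  | zero => exact .pure (by simpa using h ∅)
  | succ n ih =>
    push_cast at hv
    refine .bind (.lookDecide (.bind (.moveUp rfl (.mk (by omega)) (.bind (ih (by omega)
      fun U => .pure ?_)))))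
    have := h (∅ ∪ ({(c, v)} ∪ (U ∪ ∅)))
    rw [show v + ((n + 1 : ℕ) : ℤ) = v + 1 + n by push_cast; ring, List.range_succ_eq_map] at this
    simp only [List.map_cons, List.map_map, Function.comp_def, Nat.cast_zero, add_zero,
      Nat.cast_succ] at this
    rw [show 0 + (1 + (n + 0)) = n + 1 by omega]
    simpa only [show ∀ i : ℕ, v + 1 + (i : ℤ) = v + (i + 1) from fun i => by ring] using this

theorem writeDown_spec {Post : Unit → World Pixel (Finset Pixel) → ℕ → Set Pixel → Prop}
    (l : List Bool) (hc : x₀ ≤ c ∧ c ≤ x₁) (hv : y₀ ≤ v - l.length ∧ v ≤ y₁)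
    (hK : T.card + l.length ≤ K)
    (h : ∀ U, ∀ T' : Finset Pixel, (∀ x y, (x, y) ∈ T' ↔ if x = c ∧ v - l.length < y ∧ y ≤ v then
      l[(v - y).toNat]? = some true else (x, y) ∈ T) →
      T'.card ≤ T.card + l.length → Post () ⟨(c, v - l.length), T'⟩ l.length U) :
    Spec (Box x₀ x₁ y₀ y₁ K) (writeDown l) ⟨(c, v), T⟩ Post := by
  induction l generalizing v T Post with
  | nil =>
    refine .pure ?_
    have := h ∅ T (by intro x y; rw [if_neg (by simp)]) (by simp)
    simpa using this
  | cons b l ih =>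
    simp only [List.length_cons, Nat.cast_succ] at hv hK h
    refine .bind (.write fun T1 h1 k1 => ⟨.mk (by dsimp only; omega), ih (by dsimp only; omega)
      (by omega) fun U T2 h2 k2 => ?_⟩)
    have := h ({(c, v)} ∪ U) T2 ?_ (by omega)
    · dsimp only
      rw [show v - ((l.length : ℤ) + 1) = v - 1 - l.length by ring] at this
      rwa [Nat.add_comm 1]
    · intro x y
      rw [h2]
      simp only [h1, Prod.mk.injEq]
      by_cases e : x = c ∧ v - (l.length + 1) < y ∧ y ≤ v
      · rw [if_pos e]
        by_cases e' : y = v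
        · rw [if_neg (by omega), if_pos ⟨e.1, e'⟩, e']; simp
        · rw [if_pos (by omega)]
          obtain ⟨i, hi⟩ := Int.eq_ofNat_of_zero_le (a := v - 1 - y) (by omega)
          rw [hi, show v - y = ((i + 1 : ℕ) : ℤ) by push_cast; omega]
          simp
      · rw [if_neg e, if_neg (by omega), if_neg (by omega)]

theorem Rep.read (h : Rep code m Y T f G) (c : ℤ) :
    ((List.range m).map fun i : ℕ => decide ((c, Y + (i : ℤ)) ∈ T)) = column code m (f c) := by
  refine List.map_congr_left fun i hi => ?_
  rw [decide_eq_decide, h, if_pos (by simp at hi; omega)]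
  simp only [Option.map_eq_some_iff]
  refine exists_congr fun s => and_congr_right fun _ => ?_
  omega

theorem Rep.write (h : Rep code m Y T f G) {c : ℤ} {a : Option S}
    (h' : ∀ x y, (x, y) ∈ T' ↔ if x = c ∧ Y + m - 1 - (column code m a).reverse.length < y ∧
      y ≤ Y + m - 1 then (column code m a).reverse[(Y + m - 1 - y).toNat]? = some true
      else (x, y) ∈ T) : Rep code m Y T' (Function.update f c a) G := by
  have hl : (column code m a).reverse.length = m := by simp [column]
  rw [hl] at h'
  intro u v
  rw [h']
  by_cases hv : Y ≤ v ∧ v < Y + m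
  · rw [if_pos hv]
    by_cases hu : u = c
    · rw [if_pos (by omega)]
      obtain ⟨i, hi⟩ := Int.eq_ofNat_of_zero_le (a := v - Y) (by omega)
      rw [show Y + m - 1 - v = ((m - 1 - i : ℕ) : ℤ) by omega, Int.toNat_natCast,
        List.getElem?_reverse (by simp [column]; omega)]
      rw [show (column code m a).length - 1 - (m - 1 - i) = i by simp [column]; omega]
      subst hu
      simp only [column, List.getElem?_map, List.getElem?_range (show i < m by omega),
        Option.map_some, Option.some.injEq, decide_eq_true_eq, Function.update_self,
        Option.map_eq_some_iff]
      refine exists_congr fun s => and_congr_right fun _ => ?_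
      omega
    · rw [if_neg (by omega), h, if_pos hv, Function.update_of_ne hu]
  · rw [if_neg (by omega), h, if_neg hv, if_neg hv]

end Columns

/-- A tape step is simulated by reading the column upwards, rewriting it downwards and stepping
aside, in `2 * m + 3` moves. The number of tiles changes exactly as the number of nonblank cells;
the summand `m` in `hK` is an allowance for a column that is being rewritten. -/
theorem compile_spec {α : Type} (hm : ∀ s, code s < m) (hc : code.Injective) (hm0 : 0 < m)
    {l r : ℤ} {Kt K : ℕ} (p : TMach S α) {c : ℤ}
    {Post : α → TWorld S → ℕ → Set ℤ → Prop}
    (hp : Spec (TBox l r Kt) p ⟨c, f⟩ Post) (hT : Rep code m Y T f G)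
    (hI : TBox l r Kt ⟨c, f⟩) (hK : Kt + T.card + m ≤ K + wt f) :
    Spec (Box l r (Y - 1) (Y + m) K) (compile code m p) ⟨(c, Y), T⟩ fun a w t _ =>
      ∃ w' t' U', Post a w' t' U' ∧ TBox l r Kt w' ∧ w.pos = (w'.pos, Y) ∧
        Rep code m Y w.mem w'.mem G ∧
        w.mem.card + wt f = T.card + wt w'.mem ∧ t ≤ (2 * m + 3) * (t' + 1) := by
  obtain ⟨tr, a, w', h1, h2, h3, h4⟩ := hp hI
  -- Generalized to all states and tile sets, for an induction along the run of the tape machine.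
  suffices H : ∀ q w, Trace p q w tr a w' → ∀ T : Finset Pixel, Rep code m Y T w.mem G →
      TBox l r Kt w → Kt + T.card + m ≤ K + wt w.mem →
      Spec (Box l r (Y - 1) (Y + m) K) (compileFrom code m p q) ⟨(w.pos, Y), T⟩
        fun b w₂ t _ => b = a ∧ w₂.pos = (w'.pos, Y) ∧ Rep code m Y w₂.mem w'.mem G ∧
          t ≤ (2 * m + 3) * (tr.length + 1) by
    refine (H p.start _ h1 T hT hI hK).mono ?_
    rintro b w₂ t _ - ⟨rfl, e1, e2, e3⟩
    exact ⟨w', _, _, h4, h3, e1, e2, hT.card_eq hm e2, e3⟩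
  clear h1 h4 hT hI hK hp
  intro q w h1
  have := p.fin
  induction h1 with
  | @done q w a h =>
    intro T hT hI hK
    have hw := hI.2.2
    obtain ⟨hl, hr, -⟩ := hI
    refine Spec.iter (.bind (readUp_spec m ⟨hl, hr⟩ (by omega) (by omega) fun U => ?_))
    rw [hT.read, Function.leftInverse_invFun (column_injective hm hc)]
    rw [show w.cur = w.mem w.pos from rfl] at h
    simp only [h]
    refine .bind (walk_down_spec m ⟨hl, hr⟩ (by omega) (by omega) fun U' => .pure ?_)
    rw [show Y + m - (m : ℤ) = Y by ring]
    refine ⟨rfl, rfl, hT, ?_⟩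
    simp; omega
  | @step q w q' s d tr a w' h htr ih =>
    intro T hT hI hK
    have hw := hI.2.2
    obtain ⟨hl, hr, -⟩ := hI
    refine Spec.iter (.bind (readUp_spec m ⟨hl, hr⟩ (by omega) (by omega) fun U => ?_))
    rw [hT.read, Function.leftInverse_invFun (column_injective hm hc)]
    rw [show w.cur = w.mem w.pos from rfl] at h
    simp only [h]
    have hlen : (column code m s).reverse.length = m := by simp [column]
    refine .bind (.moveDown rfl (.mk (by omega)) ?_)
    refine .bind (writeDown_spec _ ⟨hl, hr⟩ (by omega) (by omega) fun U' T' hT' c' => ?_)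
    have hR := hT.write hT'
    have hcard := hT.card_eq hm hR
    rw [hlen] at c' ⊢
    refine .bind (.moveUp (y' := Y) (by ring) (.mk (by omega)) (.bind (.lookDecide (.pure ?_))))
    have hw' : (⟨(w.pos, Y), T'⟩ : World Pixel (Finset Pixel)).act (decide ((w.pos, Y) ∈ T'))
        (toDir d) = ⟨((w.act s d).pos, Y), T'⟩ := by
      have := World.act_cur (⟨(w.pos, Y), T'⟩ : World Pixel (Finset Pixel)) (toDir d)
      refine this.trans ?_
      cases d <;> simp [Arena.go, Direction.move, toDir, World.act]
    dsimp only
    rw [hw']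
    have hact : TBox l r Kt (w.act s d) := by
      cases htr with
      | done => exact h3
      | step => exact h2 _ (by simp)
    have hmem : (w.act s d).mem = Function.update w.mem w.pos s := rfl
    have := hact.2.2
    rw [hmem] at this
    constructor
    · refine .mk ⟨hact.1, hact.2.1, by omega, by omega, by omega⟩
    · refine (ih (fun x hx => h2 x (by simp [hx])) h3 T' (by rwa [hmem]) hact
        (by rw [hmem]; omega)).mono ?_
      rintro b w₂ t' _ - ⟨e0, e1, e2, e3⟩
      refine ⟨e0, e1, e2, ?_⟩
      have : (2 * m + 3) * ((w :: tr).length + 1) = (2 * m + 3) * (tr.length + 1) + (2 * m + 3) := by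
        simp; ring
      omega

end Compile

/-! ### Tape symbols and arithmetic on the tape -/

/-- The symbols on the tape of the robot. -/
inductive Sym (n : ℕ)
  | home | sep | lend | rend | one
  | sym (a : Fin n)

namespace Sym
variable {n : ℕ}

/-- The symbol `home` has code 0, so its tile lies in the lowest row of the strip. There the robot
meets it when it comes from below or from above. -/
def code : Sym n → ℕ
  | home => 0 | sep => 1 | lend => 2 | rend => 3 | one => 4
  | sym a => a + 5

theorem code_lt (s : Sym n) : s.code < n + 5 := by
  cases s <;> simp [code]

theorem code_injective : (code : Sym n → ℕ).Injective := by
  intro s t h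
  cases s <;> cases t <;> simp [code] at h <;> first | rfl | omega | skip
  exact congrArg _ (Fin.ext h)

instance : DecidableEq (Sym n) := fun s t =>
  decidable_of_iff (s.code = t.code) code_injective.eq_iff

instance : Finite (Sym n) :=
  Finite.of_injective (fun s : Sym n => (⟨s.code, s.code_lt⟩ : Fin (n + 5)))
    fun _ _ h => code_injective (Fin.mk.inj_iff.1 h)

end Sym

abbrev SMach (n : ℕ) (α : Type) := TMach (Sym n) α

section SymMachines
variable {n : ℕ}

/-- The representation of a bit in a cell. -/
def bit (b : Bool) : Option (Sym n) := if b then some .one else none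

def isSym (s : Sym n) (a : Option (Sym n)) : Bool := decide (a = some s)

@[simp] theorem isSym_self (s : Sym n) : isSym s (some s) = true := by simp [isSym]

theorem isSym_bit {s : Sym n} (h : s ≠ .one) (b : Bool) : isSym s (bit b) = false := by
  cases b <;> simp [isSym, bit, h.symm]

theorem isSym_map_bit {s : Sym n} (h : s ≠ .one) (l : List Bool) :
    ∀ a ∈ l.map bit, isSym s a = false := by
  simp only [List.mem_map]
  rintro _ ⟨b, -, rfl⟩
  exact isSym_bit h b

theorem cnt_bit_le (b : Bool) (L : List (Option (Sym n))) :
    cnt (bit b :: L) ≤ cnt L + 1 := cnt_cons_le _ _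

theorem cnt_map_bit_le (l : List Bool) : cnt (l.map bit : List (Option (Sym n))) ≤ l.length :=
  (cnt_le_length _).trans (by simp)

/-- Surround the home cell with end marks. -/
def initTape : SMach n Unit := do
  mv false
  act (some .lend) true
  mv true
  act (some .rend) false

/-- Append a bit at the right end. -/
def appendBit (b : Bool) : SMach n Unit := do
  seek (isSym .rend) true
  act (bit b) true
  act (some .rend) false
  seek (isSym .home) false

/-- Increment the number whose digits begin at the head, and go home. -/
def incLoop : SMach n Unit :=
  iter (fun _ : Unit => do
    let a ← look
    match a with
    | some .one => pure (.inl ((), none, false))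
    | some .lend => do
      act (some .one) false
      act (some .lend) true
      seek (isSym .home) true
      pure (.inr ())
    | _ => do
      act (some .one) false
      seek (isSym .home) true
      pure (.inr ())) ()

/-- Increment the number next to the home cell. -/
def incFirst : SMach n Unit := do
  mv false
  incLoop

/-- Increment the number next to the separator. -/
def incSecond : SMach n Unit := do
  seek (isSym .sep) false
  mv false
  incLoop

/-- Turn the left end into a separator. -/
def closeLeft : SMach n Unit := do
  seek (isSym .lend) false
  act (some .sep) false
  act (some .lend) true
  seek (isSym .home) true

/-! ### Correctness of the arithmetic on the tape. -/

def incBits : List Bool → List Bool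
  | [] => [true]
  | false :: l => true :: l
  | true :: l => false :: incBits l

/-- Digits are listed with the least significant one first, so a carry goes on to the tail of the
list. -/
theorem incBits_bits (k : ℕ) : incBits k.bits = (k + 1).bits := by
  induction k using Nat.binaryRec' with
  | zero => simp [incBits]
  | bit b k h ih =>
    rw [Nat.bits_append_bit k b h]
    cases b with
    | false =>
      rw [show Nat.bit false k + 1 = Nat.bit true k by simp [Nat.bit_val],
        Nat.bits_append_bit k true (by simp)]
      rfl
    | true =>
      rw [show Nat.bit true k + 1 = Nat.bit false (k + 1) by simp [Nat.bit_val]; ring,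
        Nat.bits_append_bit (k + 1) false (by simp), ← ih]
      rfl

variable {l r : ℤ} {K : ℕ} {X c : ℤ} {L R : List (Option (Sym n))}
  {Post : Unit → TWorld (Sym n) → ℕ → Set ℤ → Prop}

theorem initTape_spec (hl : l + 1 ≤ X ∧ X + 1 ≤ r) (hK : 3 ≤ K)
    (h : ∀ U, Post () (tw X [some .lend] [some .home, some .rend]) 4 U) :
    Spec (TBox l r K) (initTape : SMach n Unit) (tw X [] [some .home]) Post := by
  rw [tw_nil_left]
  refine .bind (.goLeft rfl (.mk (by simp; omega)) ?_)
  refine .bind (.writeRight (c' := X) (by ring) (.mk (by simp; omega)) ?_)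
  refine .bind (.goRight rfl (.mk (by simp; omega)) ?_)
  rw [tw_nil_right]
  exact .writeLeft (c' := X) (by ring) (.mk (by simp; omega)) (h _)

theorem appendBit_spec (b : Bool) (bs : List Bool) (hl : l ≤ X) (hr : X + bs.length + 2 ≤ r)
    (hK : cnt L + cnt (bs.map bit : List (Option (Sym n))) + 3 ≤ K)
    (h : ∀ U, Post () (tw X L (some .home :: ((bs ++ [b]).map bit ++ [some .rend])))
      (2 * bs.length + 4) U) :
    Spec (TBox l r K) (appendBit b : SMach n Unit)
      (tw X L (some .home :: (bs.map bit ++ [some .rend]))) Post := by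
  have hb := cnt_bit_le b ([some .rend] : List (Option (Sym n)))
  simp only [cnt_some, cnt_nil] at hb
  refine .bind (.seekTapeRight (X + bs.length + 1) (isSym_map_bit (by simp) bs) (isSym_self _)
    (by simp) hl (by omega) (by simp; omega) fun U1 => ?_)
  have hb' := cnt_bit_le b ((bs.map bit).reverse ++ some .home :: L : List (Option (Sym n)))
  simp only [cnt_append, cnt_reverse, cnt_some] at hb'
  refine .bind (.writeRight rfl (.mk (by simp only [cnt_nil]; omega)) ?_)
  rw [tw_nil_right]
  refine .bind (.writeLeft (c' := X + bs.length + 1) (by ring) (.mk (by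
    simp only [cnt_append, cnt_reverse, cnt_some]; omega)) ?_)
  refine .seekTapeLeft X (A := (bs.map bit).reverse) ?_ (isSym_self _) (by simp; ring) hl (by omega)
    (by simp only [cnt_append, cnt_reverse, cnt_some]; omega) fun U2 => ?_
  · intro a ha; exact isSym_map_bit (by simp) bs a (by simpa using ha)
  · have := h (U1 ∪ ({X + ↑bs.length + 1} ∪ ({X + ↑bs.length + 1 + 1} ∪ U2)))
    simp only [List.map_append, List.append_assoc, List.map_cons, List.map_nil, List.cons_append,
      List.nil_append, List.length_map, List.length_reverse, List.reverse_reverse] at this ⊢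
    rwa [show bs.length + 1 + (1 + (1 + (bs.length + 1))) = 2 * bs.length + 4 by ring]

/-- Induction on the digits from the head to the left. `Z` collects the cells already passed on the
way from home: a carry erases a one and adds a blank to `Z`. Reaching the left end lengthens the
number by a digit. -/
theorem incLoop_spec (ds : List Bool) {hd : Option (Sym n)} {tl Z : List (Option (Sym n))}
    (hds : hd :: tl = ds.map bit ++ [some .lend]) (hZ : ∀ a ∈ Z, isSym .home a = false)
    (hc : c = X - 1 - Z.length) (hl : l + ds.length + 1 ≤ c) (hr : X ≤ r)
    (hK : cnt tl + cnt (hd :: (Z ++ some .home :: R)) + 2 ≤ K)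
    (h : ∀ t U, t ≤ 2 * ds.length + Z.length + 4 →
      Post () (tw X (Z.reverse ++ ((incBits ds).map bit ++ [some .lend])) (some .home :: R)) t U) :
    Spec (TBox l r K) (incLoop : SMach n Unit) (tw c tl (hd :: (Z ++ some .home :: R))) Post := by
  induction ds generalizing hd tl Z c Post with
  | nil =>
    simp only [List.map_nil, List.nil_append, List.cons.injEq] at hds
    obtain ⟨rfl, rfl⟩ := hds
    simp only [cnt_append, cnt_some, cnt_nil] at hK
    simp only [List.length_nil] at hl h
    refine .iter (.bind (.tlook ?_))
    dsimp only
    rw [tw_nil_left]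
    refine .bind (.writeLeft rfl (.mk (by simp; omega)) ?_)
    refine .bind (.writeRight (c' := c) (by ring) (.mk (by simp; omega)) ?_)
    refine .bind (.seekTapeRight X hZ (isSym_self _) (by omega) (by omega) hr
      (by simp; omega) fun U => .pure (h _ _ ?_))
    omega
  | cons b ds ih =>
    simp only [List.map_cons, List.cons_append, List.cons.injEq] at hds
    obtain ⟨rfl, rfl⟩ := hds
    simp only [cnt_append, cnt_some, cnt_nil] at hK
    simp only [List.length_cons, Nat.cast_succ] at hl h
    refine .iter (.bind (.tlook ?_))
    obtain ⟨x, tl, hx⟩ : ∃ x tl, ds.map bit ++ [some (.lend : Sym n)] = x :: tl := by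
      cases ds <;> simp
    have hx' := congrArg cnt hx
    simp only [cnt_append, cnt_some, cnt_nil] at hx'
    rw [hx]
    cases b with
    | true =>
      simp only [bit, if_true, cnt_append, cnt_some] at hK ⊢
      refine .pure ⟨?_, ?_⟩
      · rw [tw_act_left _ _ rfl]
        exact .mk (by
          have : cnt (x :: none :: (Z ++ some .home :: R)) + cnt tl =
              cnt (x :: tl) + (cnt Z + (cnt R + 1)) := by
            cases x <;> simp <;> omega
          omega)
      · rw [tw_act_left _ _ rfl]
        refine ih (Z := none :: Z) hx.symm ?_ (by simp; omega) (by omega) ?_ ?_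
        · intro a ha
          rcases List.mem_cons.1 ha with rfl | ha
          exacts [rfl, hZ a ha]
        · have : cnt tl + cnt (x :: (none :: Z ++ some .home :: R)) =
              cnt (x :: tl) + (cnt Z + (cnt R + 1)) := by
            cases x <;> simp <;> omega
          omega
        · intro t U ht
          have := h (0 + 0 + 1 + t) (insert c (∅ ∪ ∅) ∪ U) (by simp at ht; omega)
          simpa [incBits, bit] using this
    | false =>
      simp only [bit, Bool.false_eq_true, if_false, cnt_none, cnt_append, cnt_some] at hK ⊢
      have key : cnt tl + cnt (x :: some .one :: (Z ++ some .home :: R)) =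
            cnt (x :: tl) + 1 + (cnt Z + (cnt R + 1)) := by
          cases x <;> simp <;> omega
      have hA : ∀ a ∈ some .one :: Z, isSym .home a = false := by
        intro a ha
        rcases List.mem_cons.1 ha with rfl | ha
        exacts [rfl, hZ a ha]
      refine .bind (.writeLeft rfl (.mk (by omega)) (.bind ?_))
      have hlen : X = c - 1 + ((some .one :: Z : List (Option (Sym n))).length : ℤ) + 1 := by
        simp; omega
      have hcnt : cnt tl + cnt (x :: ((some .one :: Z) ++ some .home :: R)) ≤ K := by
        rw [List.cons_append]; omega
      refine Spec.seekTapeRight (l := l) (r := r) (K := K) (L := tl) (R := R) (s := x) X hA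
        (isSym_self _) hlen (by omega) hr hcnt fun U => .pure ?_
      have := h (0 + (1 + (((some .one :: Z : List (Option (Sym n))).length + 1) + 0)))
        (∅ ∪ ({c} ∪ (U ∪ ∅))) (by simp; omega)
      simpa [incBits, bit, ← hx] using this

theorem incFirst_spec (ds : List Bool) (hl : l + ds.length + 2 ≤ X) (hr : X ≤ r)
    (hK : cnt (ds.map bit : List (Option (Sym n))) + cnt R + 4 ≤ K)
    (h : ∀ t U, t ≤ 2 * ds.length + 5 →
      Post () (tw X ((incBits ds).map bit ++ [some .lend]) (some .home :: R)) t U) :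
    Spec (TBox l r K) (incFirst : SMach n Unit)
      (tw X (ds.map bit ++ [some .lend]) (some .home :: R)) Post := by
  obtain ⟨x, tl, hx⟩ : ∃ x tl, ds.map bit ++ [some (.lend : Sym n)] = x :: tl := by
    cases ds <;> simp
  have hx' := congrArg cnt hx
  simp only [cnt_append, cnt_some, cnt_nil] at hx'
  have key : cnt tl + cnt (x :: some .home :: R) = cnt (x :: tl) + (cnt R + 1) := by
    cases x <;> simp <;> omega
  rw [hx]
  refine .bind (.goLeft rfl (.mk (by omega)) (incLoop_spec (X := X) (Z := []) (R := R) ds hx.symm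
    (by simp) (by simp) (by omega) hr (by simp only [List.nil_append]; omega) fun t U ht => ?_))
  have := h (1 + t) ({X} ∪ U) (by simp at ht; omega)
  simpa using this

theorem incSecond_spec (es ds : List Bool) (hl : l + ds.length + es.length + 3 ≤ X) (hr : X ≤ r)
    (hK : cnt (es.map bit : List (Option (Sym n))) + cnt (ds.map bit : List (Option (Sym n))) +
      cnt R + 5 ≤ K)
    (h : ∀ t U, t ≤ 2 * ds.length + 2 * es.length + 7 →
      Post () (tw X (es.map bit ++ some .sep :: ((incBits ds).map bit ++ [some .lend]))
        (some .home :: R)) t U) :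
    Spec (TBox l r K) (incSecond : SMach n Unit)
      (tw X (es.map bit ++ some .sep :: (ds.map bit ++ [some .lend])) (some .home :: R)) Post := by
  refine .bind (.seekTapeLeft (X - es.length - 1) (isSym_map_bit (by simp) es) (isSym_self _)
    (by simp) (by omega) hr (by simp; omega) fun U => ?_)
  obtain ⟨x, tl, hx⟩ : ∃ x tl, ds.map bit ++ [some (.lend : Sym n)] = x :: tl := by
    cases ds <;> simp
  have hx' := congrArg cnt hx
  simp only [cnt_append, cnt_some, cnt_nil] at hx'
  have key : cnt tl + cnt (x :: (some .sep :: (es.map bit).reverse) ++ some .home :: R) =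
      cnt (x :: tl) + (cnt (es.map bit : List (Option (Sym n))) + 1 + (cnt R + 1)) := by
    cases x <;> simp <;> omega
  rw [hx]
  refine .bind (.goLeft rfl (.mk (by simp only [List.cons_append] at key; omega))
    (incLoop_spec (X := X) (Z := some .sep :: (es.map bit).reverse) (R := R) ds hx.symm
    ?_ (by simp; omega) (by omega) hr (by simp only [List.cons_append] at key ⊢; omega)
    fun t U' ht => ?_))
  · intro a ha
    rcases List.mem_cons.1 ha with rfl | ha
    · rfl
    · exact isSym_map_bit (by simp) es a (by simpa using ha)
  · have := h ((es.map (bit (n := n))).length + 1 + (1 + t)) (U ∪ ({X - es.length - 1} ∪ U'))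
      (by simp at ht ⊢; omega)
    simpa using this

theorem closeLeft_spec (ds : List Bool) (hl : l + ds.length + 2 ≤ X) (hr : X ≤ r)
    (hK : cnt (ds.map bit : List (Option (Sym n))) + cnt R + 3 ≤ K)
    (h : ∀ U, Post () (tw X (ds.map bit ++ some .sep :: [some .lend]) (some .home :: R))
      (2 * ds.length + 4) U) :
    Spec (TBox l r K) (closeLeft : SMach n Unit)
      (tw X (ds.map bit ++ [some .lend]) (some .home :: R)) Post := by
  refine .bind (.seekTapeLeft (X - ds.length - 1) (isSym_map_bit (by simp) ds) (isSym_self _)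
    (by simp) (by omega) hr (by simp; omega) fun U => ?_)
  rw [tw_nil_left]
  refine .bind (.writeLeft rfl (.mk (by simp; omega)) ?_)
  refine .bind (.writeRight (c' := X - ds.length - 1) (by ring) (.mk (by simp; omega)) ?_)
  refine .seekTapeRight X (A := (ds.map bit).reverse) ?_ (isSym_self _) (by simp; ring)
    (by omega) hr (by simp; omega) fun U' => ?_
  · intro a ha; exact isSym_map_bit (by simp) ds a (by simpa using ha)
  · have := h (U ∪ ({X - ds.length - 1} ∪ ({X - ds.length - 1 - 1} ∪ U')))
    simp only [List.length_map, List.length_reverse, List.reverse_reverse]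
    rwa [show ds.length + 1 + (1 + (1 + (ds.length + 1))) = 2 * ds.length + 4 by ring]

end SymMachines
end TileRobot

namespace TileRobot
open Mach

/-! ### Decoding the tape -/

section Decode
variable {n : ℕ}

/-- Decrement the number whose digits begin at the head, and go home. The result tells whether
the number was positive. -/
def decLoop : SMach n Bool :=
  iter (fun _ : Unit => do
    let a ← look
    match a with
    | none => pure (.inl ((), some .one, false))
    | some .one => do
      act none false
      seek (isSym .home) true
      pure (.inr true)
    | _ => do
      seek (isSym .home) true
      pure (.inr false)) ()

/-- Decrement the number next to the home cell. -/
def decFirst : SMach n Bool := do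
  mv false
  decLoop

/-- Erase everything to the left of the home cell. -/
def clearLeft : SMach n Unit := do
  seek (isSym .lend) false
  iter (fun _ : Unit => do
    let a ← look
    match isSym .home a with
    | true => pure (.inr ())
    | false => pure (.inl ((), none, true))) ()

/-- Remove the last bit from the right end. -/
def popBit : SMach n (Option Bool) := do
  seek (isSym .rend) true
  act none false
  let a ← look
  match isSym .home a with
  | true => pure none
  | false => do
    act (some .rend) true
    seek (isSym .home) false
    pure (some (isSym .one a))

/-- The number with given digits, least significant digit first. -/
def bitsVal : List Bool → ℕ
  | [] => 0
  | b :: l => b.toNat + 2 * bitsVal l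

theorem bitsVal_bits (k : ℕ) : bitsVal k.bits = k := by
  induction k using Nat.binaryRec' with
  | zero => simp [bitsVal]
  | bit b k h ih =>
    rw [Nat.bits_append_bit k b h, bitsVal, ih, Nat.bit_val]; ring

variable {l r : ℤ} {K : ℕ} {X c : ℤ} {L R : List (Option (Sym n))}

/-- A borrow turns zeros into ones until a one is found. If there is none, the number was zero and
its digits are spoiled; hence `ds'` is then only known by its length. This is harmless, because the
number is erased afterwards. -/
theorem decLoop_spec {Post : Bool → TWorld (Sym n) → ℕ → Set ℤ → Prop} (ds : List Bool)
    {hd : Option (Sym n)} {tl Z : List (Option (Sym n))}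
    (hds : hd :: tl = ds.map bit ++ [some .lend]) (hZ : ∀ a ∈ Z, isSym .home a = false)
    (hc : c = X - 1 - Z.length) (hl : l + ds.length + 1 ≤ c) (hr : X ≤ r)
    (hK : ds.length + cnt Z + cnt R + 2 ≤ K)
    (h : ∀ b ds' t U, t ≤ 2 * ds.length + Z.length + 4 → ds'.length = ds.length →
      (if b = true then bitsVal ds' + 1 = bitsVal ds else bitsVal ds = 0) →
      Post b (tw X (Z.reverse ++ (ds'.map bit ++ [some .lend])) (some .home :: R)) t U) :
    Spec (TBox l r K) (decLoop : SMach n Bool) (tw c tl (hd :: (Z ++ some .home :: R))) Post := by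
  induction ds generalizing hd tl Z c Post with
  | nil =>
    simp only [List.map_nil, List.nil_append, List.cons.injEq] at hds
    obtain ⟨rfl, rfl⟩ := hds
    simp only [List.length_nil] at hl h hK
    refine .iter (.bind (.tlook ?_))
    dsimp only
    refine .bind (.seekTapeRight X hZ (isSym_self _) (by omega) (by omega) hr
      (by simp; omega) fun U => .pure (h false [] _ _ ?_ rfl (by simp [bitsVal])))
    omega
  | cons b ds ih =>
    simp only [List.map_cons, List.cons_append, List.cons.injEq] at hds
    obtain ⟨rfl, rfl⟩ := hds
    simp only [List.length_cons, Nat.cast_succ] at hl h hK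
    refine .iter (.bind (.tlook ?_))
    obtain ⟨x, tl, hx⟩ : ∃ x tl, ds.map bit ++ [some (.lend : Sym n)] = x :: tl := by
      cases ds <;> simp
    have hx' := congrArg cnt hx
    have hle := cnt_map_bit_le (n := n) ds
    simp only [cnt_append, cnt_some, cnt_nil] at hx'
    rw [hx]
    cases b with
    | false =>
      simp only [bit, Bool.false_eq_true, if_false]
      have key : cnt tl + cnt (x :: (some .one :: Z ++ some .home :: R)) =
          cnt (x :: tl) + 1 + (cnt Z + (cnt R + 1)) := by
        cases x <;> simp <;> omega
      refine .pure ⟨?_, ?_⟩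
      · rw [tw_act_left _ _ rfl]
        exact .mk (by rw [List.cons_append] at key; omega)
      · rw [tw_act_left _ _ rfl]
        refine ih (Z := some .one :: Z) hx.symm ?_ (by simp; omega) (by omega) (by simp; omega) ?_
        · intro a ha
          rcases List.mem_cons.1 ha with rfl | ha
          exacts [rfl, hZ a ha]
        · intro b ds' t U ht hl' hv
          have := h b (true :: ds') (0 + 0 + 1 + t) (insert c (∅ ∪ ∅) ∪ U) (by simp at ht; omega)
            (by simp [hl']) (by simp only [bitsVal, Bool.toNat_true, Bool.toNat_false]
                                split at hv <;> simp_all <;> omega)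
          simpa [bit] using this
    | true =>
      simp only [bit, if_true]
      have key : cnt tl + cnt (x :: none :: (Z ++ some .home :: R)) =
            cnt (x :: tl) + (cnt Z + (cnt R + 1)) := by
          cases x <;> simp <;> omega
      have hA : ∀ a ∈ none :: Z, isSym .home a = false := by
        intro a ha
        rcases List.mem_cons.1 ha with rfl | ha
        exacts [rfl, hZ a ha]
      refine .bind (.writeLeft rfl (.mk (by omega)) (.bind ?_))
      have hlen : X = c - 1 + ((none :: Z : List (Option (Sym n))).length : ℤ) + 1 := by
        simp; omega
      have hcnt : cnt tl + cnt (x :: ((none :: Z) ++ some .home :: R)) ≤ K := by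
        rw [List.cons_append]; omega
      refine Spec.seekTapeRight (l := l) (r := r) (K := K) (L := tl) (R := R) (s := x) X hA
        (isSym_self _) hlen (by omega) hr hcnt fun U => .pure ?_
      have := h true (false :: ds) (0 + (1 + (((none :: Z : List (Option (Sym n))).length + 1) + 0)))
        (∅ ∪ ({c} ∪ (U ∪ ∅))) (by simp; omega) (by simp) (by simp [bitsVal]; omega)
      simpa [bit, ← hx] using this

theorem decFirst_spec {Post : Bool → TWorld (Sym n) → ℕ → Set ℤ → Prop} (ds : List Bool)
    (hl : l + ds.length + 2 ≤ X) (hr : X ≤ r) (hK : ds.length + cnt R + 2 ≤ K)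
    (h : ∀ b ds' t U, t ≤ 2 * ds.length + 5 → ds'.length = ds.length →
      (if b = true then bitsVal ds' + 1 = bitsVal ds else bitsVal ds = 0) →
      Post b (tw X (ds'.map bit ++ [some .lend]) (some .home :: R)) t U) :
    Spec (TBox l r K) (decFirst : SMach n Bool)
      (tw X (ds.map bit ++ [some .lend]) (some .home :: R)) Post := by
  obtain ⟨x, tl, hx⟩ : ∃ x tl, ds.map bit ++ [some (.lend : Sym n)] = x :: tl := by
    cases ds <;> simp
  have hx' := congrArg cnt hx
  have hle := cnt_map_bit_le (n := n) ds
  simp only [cnt_append, cnt_some, cnt_nil] at hx'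
  have key : cnt tl + cnt (x :: some .home :: R) = cnt (x :: tl) + (cnt R + 1) := by
    cases x <;> simp <;> omega
  rw [hx]
  refine .bind (.goLeft rfl (.mk (by omega)) (decLoop_spec (X := X) (Z := []) (R := R) ds hx.symm
    (by simp) (by simp) (by omega) hr (by simpa using hK) fun b ds' t U ht h1 h2 => ?_))
  have := h b ds' (1 + t) ({X} ∪ U) (by simp at ht; omega) h1 h2
  simpa using this

variable {Post : Unit → TWorld (Sym n) → ℕ → Set ℤ → Prop}

theorem clearLoop_spec (A : List (Option (Sym n))) (hA : ∀ a ∈ A, isSym .home a = false)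
    (hc : X = c + A.length) (hl : l ≤ c) (hr : X ≤ r) (hK : cnt L + cnt A + cnt R + 1 ≤ K)
    (h : ∀ U, Post () (tw X (List.replicate A.length none ++ L) (some .home :: R)) A.length U) :
    Spec (TBox l r K) (iter (fun _ : Unit => do
      let a ← (look : SMach n _)
      match isSym .home a with
      | true => pure (.inr ())
      | false => pure (.inl ((), none, true))) ()) (tw c L (A ++ some .home :: R)) Post := by
  induction A generalizing c L Post with
  | nil =>
    simp only [List.length_nil, Nat.cast_zero, add_zero] at hc
    subst hc
    refine .iter (.bind (.tlook ?_))
    exact .pure (by simpa using h _)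
  | cons a A ih =>
    simp only [List.length_cons, Nat.cast_succ] at hc
    refine .iter (.bind (.tlook ?_))
    simp only [hA a (by simp)]
    have : cnt A ≤ cnt (a :: A) := by cases a <;> simp
    refine .pure ⟨?_, ?_⟩
    · rw [tw_act_right _ _ rfl]
      exact .mk (by simp; omega)
    · rw [tw_act_right _ _ rfl]
      refine ih (fun a ha => hA a (by simp [ha])) (by omega) (by omega) (by simp; omega)
        fun U => ?_
      have := h (insert c (∅ ∪ ∅) ∪ U)
      rw [List.length_cons, List.replicate_succ', List.append_assoc, List.singleton_append] at this
      rw [Nat.add_comm] at this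
      rw [show 0 + 0 + 1 + A.length = 1 + A.length by omega]
      exact this

theorem clearLeft_spec (ds : List Bool) (hl : l + ds.length + 2 ≤ X) (hr : X ≤ r)
    (hK : ds.length + cnt R + 2 ≤ K)
    (h : ∀ U, Post () (tw X [] (some .home :: R)) (2 * ds.length + 2) U) :
    Spec (TBox l r K) (clearLeft : SMach n Unit)
      (tw X (ds.map bit ++ [some .lend]) (some .home :: R)) Post := by
  have hle := cnt_map_bit_le (n := n) ds
  refine .bind (.seekTapeLeft (X - ds.length - 1) (isSym_map_bit (by simp) ds) (isSym_self _)
    (by simp) (by omega) hr (by simp; omega) fun U => ?_)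
  refine clearLoop_spec (X := X) (some .lend :: (ds.map bit).reverse) ?_ (by simp) (by omega) hr
    (by simp; omega) fun U' => ?_
  · intro a ha
    rcases List.mem_cons.1 ha with rfl | ha
    · rfl
    · exact isSym_map_bit (by simp) ds a (by simpa using ha)
  · have := h (U ∪ U')
    rw [List.append_nil, ← List.nil_append (List.replicate _ _), tw_replicate_left]
    simp only [List.length_map, List.length_cons, List.length_reverse]
    rwa [show ds.length + 1 + (ds.length + 1) = 2 * ds.length + 2 by ring]

theorem tw_none_right (c : ℤ) (L R : List (Option (Sym n))) : tw c L (R ++ [none]) = tw c L R := by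
  refine World.ext rfl (funext fun u => ?_)
  simp only [tw]
  split
  · rfl
  · generalize (u - c).toNat = i
    rw [List.getD_eq_getElem?_getD, List.getD_eq_getElem?_getD, List.getElem?_append]
    split
    · rfl
    · rename_i h
      rw [List.getElem?_eq_none (l := R) (by omega)]
      rcases i - R.length with _ | j <;> simp

theorem popBit_nil_spec {Post : Option Bool → TWorld (Sym n) → ℕ → Set ℤ → Prop}
    (hl : l ≤ X) (hr : X + 1 ≤ r) (hK : cnt L + 2 ≤ K)
    (h : ∀ U, Post none (tw X L [some .home]) 2 U) :
    Spec (TBox l r K) (popBit : SMach n _) (tw X L [some .home, some .rend]) Post := by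
  refine .bind (.seekTapeRight (A := []) (X + 1) (by simp) (isSym_self _)
    (by simp) hl (by omega) (by simp; omega) fun U1 => ?_)
  refine .bind (.writeLeft (c' := X) (by ring) (.mk (by simp; omega)) ?_)
  refine .bind (.tlook ?_)
  refine .pure ?_
  have := tw_none_right X L [some .home]
  rw [List.singleton_append] at this
  rw [this]
  exact h _

theorem popBit_spec {Post : Option Bool → TWorld (Sym n) → ℕ → Set ℤ → Prop}
    (b : Bool) (bs : List Bool) (hl : l ≤ X) (hr : X + bs.length + 2 ≤ r)
    (hK : cnt L + cnt (bs.map bit : List (Option (Sym n))) + 3 ≤ K)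
    (h : ∀ U, Post (some b) (tw X L (some .home :: (bs.map bit ++ [some .rend])))
      (2 * bs.length + 6) U) :
    Spec (TBox l r K) (popBit : SMach n _)
      (tw X L (some .home :: ((bs ++ [b]).map bit ++ [some .rend]))) Post := by
  have hb := cnt_bit_le (n := n) b []
  simp only [cnt_nil] at hb
  have hb' := cnt_bit_le b ([some .rend] : List (Option (Sym n)))
  simp only [cnt_some, cnt_nil] at hb'
  have hb'' : cnt (bit b :: [none] : List (Option (Sym n))) ≤ 1 := by simpa using cnt_bit_le b [none]
  refine .bind (.seekTapeRight (X + bs.length + 2) (isSym_map_bit (by simp) (bs ++ [b]))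
    (isSym_self _) (by simp; ring) hl (by omega) (by simp; omega) fun U1 => ?_)
  rw [List.map_append, List.reverse_append]
  simp only [List.map_cons, List.map_nil, List.reverse_singleton,
    List.cons_append]
  refine .bind (.writeLeft (c' := X + bs.length + 1) (by ring) (.mk (by
    simp only [cnt_append, cnt_reverse, cnt_some, cnt_nil]; omega)) ?_)
  refine .bind (.tlook ?_)
  rw [isSym_bit (by simp)]
  refine .bind (.writeRight (c' := X + bs.length + 2) (by ring) (.mk (by simp; omega)) ?_)
  have hA : ∀ a ∈ some .rend :: (bs.map (bit (n := n))).reverse, isSym .home a = false := by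
    intro a ha
    rcases List.mem_cons.1 ha with rfl | ha
    · rfl
    · exact isSym_map_bit (by simp) bs a (by simpa using ha)
  refine .bind (Spec.seekTapeLeft (l := l) (r := r) (K := K) (L := L) (R := []) (s := none) X hA
    (isSym_self _) (by simp; ring) hl (by omega) (by simp; omega) fun U2 => .pure ?_)
  have := h (U1 ∪ ({X + bs.length + 2} ∪ (∅ ∪ ({X + bs.length + 1} ∪ (U2 ∪ ∅)))))
  have e : isSym Sym.one (bit b : Option (Sym n)) = b := by cases b <;> simp [bit, isSym]
  have e2 := tw_none_right X L (some .home :: (bs.map bit ++ [some .rend]))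
  have e3 : tw X L (some .home :: ((some .rend :: (bs.map bit).reverse).reverse ++ [none])) =
      tw X L (some .home :: (bs.map bit ++ [some (.rend : Sym n)])) := by
    rw [← e2]; simp
  rw [e, e3]
  convert this using 1
  simp; ring

end Decode

/-! ### Normalizing the tape -/

section Normalize
variable {n : ℕ} (rd : Fin n → Option Bool)

/-- The digit in a cell, or `none` for a blank. -/
def classify : Option (Sym n) → Option Bool
  | none => some false
  | some .one => some true
  | some (.sym a) => rd a
  | some .home => none
  | some .sep => none
  | some .lend => none
  | some .rend => none

/-- The new stage and the letter to write. The stages are: skip blanks, erase the first number,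
copy the second number, copy the bits, erase blanks. -/
def normStep (i : Fin 5) (a : Option (Sym n)) : Option (Fin 5 × Option (Sym n)) :=
  match i, classify rd a with
  | 0, none => some (0, none)
  | 0, some _ => some (1, none)
  | 1, some _ => some (1, none)
  | 1, none => some (2, some .lend)
  | 2, some b => some (2, bit b)
  | 2, none => some (3, some .home)
  | 3, some b => some (3, bit b)
  | 3, none => if a = some .rend then none else some (4, some .rend)
  | 4, _ => if a = some .rend then none else some (4, none)

/-- The sweep of `normalize`. -/
def normLoop (i : Fin 5) : SMach n Unit :=
  iter (fun i => do
    let a ← look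
    match normStep rd i a with
    | some x => pure (.inl (x.1, x.2, true))
    | none => match decide (i = 4) with
      | true => do
        act none false
        seek (isSym .home) false
        pure (.inr ())
      | false => do
        seek (isSym .home) false
        pure (.inr ())) i

/-- Given two numbers and a list of bits on the tape, separated by blanks, erase the first number,
and replace the separators and the ends by marks. -/
def normalize : SMach n Unit := do
  seek (isSym .lend) false
  normLoop rd 0

def normRun : Fin 5 → List (Option (Sym n)) → Option (Fin 5 × List (Option (Sym n)))
  | i, [] => some (i, [])
  | i, a :: A => (normStep rd i a).bind fun x => (normRun x.1 A).map fun y => (y.1, x.2 :: y.2)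

variable {rd}

theorem normRun_append {i j k : Fin 5} {A A' B B' : List (Option (Sym n))}
    (h : normRun rd i A = some (j, B)) (h' : normRun rd j A' = some (k, B')) :
    normRun rd i (A ++ A') = some (k, B ++ B') := by
  induction A generalizing i B with
  | nil => simp [normRun] at h; obtain ⟨rfl, rfl⟩ := h; simpa using h'
  | cons a A ih =>
    simp only [normRun, Option.bind_eq_some_iff, Option.map_eq_some_iff, Prod.mk.injEq] at h
    obtain ⟨x, hx, y, hy, rfl, rfl⟩ := h
    simp [normRun, hx, ih hy]

theorem normRun_blank {A : List (Option (Sym n))} {k : ℕ}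
    (h : A.map (classify rd) = List.replicate k none) :
    normRun rd 0 A = some (0, List.replicate k none) := by
  induction A generalizing k with
  | nil => cases k <;> simp [List.replicate_succ] at h; rfl
  | cons a A ih =>
    cases k with
    | zero => simp at h
    | succ k =>
      simp only [List.map_cons, List.replicate_succ, List.cons.injEq] at h
      simp [normRun, normStep, h.1, ih h.2, List.replicate_succ]

theorem normRun_first {A : List (Option (Sym n))} {d : List Bool}
    (h : A.map (classify rd) = d.map some) :
    normRun rd 1 A = some (1, List.replicate d.length none) := by
  induction A generalizing d with
  | nil => cases d <;> simp at h; rfl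
  | cons a A ih =>
    cases d with
    | nil => simp at h
    | cons b d =>
      simp only [List.map_cons, List.cons.injEq] at h
      simp [normRun, normStep, h.1, ih h.2, List.replicate_succ]

theorem normRun_second {A : List (Option (Sym n))} {d : List Bool}
    (h : A.map (classify rd) = d.map some) :
    normRun rd 2 A = some (2, d.map bit) := by
  induction A generalizing d with
  | nil => cases d <;> simp at h; rfl
  | cons a A ih =>
    cases d with
    | nil => simp at h
    | cons b d =>
      simp only [List.map_cons, List.cons.injEq] at h
      simp [normRun, normStep, h.1, ih h.2]

theorem normRun_third {A : List (Option (Sym n))} {d : List Bool}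
    (h : A.map (classify rd) = d.map some) :
    normRun rd 3 A = some (3, d.map bit) := by
  induction A generalizing d with
  | nil => cases d <;> simp at h; rfl
  | cons a A ih =>
    cases d with
    | nil => simp at h
    | cons b d =>
      simp only [List.map_cons, List.cons.injEq] at h
      simp [normRun, normStep, h.1, ih h.2]

theorem normRun_last {A : List (Option (Sym n))} (h : some .rend ∉ A) :
    normRun rd 4 A = some (4, List.replicate A.length none) := by
  induction A with
  | nil => rfl
  | cons a A ih =>
    simp only [List.mem_cons, not_or] at h
    have := Ne.symm h.1
    simp [normRun, normStep, ih h.2, this, List.replicate_succ]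

/-- A blank cell is classified as the digit 0 and replaced by a blank at every stage, so the sweep
never makes a blank cell nonblank. -/
theorem cnt_normStep {i j : Fin 5} {a s : Option (Sym n)} (h : normStep rd i a = some (j, s))
    (L : List (Option (Sym n))) : cnt (s :: L) ≤ cnt (a :: L) := by
  cases a with
  | some a => rw [cnt_some]; exact cnt_cons_le _ _
  | none =>
    have : s = none := by
      simp only [normStep, classify] at h
      split at h <;> simp_all [bit]
    rw [this]

theorem cnt_normRun {i j : Fin 5} {A B : List (Option (Sym n))}
    (h : normRun rd i A = some (j, B)) : cnt B ≤ cnt A ∧ B.length = A.length := by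
  induction A generalizing i B with
  | nil => simp [normRun] at h; obtain ⟨rfl, rfl⟩ := h; simp
  | cons a A ih =>
    simp only [normRun, Option.bind_eq_some_iff, Option.map_eq_some_iff, Prod.mk.injEq] at h
    obtain ⟨x, hx, y, hy, rfl, rfl⟩ := h
    have h1 := ih hy
    have h2 := cnt_normStep hx y.2
    have h3 : cnt (a :: y.2) ≤ cnt (a :: A) := by cases a <;> simp <;> omega
    exact ⟨h2.trans h3, by simp [h1.2]⟩

variable {l r : ℤ} {K : ℕ} {c : ℤ} {L R : List (Option (Sym n))}

/-- As long as `normRun` does not stop, the loop just executes it from left to right. What remains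
is the behaviour at the right end mark. -/
theorem normLoop_sweep {Post : Unit → TWorld (Sym n) → ℕ → Prop} {i j : Fin 5}
    {A B : List (Option (Sym n))} (h : normRun rd i A = some (j, B)) (hl : l ≤ c)
    (hr : c + A.length ≤ r) (hK : cnt L + cnt (A ++ R) ≤ K)
    (hS : Spec (TBox l r K) (normLoop rd j) (tw (c + A.length) (B.reverse ++ L) R)
      fun b w t _ => Post b w (A.length + t)) :
    Spec (TBox l r K) (normLoop rd i) (tw c L (A ++ R)) fun b w t _ => Post b w t := by
  induction A generalizing i B c L Post with
  | nil =>
    simp [normRun] at h; obtain ⟨rfl, rfl⟩ := h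
    simpa using hS
  | cons a A ih =>
    simp only [normRun, Option.bind_eq_some_iff, Option.map_eq_some_iff, Prod.mk.injEq] at h
    obtain ⟨x, hx, y, hy, rfl, rfl⟩ := h
    simp only [List.length_cons, Nat.cast_succ] at hr
    rw [List.cons_append]
    have hc := cnt_normStep (s := x.2) (j := x.1) hx L
    have hk : cnt (x.2 :: L) + cnt (A ++ R) ≤ K := by
      have : cnt L + cnt (a :: A ++ R) = cnt (a :: L) + cnt (A ++ R) := by
        cases a <;> simp <;> omega
      omega
    refine .iter (.bind (.tlook ?_))
    simp only [hx]
    refine .pure ⟨?_, ?_⟩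
    · rw [tw_act_right _ _ rfl]
      exact .mk (by omega)
    · rw [tw_act_right _ _ rfl]
      refine ih (Post := fun b w t => Post b w (0 + 0 + 1 + t)) hy (by omega) (by omega) hk ?_
      simp only [List.length_cons, Nat.cast_succ, List.reverse_cons, List.append_assoc,
        List.singleton_append] at hS
      rw [show c + 1 + (A.length : ℤ) = c + (A.length + 1) by ring]
      refine hS.mono fun b w t U _ hp => ?_
      rwa [show 0 + 0 + 1 + (A.length + t) = A.length + 1 + t by ring]

theorem tw_replicate_right (c : ℤ) (L R : List (Option (Sym n))) (k : ℕ) :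
    tw c L (R ++ List.replicate k none) = tw c L R := by
  induction k with
  | zero => simp
  | succ k ih => rw [List.replicate_succ', ← List.append_assoc, tw_none_right, ih]

/-- The segments of the inscription correspond to the stages of the sweep. A nonempty first number
is needed to tell where the leading blanks end. -/
theorem normRun_main {z₀ z₁ z₂ z₃ : List (Option (Sym n))} {x₁ x₂ : Option (Sym n)}
    {d₁ d₂ d₃ : List Bool} {p : ℕ} (hd : d₁ ≠ [])
    (h₀ : z₀.map (classify rd) = List.replicate p none) (h₁ : z₁.map (classify rd) = d₁.map some)
    (h₂ : z₂.map (classify rd) = d₂.map some) (h₃ : z₃.map (classify rd) = d₃.map some)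
    (e₁ : classify rd x₁ = none) (e₂ : classify rd x₂ = none) :
    normRun rd 0 (some .lend :: z₀ ++ (z₁ ++ (x₁ :: (z₂ ++ (x₂ :: z₃))))) =
      some (3, List.replicate (p + 1) none ++ (List.replicate d₁.length none ++ (some .lend ::
        (d₂.map bit ++ (some .home :: d₃.map bit))))) := by
  have r₀ : normRun rd 0 (some .lend :: z₀) = some (0, List.replicate (p + 1) none) :=
    normRun_blank (by simp [h₀, List.replicate_succ, classify])
  have r₁ : normRun rd 0 z₁ = some (1, List.replicate d₁.length none) := by
    cases z₁ with
    | nil => cases d₁ <;> simp at h₁ hd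
    | cons a z =>
      cases d₁ with
      | nil => simp at hd
      | cons b d =>
        simp only [List.map_cons, List.cons.injEq] at h₁
        simp [normRun, normStep, h₁.1, normRun_first h₁.2, List.replicate_succ]
  refine normRun_append r₀ (normRun_append r₁ ?_)
  refine normRun_append (A := [x₁]) (B := [some .lend]) (j := 2) (by simp [normRun, normStep, e₁]) ?_
  refine normRun_append (normRun_second h₂) ?_
  exact normRun_append (A := [x₂]) (B := [some .home]) (j := 3) (by simp [normRun, normStep, e₂])
    (normRun_third h₃)

/-- No blank follows the bits, so the old end mark is at the right place. -/
theorem normLoop_end₃ {Post : Unit → TWorld (Sym n) → ℕ → Prop} {d : List Bool}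
    (hl : l + d.length + 1 ≤ c) (hr : c ≤ r)
    (hK : cnt L + cnt (d.map bit : List (Option (Sym n))) + 2 ≤ K)
    (h : Post () (tw (c - d.length - 1) L (some .home :: (d.map bit ++ [some .rend]))) (d.length + 1)) :
    Spec (TBox l r K) (normLoop rd 3) (tw c ((some .home :: d.map bit).reverse ++ L) [some .rend])
      fun b w t _ => Post b w t := by
  refine .iter (.bind (.tlook ?_))
  have e : normStep rd 3 (some .rend) = none := by simp [normStep, classify]
  simp only [e]
  rw [List.reverse_cons, List.append_assoc, List.singleton_append]
  refine .bind (.seekTapeLeft (c - d.length - 1) ?_ (isSym_self _) (by simp) (by omega) hr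
    (by simp; omega) fun U => .pure ?_)
  · intro a ha; exact isSym_map_bit (by simp) d a (by simpa using ha)
  · simpa using h

/-- A new end mark has been put directly behind the bits, and the old one has to be erased. -/
theorem normLoop_end₄ {Post : Unit → TWorld (Sym n) → ℕ → Prop} {d : List Bool} {k : ℕ}
    (hl : l + d.length + k + 2 ≤ c) (hr : c ≤ r)
    (hK : cnt L + cnt (d.map bit : List (Option (Sym n))) + 3 ≤ K)
    (h : Post () (tw (c - k - d.length - 2) L (some .home :: (d.map bit ++ [some .rend])))
      (d.length + k + 2)) :
    Spec (TBox l r K) (normLoop rd 4) (tw c ((some .home :: (d.map bit ++ some .rend ::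
      List.replicate k none)).reverse ++ L) [some .rend]) fun b w t _ => Post b w t := by
  refine .iter (.bind (.tlook ?_))
  have e : normStep rd 4 (some .rend) = none := by
    simp only [normStep]; rfl
  simp only [e]
  rw [List.reverse_cons, List.append_assoc, List.singleton_append]
  have hall : ∀ a ∈ d.map bit ++ some (.rend : Sym n) :: List.replicate k none,
      isSym .home a = false := by
    intro a ha
    simp only [List.mem_append, List.mem_cons, List.mem_replicate] at ha
    rcases ha with ha | rfl | ⟨-, rfl⟩
    exacts [isSym_map_bit (by simp) d a ha, rfl, rfl]
  have hlen : (d.map bit ++ some (.rend : Sym n) :: List.replicate k none).length =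
    d.length + k + 1 := by simp; ring
  have hcnt : cnt (d.map bit ++ some (.rend : Sym n) :: List.replicate k none) =
    cnt (d.map bit : List (Option (Sym n))) + 1 := by simp
  have hfin : tw (c - k - d.length - 2) L (some .home :: (d.map bit ++ some (.rend : Sym n) ::
      List.replicate k none ++ [none])) = tw (c - k - d.length - 2) L
      (some .home :: (d.map bit ++ [some .rend])) := by
    have e := tw_replicate_right (c - k - d.length - 2) L
      (some .home :: (d.map bit ++ [some (.rend : Sym n)])) (k + 1)
    rw [← e, List.replicate_succ']
    simp
  rw [← hfin] at h
  generalize d.map bit ++ some (.rend : Sym n) :: List.replicate k none = W at hall hlen hcnt h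
  obtain ⟨x, V, hV⟩ : ∃ x V, W.reverse = x :: V := by
    cases hW : W.reverse with
    | nil => simp at hW; subst hW; simp at hlen
    | cons x V => exact ⟨x, V, rfl⟩
  have hall' : ∀ a ∈ V, isSym .home a = false := fun a ha =>
    hall a (by rw [← List.mem_reverse, hV]; simp [ha])
  have hlen' : V.length + 1 = d.length + k + 1 := by
    rw [← hlen, ← List.length_reverse (as := W), hV]; simp
  have hcnt' : cnt (x :: V) = cnt (d.map bit : List (Option (Sym n))) + 1 := by
    rw [← hcnt, ← hV, cnt_reverse]
  have hW : W = V.reverse ++ [x] := by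
    rw [← List.reverse_reverse W, hV, List.reverse_cons]
  have hx : cnt V + cnt [x, none] = cnt (x :: V) := by
    cases x <;> simp
  rw [hV, List.cons_append]
  refine .bind (.writeLeft rfl (.mk (by simp only [cnt_append, cnt_some]; omega)) ?_)
  refine .bind (.seekTapeLeft (c - k - d.length - 2) hall' (isSym_self _) (by omega) (by omega)
    (by omega) (by simp only [cnt_append, cnt_some]; omega) fun U => .pure ?_)
  rw [hW] at h
  simp only [List.append_assoc, List.singleton_append] at h
  rwa [show 0 + (1 + (V.length + 1 + 0)) = d.length + k + 2 by omega]

/-- The inscription is cut into its segments. Whether blanks follow it (`q`) decides if the sweep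
ends in stage 3 or in stage 4. The erased prefix leaves only blanks to the left of the new left end,
which `tw` does not see. -/
theorem normLoop_spec {zs : List (Option (Sym n))} {d₁ d₂ d₃ : List Bool} {p q : ℕ}
    (hs : some .rend ∉ zs) (hd : d₁ ≠ [])
    (hz : zs.map (classify rd) = List.replicate p none ++ (d₁.map some ++ none ::
      d₂.map some ++ none :: d₃.map some) ++ List.replicate q none)
    (hl : l ≤ c) (hr : c + zs.length + 1 ≤ r) (hK : cnt zs + 2 ≤ K) :
    Spec (TBox l r K) (normLoop rd 0) (tw c [] (some .lend :: (zs ++ [some .rend])))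
      fun _ w t _ => ∃ z, l + d₂.length + 2 ≤ z ∧ z + d₃.length + 1 ≤ r ∧
        t ≤ 2 * zs.length + 4 ∧
        w = tw z (d₂.reverse.map bit ++ [some .lend]) (some .home :: (d₃.map bit ++ [some .rend])) := by
  obtain ⟨y₁, z₄, rfl, g₁, h₄⟩ := List.map_eq_append_iff.1 hz
  obtain ⟨z₀, y₂, rfl, h₀, g₂⟩ := List.map_eq_append_iff.1 g₁
  obtain ⟨y₃, y₄, rfl, g₃, g₄⟩ := List.map_eq_append_iff.1 g₂
  obtain ⟨z₁, y₅, rfl, h₁, g₅⟩ := List.map_eq_append_iff.1 g₃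
  obtain ⟨x₁, z₂, rfl, e₁, h₂⟩ := List.map_eq_cons_iff.1 g₅
  obtain ⟨x₂, z₃, rfl, e₂, h₃⟩ := List.map_eq_cons_iff.1 g₄
  have hrun := normRun_main hd h₀ h₁ h₂ h₃ e₁ e₂
  have l₁ := congrArg List.length h₁
  have l₂ := congrArg List.length h₂
  have l₃ := congrArg List.length h₃
  have l₀ := congrArg List.length h₀
  have l₄ := congrArg List.length h₄
  simp only [List.length_map, List.length_replicate] at l₀ l₁ l₂ l₃ l₄
  have hpos : 0 < d₁.length := List.length_pos_iff.2 hd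
  have hcr := (cnt_normRun hrun).1
  simp only [cnt_append, cnt_some, cnt_replicate] at hcr
  have c₁ : cnt (x₁ :: (z₂ ++ x₂ :: z₃)) = cnt (x₁ :: z₂) + cnt (x₂ :: z₃) := by
    rw [← cnt_append, List.cons_append]
  cases q with
  | zero =>
    simp only [List.replicate_zero, List.map_eq_nil_iff] at h₄
    subst h₄
    simp only [List.append_nil, List.length_append, List.length_cons, cnt_append] at hr hK ⊢
    have hA : some .lend :: (z₀ ++ (z₁ ++ x₁ :: z₂ ++ x₂ :: z₃) ++ [some .rend]) =
      (some .lend :: z₀ ++ (z₁ ++ (x₁ :: (z₂ ++ (x₂ :: z₃))))) ++ [some (.rend : Sym n)] := by simp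
    rw [hA]
    refine normLoop_sweep (Post := fun _ w t => ∃ z, l + d₂.length + 2 ≤ z ∧
      z + d₃.length + 1 ≤ r ∧ t ≤ 2 * (z₀.length + (z₁.length + (z₂.length + 1) + (z₃.length + 1)))
        + 4 ∧ w = tw z (d₂.reverse.map bit ++ [some .lend])
        (some .home :: (d₃.map bit ++ [some .rend]))) hrun hl ?_ ?_ ?_
    · simp; omega
    · simp only [cnt_append, cnt_some, cnt_nil]; omega
    have hB : ∀ P, (List.replicate P none ++ (List.replicate d₁.length none ++ (some (.lend : Sym n) ::
        (d₂.map bit ++ (some (.home : Sym n) :: d₃.map bit))))).reverse ++ [] =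
        (some .home :: d₃.map bit).reverse ++ ((d₂.reverse.map bit ++ [some .lend]) ++
          List.replicate (d₁.length + P) none) := by
      intro P; simp
    rw [hB (p + 1)]
    refine normLoop_end₃ (Post := _) (by simp; omega) (by simp; omega)
      (by simp [List.map_reverse]; omega) ?_
    rw [tw_replicate_left]
    refine ⟨_, ?_, ?_, ?_, rfl⟩ <;> simp <;> omega
  | succ q =>
    obtain ⟨x₄, z₄, rfl, e₄, h₄⟩ := List.map_eq_cons_iff.1 (List.replicate_succ ▸ h₄)
    simp only [List.mem_append, List.mem_cons, not_or] at hs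
    simp only [List.length_append, List.length_cons, cnt_append] at hr hK ⊢ l₄
    have hA : some .lend :: (z₀ ++ (z₁ ++ x₁ :: z₂ ++ x₂ :: z₃) ++ x₄ :: z₄ ++ [some .rend]) =
      (some .lend :: z₀ ++ (z₁ ++ (x₁ :: (z₂ ++ (x₂ :: z₃))))) ++ (x₄ :: z₄) ++
        [some (.rend : Sym n)] := by simp
    have hrun' := normRun_append hrun (normRun_append (A := [x₄]) (B := [some .rend]) (j := 4)
      (by simp [normRun, normStep, e₄, Ne.symm hs.2.1]) (normRun_last hs.2.2))
    rw [List.singleton_append] at hrun'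
    rw [hA]
    refine normLoop_sweep (Post := fun _ w t => ∃ z, l + d₂.length + 2 ≤ z ∧
      z + d₃.length + 1 ≤ r ∧ t ≤ 2 * (z₀.length + (z₁.length + (z₂.length + 1) + (z₃.length + 1))
        + (z₄.length + 1)) + 4 ∧ w = tw z (d₂.reverse.map bit ++ [some .lend])
        (some .home :: (d₃.map bit ++ [some .rend]))) hrun' hl ?_ ?_ ?_
    · simp; omega
    · simp only [cnt_append, cnt_some, cnt_nil]; omega
    have hB : ∀ P, (List.replicate P none ++ (List.replicate d₁.length none ++ (some (.lend : Sym n) ::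
        (d₂.map bit ++ (some (.home : Sym n) :: d₃.map bit)))) ++ ([some (.rend : Sym n)] ++
          List.replicate z₄.length none)).reverse ++ [] =
        (some .home :: (d₃.map bit ++ some .rend :: List.replicate z₄.length none)).reverse ++
          ((d₂.reverse.map bit ++ [some .lend]) ++
          List.replicate (d₁.length + P) none) := by
      intro P; simp
    rw [hB (p + 1)]
    have c₄ : cnt z₄ ≤ cnt (x₄ :: z₄) := by cases x₄ <;> simp
    have c₅ : 1 ≤ cnt (x₄ :: z₄) := by
      cases x₄ with
      | none => simp [classify] at e₄
      | some s => simp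
    refine normLoop_end₄ (Post := _) (by simp; omega) (by simp; omega)
      (by simp [List.map_reverse]; omega) ?_
    rw [tw_replicate_left]
    refine ⟨_, ?_, ?_, ?_, rfl⟩ <;> simp <;> omega

theorem normalize_spec {Post : Unit → TWorld (Sym n) → ℕ → Set ℤ → Prop}
    {A B : List (Option (Sym n))} {s : Option (Sym n)} {d₁ d₂ d₃ : List Bool} {p q : ℕ}
    (hA : some .lend ∉ A) (hs : some .rend ∉ A.reverse ++ s :: B) (hd : d₁ ≠ [])
    (hz : (A.reverse ++ s :: B).map (classify rd) = List.replicate p none ++ (d₁.map some ++ none ::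
      d₂.map some ++ none :: d₃.map some) ++ List.replicate q none)
    (hl : l + A.length + 1 ≤ c) (hr : c + B.length + 1 ≤ r)
    (hK : cnt (A.reverse ++ s :: B) + 2 ≤ K)
    (h : ∀ z t U, l + d₂.length + 2 ≤ z → z + d₃.length + 1 ≤ r →
      t ≤ 3 * (A.length + B.length + 4) →
      Post () (tw z (d₂.reverse.map bit ++ [some .lend]) (some .home :: (d₃.map bit ++ [some .rend])))
        t U) :
    Spec (TBox l r K) (normalize rd) (tw c (A ++ [some .lend]) (s :: (B ++ [some .rend]))) Post := by
  have hA' : ∀ a ∈ A, isSym .lend a = false := by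
    intro a ha
    simp only [isSym, decide_eq_false_iff_not]
    rintro rfl; exact hA ha
  have hlen := congrArg List.length hz
  simp only [List.length_map, List.length_append, List.length_cons, List.length_replicate,
    List.length_reverse] at hlen
  simp only [cnt_append, cnt_reverse] at hK
  have hsB : cnt (s :: (B ++ [some .rend])) = cnt (s :: B) + 1 := by cases s <;> simp
  refine .bind (.seekTapeLeft (c - A.length - 1) hA' (isSym_self _) rfl (by omega) (by omega)
    (by simp only [cnt_append, cnt_some, cnt_nil]; omega) fun U0 => ?_)
  suffices H : Spec (TBox l r K) (normLoop rd 0) (tw (c - A.length - 1) []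
      (some .lend :: (A.reverse ++ s :: (B ++ [some .rend])))) fun _ w t _ => ∃ z,
        l + d₂.length + 2 ≤ z ∧ z + d₃.length + 1 ≤ r ∧ t ≤ 2 * (A.length + B.length) + 10 ∧
        w = tw z (d₂.reverse.map bit ++ [some .lend]) (some .home :: (d₃.map bit ++ [some .rend])) by
    refine H.mono ?_
    rintro _ w t U - ⟨z, h1, h2, h3, rfl⟩
    exact h _ _ _ h1 h2 (by omega)
  have e : A.reverse ++ s :: (B ++ [some .rend]) = (A.reverse ++ s :: B) ++ [some .rend] := by simp
  rw [e]
  refine (normLoop_spec hs hd hz (by omega) (by simp; omega)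
    (by simp only [cnt_append, cnt_reverse]; omega)).mono ?_
  rintro _ w t U - ⟨z, h1, h2, h3, h4⟩
  refine ⟨z, h1, h2, ?_, h4⟩
  simp at h3; omega

end Normalize
end TileRobot

namespace TileRobot
open Mach Turing

/-! ### Runs of Turing machines -/

section TMRuns
universe u v
variable {Γ : Type u} {Λ : Type v} [Inhabited Γ] [Inhabited Λ] {M : TM0.Machine Γ Λ} {x : List Γ}

theorem runFor_succ {σ : Type*} {step : σ → Option σ} {a b : σ} {i : ℕ}
    (h : step (runFor step a i) = some b) : runFor step a (i + 1) = b := by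
  rw [runFor, Function.iterate_succ_apply', ← runFor, h]
  rfl

theorem cell_self (C : TMConfig Γ Λ) : cell C C.2 = C.1.Tape.head := by
  simp [cell]

theorem tmStep_eq_none {C : TMConfig Γ Λ} : tmStep M C = none ↔ M C.1.q (cell C C.2) = none := by
  rw [cell_self]
  obtain ⟨⟨q, T⟩, p⟩ := C
  cases h : M q T.head <;> simp [tmStep, TM0.step, h]

theorem tmStep_move {C : TMConfig Γ Λ} {q' : Λ} {d : Dir}
    (h : M C.1.q (cell C C.2) = some (q', .move d)) : ∃ C', tmStep M C = some C' ∧ C'.1.q = q' ∧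
      C'.2 = (if d = .right then C.2 + 1 else C.2 - 1) ∧ ∀ j, cell C' j = cell C j := by
  rw [cell_self] at h
  obtain ⟨⟨q, T⟩, p⟩ := C
  dsimp only at h
  refine ⟨_, by simp [tmStep, TM0.step, h]; exact rfl, rfl, ?_, ?_⟩
  · cases d <;> simp [headShift]; ring
  · intro j
    cases d <;> simp only [cell, headShift]
    · rw [Tape.move_left_nth]; congr 1; ring
    · rw [Tape.move_right_nth]; congr 1; ring

theorem tmStep_write {C : TMConfig Γ Λ} {q' : Λ} {a : Γ}
    (h : M C.1.q (cell C C.2) = some (q', .write a)) : ∃ C', tmStep M C = some C' ∧ C'.1.q = q' ∧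
      C'.2 = C.2 ∧ ∀ j, cell C' j = if j = C.2 then a else cell C j := by
  rw [cell_self] at h
  obtain ⟨⟨q, T⟩, p⟩ := C
  dsimp only at h
  refine ⟨_, by simp [tmStep, TM0.step, h]; exact rfl, rfl, by simp [headShift], ?_⟩
  intro j
  simp only [cell, headShift, Tape.write_nth, add_zero]
  refine if_congr (by omega) rfl rfl

theorem cell_tmInit (x : List Γ) (j : ℤ) : cell (tmInit x : TMConfig Γ Λ) j =
    if 0 ≤ j then x.getD j.toNat default else default := by
  simp only [cell, tmInit, TM0.init, sub_zero, Tape.mk₁, Tape.mk₂]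
  rcases j with n | n
  · simp only [Int.ofNat_eq_natCast, Int.natCast_nonneg, if_true, Int.toNat_natCast]
    rw [Tape.mk'_nth_nat, ListBlank.nth_mk, List.getI_eq_getElem?_getD, List.getD_eq_getElem?_getD]
  · simp only [Int.negSucc_not_nonneg, if_false]
    simp [Tape.mk', Tape.nth, ListBlank.nth_mk]

theorem mem_additionalCells {t : ℕ} {j : ℤ} : j ∈ additionalCells M x t ↔
    (∃ n ≤ t, (runFor (tmStep M) (tmInit x) n).2 = j) ∧ (¬ (0 ≤ j ∧ j < x.length) ∨
      ∃ n ≤ t, cell (runFor (tmStep M) (tmInit x) n) j ≠ cell (tmInit x : TMConfig Γ Λ) j) := by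
  simp [additionalCells]

theorem additionalCells_mono {s t : ℕ} (h : s ≤ t) :
    additionalCells M x s ⊆ additionalCells M x t := by
  intro j
  simp only [mem_additionalCells]
  rintro ⟨⟨m, hm, h1⟩, h2⟩
  refine ⟨⟨m, hm.trans h, h1⟩, h2.imp id ?_⟩
  rintro ⟨m, hm, h3⟩
  exact ⟨m, hm.trans h, h3⟩

end TMRuns

/-! ### Simulating a Turing machine -/

section Simulate
variable {n k : ℕ}

/-- The letter that is represented by a cell; `ls b` is the letter for the bit `b`. -/
def letterOf (ls : Option Bool → Fin n) : Option (Sym n) → Fin n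
  | none => ls (some false)
  | some .one => ls (some true)
  | some (.sym a) => a
  | _ => ls none

/-- Move an end mark away from the head. -/
def extend (ls : Option Bool → Fin n) : SMach n Unit := do
  let a ← look
  match a with
  | some .lend => do
    act (some (.sym (ls none))) false
    act (some .lend) true
  | some .rend => do
    act (some (.sym (ls none))) true
    act (some .rend) false
  | _ => pure ()

/-- Simulate a Turing machine. Letters that differ from the input are flagged. -/
def simLoop (ls : Option Bool → Fin n) (δ : Fin k → Fin n → Option (Fin k × (Bool ⊕ Fin n)))
    (q : Fin k) : SMach n Unit :=
  iter (fun q => do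
    extend ls
    let a ← look
    match δ q (letterOf ls a) with
    | none => pure (.inr ())
    | some (q', .inl d) => pure (.inl (q', a, d))
    | some (q', .inr g) => do
      -- Writing the letter that is already there must not flag the cell: such a cell need not count
      -- in the additional space, and a flag costs a tile.
      act (if g = letterOf ls a then a else some (.sym g)) true
      let b ← look
      pure (.inl (q', b, false))) q

universe u v
variable {Γ : Type u} {Λ : Type v} [Inhabited Γ] [Inhabited Λ] (M : TM0.Machine Γ Λ) (x : List Γ)

/-- The transition function of a Turing machine, with encoded letters and states. -/
def transFun (e : Γ ≃ Fin n) (eΛ : Λ ≃ Fin k) (q : Fin k) (a : Fin n) :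
    Option (Fin k × (Bool ⊕ Fin n)) :=
  (M (eΛ.symm q) (e.symm a)).map fun y => (eΛ y.1, match y.2 with
    | .move d => .inl (decide (d = .right))
    | .write b => .inr (e b))

/-- The configuration after `i` steps. -/
abbrev conf (i : ℕ) : TMConfig Γ Λ := runFor (tmStep M) (tmInit x) i

/-- The tape `f` represents the configuration of a Turing machine after `i` steps, where cell `0`
of the Turing machine is cell `o` of `f`, and the end marks stand on the cells `l` and `r`. -/
structure SimInv (e : Γ ≃ Fin n) (ls : Option Bool → Fin n) (f₀ : ℤ → Option (Sym n)) (o : ℤ)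
    (i : ℕ) (f : ℤ → Option (Sym n)) (l r : ℤ) : Prop where
  lneg : l < 0
  rpos : x.length ≤ r
  left : f (o + l) = some .lend
  right : f (o + r) = some .rend
  out : ∀ j, j < l ∨ r < j → f (o + j) = none
  ne : ∀ j, l < j → j < r → f (o + j) ≠ some .lend ∧ f (o + j) ≠ some .rend
  letter : ∀ j, l < j → j < r → letterOf ls (f (o + j)) = e (cell (conf M x i) j)
  blank : ∀ j, j ≤ l ∨ r ≤ j → cell (conf M x i) j = default
  flag : ∀ j, l < j → j < r → ((∃ g, f (o + j) = some (.sym g)) ∧ j ∈ additionalCells M x i) ∨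
    (f (o + j) = f₀ (o + j) ∧ 0 ≤ j ∧ j < x.length ∧
      ∀ m ≤ i, cell (conf M x m) j = cell (conf M x 0) j)
  visited : ∀ m < i, l < (conf M x m).2 ∧ (conf M x m).2 < r

variable {M x} {e : Γ ≃ Fin n} {eΛ : Λ ≃ Fin k} {ls : Option Bool → Fin n}
  {f₀ f : ℤ → Option (Sym n)} {o : ℤ} {i : ℕ} {l r : ℤ}

/-- The cell of the end mark is still blank for the Turing machine. Since the head stands on it and
it lies outside the input, it is an additional cell and may be flagged. -/
theorem SimInv.extend_left (h : SimInv M x e ls f₀ o i f l r) (hb : ls none = e default)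
    (hp : (conf M x i).2 = l) : SimInv M x e ls f₀ o i (Function.update
      (Function.update f (o + l) (some (.sym (ls none)))) (o + (l - 1)) (some .lend)) (l - 1) r := by
  have h1 := h.lneg
  have h2 := h.rpos
  refine ⟨by omega, h2, by simp, ?_, ?_, ?_, ?_, ?_, ?_, ?_⟩
  · rw [Function.update_of_ne (by omega), Function.update_of_ne (by omega), h.right]
  · intro j hj
    rw [Function.update_of_ne (by omega), Function.update_of_ne (by omega), h.out j (by omega)]
  · intro j hj hj'
    rw [Function.update_of_ne (by omega)]
    by_cases hjl : j = l
    · subst hjl; simp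
    · rw [Function.update_of_ne (by omega)]; exact h.ne j (by omega) hj'
  · intro j hj hj'
    rw [Function.update_of_ne (by omega)]
    by_cases hjl : j = l
    · subst hjl; simp [letterOf, hb, h.blank j (.inl le_rfl)]
    · rw [Function.update_of_ne (by omega)]; exact h.letter j (by omega) hj'
  · intro j hj; exact h.blank j (by omega)
  · intro j hj hj'
    rw [Function.update_of_ne (by omega)]
    by_cases hjl : j = l
    · subst hjl
      exact .inl ⟨⟨ls none, by simp⟩, mem_additionalCells.2 ⟨⟨i, le_rfl, hp⟩, .inl (by omega)⟩⟩
    · rw [Function.update_of_ne (by omega)]; exact h.flag j (by omega) hj'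
  · intro m hm; have := h.visited m hm; omega

theorem SimInv.extend_right (h : SimInv M x e ls f₀ o i f l r) (hb : ls none = e default)
    (hp : (conf M x i).2 = r) : SimInv M x e ls f₀ o i (Function.update
      (Function.update f (o + r) (some (.sym (ls none)))) (o + (r + 1)) (some .rend)) l (r + 1) := by
  have h1 := h.lneg
  have h2 := h.rpos
  refine ⟨h1, by omega, ?_, by simp, ?_, ?_, ?_, ?_, ?_, ?_⟩
  · rw [Function.update_of_ne (by omega), Function.update_of_ne (by omega), h.left]
  · intro j hj
    rw [Function.update_of_ne (by omega), Function.update_of_ne (by omega), h.out j (by omega)]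
  · intro j hj hj'
    rw [Function.update_of_ne (by omega)]
    by_cases hjl : j = r
    · subst hjl; simp
    · rw [Function.update_of_ne (by omega)]; exact h.ne j hj (by omega)
  · intro j hj hj'
    rw [Function.update_of_ne (by omega)]
    by_cases hjl : j = r
    · subst hjl; simp [letterOf, hb, h.blank j (.inr le_rfl)]
    · rw [Function.update_of_ne (by omega)]; exact h.letter j hj (by omega)
  · intro j hj; exact h.blank j (by omega)
  · intro j hj hj'
    rw [Function.update_of_ne (by omega)]
    by_cases hjl : j = r
    · subst hjl
      exact .inl ⟨⟨ls none, by simp⟩, mem_additionalCells.2 ⟨⟨i, le_rfl, hp⟩, .inl (by omega)⟩⟩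
    · rw [Function.update_of_ne (by omega)]; exact h.flag j hj (by omega)
  · intro m hm; have := h.visited m hm; omega

theorem SimInv.move (h : SimInv M x e ls f₀ o i f l r)
    (hp : l < (conf M x i).2 ∧ (conf M x i).2 < r)
    (hc : ∀ j, cell (conf M x (i + 1)) j = cell (conf M x i) j) :
    SimInv M x e ls f₀ o (i + 1) f l r := by
  refine ⟨h.lneg, h.rpos, h.left, h.right, h.out, h.ne, ?_, ?_, ?_, ?_⟩
  · intro j hj hj'; rw [h.letter j hj hj', hc]
  · intro j hj; rw [hc, h.blank j hj]
  · intro j hj hj'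
    refine (h.flag j hj hj').imp (And.imp_right fun ha =>
      additionalCells_mono (Nat.le_succ i) ha) ?_
    rintro ⟨h1, h2, h3, h4⟩
    refine ⟨h1, h2, h3, fun m hm => ?_⟩
    rcases Nat.le_succ_iff.1 hm with hm | rfl
    · exact h4 m hm
    · rw [hc]; exact h4 i le_rfl
  · intro m hm
    rcases Nat.lt_succ_iff_lt_or_eq.1 hm with hm | rfl
    exacts [h.visited m hm, hp]

/-- If the letter does not change, this is like a move. Otherwise the cell is flagged, and it is
additional because its content has differed from the input at some time. -/
theorem SimInv.write (h : SimInv M x e ls f₀ o i f l r) {a : Γ}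
    (hp : l < (conf M x i).2 ∧ (conf M x i).2 < r)
    (hc : ∀ j, cell (conf M x (i + 1)) j = if j = (conf M x i).2 then a else cell (conf M x i) j) :
    SimInv M x e ls f₀ o (i + 1) (Function.update f (o + (conf M x i).2)
      (if e a = letterOf ls (f (o + (conf M x i).2)) then f (o + (conf M x i).2)
        else some (.sym (e a)))) l r := by
  have hl := h.letter _ hp.1 hp.2
  by_cases he : e a = letterOf ls (f (o + (conf M x i).2))
  · rw [if_pos he, Function.update_eq_self]
    refine h.move hp fun j => ?_
    rw [hl] at he
    rw [hc]
    split
    · rename_i hj; rw [hj]; exact e.injective he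
    · rfl
  · rw [if_neg he]
    rw [hl] at he
    have ha : a ≠ cell (conf M x i) (conf M x i).2 := fun h => he (congrArg e h)
    refine ⟨h.lneg, h.rpos, ?_, ?_, ?_, ?_, ?_, ?_, ?_, ?_⟩
    · rw [Function.update_of_ne (by omega), h.left]
    · rw [Function.update_of_ne (by omega), h.right]
    · intro j hj
      rw [Function.update_of_ne (by omega), h.out j hj]
    · intro j hj hj'
      by_cases hjp : j = (conf M x i).2
      · rw [hjp]; simp
      · rw [Function.update_of_ne (by omega)]; exact h.ne j hj hj'
    · intro j hj hj'
      rw [hc]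
      by_cases hjp : j = (conf M x i).2
      · rw [if_pos hjp, hjp]; simp [letterOf]
      · rw [if_neg hjp, Function.update_of_ne (by omega)]; exact h.letter j hj hj'
    · intro j hj
      rw [hc, if_neg (by omega)]; exact h.blank j hj
    · intro j hj hj'
      by_cases hjp : j = (conf M x i).2
      · refine .inl ⟨⟨e a, by rw [hjp]; simp⟩, mem_additionalCells.2 ⟨⟨i, by omega, hjp.symm⟩, .inr ?_⟩⟩
        -- If the cell still has its initial letter, the new letter differs from that one; if not,
        -- the change has happened before.
        by_cases h0 : cell (conf M x i) j = cell (conf M x 0) j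
        · refine ⟨i + 1, le_rfl, ?_⟩
          rw [hc, if_pos hjp]
          intro h1
          apply ha
          rw [← hjp, h0]; exact h1
        · exact ⟨i, by omega, h0⟩
      · rw [Function.update_of_ne (by omega)]
        refine (h.flag j hj hj').imp (And.imp_right fun ha =>
          additionalCells_mono (Nat.le_succ i) ha) ?_
        rintro ⟨h1, h2, h3, h4⟩
        refine ⟨h1, h2, h3, fun m hm => ?_⟩
        rcases Nat.le_succ_iff.1 hm with hm | rfl
        · exact h4 m hm
        · rw [hc, if_neg hjp]; exact h4 i le_rfl
    · intro m hm
      rcases Nat.lt_succ_iff_lt_or_eq.1 hm with hm | rfl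
      exacts [h.visited m hm, hp]

end Simulate

section Simulate
universe u v
variable {n k : ℕ} {Γ : Type u} {Λ : Type v} [Inhabited Γ] [Inhabited Λ] {M : TM0.Machine Γ Λ}
  {x : List Γ} {e : Γ ≃ Fin n} {eΛ : Λ ≃ Fin k} {ls : Option Bool → Fin n}
  {f₀ f : ℤ → Option (Sym n)} {o : ℤ} {i T : ℕ} {l r : ℤ}

theorem SimInv.finite (h : SimInv M x e ls f₀ o i f l r) : {u | f u ≠ none}.Finite := by
  refine (Set.finite_Icc (o + l) (o + r)).subset fun u hu => ?_
  by_contra hu'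
  refine hu ?_
  rw [show u = o + (u - o) by ring]
  refine h.out _ ?_
  simp only [Set.mem_Icc] at hu'; omega

/-- The cells between the left end mark and cell 0 do not belong to the input, so they are flagged
and hence additional. -/
theorem SimInv.neg_le (h : SimInv M x e ls f₀ o i f l r) (hi : i ≤ T) :
    -l ≤ tmAdditionalSpace M x T + 1 := by
  have h1 := h.lneg
  have h2 := h.rpos
  have : Finset.Ioo l 0 ⊆ additionalCells M x T := by
    intro j hj
    simp only [Finset.mem_Ioo] at hj
    rcases h.flag j hj.1 (by omega) with h3 | h3
    · exact additionalCells_mono hi h3.2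
    · omega
  have := Finset.card_le_card this
  rw [Int.card_Ioo] at this
  unfold tmAdditionalSpace
  omega

theorem SimInv.le (h : SimInv M x e ls f₀ o i f l r) (hi : i ≤ T) :
    r ≤ x.length + tmAdditionalSpace M x T := by
  have h1 := h.lneg
  have h2 := h.rpos
  have : Finset.Ico (x.length : ℤ) r ⊆ additionalCells M x T := by
    intro j hj
    simp only [Finset.mem_Ico] at hj
    rcases h.flag j (by omega) (by omega) with h3 | h3
    · exact additionalCells_mono hi h3.2
    · omega
  have := Finset.card_le_card this
  rw [Int.card_Ico] at this
  unfold tmAdditionalSpace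
  omega

/-- A nonblank cell was nonblank at the start, or is flagged and hence additional, or is one of the
two end marks. -/
theorem SimInv.wt_le (h : SimInv M x e ls f₀ o i f l r) (hi : i ≤ T)
    (hf : {u | f₀ u ≠ none}.Finite) : wt f ≤ wt f₀ + tmAdditionalSpace M x T + 2 := by
  have hsub : {u | f u ≠ none} ⊆ ({u | f₀ u ≠ none} ∪
      (((additionalCells M x T).image fun j => o + j : Finset ℤ) : Set ℤ)) ∪
      (({o + l, o + r} : Finset ℤ) : Set ℤ) := by
    intro u hu
    obtain ⟨j, rfl⟩ : ∃ j, u = o + j := ⟨u - o, by ring⟩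
    by_cases hl : j = l
    · right; simp [hl]
    by_cases hr : j = r
    · right; simp [hr]
    left
    by_cases hout : j < l ∨ r < j
    · exact absurd (h.out j hout) hu
    rcases h.flag j (by omega) (by omega) with h1 | h1
    · right
      simp only [Finset.coe_image, Set.mem_image, Finset.mem_coe]
      exact ⟨j, additionalCells_mono hi h1.2, rfl⟩
    · left
      simpa [h1.1] using hu
  have hfin := (hf.union (Finset.finite_toSet ((additionalCells M x T).image fun j => o + j))).union
    (Finset.finite_toSet ({o + l, o + r} : Finset ℤ))
  refine (Set.ncard_le_ncard hsub hfin).trans ((Set.ncard_union_le _ _).trans ?_)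
  refine Nat.add_le_add ((Set.ncard_union_le _ _).trans (Nat.add_le_add le_rfl ?_)) ?_
  · rw [Set.ncard_coe_finset]; exact Finset.card_image_le
  · rw [Set.ncard_coe_finset]; exact Finset.card_le_two

theorem wt_update_le {S : Type} {f : ℤ → Option S} (hf : {u | f u ≠ none}.Finite) (c : ℤ)
    (a : Option S) : wt (Function.update f c a) ≤ wt f + 1 := by
  refine (Set.ncard_le_ncard (t := insert c {u | f u ≠ none}) ?_ (hf.insert c)).trans
    (Set.ncard_insert_le _ _)
  intro u hu
  by_cases h : u = c
  · exact .inl h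
  · right; simpa [Function.update_apply, h] using hu

/-- The invariant on the robot tape during the simulation. -/
def SimBox (x : List Γ) (f₀ : ℤ → Option (Sym n)) (o : ℤ) (s : ℕ) :
    TWorld (Sym n) → Prop :=
  TBox (o - s - 2) (o + x.length + s + 2) (wt f₀ + s + 4)

theorem extend_spec (hb : ls none = e default) (hi : i ≤ T) (hf : {u | f₀ u ≠ none}.Finite)
    (h : SimInv M x e ls f₀ o i f l r) (hp : l ≤ (conf M x i).2 ∧ (conf M x i).2 ≤ r)
    {Post : Unit → TWorld (Sym n) → ℕ → Set ℤ → Prop}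
    (hP : ∀ t U f' l' r', t ≤ 2 → SimInv M x e ls f₀ o i f' l' r' →
      l' < (conf M x i).2 ∧ (conf M x i).2 < r' → Post () ⟨o + (conf M x i).2, f'⟩ t U) :
    Spec (SimBox x f₀ o (tmAdditionalSpace M x T)) (extend ls) ⟨o + (conf M x i).2, f⟩ Post := by
  have hw := h.wt_le hi hf
  have b1 := h.neg_le hi
  have b2 := h.le hi
  have b3 := h.lneg
  have b4 := h.rpos
  refine .bind (.look ?_)
  by_cases hl : (conf M x i).2 = l
  · have hI := h.extend_left hb hl
    have hcur : (⟨o + (conf M x i).2, f⟩ : TWorld (Sym n)).cur = some .lend := by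
      rw [hl]; exact h.left
    rw [hcur]
    have hw1 := wt_update_le h.finite (o + (conf M x i).2) (some (.sym (ls none)))
    refine .bind (.act ⟨?_, ?_, ?_⟩ (.act ⟨?_, ?_, ?_⟩ ?_))
    · simp [World.act, Arena.go]; omega
    · simp [World.act, Arena.go]; omega
    · simp only [World.act, Arena.set]; omega
    · simp [World.act, Arena.go]; omega
    · simp [World.act, Arena.go]; omega
    · have := hI.wt_le hi hf
      rw [hl]
      simp only [World.act, Arena.set, Arena.go]
      simp only [Bool.false_eq_true, if_false]
      rw [show o + l - 1 = o + (l - 1) by ring]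
      omega
    · have hact : ((⟨o + (conf M x i).2, f⟩ : TWorld (Sym n)).act (some (.sym (ls none))) false).act
          (some .lend) true = ⟨o + (conf M x i).2, Function.update (Function.update f (o + l)
          (some (.sym (ls none)))) (o + (l - 1)) (some .lend)⟩ := by
        rw [hl]
        refine World.ext ?_ ?_
        · simp [World.act, Arena.go]
        · simp only [World.act, Arena.set, Arena.go]
          simp only [Bool.false_eq_true, if_false]
          rw [show o + l - 1 = o + (l - 1) by ring]
      rw [hact]; exact hP _ _ _ _ _ (by omega) hI (by omega)
  by_cases hr : (conf M x i).2 = r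
  · have hI := h.extend_right hb hr
    have hcur : (⟨o + (conf M x i).2, f⟩ : TWorld (Sym n)).cur = some .rend := by
      rw [hr]; exact h.right
    rw [hcur]
    have hw1 := wt_update_le h.finite (o + (conf M x i).2) (some (.sym (ls none)))
    refine .bind (.act ⟨?_, ?_, ?_⟩ (.act ⟨?_, ?_, ?_⟩ ?_))
    · simp [World.act, Arena.go]; omega
    · simp [World.act, Arena.go]; omega
    · simp only [World.act, Arena.set]; omega
    · simp [World.act, Arena.go]; omega
    · simp [World.act, Arena.go]; omega
    · have := hI.wt_le hi hf
      rw [hr]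
      simp only [World.act, Arena.set, Arena.go]
      simp only [if_true]
      rw [show o + r + 1 = o + (r + 1) by ring]
      omega
    · have hact : ((⟨o + (conf M x i).2, f⟩ : TWorld (Sym n)).act (some (.sym (ls none))) true).act
          (some .rend) false = ⟨o + (conf M x i).2, Function.update (Function.update f (o + r)
          (some (.sym (ls none)))) (o + (r + 1)) (some .rend)⟩ := by
        rw [hr]
        refine World.ext ?_ ?_
        · simp [World.act, Arena.go]
        · simp only [World.act, Arena.set, Arena.go]
          simp only [if_true]
          rw [show o + r + 1 = o + (r + 1) by ring]
      rw [hact]; exact hP _ _ _ _ _ (by omega) hI (by omega)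
  · have hne := h.ne (conf M x i).2 (by omega) (by omega)
    have hcur : (⟨o + (conf M x i).2, f⟩ : TWorld (Sym n)).cur = f (o + (conf M x i).2) := rfl
    rw [hcur]
    have fin := hP (0 + 0) (∅ ∪ ∅) f l r (by omega) h (by omega)
    split
    · rename_i h1; exact absurd h1 hne.1
    · rename_i h1; exact absurd h1 hne.2
    · exact .pure fin

/-- Induction on the number `d` of steps before the Turing machine halts. Before each step the end
marks are moved away from the head if necessary, so that the head stands on a proper letter; one
simulated step costs at most five moves. -/
theorem simLoop_spec (hb : ls none = e default) (hf : {u | f₀ u ≠ none}.Finite)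
    (hhalt : tmStep M (conf M x T) = none) (hrun : ∀ i < T, tmStep M (conf M x i) ≠ none) (d : ℕ)
    (hi : i + d = T) (h : SimInv M x e ls f₀ o i f l r)
    (hp : l ≤ (conf M x i).2 ∧ (conf M x i).2 ≤ r) :
    Spec (SimBox x f₀ o (tmAdditionalSpace M x T))
      (simLoop ls (transFun M e eΛ) (eΛ (conf M x i).1.q)) ⟨o + (conf M x i).2, f⟩
      fun _ w t _ => t ≤ 5 * (d + 1) ∧ w.pos = o + (conf M x T).2 ∧ ∃ l r,
        SimInv M x e ls f₀ o T w.mem l r ∧ l < (conf M x T).2 ∧ (conf M x T).2 < r := by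
  induction d generalizing i f l r with
  | zero =>
    obtain rfl : i = T := by omega
    refine .iter (.bind (extend_spec hb le_rfl hf h hp fun t U f' l' r' ht h' hp' => ?_))
    refine .bind (.look ?_)
    have e1 : letterOf ls (⟨o + (conf M x i).2, f'⟩ : TWorld (Sym n)).cur =
      e (cell (conf M x i) (conf M x i).2) := h'.letter _ hp'.1 hp'.2
    have e2 : transFun M e eΛ (eΛ (conf M x i).1.q) (e (cell (conf M x i) (conf M x i).2)) =
        none := by
      simp [transFun, tmStep_eq_none.1 hhalt]
    rw [e1, e2]
    exact .pure ⟨by omega, rfl, l', r', h', hp'⟩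
  | succ d ih =>
    refine .iter (.bind (extend_spec hb (by omega) hf h hp fun t U f' l' r' ht h' hp' => ?_))
    refine .bind (.look ?_)
    have hw := h'.wt_le (T := T) (by omega) hf
    have b1 := h'.neg_le (T := T) (by omega)
    have b2 := h'.le (T := T) (by omega)
    have b3 := h'.lneg
    have b4 := h'.rpos
    have e1 : letterOf ls (⟨o + (conf M x i).2, f'⟩ : TWorld (Sym n)).cur =
      e (cell (conf M x i) (conf M x i).2) := h'.letter _ hp'.1 hp'.2
    have hne := hrun i (by omega)
    rw [Ne, tmStep_eq_none] at hne
    obtain ⟨⟨q', s⟩, hM⟩ := Option.ne_none_iff_exists'.1 hne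
    cases s with
    | move dir =>
      obtain ⟨C', hC', hq, hpos, hcell⟩ := tmStep_move hM
      have hnext := runFor_succ hC'
      have e2 : transFun M e eΛ (eΛ (conf M x i).1.q) (e (cell (conf M x i) (conf M x i).2)) =
          some (eΛ q', .inl (decide (dir = .right))) := by
        simp [transFun, hM]
      rw [e1, e2]
      have hI := h'.move hp' (by rw [conf, hnext]; exact hcell)
      have hq' : (conf M x (i + 1)).1.q = q' := by rw [conf, hnext]; exact hq
      have hpos' : (conf M x (i + 1)).2 = if dir = .right then (conf M x i).2 + 1 else
          (conf M x i).2 - 1 := by rw [conf, hnext]; exact hpos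
      have hact : (⟨o + (conf M x i).2, f'⟩ : TWorld (Sym n)).act
          (⟨o + (conf M x i).2, f'⟩ : TWorld (Sym n)).cur (decide (dir = .right)) =
          ⟨o + (conf M x (i + 1)).2, f'⟩ := by
        rw [World.act_cur, hpos']
        cases dir <;> simp [Arena.go] <;> ring
      have hpb : l' ≤ (conf M x (i + 1)).2 ∧ (conf M x (i + 1)).2 ≤ r' := by
        rw [hpos']; split <;> omega
      refine .pure ?_
      dsimp only
      rw [hact]
      refine ⟨⟨by dsimp only; omega, by dsimp only; omega, by dsimp only; omega⟩, ?_⟩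
      have := ih (i := i + 1) (by omega) hI hpb
      rw [hq'] at this
      refine this.mono ?_
      rintro _ w t' U' - ⟨h1, h2⟩
      exact ⟨by omega, h2⟩
    | write a =>
      obtain ⟨C', hC', hq, hpos, hcell⟩ := tmStep_write hM
      have hnext := runFor_succ hC'
      have e2 : transFun M e eΛ (eΛ (conf M x i).1.q) (e (cell (conf M x i) (conf M x i).2)) =
          some (eΛ q', .inr (e a)) := by
        simp [transFun, hM]
      rw [e1, e2]
      have hI := h'.write (a := a) hp' (by rw [conf, hnext]; exact hcell)
      have hq' : (conf M x (i + 1)).1.q = q' := by rw [conf, hnext]; exact hq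
      have hpos' : (conf M x (i + 1)).2 = (conf M x i).2 := by rw [conf, hnext]; exact hpos
      rw [← h'.letter _ hp'.1 hp'.2]
      have hw' := hI.wt_le (T := T) (by omega) hf
      generalize hf'' : Function.update f' (o + (conf M x i).2)
        (if e a = letterOf ls (f' (o + (conf M x i).2)) then f' (o + (conf M x i).2)
        else some (.sym (e a))) = f'' at hI hw'
      have hact : (⟨o + (conf M x i).2, f'⟩ : TWorld (Sym n)).act
          (if e a = letterOf ls (f' (o + (conf M x i).2)) then
          (⟨o + (conf M x i).2, f'⟩ : TWorld (Sym n)).cur else some (.sym (e a))) true =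
          ⟨o + (conf M x i).2 + 1, f''⟩ := by
        rw [← hf'']; rfl
      refine .bind (.act ?_ (.bind (.look (.pure ?_))))
      · rw [hact]
        exact ⟨by dsimp only; omega, by dsimp only; omega, by dsimp only; omega⟩
      · dsimp only
        rw [hact, World.act_cur]
        have hgo : (Arena.go (Mem := ℤ → Option (Sym n)) (A := Option (Sym n)) false
            (o + (conf M x i).2 + 1)) = o + (conf M x (i + 1)).2 := by
          rw [hpos']; simp [Arena.go]
        rw [hgo]
        refine ⟨⟨by dsimp only; omega, by dsimp only; omega, by dsimp only; omega⟩, ?_⟩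
        have := ih (i := i + 1) (by omega) hI (by omega)
        rw [hq'] at this
        refine this.mono ?_
        rintro _ w t' U' - ⟨h1, h2⟩
        exact ⟨by omega, h2⟩

end Simulate

section Simulate
universe u v
variable {n k : ℕ} {Γ : Type u} {Λ : Type v} [Inhabited Γ] [Inhabited Λ] {M : TM0.Machine Γ Λ}
  {x : List Γ} {e : Γ ≃ Fin n} {eΛ : Λ ≃ Fin k} {ls : Option Bool → Fin n}
  {f₀ f : ℤ → Option (Sym n)} {o : ℤ} {i T : ℕ} {l r : ℤ}

/-- Go to the first letter and simulate a Turing machine. -/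
def simulate (ls : Option Bool → Fin n) (δ : Fin k → Fin n → Option (Fin k × (Bool ⊕ Fin n)))
    (q : Fin k) : SMach n Unit := do
  seek (isSym .lend) false
  mv true
  simLoop ls δ q

/-- At the start all cells between the end marks belong to the input, and none is flagged. -/
theorem SimInv.init {xs : List (Option (Sym n))} (hx : xs.map (letterOf ls) = x.map e)
    (hxs : ∀ a ∈ xs, a ≠ some .lend ∧ a ≠ some .rend) :
    SimInv M x e ls (tw o [some .lend] (xs ++ [some .rend])).mem o 0
      (tw o [some .lend] (xs ++ [some .rend])).mem (-1) x.length := by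
  have hlen : xs.length = x.length := by simpa using congrArg List.length hx
  have hget : ∀ j : ℤ, -1 < j → j < x.length → ∃ (m : ℕ) (hm : m < xs.length), j = m ∧
      (tw o [some .lend] (xs ++ [some .rend])).mem (o + j) = xs[m] := by
    intro j h1 h2
    obtain ⟨m, rfl⟩ := Int.eq_ofNat_of_zero_le (a := j) (by omega)
    refine ⟨m, by omega, rfl, ?_⟩
    rw [tw_mem_add, List.getD_append _ _ _ _ (by omega), List.getD_eq_getElem _ _ (by omega)]
  refine ⟨by omega, le_rfl, ?_, ?_, ?_, ?_, ?_, ?_, ?_, ?_⟩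
  · simp [tw]
  · rw [tw_mem_add, List.getD_append_right _ _ _ _ (by omega)]
    simp [hlen]
  · rintro j (hj | hj)
    · simp only [tw]
      rw [if_pos (by omega)]
      obtain ⟨m, hm⟩ := Int.eq_ofNat_of_zero_le (a := o - 1 - (o + j) - 1) (by omega)
      rw [show o - 1 - (o + j) = ((m + 1 : ℕ) : ℤ) by push_cast; omega]
      simp
    · obtain ⟨m, rfl⟩ := Int.eq_ofNat_of_zero_le (a := j) (by omega)
      rw [tw_mem_add, List.getD_eq_default]
      simp; omega
  · intro j h1 h2
    obtain ⟨m, hm, -, e⟩ := hget j h1 h2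
    rw [e]; exact hxs _ (List.getElem_mem _)
  · intro j h1 h2
    obtain ⟨m, hm, rfl, e⟩ := hget j h1 h2
    rw [e, conf, runFor, Function.iterate_zero, id, cell_tmInit, if_pos (by omega)]
    have h3 : (xs.map (letterOf ls))[m]? = (x.map _)[m]? := congrArg (fun l => l[m]?) hx
    simp only [List.getElem?_map, List.getElem?_eq_getElem hm,
      List.getElem?_eq_getElem (hlen ▸ hm), Option.map_some, Option.some.injEq] at h3
    rw [h3, Int.toNat_natCast, List.getD_eq_getElem _ _ (hlen ▸ hm)]
  · intro j hj
    rw [conf, runFor, Function.iterate_zero, id, cell_tmInit]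
    split
    · rw [List.getD_eq_default]; omega
    · rfl
  · intro j h1 h2
    refine .inr ⟨rfl, by omega, h2, fun m hm => ?_⟩
    rw [Nat.le_zero.1 hm]
  · intro m hm; omega

theorem simulate_spec {D R : List (Option (Sym n))} {c : ℤ}
    (hb : ls none = e default) (hx : (D.reverse ++ some .home :: R).map (letterOf ls) = x.map e)
    (hD : ∀ a ∈ D, a ≠ some .lend ∧ a ≠ some .rend) (hR : ∀ a ∈ R, a ≠ some .lend ∧ a ≠ some .rend)
    (ho : o = c - D.length)
    (hf₀ : f₀ = (tw c (D ++ [some .lend]) (some .home :: (R ++ [some .rend]))).mem)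
    (hhalt : tmStep M (conf M x T) = none) (hrun : ∀ i < T, tmStep M (conf M x i) ≠ none) :
    Spec (SimBox x f₀ o (tmAdditionalSpace M x T))
      (simulate ls (transFun M e eΛ) (eΛ default)) ⟨c, f₀⟩
      fun _ w t _ => t ≤ 5 * (T + 1) + D.length + 2 ∧ w.pos = o + (conf M x T).2 ∧ ∃ l r,
        SimInv M x e ls f₀ o T w.mem l r ∧ l < (conf M x T).2 ∧ (conf M x T).2 < r := by
  have hlen : D.length + R.length + 1 = x.length := by
    have := congrArg List.length hx
    simp at this; omega
  have hw : wt f₀ = cnt (D ++ [some .lend]) + cnt (some .home :: (R ++ [some .rend])) := by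
    rw [hf₀, (tw_finite_wt _ _ _).2]
  have hfin : {u | f₀ u ≠ none}.Finite := by rw [hf₀]; exact (tw_finite_wt _ _ _).1
  have hD' : ∀ a ∈ D, isSym .lend a = false := by
    intro a ha; simpa [isSym] using (hD a ha).1
  have hstart : (⟨c, f₀⟩ : TWorld (Sym n)) =
      tw c (D ++ [some .lend]) (some .home :: (R ++ [some .rend])) := World.ext rfl hf₀
  have he : f₀ = (tw o [some .lend] ((D.reverse ++ some .home :: R) ++ [some .rend])).mem := by
    have := tw_shift_append o c [some .lend] D.reverse (some .home :: (R ++ [some .rend]))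
      (by simp; omega)
    rw [hf₀]; simpa using this.symm
  simp only [cnt_append, cnt_some, cnt_nil] at hw
  unfold SimBox simulate
  rw [hstart]
  refine .bind (.seekTapeLeft (o - 1) hD' (isSym_self _) (by omega) (by omega) (by omega)
    (by simp; omega) fun U => ?_)
  refine .bind (.goRight (c' := o) (by ring) (.mk (by simp; omega)) ?_)
  have hinit := SimInv.init (M := M) (o := o) hx (by
    simp only [List.mem_append, List.mem_cons, List.mem_reverse]
    rintro a (ha | rfl | ha)
    exacts [hD a ha, by simp, hR a ha])
  rw [← he] at hinit
  have hw0 : tw o [some .lend] (D.reverse ++ some .home :: (R ++ [some .rend])) =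
      (⟨o + (conf M x 0).2, f₀⟩ : TWorld (Sym n)) := by
    refine World.ext ?_ ?_
    · simp [conf, runFor, tmInit]
    · rw [he]; simp
  rw [hw0]
  have := simLoop_spec (eΛ := eΛ) hb hfin hhalt hrun T (by omega) hinit
    (by simp [conf, runFor, tmInit])
  refine this.mono ?_
  rintro _ w t U' - ⟨h1, h2⟩
  exact ⟨by omega, h2⟩

/-- Converts the tape given as a function back to two lists, cut at the head, as the specifications
of tape machines require. -/
theorem SimInv.exists_tw (h : SimInv M x e ls f₀ o i f l r) {p : ℤ} (hp : l < p ∧ p < r) :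
    ∃ A s B, (⟨o + p, f⟩ : TWorld (Sym n)) = tw (o + p) (A ++ [some .lend]) (s :: (B ++ [some .rend])) ∧
      A.reverse ++ s :: B = (List.range (r - l - 1).toNat).map (fun m : ℕ => f (o + (l + 1 + m))) ∧
      (A.length : ℤ) = p - l - 1 ∧ (B.length : ℤ) = r - p - 1 := by
  have h1 := h.lneg
  have h2 := h.rpos
  have hf : f = (tw (o + (l + 1)) [some .lend] ((List.range (r - l - 1).toNat).map
      (fun m : ℕ => f (o + (l + 1 + m))) ++ [some .rend])).mem := by
    funext u
    obtain ⟨j, rfl⟩ : ∃ j, u = o + j := ⟨u - o, by ring⟩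
    rcases lt_trichotomy j l with hj | rfl | hj
    · rw [h.out j (.inl hj)]
      simp only [tw]
      rw [if_pos (by omega)]
      obtain ⟨m, hm⟩ := Int.eq_ofNat_of_zero_le (a := o + (l + 1) - 1 - (o + j) - 1) (by omega)
      rw [show o + (l + 1) - 1 - (o + j) = ((m + 1 : ℕ) : ℤ) by push_cast; omega]
      simp
    · rw [h.left]
      simp only [tw]
      rw [if_pos (by omega), show o + (j + 1) - 1 - (o + j) = 0 by ring]
      simp
    · obtain ⟨m, hm⟩ := Int.eq_ofNat_of_zero_le (a := j - l - 1) (by omega)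
      obtain rfl : j = l + 1 + m := by omega
      conv_rhs => rw [show o + (l + 1 + (m : ℤ)) = o + (l + 1) + m by ring, tw_mem_add]
      rcases lt_trichotomy (l + 1 + (m : ℤ)) r with hr | hr | hr
      · rw [List.getD_append _ _ _ _ (by simp; omega), List.getD_eq_getElem _ _ (by simp; omega)]
        simp
      · rw [hr, h.right, List.getD_append_right _ _ _ _ (by simp; omega)]
        simp [show m - ((r - l).toNat - 1) = 0 by omega]
      · rw [h.out _ (.inr hr), List.getD_eq_default _ _ (by simp; omega)]
  generalize hzs : (List.range (r - l - 1).toNat).map (fun m : ℕ => f (o + (l + 1 + m))) = zs at hf ⊢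
  have hlen : (zs.length : ℤ) = r - l - 1 := by rw [← hzs]; simp; omega
  obtain ⟨a, ha⟩ := Int.eq_ofNat_of_zero_le (a := p - l - 1) (by omega)
  obtain ⟨s, B, hB⟩ : ∃ s B, zs.drop a = s :: B := by
    cases hd : zs.drop a with
    | nil => have := congrArg List.length hd; simp at this; omega
    | cons s B => exact ⟨s, B, rfl⟩
  have hBl := congrArg List.length hB
  simp only [List.length_drop, List.length_cons] at hBl
  refine ⟨(zs.take a).reverse, s, B, ?_, ?_, by simp; omega, by omega⟩
  · refine World.ext rfl ?_
    have := tw_shift_append (o + (l + 1)) (o + p) [some .lend] (zs.take a) (zs.drop a ++ [some .rend])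
      (by simp; omega)
    rw [← List.append_assoc, List.take_append_drop, ← hf, hB] at this
    exact this
  · rw [List.reverse_reverse, ← hB, List.take_append_drop]

theorem classify_eq {rd : Fin n → Option Bool} (hrd : ∀ b, rd (ls b) = b) {a : Option (Sym n)}
    (h : a ≠ some .lend ∧ a ≠ some .rend) : classify rd a = rd (letterOf ls a) := by
  rcases a with _ | _ | _ | _ | _ | _ | a <;> simp [classify, letterOf, hrd] at h ⊢

/-- The inscription begins and ends with a letter that is not blank, while everything at and beyond
the end marks is blank. So it lies entirely between the end marks, padded by blanks. -/
theorem range_map_eq {g : ℤ → Option Bool} {enc : List (Option Bool)} {c : ℤ}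
    (h0 : enc.getD 0 none ≠ none) (h1 : enc.getD (enc.length - 1) none ≠ none)
    (hg : ∀ m : ℤ, g (c + m) = if 0 ≤ m then enc.getD m.toNat none else none)
    (hlr : ∀ j, j ≤ l ∨ r ≤ j → g j = none) :
    ∃ p q, (List.range (r - l - 1).toNat).map (fun m : ℕ => g (l + 1 + m)) =
      List.replicate p none ++ enc ++ List.replicate q none := by
  have hpos : 0 < enc.length := by
    rw [List.length_pos_iff]; rintro rfl; simp at h0
  have hl : l < c := by
    by_contra hc
    have := hg 0
    rw [add_zero, if_pos le_rfl, hlr c (.inl (by omega))] at this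
    exact h0 this.symm
  have hr : c + enc.length ≤ r := by
    by_contra hc
    have := hg ((enc.length - 1 : ℕ) : ℤ)
    rw [if_pos (by omega), hlr _ (.inr (by omega))] at this
    exact h1 this.symm
  refine ⟨(c - l - 1).toNat, (r - c - enc.length).toNat, List.ext_getElem ?_ ?_⟩
  · simp; omega
  · intro m h2 h3
    simp only [List.getElem_map, List.getElem_range]
    have := hg (l + 1 + m - c)
    rw [show c + (l + 1 + (m : ℤ) - c) = l + 1 + m by ring] at this
    rw [this]
    simp only [List.length_append, List.length_replicate] at h3
    by_cases h4 : m < (c - l - 1).toNat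
    · rw [if_neg (by omega), List.getElem_append_left (by simp; omega),
        List.getElem_append_left (by simpa using h4), List.getElem_replicate]
    · rw [if_pos (by omega)]
      by_cases h5 : m < (c - l - 1).toNat + enc.length
      · rw [List.getElem_append_left (by simpa using h5), List.getElem_append_right (by simp; omega),
          List.getD_eq_getElem _ _ (by omega)]
        congr 1
        simp; omega
      · rw [List.getElem_append_right (by simp; omega), List.getElem_replicate,
          List.getD_eq_default _ _ (by omega)]

theorem bits_getLast {m : ℕ} (hm : m ≠ 0) : m.bits.getLast? = some true := by
  induction m using Nat.binaryRec' with
  | zero => exact absurd rfl hm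
  | bit b m h ih =>
    rw [Nat.bits_append_bit m b h]
    by_cases h0 : m = 0
    · subst h0; simp [h rfl]
    · rw [List.getLast?_cons, ih h0]; rfl

theorem length_bits_le (m : ℕ) : m.bits.length ≤ m := by
  induction m using Nat.binaryRec' with
  | zero => simp
  | bit b m h ih =>
    rw [Nat.bits_append_bit m b h, List.length_cons, Nat.bit_val]
    by_cases h0 : m = 0
    · subst h0; simp [h rfl]
    · cases b <;> simp <;> omega

namespace Polyomino
variable (P : Polyomino)

theorem length_bitmap : P.bitmap.length = P.height * P.width := by
  simp [bitmap, List.length_flatMap]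

/-- The height is positive, so its binary representation has a first digit. -/
theorem encode_head : P.encode.getD 0 none ≠ none := by
  have h := bits_getLast (P.height_pos.ne')
  have : (binary P.height).head? = some true := by rw [binary, List.head?_reverse, h]
  cases hb : binary P.height with
  | nil => rw [hb] at this; simp at this
  | cons b l => simp [encode, hb]

theorem encode_last : P.encode.getD (P.encode.length - 1) none ≠ none := by
  have h : P.bitmap ≠ [] := by
    rw [← List.length_pos_iff, length_bitmap]
    exact Nat.mul_pos P.height_pos P.width_pos
  have : P.encode.getLast? = some (some (P.bitmap.getLast h)) := by
    unfold encode
    rw [List.getLast?_append, List.getLast?_cons, List.getLast?_map, List.getLast?_eq_getLast_of_ne_nil h]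
    rfl
  rw [List.getLast?_eq_getElem?] at this
  rw [List.getD_eq_getElem?_getD, this]
  simp

end Polyomino

/-- Normalizing the tape after the simulation. -/
theorem SimInv.normalize {P : Polyomino} {letter : Option Bool → Γ} (hletter : letter.Injective)
    (hblank : letter none = default) (hls : ∀ b, ls b = e (letter b))
    (h : SimInv M x e ls f₀ o i f l r) {p c : ℤ} (hp : l < p ∧ p < r)
    (hy : ∀ j, cell (conf M x i) (c + j) = cell (tmInit (P.encode.map letter) : TMConfig Γ Λ) j)
    {lo hi : ℤ} {K : ℕ} (hlo : lo ≤ o + l) (hhi : o + r ≤ hi) (hK : wt f ≤ K) :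
    Spec (TBox lo hi K) (TileRobot.normalize fun a => Function.invFun letter (e.symm a)) ⟨o + p, f⟩
      fun _ w t _ => t ≤ 3 * (r - l + 3) ∧ ∃ z, lo + P.width.bits.length + 2 ≤ z ∧
        z + P.bitmap.length + 1 ≤ hi ∧ w = tw z (P.width.bits.map bit ++ [some .lend])
          (some .home :: (P.bitmap.map bit ++ [some .rend])) := by
  obtain ⟨A, s, B, hw, hzs, hA, hB⟩ := h.exists_tw hp
  have hmem : ∀ a ∈ A.reverse ++ s :: B, a ≠ some .lend ∧ a ≠ some .rend := by
    rw [hzs]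
    intro a ha
    simp only [List.mem_map, List.mem_range] at ha
    obtain ⟨m, hm, rfl⟩ := ha
    exact h.ne _ (by omega) (by omega)
  have hinv := Function.leftInverse_invFun hletter
  have hrd : ∀ b, Function.invFun letter (e.symm (ls b)) = b := by
    intro b; rw [hls, e.symm_apply_apply, hinv]
  have hcls : (A.reverse ++ s :: B).map (classify fun a => Function.invFun letter (e.symm a)) =
      (List.range (r - l - 1).toNat).map (fun m : ℕ =>
        Function.invFun letter (cell (conf M x i) (l + 1 + m))) := by
    rw [hzs, List.map_map]
    refine List.map_congr_left fun m hm => ?_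
    simp only [List.mem_range] at hm
    simp only [Function.comp]
    rw [classify_eq (ls := ls) hrd (h.ne _ (by omega) (by omega)), h.letter _ (by omega) (by omega),
      e.symm_apply_apply]
  have hdef : Function.invFun letter (default : Γ) = none := by rw [← hblank, hinv]
  obtain ⟨a, b, hab⟩ := range_map_eq (l := l) (r := r) (c := c)
    (g := fun j => Function.invFun letter (cell (conf M x i) j)) P.encode_head P.encode_last (by
      intro m
      rw [hy, cell_tmInit]
      split
      · rw [List.getD_eq_getElem?_getD, List.getD_eq_getElem?_getD, List.getElem?_map]
        cases P.encode[m.toNat]? <;> simp [hdef, hinv _]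
      · exact hdef) (by
      intro j hj
      rw [h.blank j hj, hdef])
  rw [hab] at hcls
  have hcnt : cnt (A.reverse ++ s :: B) + 2 ≤ K := by
    have h1 : wt f = cnt (A ++ [some .lend]) + cnt (s :: (B ++ [some .rend])) := by
      rw [← (tw_finite_wt (o + p) _ _).2, ← hw]
    have h2 : cnt (s :: (B ++ [some .rend])) = cnt (s :: B) + 1 := by cases s <;> simp
    simp only [cnt_append, cnt_some, cnt_nil, cnt_reverse] at h1 ⊢
    omega
  rw [hw]
  refine normalize_spec (p := a) (q := b) (d₁ := Polyomino.binary P.height)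
    (d₂ := Polyomino.binary P.width) (d₃ := P.bitmap) (fun hA => (hmem _ (by simp [hA])).1 rfl)
    (fun hs => (hmem _ hs).2 rfl) ?_ hcls (by omega) (by omega) hcnt fun z t U h1 h2 h3 => ?_
  · have := bits_getLast (P.height_pos.ne')
    intro h0
    simp only [Polyomino.binary, List.reverse_eq_nil_iff] at h0
    rw [h0] at this; simp at this
  · simp only [Polyomino.binary, List.length_reverse, List.reverse_reverse] at h1 ⊢
    exact ⟨by omega, z, h1, h2, rfl⟩

end Simulate
end TileRobot

namespace TileRobot
open Mach

/-! ### Reading the polyomino pixel by pixel -/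

namespace Mach.Spec
variable {I : World Pixel (Finset Pixel) → Prop} {x y : ℤ} {T : Finset Pixel}
  {Post : Unit → World Pixel (Finset Pixel) → ℕ → Set Pixel → Prop}

/-- Occupy a pixel that may or may not be occupied already. -/
theorem fillUp {y' : ℤ} (e : y' = y + 1)
    (h : ∀ T' : Finset Pixel, (∀ u v, (u, v) ∈ T' ↔ u = x ∧ v = y ∨ (u, v) ∈ T) →
      T'.card + (decide ((x, y) ∈ T)).toNat = T.card + 1 →
      I ⟨(x, y'), T'⟩ ∧ Post () ⟨(x, y'), T'⟩ 1 {(x, y)}) :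
    Spec I (Mach.act true .up : Mach Bool Direction Unit) ⟨(x, y), T⟩ Post := by
  subst e
  have := h (insert (x, y) T) (by simp) (by by_cases h : (x, y) ∈ T <;> simp [h])
  exact Spec.act this.1 this.2

end Mach.Spec

/-- Read the next pixel of the polyomino, starting and ending at the home pixel. The second value
is `none` within a row, `some false` at the end of a row, and `some true` at the end of the last
row. -/
def readNext : GMach (Bool × Option Bool) := do
  seek id .down
  seek id .left
  act false .left
  let bit ← look
  act true .up
  let limit ← look
  match limit with
  | false => do
    mv .down
    seek id .right
    seek id .up
    pure (bit, none)
  | true => do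
    act false .down
    seek id .right
    mv .down
    mv .down
    -- The bottom mark stands two rows below the last row.
    let last ← look
    match last with
    | false => do
      -- The pebble at the left end of the finished row stays there and becomes the limit of the
      -- next row.
      mv .up
      mv .up
      act false .down
      act true .left
      act true .up
      mv .right
      seek id .up
      pure (bit, some false)
    | true => do
      act false .up
      mv .up
      seek id .left
      act false .right
      seek id .right
      act false .up
      seek id .up
      pure (bit, some true)

/-- The pixels below the strip while the pixel left of `(p, y)` is to be read: the pebble, the
pointer, the limit, the bottom mark, and the unread tiles. -/
def Unread (P : Finset Pixel) (a b c p y u v : ℤ) : Prop :=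
  u = p ∧ v = y ∨ u = b + 2 ∧ v = y ∨ u = a ∧ v = y + 1 ∨ u = b + 2 ∧ v = c - 2 ∨
    (u, v) ∈ P ∧ (v < y ∨ v = y ∧ u < p)

/-- Above row `y`, and in row `y` from the pebble on, all tiles have been consumed. So the searches
meet only the pointer, the pebble and the home tile, and a tile above the pebble can only be the
limit. If the pixel is a tile, it becomes the pebble, and the old pebble is the tile that
disappears. After the last pixel the four marks are removed too. -/
theorem readNext_spec {P T : Finset Pixel} {a b c e p y x₀ x₁ y₀ y₁ : ℤ} {K : ℕ}
    {Post : Bool × Option Bool → World Pixel (Finset Pixel) → ℕ → Set Pixel → Prop}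
    (hP : ∀ u v, (u, v) ∈ P → a ≤ u ∧ u ≤ b ∧ c ≤ v ∧ v ≤ e)
    (hp : a + 1 ≤ p ∧ p ≤ b + 1) (hy : c ≤ y ∧ y ≤ e)
    (hT : ∀ u v, v < e + 2 → ((u, v) ∈ T ↔ Unread P a b c p y u v))
    (hX : (b + 2, e + 2) ∈ T) (hx : x₀ ≤ a ∧ b + 2 ≤ x₁) (hy' : y₀ ≤ c - 2 ∧ e + 2 ≤ y₁)
    (hK : T.card ≤ K)
    (h : ∀ (t : ℕ) U T', (t : ℤ) ≤ 4 * (b - a + e - c) + 40 →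
      (∀ u v, e + 2 ≤ v → ((u, v) ∈ T' ↔ (u, v) ∈ T)) →
      (a < p - 1 → T'.card + (decide ((p - 1, y) ∈ P)).toNat = T.card →
        (∀ u v, v < e + 2 → ((u, v) ∈ T' ↔ Unread P a b c (p - 1) y u v)) →
        Post (decide ((p - 1, y) ∈ P), none) ⟨(b + 2, e + 2), T'⟩ t U) ∧
      (p - 1 = a → c < y → T'.card + (decide ((p - 1, y) ∈ P)).toNat = T.card →
        (∀ u v, v < e + 2 → ((u, v) ∈ T' ↔ Unread P a b c (b + 1) (y - 1) u v)) →
        Post (decide ((p - 1, y) ∈ P), some false) ⟨(b + 2, e + 2), T'⟩ t U) ∧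
      (p - 1 = a → c = y → T'.card + (decide ((p - 1, y) ∈ P)).toNat + 4 = T.card →
        (∀ u v, v < e + 2 → (u, v) ∉ T') →
        Post (decide ((p - 1, y) ∈ P), some true) ⟨(b + 2, e + 2), T'⟩ t U)) :
    Spec (Box x₀ x₁ y₀ y₁ K) readNext ⟨(b + 2, e + 2), T⟩ Post := by
  unfold Unread at *
  refine .bind (.seekDown y (by omega) (by grind) (by grind)
    (fun u hu hu' => .mk (by omega)) ?_)
  refine .bind (.seekLeft p (by omega) (by grind) (by grind)
    (fun u hu hu' => .mk (by omega)) ?_)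
  refine .bind (.eraseLeft (by grind) rfl fun T1 h1 c1 => ⟨.mk (by omega), ?_⟩)
  refine .bind (.lookDecide ?_)
  rw [show decide ((p - 1, y) ∈ T1) = decide ((p - 1, y) ∈ P) from decide_eq_decide.2 (by grind)]
  refine .bind (.fillUp rfl fun T2 h2 c2 => ?_)
  rw [show decide ((p - 1, y) ∈ T1) = decide ((p - 1, y) ∈ P) from decide_eq_decide.2 (by grind)] at c2
  generalize (decide ((p - 1, y) ∈ P)) = bit at *
  have hb := Bool.toNat_le bit
  refine ⟨.mk (by omega), ?_⟩
  by_cases hpa : a < p - 1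
  · refine .bind (.lookFalse (by grind) ?_)
    refine .bind (.moveDown (y' := y) (by ring) (.mk (by omega)) ?_)
    refine .bind (.seekRight (b + 2) (by omega) (by grind) (by grind)
      (fun u hu hu' => .mk (by omega)) ?_)
    refine .bind (.seekUp (e + 2) (by omega) (by grind) (by grind)
      (fun u hu hu' => .mk (by omega)) (.pure ?_))
    refine (h _ _ _ ?_ ?_).1 hpa (by omega) ?_
    · omega
    · grind
    · grind
  obtain rfl : p = a + 1 := by omega
  rw [show a + 1 - 1 = a by ring] at *
  refine .bind (.lookTrue (by grind) ?_)
  refine .bind (.eraseDown (y' := y) (by grind) (by ring) fun T3 h3 c3 => ⟨.mk (by omega), ?_⟩)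
  refine .bind (.seekRight (b + 2) (by omega) (by grind) (by grind)
      (fun u hu hu' => .mk (by omega)) ?_)
  refine .bind (.moveDown rfl (.mk (by omega)) ?_)
  refine .bind (.moveDown (y' := y - 2) (by ring) (.mk (by omega)) ?_)
  by_cases hyc : c < y
  · refine .bind (.lookFalse (by grind) ?_)
    refine .bind (.moveUp (y' := y - 1) (by ring) (.mk (by omega)) ?_)
    refine .bind (.moveUp (y' := y) (by ring) (.mk (by omega)) ?_)
    refine .bind (.eraseDown (by grind) rfl fun T4 h4 c4 => ⟨.mk (by omega), ?_⟩)
    refine .bind (.putLeft (x' := b + 1) (by grind) (by ring) fun T5 h5 c5 => ⟨.mk (by omega), ?_⟩)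
    refine .bind (.putUp (y' := y) (by grind) (by ring) fun T6 h6 c6 => ⟨.mk (by omega), ?_⟩)
    refine .bind (.moveRight (x' := b + 2) (by ring) (.mk (by omega)) ?_)
    refine .bind (.seekUp (e + 2) (by omega) (by grind) (by grind)
      (fun u hu hu' => .mk (by omega)) (.pure ?_))
    refine (h _ _ _ ?_ ?_).2.1 (by ring) hyc (by omega) ?_
    · omega
    · grind
    · grind
  · obtain rfl : c = y := by omega
    refine .bind (.lookTrue (by grind) ?_)
    refine .bind (.eraseUp (y' := c - 1) (by grind) (by ring) fun T4 h4 c4 => ⟨.mk (by omega), ?_⟩)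
    refine .bind (.moveUp (y' := c) (by ring) (.mk (by omega)) ?_)
    refine .bind (.seekLeft a (by omega) (by grind) (by grind)
      (fun u hu hu' => .mk (by omega)) ?_)
    refine .bind (.eraseRight (by grind) rfl fun T5 h5 c5 => ⟨.mk (by omega), ?_⟩)
    refine .bind (.seekRight (b + 2) (by omega) (by grind) (by grind)
      (fun u hu hu' => .mk (by omega)) ?_)
    refine .bind (.eraseUp (by grind) rfl fun T6 h6 c6 => ⟨.mk (by omega), ?_⟩)
    refine .bind (.seekUp (e + 2) (by omega) (by grind) (by grind)
      (fun u hu hu' => .mk (by omega)) (.pure ?_))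
    refine (h _ _ _ ?_ ?_).2.2 (by ring) rfl (by omega) ?_
    · omega
    · grind
    · grind

/-- Extend the triangle above the strip by a row, starting and ending at the home pixel. -/
def triangleStep (n : ℕ) : GMach Unit := do
  walk .up (n + 4)
  seek id .up
  seek id .right
  act false .right
  mv .up
  act true .left
  mv .down
  seek id .left
  act false .up
  act true .down
  seek id .down

/-- Remove the marks of the triangle. -/
def triangleEnd (n : ℕ) : GMach Unit := do
  walk .up (n + 4)
  seek id .up
  seek id .right
  act false .right
  seek id .left
  act false .down
  seek id .down

/-- The two marks of the current row move up by one, the right one also by one to the right. The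
tile count is unchanged, while the visited part of the row gets longer with `j`. -/
theorem triangleStep_spec {n j : ℕ} {T : Finset Pixel} {X Y x₀ x₁ y₀ y₁ : ℤ} {K : ℕ}
    {Post : Unit → World Pixel (Finset Pixel) → ℕ → Set Pixel → Prop}
    (hT : ∀ u v, Y + n + 5 ≤ v →
      ((u, v) ∈ T ↔ u = X ∧ v = Y + n + 5 + j ∨ u = X + 1 + j ∧ v = Y + n + 5 + j))
    (hX : (X, Y) ∈ T) (hc : ∀ v, Y < v → v < Y + n + 5 → (X, v) ∉ T)
    (hx : x₀ ≤ X ∧ X + j + 2 ≤ x₁) (hy : y₀ ≤ Y ∧ Y + n + j + 6 ≤ y₁) (hK : T.card ≤ K)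
    (h : ∀ t U T', t ≤ 2 * n + 4 * j + 18 → T'.card = T.card → (∀ u v, v < Y + n + 5 → ((u, v) ∈ T' ↔ (u, v) ∈ T)) →
      (∀ u v, Y + n + 5 ≤ v → ((u, v) ∈ T' ↔ u = X ∧ v = Y + n + 5 + (j + 1 : ℕ) ∨
        u = X + 1 + (j + 1 : ℕ) ∧ v = Y + n + 5 + (j + 1 : ℕ))) →
      (∀ u, X ≤ u → u ≤ X + j → (u, Y + n + 5 + j) ∈ U) →
      Post () ⟨(X, Y), T'⟩ t U) :
    Spec (Box x₀ x₁ y₀ y₁ K) (triangleStep n) ⟨(X, Y), T⟩ Post := by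
  refine .bind (walk_up_spec (n + 4) (by omega) (by omega) (by omega) fun U => ?_)
  refine .bind (.seekUp (Y + n + 5 + j) (by omega) (by grind) (by grind)
    (fun u hu hu' => .mk (by omega)) ?_)
  refine .bind (.seekRight (X + 1 + j) (by omega) (by grind) (by grind)
    (fun u hu hu' => .mk (by omega)) ?_)
  refine .bind (.eraseRight (by grind) rfl fun T1 h1 c1 => ⟨.mk (by omega), ?_⟩)
  refine .bind (.moveUp rfl (.mk (by omega)) ?_)
  refine .bind (.putLeft (x' := X + 1 + j) (by grind) (by ring) fun T2 h2 c2 => ⟨.mk (by omega), ?_⟩)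
  refine .bind (.moveDown (y' := Y + n + 5 + j) (by ring) (.mk (by omega)) ?_)
  refine .bind (.seekLeft X (by omega) (by grind) (by grind)
    (fun u hu hu' => .mk (by omega)) ?_)
  refine .bind (.eraseUp (by grind) rfl fun T3 h3 c3 => ⟨.mk (by omega), ?_⟩)
  refine .bind (.putDown (y' := Y + n + 5 + j) (by grind) (by ring)
    fun T4 h4 c4 => ⟨.mk (by omega), ?_⟩)
  refine .seekDown Y (by omega) (by grind) (by grind) (fun u hu hu' => .mk (by omega)) ?_
  refine h _ _ T4 ?_ (by omega) (by grind) (by push_cast; grind) ?_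
  · omega
  · intro u hu hu'
    -- The search to the right has swept the row.
    exact .inr (.inr (.inl (by simp only [Set.mem_ofPred_eq, and_true]; omega)))

theorem triangleEnd_spec {n j : ℕ} {T : Finset Pixel} {X Y x₀ x₁ y₀ y₁ : ℤ} {K : ℕ}
    {Post : Unit → World Pixel (Finset Pixel) → ℕ → Set Pixel → Prop}
    (hT : ∀ u v, Y + n + 5 ≤ v →
      ((u, v) ∈ T ↔ u = X ∧ v = Y + n + 5 + j ∨ u = X + 1 + j ∧ v = Y + n + 5 + j))
    (hX : (X, Y) ∈ T) (hc : ∀ v, Y < v → v < Y + n + 5 → (X, v) ∉ T)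
    (hx : x₀ ≤ X ∧ X + j + 2 ≤ x₁) (hy : y₀ ≤ Y ∧ Y + n + j + 6 ≤ y₁) (hK : T.card ≤ K)
    (h : ∀ t U T', t ≤ 2 * n + 4 * j + 14 → T'.card + 2 = T.card → (∀ u v, v < Y + n + 5 → ((u, v) ∈ T' ↔ (u, v) ∈ T)) →
      (∀ u v, Y + n + 5 ≤ v → (u, v) ∉ T') → Post () ⟨(X, Y), T'⟩ t U) :
    Spec (Box x₀ x₁ y₀ y₁ K) (triangleEnd n) ⟨(X, Y), T⟩ Post := by
  refine .bind (walk_up_spec (n + 4) (by omega) (by omega) (by omega) fun U => ?_)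
  refine .bind (.seekUp (Y + n + 5 + j) (by omega) (by grind) (by grind)
    (fun u hu hu' => .mk (by omega)) ?_)
  refine .bind (.seekRight (X + 1 + j) (by omega) (by grind) (by grind)
    (fun u hu hu' => .mk (by omega)) ?_)
  refine .bind (.eraseRight (by grind) rfl fun T1 h1 c1 => ⟨.mk (by omega), ?_⟩)
  refine .bind (.seekLeft X (by omega) (by grind) (by grind)
    (fun u hu hu' => .mk (by omega)) ?_)
  refine .bind (.eraseDown (by grind) rfl fun T3 h3 c3 => ⟨.mk (by omega), ?_⟩)
  refine .seekDown Y (by omega) (by grind) (by grind) (fun u hu hu' => .mk (by omega)) ?_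
  refine h _ _ T3 ?_ (by omega) (by grind) (by grind)
  omega

end TileRobot

/-! ### The reading phase. -/

namespace TileRobot
open Mach

/-- Replace the marks of the corners by the marks for reading. -/
def setMarks : GMach Unit := do
  act false .up
  mv .right
  act false .down
  seek id .right
  mv .right
  mv .up
  act false .left
  seek id .up
  mv .right
  mv .up
  act false .left
  mv .down
  seek id .left
  act false .right
  mv .up
  act false .right
  mv .down
  mv .down
  act true .up
  seek id .right
  mv .down
  mv .down
  act true .left
  act true .up
  mv .right
  mv .up

/-- Set the marks of the triangle. -/
def triangleStart (n : ℕ) : GMach Unit := do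
  walk .up (n + 5)
  act true .right
  act true .left
  walk .down (n + 5)

/-- Around the bounding box the marks hide no tile, so from now on they can be erased without
restoring blocks. -/
theorem Overlay.mem_iff {P : Polyomino} {T : Finset Pixel} (h : Overlay P.tiles P.rect.corner T)
    (u v : ℤ) : (u, v) ∈ T ↔ u = P.xMin - 2 ∧ v = P.yMin - 2 ∨ u = P.xMin - 1 ∧ v = P.yMin - 1 ∨
      u = P.xMax + 2 ∧ v = P.yMin - 2 ∨ u = P.xMax + 3 ∧ v = P.yMin - 1 ∨
      u = P.xMax + 2 ∧ v = P.yMax + 2 ∨ u = P.xMax + 3 ∧ v = P.yMax + 3 ∨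
      u = P.xMin - 2 ∧ v = P.yMax + 2 ∨ u = P.xMin - 1 ∧ v = P.yMax + 3 ∨ (u, v) ∈ P.tiles := by
  rw [h]
  have e : (∃ d, MarkPix (P.rect.corner d) u v) ↔ MarkPix (P.rect.corner .right) u v ∨
      MarkPix (P.rect.corner .up) u v ∨ MarkPix (P.rect.corner .left) u v ∨
      MarkPix (P.rect.corner .down) u v := by
    constructor
    · rintro ⟨d, hd⟩; cases d <;> simp [hd]
    · rintro (h | h | h | h) <;> exact ⟨_, h⟩
  have e' : ((u, v) ∈ P.tiles ∧ ∀ d, ¬ BlockPix (P.rect.corner d) u v) ↔ (u, v) ∈ P.tiles := by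
    refine and_iff_left_of_imp fun h d hd => ?_
    have := P.le_of_mem h
    cases d <;> simp only [Polyomino.rect, Rect.corner, BlockPix] at hd <;> omega
  rw [e, e']
  simp only [MarkPix, Polyomino.rect, Rect.corner, show P.xMin - 2 + 1 = P.xMin - 1 by ring,
    show P.yMin - 2 + 1 = P.yMin - 1 by ring, show P.xMax + 2 + 1 = P.xMax + 3 by ring,
    show P.yMax + 2 + 1 = P.yMax + 3 by ring, or_assoc]

theorem setMarks_spec {P : Polyomino} {T : Finset Pixel} {x₀ x₁ y₀ y₁ : ℤ} {K : ℕ}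
    {Post : Unit → World Pixel (Finset Pixel) → ℕ → Set Pixel → Prop}
    (hT : Overlay P.tiles P.rect.corner T) (hx : x₀ ≤ P.xMin - 2 ∧ P.xMax + 3 ≤ x₁)
    (hy : y₀ ≤ P.yMin - 2 ∧ P.yMax + 3 ≤ y₁) (hK : P.tiles.card + 8 ≤ K)
    (h : ∀ t U T', t ≤ 3 * P.width + 2 * P.height + 60 → T'.card = P.tiles.card + 5 →
      (∀ u v, v < P.yMax + 2 → ((u, v) ∈ T' ↔
        Unread P.tiles P.xMin P.xMax P.yMin (P.xMax + 1) P.yMax u v)) →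
      (∀ u v, P.yMax + 2 ≤ v → ((u, v) ∈ T' ↔ u = P.xMax + 2 ∧ v = P.yMax + 2)) →
      Post () ⟨(P.xMax + 2, P.yMax + 2), T'⟩ t U) :
    Spec (Box x₀ x₁ y₀ y₁ K) setMarks ⟨P.rect.corner .right, T⟩ Post := by
  have hP := fun u v => P.le_of_mem (u := u) (v := v)
  have hw := P.width_eq
  have hh := P.height_eq
  have hw0 := P.width_pos
  have hh0 := P.height_pos
  have c0 := hT.card_le
  replace hT := hT.mem_iff
  show Spec _ _ ⟨(P.xMin - 2, P.yMin - 2), T⟩ _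
  generalize P.xMin = a at *
  generalize P.xMax = b at *
  generalize P.yMin = c at *
  generalize P.yMax = e at *
  refine .bind (.eraseUp (y' := c - 1) (by grind) (by ring) fun T1 h1 c1 => ⟨.mk (by omega), ?_⟩)
  refine .bind (.moveRight (x' := a - 1) (by ring) (.mk (by omega)) ?_)
  refine .bind (.eraseDown (y' := c - 2) (by grind) (by ring) fun T2 h2 c2 => ⟨.mk (by omega), ?_⟩)
  refine .bind (.seekRight (b + 2) (by omega) (by grind) (by grind)
    (fun u hu hu' => .mk (by omega)) ?_)
  refine .bind (.moveRight (x' := b + 3) (by ring) (.mk (by omega)) ?_)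
  refine .bind (.moveUp (y' := c - 1) (by ring) (.mk (by omega)) ?_)
  refine .bind (.eraseLeft (x' := b + 2) (by grind) (by ring) fun T3 h3 c3 => ⟨.mk (by omega), ?_⟩)
  have k3 : ∀ u v, (u, v) ∈ T3 ↔ u = b + 3 ∧ v = e + 3 ∨ u = a - 2 ∧ v = e + 2 ∨
      u = a - 1 ∧ v = e + 3 ∨ u = b + 2 ∧ v = c - 2 ∨ u = b + 2 ∧ v = e + 2 ∨
      (u, v) ∈ P.tiles := by
    intro u v
    rw [h3, h2, h1, hT]
    have := hP u v
    by_cases hq : (u, v) ∈ P.tiles <;> simp only [hq, true_imp_iff, or_true, or_false,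
      and_true, iff_true] at this ⊢ <;> omega
  clear h1 h2 h3 hT
  refine .bind (.seekUp (e + 2) (by omega) (by grind) (by grind)
    (fun u hu hu' => .mk (by omega)) ?_)
  refine .bind (.moveRight (x' := b + 3) (by ring) (.mk (by omega)) ?_)
  refine .bind (.moveUp (y' := e + 3) (by ring) (.mk (by omega)) ?_)
  refine .bind (.eraseLeft (x' := b + 2) (by grind) (by ring) fun T4 h4 c4 => ⟨.mk (by omega), ?_⟩)
  refine .bind (.moveDown (y' := e + 2) (by ring) (.mk (by omega)) ?_)
  refine .bind (.seekLeft (a - 2) (by omega) (by grind) (by grind)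
    (fun u hu hu' => .mk (by omega)) ?_)
  refine .bind (.eraseRight (x' := a - 1) (by grind) (by ring) fun T5 h5 c5 => ⟨.mk (by omega), ?_⟩)
  refine .bind (.moveUp (y' := e + 3) (by ring) (.mk (by omega)) ?_)
  refine .bind (.eraseRight (x' := a) (by grind) (by ring) fun T6 h6 c6 => ⟨.mk (by omega), ?_⟩)
  refine .bind (.moveDown (y' := e + 2) (by ring) (.mk (by omega)) ?_)
  refine .bind (.moveDown (y' := e + 1) (by ring) (.mk (by omega)) ?_)
  -- Two tiles of the corner marks are kept: `(b + 2, c - 2)` as the bottom mark and `(b + 2, e +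
  -- 2)` as the home tile.
  have k6 : ∀ u v, (u, v) ∈ T6 ↔ u = b + 2 ∧ v = c - 2 ∨ u = b + 2 ∧ v = e + 2 ∨
      (u, v) ∈ P.tiles := by
    intro u v
    rw [h6, h5, h4, k3]
    have := hP u v
    by_cases hq : (u, v) ∈ P.tiles <;> simp only [hq, true_imp_iff, or_true, or_false,
      and_true, iff_true] at this ⊢ <;> omega
  clear h4 h5 h6 k3
  refine .bind (.putUp (y' := e + 2) (by grind) (by ring) fun T7 h7 c7 => ⟨.mk (by omega), ?_⟩)
  refine .bind (.seekRight (b + 2) (by omega) (by grind) (by grind)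
    (fun u hu hu' => .mk (by omega)) ?_)
  refine .bind (.moveDown (y' := e + 1) (by ring) (.mk (by omega)) ?_)
  refine .bind (.moveDown (y' := e) (by ring) (.mk (by omega)) ?_)
  refine .bind (.putLeft (x' := b + 1) (by grind) (by ring) fun T8 h8 c8 => ⟨.mk (by omega), ?_⟩)
  refine .bind (.putUp (y' := e + 1) (by grind) (by ring) fun T9 h9 c9 => ⟨.mk (by omega), ?_⟩)
  refine .bind (.moveRight (x' := b + 2) (by ring) (.mk (by omega)) ?_)
  refine .moveUp (y' := e + 2) (by ring) (.mk (by omega)) ?_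
  have c10 : T6.card = P.tiles.card + 2 := by
    have : T6 = insert (b + 2, c - 2) (insert (b + 2, e + 2) P.tiles) := by
      ext ⟨u, v⟩; simp [k6]
    rw [this, Finset.card_insert_of_notMem (by simp; grind),
      Finset.card_insert_of_notMem (by grind)]
  refine h _ _ T9 ?_ (by omega) ?_ ?_
  · clear * - hw hh hw0 hh0
    rw [show (b + 2 - (a - 1)).toNat = P.width + 2 by omega]
    rw [show (b + 2 - (a - 2)).toNat = P.width + 3 by omega]
    rw [show (b + 2 - a).toNat = P.width + 1 by omega]
    rw [show (e + 2 - (c - 1)).toNat = P.height + 2 by omega]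
    ring_nf
    omega
  · unfold Unread; grind
  · grind

theorem triangleStart_spec {n : ℕ} {T : Finset Pixel} {X Y x₀ x₁ y₀ y₁ : ℤ} {K : ℕ}
    {Post : Unit → World Pixel (Finset Pixel) → ℕ → Set Pixel → Prop}
    (hT : ∀ u v, Y + n + 5 ≤ v → (u, v) ∉ T)
    (hx : x₀ ≤ X ∧ X + 1 ≤ x₁) (hy : y₀ ≤ Y ∧ Y + n + 5 ≤ y₁) (hK : T.card + 2 ≤ K)
    (h : ∀ U T', T'.card = T.card + 2 → (∀ u v, v < Y + n + 5 → ((u, v) ∈ T' ↔ (u, v) ∈ T)) →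
      (∀ u v, Y + n + 5 ≤ v → ((u, v) ∈ T' ↔ u = X ∧ v = Y + n + 5 + (0 : ℕ) ∨
        u = X + 1 + (0 : ℕ) ∧ v = Y + n + 5 + (0 : ℕ))) →
      Post () ⟨(X, Y), T'⟩ (2 * n + 12) U) :
    Spec (Box x₀ x₁ y₀ y₁ K) (triangleStart n) ⟨(X, Y), T⟩ Post := by
  refine .bind (walk_up_spec (n + 5) (by omega) (by omega) (by omega) fun U => ?_)
  refine .bind (.putRight (by grind) rfl fun T1 h1 c1 => ⟨.mk (by omega), ?_⟩)
  refine .bind (.putLeft (x' := X) (by grind) (by ring) fun T2 h2 c2 => ⟨.mk (by omega), ?_⟩)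
  refine walk_down_spec (n + 5) (by omega) (by omega) (by omega) fun U' => ?_
  rw [show Y + ((n + 5 : ℕ) : ℤ) - ((n + 5 : ℕ) : ℤ) = Y by ring]
  rw [show n + 5 + (1 + (1 + (n + 5))) = 2 * n + 12 by ring]
  exact h _ T2 (by omega) (by grind) (by push_cast at *; grind)


/-- Two predicates below and above a row. -/
def Layers (Y : ℤ) (low high : ℤ → ℤ → Prop) (u v : ℤ) : Prop := if v < Y then low u v else high u v

section
variable {S : Type} {code : S → ℕ} {m : ℕ} {Y : ℤ} {T T' : Finset Pixel} {f : ℤ → Option S}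
  {low low' high high' : ℤ → ℤ → Prop}

theorem Layers.below {u v : ℤ} (hv : v < Y) : Layers Y low high u v ↔ low u v := by
  rw [Layers, if_pos hv]

theorem Layers.above {u v : ℤ} (hv : Y ≤ v) : Layers Y low high u v ↔ high u v := by
  rw [Layers, if_neg (by omega)]

theorem Rep.mem_low (h : Rep code m Y T f (Layers Y low high)) (u v : ℤ) (hv : v < Y) :
    (u, v) ∈ T ↔ low u v := by
  rw [h, if_neg (by omega), Layers.below hv]

theorem Rep.mem_high (h : Rep code m Y T f (Layers Y low high)) (u v : ℤ) (hv : Y + m ≤ v) :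
    (u, v) ∈ T ↔ high u v := by
  rw [h, if_neg (by omega), Layers.above (by omega)]

theorem Rep.congr_low (h : Rep code m Y T f (Layers Y low high))
    (h1 : ∀ u v, Y ≤ v → ((u, v) ∈ T' ↔ (u, v) ∈ T))
    (h2 : ∀ u v, v < Y → ((u, v) ∈ T' ↔ low' u v)) :
    Rep code m Y T' f (Layers Y low' high) := by
  intro u v
  by_cases hv : v < Y
  · rw [h2 u v hv, if_neg (by omega), Layers.below hv]
  · rw [h1 u v (by omega), h, Layers.above (by omega), Layers.above (by omega)]

theorem Rep.congr_high (h : Rep code m Y T f (Layers Y low high))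
    (h1 : ∀ u v, v < Y + m → ((u, v) ∈ T' ↔ (u, v) ∈ T))
    (h2 : ∀ u v, Y + m ≤ v → ((u, v) ∈ T' ↔ high' u v)) :
    Rep code m Y T' f (Layers Y low high') := by
  intro u v
  by_cases hv : v < Y + m
  · rw [h1 u v hv, h]
    by_cases hv' : v < Y
    · rw [Layers.below hv', Layers.below hv']
    · rw [if_pos (by omega), if_pos (by omega)]
  · rw [h2 u v (by omega), if_neg (by omega), Layers.above (by omega)]

end

theorem Rep.home {n : ℕ} {X Y : ℤ} {T : Finset Pixel} {D R : List (Option (Sym n))}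
    {G : ℤ → ℤ → Prop} (h : Rep Sym.code (n + 5) Y T (tw X D (some .home :: R)).mem G) :
    (X, Y) ∈ T := by
  rw [h, if_pos (by omega)]
  refine ⟨.home, ?_, by simp [Sym.code]⟩
  have := tw_mem_add X D (some .home :: R) 0
  simpa using this

/-- The robot crosses the strip in the home column, and no other tile there may stop its vertical
searches. -/
theorem Rep.above_home {n : ℕ} {X Y : ℤ} {T : Finset Pixel} {D R : List (Option (Sym n))}
    {G : ℤ → ℤ → Prop} (h : Rep Sym.code (n + 5) Y T (tw X D (some .home :: R)).mem G)
    (v : ℤ) (h1 : Y < v) (h2 : v < Y + n + 5) : (X, v) ∉ T := by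
  rw [h, if_pos (by omega)]
  have := tw_mem_add X D (some .home :: R) 0
  rintro ⟨s, hs, hv⟩
  rw [show X + ((0 : ℕ) : ℤ) = X by simp] at this
  rw [this] at hs
  obtain rfl : .home = s := by simpa using hs
  simp [Sym.code] at hv
  omega

/-- A tape machine running on the strip. -/
noncomputable def onStrip {n : ℕ} {α : Type} (p : SMach n α) : GMach α := compile Sym.code (n + 5) p

/-- A tape machine that starts and ends at the home pixel. -/
theorem onStrip_spec {n : ℕ} {α : Type} {p : SMach n α} {X X' Y l r : ℤ} {Kt K τ : ℕ}
    {I : World Pixel (Finset Pixel) → Prop} {a : α}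
    {D D' R R' : List (Option (Sym n))} {T : Finset Pixel} {G : ℤ → ℤ → Prop}
    {Post : α → World Pixel (Finset Pixel) → ℕ → Set Pixel → Prop}
    (hp : Spec (TBox l r Kt) p (tw X D R) fun b w t _ => b = a ∧ w = tw X' D' R' ∧ t ≤ τ)
    (hT : Rep Sym.code (n + 5) Y T (tw X D R).mem G) (hX : l ≤ X ∧ X ≤ r)
    (hKt : cnt D + cnt R ≤ Kt) (hK : Kt + T.card + (n + 5) ≤ K + (cnt D + cnt R))
    (hS : ∀ w, Box l r (Y - 1) (Y + (n + 5 : ℕ)) K w → I w)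
    (h : ∀ t U T', t ≤ (2 * (n + 5) + 3) * (τ + 1) →
      Rep Sym.code (n + 5) Y T' (tw X' D' R').mem G →
      T'.card + (cnt D + cnt R) = T.card + (cnt D' + cnt R') → Post a ⟨(X', Y), T'⟩ t U) :
    Spec I (onStrip p) ⟨(X, Y), T⟩ Post := by
  have e := (tw_finite_wt X D R).2
  have e' := (tw_finite_wt X' D' R').2
  refine Spec.mono_inv (I := Box l r (Y - 1) (Y + (n + 5 : ℕ)) K) (.mk (by push_cast; omega)) hS ?_
  refine (compile_spec Sym.code_lt Sym.code_injective (by omega) p (c := X)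
    (f := (tw X D R).mem) hp hT ⟨hX.1, hX.2, by simpa only [e] using hKt⟩ (by rw [e]; exact hK)).mono ?_
  rintro b ⟨q, T'⟩ t U - ⟨w', t', U', ⟨rfl, rfl, ht⟩, -, rfl, h1, h2, h3⟩
  rw [e, e'] at h2
  exact h _ _ _ (h3.trans (Nat.mul_le_mul_left _ (by omega))) h1 h2

/-- Run a machine under a condition. -/
def whenever (b : Bool) (p : GMach Unit) : GMach Unit :=
  match b with
  | true => p
  | false => pure ()

/-- Read a pixel, append it to the tape, and extend the triangle if it is a tile. -/
noncomputable def readBit (n : ℕ) : GMach (Option Bool) := do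
  let r ← readNext
  onStrip (appendBit (n := n) r.1)
  whenever r.1 (triangleStep n)
  pure r.2

/-- The marks of the triangle with `j` rows. -/
def Apex (X V : ℤ) (j : ℕ) (u v : ℤ) : Prop := u = X ∧ v = V + j ∨ u = X + 1 + j ∧ v = V + j

/-- The state of the tiles while a polyomino is read. -/
def Reading (n : ℕ) (X Y : ℤ) (T : Finset Pixel) (D : List (Option (Sym n))) (bs : List Bool)
    (low : ℤ → ℤ → Prop) : Prop :=
  Rep Sym.code (n + 5) Y T (tw X D (some .home :: (bs.map bit ++ [some .rend]))).mem
    (Layers Y low (Apex X (Y + n + 5) (cnt (bs.map bit : List (Option (Sym n))))))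

/-- A zero is a blank cell, so only ones need tiles. -/
theorem cnt_map_bit_append (n : ℕ) (bs : List Bool) (b : Bool) :
    cnt ((bs ++ [b]).map bit : List (Option (Sym n))) =
      cnt (bs.map bit : List (Option (Sym n))) + b.toNat := by
  cases b <;> simp [bit]

section
variable {n : ℕ} {P : Polyomino} {T : Finset Pixel} {x₀ x₁ y₀ y₁ l r p y : ℤ} {K : ℕ}
  {I : World Pixel (Finset Pixel) → Prop} {D : List (Option (Sym n))} {bs : List Bool}

/-- The part of `readBit` after reading. -/
theorem storeBit_spec {X Y : ℤ} {bit : Bool} {e : Option Bool} {low : ℤ → ℤ → Prop}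
    {Post : Option Bool → World Pixel (Finset Pixel) → ℕ → Set Pixel → Prop}
    (hT : Reading n X Y T D bs low)
    (hx : x₀ ≤ X ∧ X + cnt (bs.map TileRobot.bit : List (Option (Sym n))) + 2 ≤ x₁)
    (hy : y₀ ≤ Y ∧ Y + n + cnt (bs.map TileRobot.bit : List (Option (Sym n))) + 6 ≤ y₁)
    (hl : l ≤ X) (hr : X + bs.length + 2 ≤ r) (hK : T.card + n + 15 ≤ K)
    (hR : ∀ w, Box x₀ x₁ y₀ y₁ K w → I w)
    (hS : ∀ w, Box l r (Y - 1) (Y + (n + 5 : ℕ)) K w → I w)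
    (h : ∀ t U T', t ≤ (2 * (n + 5) + 3) * (2 * bs.length + 5) + (2 * n + 4 * bs.length + 18) →
      T'.card = T.card + bit.toNat → Reading n X Y T' D (bs ++ [bit]) low →
      (bit = true → ∀ u, X ≤ u → u ≤ X + cnt (bs.map TileRobot.bit : List (Option (Sym n))) →
        (u, Y + n + 5 + cnt (bs.map TileRobot.bit : List (Option (Sym n)))) ∈ U) →
      Post e ⟨(X, Y), T'⟩ t U) :
    Spec I (do
      onStrip (appendBit (n := n) bit)
      whenever bit (triangleStep n)
      pure e : GMach (Option Bool)) ⟨(X, Y), T⟩ Post := by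
  have hb := cnt_map_bit_le (n := n) bs
  have hb' := cnt_map_bit_append n bs bit
  refine .bind (onStrip_spec (l := l) (r := r) (Kt := cnt D +
      cnt (bs.map TileRobot.bit : List (Option (Sym n))) + 5) (K := K) (a := ())
    (appendBit_spec bit bs hl hr (by omega) fun U => ⟨rfl, rfl, le_rfl⟩) hT (by omega)
    (by simp; omega) (by simp; omega) hS fun t1 U1 T1 ht1 h1 c1 => ?_)
  have c2 : T1.card = T.card + bit.toNat := by
    simp only [cnt_append, cnt_some, cnt_nil, hb'] at c1; omega
  have hb1 := Bool.toNat_le bit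
  cases bit with
  | false =>
    refine .bind (.pure (.pure (h _ _ _ ?_ c2 ?_ (by simp))))
    · have : (2 * (n + 5) + 3) * (2 * bs.length + 4 + 1) = (2 * (n + 5) + 3) * (2 * bs.length + 5) := by
        ring
      rw [this] at ht1
      generalize (2 * (n + 5) + 3) * (2 * bs.length + 5) = z at *
      omega
    · unfold Reading
      rw [hb']; simpa using h1
  | true =>
    refine .bind (Spec.mono_inv (I := Box x₀ x₁ y₀ y₁ K) (.mk (by omega)) hR
      (triangleStep_spec (j := cnt (bs.map TileRobot.bit : List (Option (Sym n))))
        (fun u v hv => ?_) h1.home (fun v h2 h3 => h1.above_home v h2 h3)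
        (by omega) (by omega) (by omega) fun t U T2 ht c3 h2 h3 h4 => .pure (h _ _ _ ?_ ?_ ?_ ?_)))
    · rw [h1.mem_high u v (by push_cast; omega)]; rfl
    · have : (2 * (n + 5) + 3) * (2 * bs.length + 4 + 1) = (2 * (n + 5) + 3) * (2 * bs.length + 5) := by
        ring
      rw [this] at ht1
      generalize (2 * (n + 5) + 3) * (2 * bs.length + 5) = z at *
      omega
    · omega
    · unfold Reading
      rw [hb']
      refine h1.congr_high (fun u v hv => h2 u v (by push_cast at hv; omega)) fun u v hv =>
        h3 u v (by push_cast at hv; omega)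
    · intro _ u hu hu'
      exact .inr (.inl (h4 u hu hu'))

end

/-! ### Access to the bitmap by rows and columns. -/

namespace Polyomino
variable (P : Polyomino)

theorem getElem?_flatMap_range {α : Type} (g : ℕ → ℕ → α) {w h i j : ℕ} (hi : i < w) (hj : j < h) :
    ((List.range h).flatMap fun j => (List.range w).map (g j))[j * w + i]? = some (g j i) := by
  induction h with
  | zero => omega
  | succ h ih =>
    have hl : ((List.range h).flatMap fun j => (List.range w).map (g j)).length = h * w := by
      simp [List.length_flatMap]
    rw [List.range_succ, List.flatMap_append]
    by_cases hjh : j < h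
    · rw [List.getElem?_append_left, ih hjh]
      rw [hl]
      calc j * w + i < j * w + w := by omega
        _ = (j + 1) * w := by ring
        _ ≤ h * w := Nat.mul_le_mul_right _ hjh
    · obtain rfl : j = h := by omega
      rw [List.getElem?_append_right (by omega), hl]
      simp [hi]

theorem bitmap_eq : P.bitmap = (List.range P.height).flatMap fun j : ℕ => (List.range P.width).map
    fun i : ℕ => decide ((P.xMax - (i : ℤ), P.yMax - (j : ℤ)) ∈ P.tiles) := by
  simp [bitmap, List.flatMap_map, Function.comp_def, ← List.map_eq_flatMap]

theorem take_bitmap {i j : ℕ} (hi : i < P.width) (hj : j < P.height) :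
    P.bitmap.take (j * P.width + i) ++
      [decide ((P.xMax - (i : ℤ), P.yMax - (j : ℤ)) ∈ P.tiles)] =
        P.bitmap.take (j * P.width + i + 1) := by
  rw [List.take_add_one, bitmap_eq, getElem?_flatMap_range (fun j i : ℕ =>
    decide ((P.xMax - (i : ℤ), P.yMax - (j : ℤ)) ∈ P.tiles)) hi hj]
  rfl

end Polyomino

/-! ### Counting the width and the height. -/

/-- The left part of the tape after `j` rows of length `w` and `i` pixels of the next row. -/
def counters (n w i j : ℕ) : List (Option (Sym n)) :=
  if j = 0 then i.bits.map bit ++ [some .lend]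
  else w.bits.map bit ++ some .sep :: (j.bits.map bit ++ [some .lend])

theorem counters_zero (n w i : ℕ) : counters n w i 0 = i.bits.map bit ++ [some .lend] := rfl

theorem counters_pos (n w i : ℕ) {j : ℕ} (hj : 0 < j) :
    counters n w i j = w.bits.map bit ++ some .sep :: (j.bits.map bit ++ [some .lend]) :=
  if_neg hj.ne'

/-- Estimating the number of digits by the number itself is enough, since width and height are
bounded by the boundary. -/
theorem cnt_counters_le {n w i j : ℕ} (hi : i ≤ w) : cnt (counters n w i j) ≤ w + j + 2 := by
  have h1 := length_bits_le w
  have h2 := length_bits_le j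
  have h3 := length_bits_le i
  refine (cnt_le_length _).trans ?_
  unfold counters
  split_ifs <;> simp <;> omega

/-- Count pixels in the first row, and rows. -/
noncomputable def count (n : ℕ) (first : Bool) (e : Option Bool) : GMach Unit := do
  whenever first (onStrip (incFirst (n := n)))
  whenever (first && e.isSome) (onStrip (closeLeft (n := n)))
  whenever e.isSome (onStrip (incSecond (n := n)))

theorem whenever_true (p : GMach Unit) : whenever true p = p := rfl

theorem whenever_false (p : GMach Unit) : whenever false p = pure () := rfl

section
variable {n w i j z : ℕ} {T : Finset Pixel} {l r X Y : ℤ} {K : ℕ}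
  {I : World Pixel (Finset Pixel) → Prop} {R : List (Option (Sym n))} {G : ℤ → ℤ → Prop}
  {Post : Unit → World Pixel (Finset Pixel) → ℕ → Set Pixel → Prop}

/-- The tile count varies with the digits. Therefore `hK` discounts the present digits: the other
tiles stay the same while counting. -/
theorem count_first_spec (hi : i < w)
    (hT : Rep Sym.code (n + 5) Y T (tw X (counters n w i 0) (some .home :: R)).mem G)
    (hl : l + w + 6 ≤ X) (hr : X ≤ r) (hK : T.card + w + n + 30 ≤ K + cnt (counters n w i 0))
    (hS : ∀ w, Box l r (Y - 1) (Y + (n + 5 : ℕ)) K w → I w)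
    (hz : (2 * (n + 5) + 3) * (2 * w + 8) ≤ z)
    (h : ∀ t U T', t ≤ z →
      Rep Sym.code (n + 5) Y T' (tw X (counters n w (i + 1) 0) (some .home :: R)).mem G →
      T'.card + cnt (counters n w i 0) = T.card + cnt (counters n w (i + 1) 0) →
      Post () ⟨(X, Y), T'⟩ t U) :
    Spec I (onStrip (incFirst (n := n))) ⟨(X, Y), T⟩ Post := by
  have h1 := length_bits_le i
  have h2 := cnt_counters_le (n := n) (j := 0) hi.le
  simp only [counters_zero] at *
  refine onStrip_spec (l := l) (r := r) (K := K) (X' := X) (a := ())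
    (Kt := cnt (i.bits.map bit ++ [some (.lend : Sym n)]) + cnt (some .home :: R) + 5)
    (τ := 2 * w + 5) (D' := counters n w (i + 1) 0) (R' := some .home :: R)
    (incFirst_spec i.bits (by omega) hr ?_ fun t U ht => ?_) hT
    (by omega) (by omega) (by omega) hS
    fun t U T' ht hT' c => ?_
  · simp; omega
  · rw [incBits_bits]
    exact ⟨rfl, rfl, by omega⟩
  · refine h t U T' (ht.trans ((Nat.mul_le_mul_left _ (by omega)).trans hz)) hT' ?_
    simp only [counters_zero, cnt_some] at c; omega

theorem count_close_spec (hw : 0 < w)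
    (hT : Rep Sym.code (n + 5) Y T (tw X (counters n w w 0) (some .home :: R)).mem G)
    (hl : l + w + 6 ≤ X) (hr : X ≤ r) (hK : T.card + w + n + 30 ≤ K + cnt (counters n w w 0))
    (hS : ∀ w, Box l r (Y - 1) (Y + (n + 5 : ℕ)) K w → I w)
    (hz : (2 * (n + 5) + 3) * (2 * w + 8) ≤ z)
    (h : ∀ t U T', t ≤ z →
      Rep Sym.code (n + 5) Y T' (tw X (w.bits.map bit ++ some .sep :: [some .lend])
        (some .home :: R)).mem G → T'.card = T.card + 1 → Post () ⟨(X, Y), T'⟩ t U) :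
    Spec I (onStrip (closeLeft (n := n))) ⟨(X, Y), T⟩ Post := by
  have h1 := length_bits_le w
  have h2 := cnt_counters_le (n := n) (w := w) (j := 0) le_rfl
  simp only [counters_zero] at *
  refine onStrip_spec (l := l) (r := r) (K := K) (X' := X) (a := ())
    (Kt := cnt (w.bits.map bit ++ [some (.lend : Sym n)]) + cnt (some .home :: R) + 5)
    (τ := 2 * w + 4) (D' := w.bits.map bit ++ some .sep :: [some .lend]) (R' := some .home :: R)
    (closeLeft_spec w.bits (by omega) hr ?_ fun U => ⟨rfl, rfl, by omega⟩) hT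
    (by omega) (by omega) (by omega) hS
    fun t U T' ht hT' c => ?_
  · simp; omega
  · refine h t U T' (ht.trans ((Nat.mul_le_mul_left _ (by omega)).trans hz)) hT' ?_
    simp only [cnt_append, cnt_some, cnt_nil] at c; omega

theorem count_row_spec
    (hT : Rep Sym.code (n + 5) Y T (tw X (w.bits.map bit ++ some .sep ::
      (j.bits.map bit ++ [some .lend])) (some .home :: R)).mem G)
    (hl : l + w + j + 8 ≤ X) (hr : X ≤ r) (hK : T.card + n + 10 ≤ K)
    (hS : ∀ w, Box l r (Y - 1) (Y + (n + 5 : ℕ)) K w → I w)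
    (hz : (2 * (n + 5) + 3) * (2 * w + 2 * j + 8) ≤ z)
    (h : ∀ t U T', t ≤ z →
      Rep Sym.code (n + 5) Y T' (tw X (counters n w 0 (j + 1)) (some .home :: R)).mem G →
      T'.card + cnt (w.bits.map bit ++ some (.sep : Sym n) :: (j.bits.map bit ++ [some .lend])) =
        T.card + cnt (counters n w 0 (j + 1)) →
      Post () ⟨(X, Y), T'⟩ t U) :
    Spec I (onStrip (incSecond (n := n))) ⟨(X, Y), T⟩ Post := by
  have h1 := length_bits_le w
  have h2 := length_bits_le j
  refine onStrip_spec (l := l) (r := r) (K := K) (X' := X) (a := ())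
    (Kt := cnt (w.bits.map bit ++ some (.sep : Sym n) :: (j.bits.map bit ++ [some .lend])) +
      cnt (some .home :: R) + 5)
    (τ := 2 * w + 2 * j + 7) (D' := counters n w 0 (j + 1)) (R' := some .home :: R)
    (incSecond_spec w.bits j.bits (by omega) hr ?_ fun t U ht => ?_) hT
    (by omega) (by omega) (by omega) hS
    fun t U T' ht hT' c => ?_
  · simp; omega
  · rw [incBits_bits, counters_pos _ _ _ j.succ_pos]
    exact ⟨rfl, rfl, by omega⟩
  · refine h t U T' (ht.trans ((Nat.mul_le_mul_left _ (by omega)).trans hz)) hT' ?_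
    simp only [cnt_some] at c; omega

theorem count_inner_spec (hi : i + 1 < w)
    (hT : Rep Sym.code (n + 5) Y T (tw X (counters n w i j) (some .home :: R)).mem G)
    (hl : l + w + j + 8 ≤ X) (hr : X ≤ r) (hK : T.card + w + j + n + 40 ≤ K + cnt (counters n w i j))
    (hS : ∀ w, Box l r (Y - 1) (Y + (n + 5 : ℕ)) K w → I w)
    (hz : (2 * (n + 5) + 3) * (2 * w + 2 * j + 8) ≤ z)
    (h : ∀ t U T', t ≤ 3 * z →
      Rep Sym.code (n + 5) Y T' (tw X (counters n w (i + 1) j) (some .home :: R)).mem G →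
      T'.card + cnt (counters n w i j) = T.card + cnt (counters n w (i + 1) j) →
      Post () ⟨(X, Y), T'⟩ t U) :
    Spec I (count n (decide (j = 0)) none) ⟨(X, Y), T⟩ Post := by
  unfold count
  simp only [Option.isSome_none, Bool.and_false, whenever_false]
  rcases Nat.eq_zero_or_pos j with rfl | hj
  · simp only [decide_true, whenever_true]
    refine .bind (count_first_spec (by omega) hT (by omega) hr (by omega) hS hz
      fun t U T' ht hT' c => .bind (.pure (.pure (h _ _ _ ?_ hT' c))))
    clear * - ht; omega
  · rw [decide_eq_false hj.ne', whenever_false]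
    refine .bind (.pure (.bind (.pure (.pure (h _ _ _ (by omega) ?_ ?_)))))
    · rw [counters_pos _ _ _ hj] at hT ⊢; exact hT
    · rw [counters_pos _ _ _ hj, counters_pos _ _ _ hj]

/-- At the end of the first row three machines run: the pixel counter gets its last increment and is
thereby the width, a separator closes it, and a row counter is opened. Later only the row counter
advances. -/
theorem count_end_spec (hi : i + 1 = w) (b : Bool)
    (hT : Rep Sym.code (n + 5) Y T (tw X (counters n w i j) (some .home :: R)).mem G)
    (hl : l + w + j + 8 ≤ X) (hr : X ≤ r) (hK : T.card + w + j + n + 40 ≤ K + cnt (counters n w i j))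
    (hS : ∀ w, Box l r (Y - 1) (Y + (n + 5 : ℕ)) K w → I w)
    (hz : (2 * (n + 5) + 3) * (2 * w + 2 * j + 8) ≤ z)
    (h : ∀ t U T', t ≤ 3 * z →
      Rep Sym.code (n + 5) Y T' (tw X (counters n w 0 (j + 1)) (some .home :: R)).mem G →
      T'.card + cnt (counters n w i j) = T.card + cnt (counters n w 0 (j + 1)) →
      Post () ⟨(X, Y), T'⟩ t U) :
    Spec I (count n (decide (j = 0)) (some b)) ⟨(X, Y), T⟩ Post := by
  have hc := cnt_counters_le (n := n) (w := w) (i := i) (j := j) (by omega)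
  unfold count
  simp only [Option.isSome_some, Bool.and_true, whenever_true]
  rcases Nat.eq_zero_or_pos j with rfl | hj
  · have hc' := cnt_counters_le (n := n) (w := w) (j := 0) le_rfl
    simp only [decide_true, whenever_true]
    refine .bind (count_first_spec (by omega) hT (by omega) hr (by omega) hS hz
      fun t1 U1 T1 ht1 hT1 c1 => ?_)
    rw [hi] at hT1 c1
    refine .bind (count_close_spec (by omega) hT1 (by omega) hr (by omega) hS hz
      fun t2 U2 T2 ht2 hT2 c2 => ?_)
    refine count_row_spec (j := 0) (l := l) (r := r) (K := K) (w := w)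
      (by simpa using hT2) (by omega) hr (by omega) hS hz fun t3 U3 T3 ht3 hT3 c3 => h _ _ _ ?_ hT3 ?_
    · clear * - ht1 ht2 ht3; omega
    · have : cnt (counters n w w 0) + 1 =
          cnt (w.bits.map bit ++ some (.sep : Sym n) :: ((0 : ℕ).bits.map bit ++ [some .lend])) := by
        simp [counters_zero]
      omega
  · rw [decide_eq_false hj.ne', whenever_false]
    have e := counters_pos n w i hj
    rw [e] at hT
    refine .bind (.pure (.bind (.pure (count_row_spec hT (by omega) hr (by omega) hS hz
      fun t U T' ht hT' c => h _ _ _ ?_ hT' ?_))))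
    · clear * - ht; omega
    · rw [e]; exact c

end

/-- Start the next round of a loop at the home pixel. -/
def again (b : Bool) : GMach ((Bool × Bool × Direction) ⊕ Unit) := do
  mv .up
  let s ← look
  pure (.inl (b, s, .down))

theorem again_spec {I : World Pixel (Finset Pixel) → Prop} {X Y : ℤ} {T : Finset Pixel} {b : Bool}
    {Post : (Bool × Bool × Direction) ⊕ Unit → World Pixel (Finset Pixel) → ℕ → Set Pixel → Prop}
    (hI : I ⟨(X, Y + 1), T⟩)
    (h : ∀ U, Post (.inl (b, decide ((X, Y + 1) ∈ T), .down)) ⟨(X, Y + 1), T⟩ 1 U) :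
    Spec I (again b) ⟨(X, Y), T⟩ Post :=
  .bind (.moveUp rfl hI (.bind (.lookDecide (.pure (h _)))))

theorem act_decide_down (X Y : ℤ) (T : Finset Pixel) :
    (⟨(X, Y + 1), T⟩ : World Pixel (Finset Pixel)).act (decide ((X, Y + 1) ∈ T)) Direction.down =
      ⟨(X, Y), T⟩ := by
  refine (World.act_cur (⟨(X, Y + 1), T⟩ : World Pixel (Finset Pixel)) Direction.down).trans ?_
  simp [Arena.go, Direction.move]

/-- Read all pixels. -/
noncomputable def readLoop (n : ℕ) (first : Bool) : GMach Unit :=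
  iter (fun first : Bool => do
    let e ← readBit n
    count n first e
    match e with
    | some true => pure (.inr ())
    | some false => again false
    | none => again first) first

section
variable {n : ℕ} {P : Polyomino} {x₀ x₁ y₀ y₁ l r : ℤ} {K z : ℕ}
  {I : World Pixel (Finset Pixel) → Prop}

/-- The state before reading pixel `i` of row `j`. -/
structure ReadState (n : ℕ) (P : Polyomino) (i j : ℕ) (T : Finset Pixel) : Prop where
  rep : Reading n (P.xMax + 2) (P.yMax + 2) T (counters n P.width i j)
    (P.bitmap.take (j * P.width + i))
    (Unread P.tiles P.xMin P.xMax P.yMin (P.xMax + 1 - i) (P.yMax - j))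
  -- The 8 extra tiles are pebble, pointer, limit, bottom mark, `home`, the right end mark and the
  -- two marks of the triangle. A consumed tile reappears as a one on the tape.
  card : T.card = P.tiles.card + 8 + cnt (counters n P.width i j)
  lt_width : i < P.width
  lt_height : j < P.height

/-- The state after reading. -/
structure ReadEnd (n : ℕ) (P : Polyomino) (T : Finset Pixel) : Prop where
  rep : Reading n (P.xMax + 2) (P.yMax + 2) T (counters n P.width 0 P.height) P.bitmap
    fun _ _ => False
  card : T.card = P.tiles.card + 4 + cnt (counters n P.width 0 P.height)

theorem Reading.cnt_le {X Y : ℤ} {T : Finset Pixel} {D : List (Option (Sym n))} {bs : List Bool}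
    {low : ℤ → ℤ → Prop} (h : Reading n X Y T D bs low) :
    cnt D + cnt (bs.map bit : List (Option (Sym n))) + 2 ≤ T.card := by
  have h1 := (h.card_eq_add Sym.code_lt).2
  rw [(tw_finite_wt X D _).2] at h1
  simp only [cnt_some, cnt_append, cnt_nil] at h1
  omega

theorem ReadState.index_lt {i j : ℕ} {T : Finset Pixel} (h : ReadState n P i j T) :
    j * P.width + i < P.bitmap.length := by
  have h1 := h.lt_width
  have h2 := Nat.mul_le_mul_right P.width (Nat.succ_le_of_lt h.lt_height)
  rw [P.length_bitmap]
  rw [Nat.succ_mul] at h2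
  omega

/-- Reading one pixel, before counting. -/
theorem readBit_spec {i j : ℕ} {T : Finset Pixel} (h : ReadState n P i j T)
    (hx : x₀ ≤ P.xMin ∧ P.xMax + P.tiles.card + 10 ≤ x₁)
    (hy : y₀ ≤ P.yMin - 2 ∧ P.yMax + n + P.tiles.card + 14 ≤ y₁)
    (hl : l ≤ P.xMax + 2) (hr : P.xMax + 4 + P.bitmap.length ≤ r)
    (hK : P.tiles.card + P.width + P.height + n + 50 ≤ K)
    (hR : ∀ w, Box x₀ x₁ y₀ y₁ K w → I w)
    (hS : ∀ w, Box l r (P.yMax + 2 - 1) (P.yMax + 2 + (n + 5 : ℕ)) K w → I w)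
    (hz : (2 * (n + 5) + 3) * (2 * P.bitmap.length + 2 * P.width + 2 * P.height + 8) ≤ z)
    {Post : Option Bool → World Pixel (Finset Pixel) → ℕ → Set Pixel → Prop}
    (hPost : ∀ (t : ℕ) U T' e, t ≤ z + 2 * n + 4 * P.bitmap.length + 4 * (P.width + P.height) + 58 →
      (e = none ∧ i + 1 < P.width ∨ e = some false ∧ i + 1 = P.width ∧ j + 1 < P.height ∨
        e = some true ∧ i + 1 = P.width ∧ j + 1 = P.height) →
      Reading n (P.xMax + 2) (P.yMax + 2) T' (counters n P.width i j)
        (P.bitmap.take (j * P.width + i + 1)) (fun u v => if e = some true then False else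
          if e = none then
            Unread P.tiles P.xMin P.xMax P.yMin (P.xMax + 1 - (i + 1 : ℕ)) (P.yMax - j) u v
          else
            Unread P.tiles P.xMin P.xMax P.yMin (P.xMax + 1 - (0 : ℕ)) (P.yMax - (j + 1 : ℕ)) u v) →
      T'.card + (if e = some true then 4 else 0) =
        P.tiles.card + 8 + cnt (counters n P.width i j) →
      (∀ k : ℕ, cnt ((P.bitmap.take (j * P.width + i)).map bit : List (Option (Sym n))) ≤ k →
        k < cnt ((P.bitmap.take (j * P.width + i + 1)).map bit : List (Option (Sym n))) →
        ∀ u, P.xMax + 2 ≤ u → u ≤ P.xMax + 2 + k → (u, P.yMax + 2 + n + 5 + k) ∈ U) →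
      Post e ⟨(P.xMax + 2, P.yMax + 2), T'⟩ t U) :
    Spec I (readBit n) ⟨(P.xMax + 2, P.yMax + 2), T⟩ Post := by
  have hw := P.width_eq
  have hh := P.height_eq
  have h1 := h.lt_width
  have h2 := h.lt_height
  have hc := cnt_counters_le (n := n) (j := j) h1.le
  have hcard := h.card
  have hidx := h.index_lt
  have hcnt := h.rep.cnt_le
  have htake := P.take_bitmap h1 h2
  have hlen : (P.bitmap.take (j * P.width + i)).length = j * P.width + i := by simp; omega
  have hsize := cnt_map_bit_append n (P.bitmap.take (j * P.width + i))
    (decide ((P.xMax - (i : ℤ), P.yMax - (j : ℤ)) ∈ P.tiles))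
  rw [htake] at hsize
  have hbit := Bool.toNat_le (decide ((P.xMax - (i : ℤ), P.yMax - (j : ℤ)) ∈ P.tiles))
  have hz' : (2 * (n + 5) + 3) * (2 * (P.bitmap.take (j * P.width + i)).length + 5) ≤ z :=
    (Nat.mul_le_mul_left _ (by omega)).trans hz
  have epix : P.xMax + 1 - (i : ℤ) - 1 = P.xMax - i := by ring
  -- The three outcomes of `readNext` differ only in `e` and in the pixels below the strip, and are
  -- treated together.
  have store : ∀ (e : Option Bool) (low : ℤ → ℤ → Prop) (t₀ : ℕ) (U₀ : Set Pixel) (T' : Finset Pixel),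
      (t₀ : ℤ) ≤ 4 * (P.xMax - P.xMin + P.yMax - P.yMin) + 40 →
      (∀ u v, P.yMax + 2 ≤ v → ((u, v) ∈ T' ↔ (u, v) ∈ T)) →
      (∀ u v, v < P.yMax + 2 → ((u, v) ∈ T' ↔ low u v)) →
      (e = none ∧ i + 1 < P.width ∨ e = some false ∧ i + 1 = P.width ∧ j + 1 < P.height ∨
        e = some true ∧ i + 1 = P.width ∧ j + 1 = P.height) →
      (low = fun u v => if e = some true then False else
          if e = none then
            Unread P.tiles P.xMin P.xMax P.yMin (P.xMax + 1 - (i + 1 : ℕ)) (P.yMax - j) u v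
          else
            Unread P.tiles P.xMin P.xMax P.yMin (P.xMax + 1 - (0 : ℕ)) (P.yMax - (j + 1 : ℕ)) u v) →
      T'.card + (decide ((P.xMax - (i : ℤ), P.yMax - (j : ℤ)) ∈ P.tiles)).toNat +
        (if e = some true then 4 else 0) = T.card →
      Spec I (do
        onStrip (appendBit (n := n) (decide ((P.xMax - (i : ℤ), P.yMax - (j : ℤ)) ∈ P.tiles)))
        whenever (decide ((P.xMax - (i : ℤ), P.yMax - (j : ℤ)) ∈ P.tiles)) (triangleStep n)
        pure e : GMach (Option Bool)) ⟨(P.xMax + 2, P.yMax + 2), T'⟩ fun b w' t' U' =>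
          Post b w' (t₀ + t') (U₀ ∪ U') := by
    intro e low t₀ U₀ T' ht₀ hT1 hT2 he hlow hc'
    have hrep : Reading n (P.xMax + 2) (P.yMax + 2) T' (counters n P.width i j)
      (P.bitmap.take (j * P.width + i)) low := h.rep.congr_low hT1 hT2
    refine storeBit_spec (x₀ := x₀) (x₁ := x₁) (y₀ := y₀) (y₁ := y₁) (l := l) (r := r) (K := K)
      hrep (by omega) (by omega) hl (by omega) (by omega) hR hS fun t U T'' ht c h3 h4 => ?_
    rw [htake] at h3
    refine hPost _ _ T'' e ?_ he (hlow ▸ h3) (by omega) ?_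
    · clear hPost hz
      generalize (2 * (n + 5) + 3) * (2 * (P.bitmap.take (j * P.width + i)).length + 5) = q at *
      omega
    · intro k hk hk'
      rw [hsize] at hk'
      generalize decide ((P.xMax - (i : ℤ), P.yMax - (j : ℤ)) ∈ P.tiles) = b at *
      cases b with
      | false => simp only [Bool.toNat_false] at hk'; omega
      | true =>
        simp only [Bool.toNat_true] at hk'
        obtain rfl : k = cnt ((P.bitmap.take (j * P.width + i)).map bit : List (Option (Sym n))) := by
          omega
        exact fun u hu hu' => .inr (h4 rfl u hu hu')
  refine .bind (Spec.mono_inv (I := Box x₀ x₁ y₀ y₁ K) (.mk (by omega)) hR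
    (readNext_spec (fun u v => P.le_of_mem) (p := P.xMax + 1 - i) (y := P.yMax - j)
      (by omega) (by omega) h.rep.mem_low h.rep.home (by omega) (by omega) (by omega) ?_))
  intro t U T' ht hhigh
  rw [epix]
  refine ⟨fun h3 h4 h5 => ?_, fun h3 h3' h4 h5 => ?_, fun h3 h3' h4 h5 => ?_⟩
  · refine store none _ t U T' ht hhigh h5 (.inl ⟨rfl, by omega⟩) ?_ (by simpa using h4)
    funext u v
    simp only [reduceCtorEq, if_false, if_true]
    rw [show P.xMax + 1 - ((i + 1 : ℕ) : ℤ) = P.xMax - i by push_cast; ring]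
  · refine store (some false) _ t U T' ht hhigh h5 (.inr (.inl ⟨rfl, by omega, by omega⟩)) ?_
      (by simpa using h4)
    funext u v
    simp only [reduceCtorEq, if_false, Option.some.injEq, Bool.false_eq_true]
    rw [show P.xMax + 1 - ((0 : ℕ) : ℤ) = P.xMax + 1 by simp,
      show P.yMax - ((j + 1 : ℕ) : ℤ) = P.yMax - j - 1 by push_cast; ring]
  · refine store (some true) (fun _ _ => False) t U T' ht hhigh (by simpa using h5)
      (.inr (.inr ⟨rfl, by omega, by omega⟩)) ?_ (by simpa using h4)
    funext u v
    simp

/-- Induction on the number `q` of unread pixels. The triangle has as many rows as ones on the tape,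
so the claim about visited pixels covers the rows from the present number of ones up to the final
one. -/
theorem readLoop_spec (hx : x₀ ≤ P.xMin ∧ P.xMax + P.tiles.card + 10 ≤ x₁)
    (hy : y₀ ≤ P.yMin - 2 ∧ P.yMax + n + P.tiles.card + 14 ≤ y₁)
    (hl : l + P.width + P.height + 6 ≤ P.xMax) (hr : P.xMax + 4 + P.bitmap.length ≤ r)
    (hK : P.tiles.card + P.width + P.height + n + 50 ≤ K)
    (hR : ∀ w, Box x₀ x₁ y₀ y₁ K w → I w)
    (hS : ∀ w, Box l r (P.yMax + 2 - 1) (P.yMax + 2 + (n + 5 : ℕ)) K w → I w)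
    (hz : (2 * (n + 5) + 3) * (2 * P.bitmap.length + 2 * P.width + 2 * P.height + 8) ≤ z)
    (hz' : 2 * n + 4 * P.bitmap.length + 4 * (P.width + P.height) + 60 ≤ z)
    (q : ℕ) {i j : ℕ} {T : Finset Pixel} (hq : q + (j * P.width + i) = P.bitmap.length)
    (h : ReadState n P i j T) :
    Spec I (readLoop n (decide (j = 0))) ⟨(P.xMax + 2, P.yMax + 2), T⟩ fun _ w t U =>
      w.pos = (P.xMax + 2, P.yMax + 2) ∧ ReadEnd n P w.mem ∧ t ≤ q * (5 * z) ∧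
      ∀ k : ℕ, cnt ((P.bitmap.take (j * P.width + i)).map bit : List (Option (Sym n))) ≤ k →
        k < cnt (P.bitmap.map bit : List (Option (Sym n))) →
        ∀ u, P.xMax + 2 ≤ u → u ≤ P.xMax + 2 + k → (u, P.yMax + 2 + n + 5 + k) ∈ U := by
  induction q generalizing i j T with
  | zero => have := h.index_lt; omega
  | succ q ih =>
    have hw := P.width_eq
    have hh := P.height_eq
    have h1 := h.lt_width
    have h2 := h.lt_height
    have hc := cnt_counters_le (n := n) (j := j) h1.le
    have hq5 : (q + 1) * (5 * z) = q * (5 * z) + 5 * z := by ring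
    have hzj : (2 * (n + 5) + 3) * (2 * P.width + 2 * j + 8) ≤ z :=
      (Nat.mul_le_mul_left _ (by omega)).trans hz
    refine Spec.iter (.bind (readBit_spec h hx hy (by omega) hr hK hR hS hz ?_))
    clear hz
    intro t U T' e ht he hrep hcard hU
    -- Common continuation for a further pixel in the row and for the start of a new row: a row of
    -- the triangle was visited in this round or will be visited later.
    have next : ∀ {i' j' : ℕ} {T'' : Finset Pixel} {t' : ℕ} {U' : Set Pixel},
        t' ≤ 3 * z → j' * P.width + i' = j * P.width + i + 1 → ReadState n P i' j' T'' →
        I ⟨(P.xMax + 2, P.yMax + 2 + 1), T''⟩ ∧ ∀ U'', I ⟨(P.xMax + 2, P.yMax + 2), T''⟩ ∧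
        Spec I (readLoop n (decide (j' = 0))) ⟨(P.xMax + 2, P.yMax + 2), T''⟩
            fun _ w'' t₃ U₃ => w''.pos = (P.xMax + 2, P.yMax + 2) ∧ ReadEnd n P w''.mem ∧
              t + (t' + 1) + 1 + t₃ ≤ (q + 1) * (5 * z) ∧
              ∀ k : ℕ, cnt ((P.bitmap.take (j * P.width + i)).map bit : List (Option (Sym n))) ≤ k →
                k < cnt (P.bitmap.map bit : List (Option (Sym n))) →
                ∀ u, P.xMax + 2 ≤ u → u ≤ P.xMax + 2 + k →
                  (u, P.yMax + 2 + n + 5 + k) ∈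
                    insert (P.xMax + 2, P.yMax + 2 + 1) (U ∪ (U' ∪ U'')) ∪ U₃ := by
      intro i' j' T'' t' U' ht' e h'
      have hc' := cnt_counters_le (n := n) (j := j') h'.lt_width.le
      have hcard' := h'.card
      have h2' := h'.lt_height
      refine ⟨hR _ (.mk (by omega)), fun U'' => ⟨hR _ (.mk (by omega)), (ih (by omega) h').mono ?_⟩⟩
      rintro _ w'' t₃ U₃ - ⟨p1, p2, p3, p4⟩
      refine ⟨p1, p2, ?_, fun k hk hk' u hu hu' => ?_⟩
      · rw [hq5]
        generalize q * (5 * z) = q' at *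
        clear * - ht ht' hz' p3
        omega
      · rw [e] at p4
        by_cases hk2 : k < cnt ((P.bitmap.take (j * P.width + i + 1)).map bit :
            List (Option (Sym n)))
        · exact .inl (.inr (.inl (hU k hk hk2 u hu hu')))
        · exact .inr (p4 k (by omega) hk' u hu hu')
    rcases he with ⟨rfl, hi⟩ | ⟨rfl, hi, hj⟩ | ⟨rfl, hi, hj⟩
    · simp only [reduceCtorEq, if_false, if_true, Nat.add_zero] at hrep hcard
      refine .bind (count_inner_spec hi hrep (by omega) (by omega) (by omega) hS hzj
        fun t' U' T'' ht' hT'' c' => ?_)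
      obtain ⟨p1, p2⟩ := next (T'' := T'') (U' := U') (i' := i + 1) (j' := j) ht' (by ring)
        ⟨by rw [← Nat.add_assoc]; exact hT'', by omega, hi, h2⟩
      refine again_spec p1 fun U'' => ?_
      dsimp only
      rw [act_decide_down]
      exact p2 U''
    · simp only [reduceCtorEq, if_false, Nat.add_zero, Option.some.injEq, Bool.false_eq_true]
        at hrep hcard
      have e : (j + 1) * P.width + 0 = j * P.width + i + 1 := by rw [Nat.succ_mul]; omega
      refine .bind (count_end_spec hi false hrep (by omega) (by omega) (by omega) hS hzj
        fun t' U' T'' ht' hT'' c' => ?_)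
      obtain ⟨p1, p2⟩ := next (T'' := T'') (U' := U') (i' := 0) (j' := j + 1) ht' e
        ⟨by rw [e]; exact hT'', by omega, P.width_pos, hj⟩
      refine again_spec p1 fun U'' => ?_
      dsimp only
      rw [act_decide_down]
      exact p2 U''
    · simp only [if_true] at hrep hcard
      have e : j * P.width + i + 1 = P.bitmap.length := by
        rw [P.length_bitmap, ← hj, Nat.succ_mul]; omega
      rw [e, List.take_length] at hrep hU
      refine .bind (count_end_spec hi true hrep (by omega) (by omega) (by omega) hS hzj
        fun t' U' T'' ht' hT'' c' => .pure ?_)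
      rw [hj] at hT'' c'
      have c'' : T''.card = P.tiles.card + 4 + cnt (counters n P.width 0 P.height) := by omega
      refine ⟨rfl, ⟨hT'', c''⟩, ?_, fun k hk hk' u hu hu' => .inl (hU k hk hk' u hu hu')⟩
      rw [hq5]
      generalize q * (5 * z) = q' at *
      clear * - ht ht' hz'
      omega

end

/-- Transform the polyomino into a tape inscription. -/
noncomputable def readAll (n : ℕ) : GMach Unit := do
  setMarks
  onStrip (initTape (n := n))
  triangleStart n
  readLoop n true
  triangleEnd n

theorem cnt_map_bit_range (n w : ℕ) (g : ℕ → Bool) :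
    cnt (((List.range w).map g).map bit : List (Option (Sym n))) =
      ∑ i ∈ Finset.range w, (g i).toNat := by
  induction w with
  | zero => simp
  | succ w ih =>
    rw [List.range_succ, List.map_append, List.map_singleton, cnt_map_bit_append, ih,
      Finset.sum_range_succ]

/-- The ones of the bitmap are in bijection with the tiles. So the inscription costs no more tiles
than the polyomino releases, although the box may have quadratic size. -/
theorem Polyomino.cnt_bitmap (n : ℕ) (P : Polyomino) :
    cnt (P.bitmap.map bit : List (Option (Sym n))) = P.tiles.card := by
  have key : ∀ (g : ℕ → ℕ → Bool) (w h : ℕ),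
      cnt (((List.range h).flatMap fun j => (List.range w).map (g j)).map bit :
        List (Option (Sym n))) = ∑ j ∈ Finset.range h, ∑ i ∈ Finset.range w, (g j i).toNat := by
    intro g w h
    induction h with
    | zero => simp
    | succ h ih =>
      rw [List.range_succ, List.flatMap_append, List.map_append, cnt_append, ih,
        Finset.sum_range_succ, List.flatMap_singleton, cnt_map_bit_range]
  rw [bitmap_eq, key, ← Finset.sum_product']
  have hw := P.width_eq
  have hh := P.height_eq
  have : ∀ p ∈ Finset.range P.height ×ˢ Finset.range P.width,
      (decide ((P.xMax - (p.2 : ℤ), P.yMax - (p.1 : ℤ)) ∈ P.tiles)).toNat =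
        if (P.xMax - (p.2 : ℤ), P.yMax - (p.1 : ℤ)) ∈ P.tiles then 1 else 0 := by
    intro p _; split_ifs with h <;> simp [h]
  rw [Finset.sum_congr rfl this, ← Finset.card_filter]
  refine Finset.card_bij' (fun p _ => (P.xMax - (p.2 : ℤ), P.yMax - (p.1 : ℤ)))
    (fun p _ => ((P.yMax - p.2).toNat, (P.xMax - p.1).toNat)) ?_ ?_ ?_ ?_
  · intro p hp; exact (Finset.mem_filter.1 hp).2
  · rintro ⟨u, v⟩ hp
    have := P.le_of_mem hp
    simp only [Finset.mem_filter, Finset.mem_product, Finset.mem_range]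
    refine ⟨⟨by omega, by omega⟩, ?_⟩
    rw [show P.xMax - (((P.xMax - u).toNat : ℕ) : ℤ) = u by omega,
      show P.yMax - (((P.yMax - v).toNat : ℕ) : ℤ) = v by omega]
    exact hp
  · intro p _; ext <;> simp
  · rintro ⟨u, v⟩ hp
    have := P.le_of_mem hp
    refine Prod.ext ?_ ?_ <;> simp only <;> omega

section
variable {n : ℕ} {P : Polyomino} {x₀ x₁ y₀ y₁ l r : ℤ} {K z : ℕ}
  {I : World Pixel (Finset Pixel) → Prop}

/-- The rest `p` of the program is a parameter, with a postcondition that tolerates the bounded time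
spent before it. -/
theorem startLoop_spec {T : Finset Pixel} (hT : T.card = P.tiles.card + 5)
    (h1 : ∀ u v, v < P.yMax + 2 → ((u, v) ∈ T ↔
      Unread P.tiles P.xMin P.xMax P.yMin (P.xMax + 1) P.yMax u v))
    (h2 : ∀ u v, P.yMax + 2 ≤ v → ((u, v) ∈ T ↔ u = P.xMax + 2 ∧ v = P.yMax + 2))
    (hx : x₀ ≤ P.xMin ∧ P.xMax + P.tiles.card + 10 ≤ x₁)
    (hy : y₀ ≤ P.yMin - 2 ∧ P.yMax + n + P.tiles.card + 14 ≤ y₁)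
    (hl : l + P.width + P.height + 6 ≤ P.xMax) (hr : P.xMax + 4 + P.bitmap.length ≤ r)
    (hK : P.tiles.card + P.width + P.height + n + 50 ≤ K)
    (hR : ∀ w, Box x₀ x₁ y₀ y₁ K w → I w)
    (hS : ∀ w, Box l r (P.yMax + 2 - 1) (P.yMax + 2 + (n + 5 : ℕ)) K w → I w)
    {β : Type} {p : GMach β} {Post : β → World Pixel (Finset Pixel) → ℕ → Set Pixel → Prop}
    (h : ∀ T', ReadState n P 0 0 T' → Spec I p ⟨(P.xMax + 2, P.yMax + 2), T'⟩
      fun b w t U => ∀ (t' : ℕ) U', t' ≤ 5 * (2 * (n + 5) + 3) + (2 * n + 12) →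
        Post b w (t' + t) (U' ∪ U)) :
    Spec I (do
      onStrip (initTape (n := n))
      triangleStart n
      p) ⟨(P.xMax + 2, P.yMax + 2), T⟩ Post := by
  have hw := P.width_eq
  have hh := P.height_eq
  -- As `home` has code 0, the home tile alone already represents a tape with this single symbol.
  have hrep : Rep Sym.code (n + 5) (P.yMax + 2) T (tw (P.xMax + 2) [] [some (.home : Sym n)]).mem
      (Layers (P.yMax + 2) (Unread P.tiles P.xMin P.xMax P.yMin (P.xMax + 1) P.yMax)
        fun _ _ => False) := by
    intro u v
    by_cases hv : v < P.yMax + 2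
    · rw [if_neg (by omega), Layers.below hv, h1 u v hv]
    · rw [h2 u v (by omega)]
      by_cases hv' : v < P.yMax + 2 + (n + 5 : ℕ)
      · rw [if_pos (by omega)]
        have := tw_mem_add (P.xMax + 2) [] [some (.home : Sym n)]
        rcases lt_trichotomy u (P.xMax + 2) with hu | rfl | hu
        · simp only [tw, if_pos hu]
          simp; omega
        · simp only [tw, lt_irrefl, if_false]
          simp [Sym.code]
        · obtain ⟨k, hk⟩ := Int.eq_ofNat_of_zero_le (a := u - (P.xMax + 2) - 1) (by omega)
          have := this (k + 1)
          rw [show u = P.xMax + 2 + ((k + 1 : ℕ) : ℤ) by push_cast; omega, this]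
          simp; omega
      · rw [if_neg (by omega), Layers.above (by omega)]
        simp; omega
  refine .bind (onStrip_spec (l := l) (r := r) (Kt := 3) (K := K) (a := ()) (τ := 4)
    (initTape_spec (by omega) (by omega) fun U => ⟨rfl, rfl, le_rfl⟩) hrep (by omega)
    (by simp) (by simp; omega) hS fun t1 U1 T1 ht1 h1 c1 => ?_)
  simp only [cnt_some, cnt_nil] at c1
  refine .bind (Spec.mono_inv (I := Box x₀ x₁ y₀ y₁ K) (.mk (by omega)) hR
    (triangleStart_spec (n := n) (T := T1) (fun u v hv => ?_) (by omega) (by omega) (by omega)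
      fun U2 T2 c2 h3 h4 => ?_))
  · rw [h1.mem_high u v (by push_cast; omega)]; exact id
  refine (h T2 ⟨?_, ?_, P.width_pos, P.height_pos⟩).mono ?_
  · have := h1.congr_high (T' := T2) (fun u v hv => h3 u v (by push_cast at hv; omega))
      (high' := Apex (P.xMax + 2) (P.yMax + 2 + n + 5) 0)
      fun u v hv => h4 u v (by push_cast at hv; omega)
    simpa [Reading, counters] using this
  · simp only [counters_zero, Nat.zero_bits, List.map_nil, List.nil_append, cnt_some, cnt_nil]
    omega
  · intro b w t U _ hp
    have := hp (t1 + (2 * n + 12)) (U1 ∪ U2) (by omega)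
    rwa [Nat.add_assoc, Set.union_assoc] at this

/-- The result of reading. -/
structure Inscribed (n : ℕ) (P : Polyomino) (T : Finset Pixel) : Prop where
  rep : Rep Sym.code (n + 5) (P.yMax + 2) T (tw (P.xMax + 2) (counters n P.width 0 P.height)
    (some .home :: (P.bitmap.map bit ++ [some .rend]))).mem fun _ _ => False
  card : T.card = P.tiles.card + 2 + cnt (counters n P.width 0 P.height)

/-- The polyomino is used up, and its tiles are the ones of the bitmap on the tape. The triangle has
one row for each tile, and nothing of it remains except that it has been visited. -/
theorem readAll_spec {T : Finset Pixel} (hT : Overlay P.tiles P.rect.corner T)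
    (hx : x₀ ≤ P.xMin - 2 ∧ P.xMax + P.tiles.card + 10 ≤ x₁)
    (hy : y₀ ≤ P.yMin - 2 ∧ P.yMax + n + P.tiles.card + 14 ≤ y₁)
    (hl : l + P.width + P.height + 6 ≤ P.xMax) (hr : P.xMax + 4 + P.bitmap.length ≤ r)
    (hK : P.tiles.card + P.width + P.height + n + 50 ≤ K)
    (hR : ∀ w, Box x₀ x₁ y₀ y₁ K w → I w)
    (hS : ∀ w, Box l r (P.yMax + 2 - 1) (P.yMax + 2 + (n + 5 : ℕ)) K w → I w)
    (hz : (2 * (n + 5) + 3) * (2 * P.bitmap.length + 2 * P.width + 2 * P.height + 8) ≤ z)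
    (hz' : 2 * n + 4 * P.bitmap.length + 4 * (P.width + P.height) + 60 ≤ z) :
    Spec I (readAll n) ⟨P.rect.corner .right, T⟩ fun _ w t U =>
      w.pos = (P.xMax + 2, P.yMax + 2) ∧ Inscribed n P w.mem ∧
      t ≤ (P.bitmap.length + 1) * (5 * z) + 4 * P.tiles.card ∧
      ∀ k : ℕ, k < P.tiles.card → ∀ u, P.xMax + 2 ≤ u → u ≤ P.xMax + 2 + k →
        (u, P.yMax + 2 + n + 5 + k) ∈ U := by
  have hw := P.width_eq
  have hh := P.height_eq
  have c0 := hT.card_le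
  have hz2 : 5 * (2 * (n + 5) + 3) ≤ z := by
    rw [Nat.mul_comm]
    exact (Nat.mul_le_mul_left _ (by omega)).trans hz
  have hm : (P.bitmap.length + 1) * (5 * z) = P.bitmap.length * (5 * z) + 5 * z := by ring
  refine .bind (Spec.mono_inv (I := Box x₀ x₁ y₀ y₁ K)
    (show Box x₀ x₁ y₀ y₁ K ⟨(P.xMin - 2, P.yMin - 2), T⟩ from .mk (by omega)) hR
    (setMarks_spec hT (by omega) (by omega) (by omega) fun t0 U0 T0 ht0 c0 h1 h2 => ?_))
  refine startLoop_spec (x₀ := x₀) (x₁ := x₁) (y₀ := y₀) (y₁ := y₁) (l := l) (r := r) (K := K)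
    c0 h1 h2 (by omega) (by omega) hl hr hK hR hS fun T1 hT1 => ?_
  refine .bind ((readLoop_spec (by omega) hy hl hr hK hR hS hz hz' P.bitmap.length
    (by simp) hT1).mono ?_)
  rintro _ ⟨_, T2⟩ t2 U2 - ⟨rfl, hT2, ht2, hU2⟩
  dsimp only at hT2
  have hcnt := P.cnt_bitmap n
  have hrep := hT2.rep
  have hc := cnt_counters_le (n := n) (w := P.width) (i := 0) (j := P.height) (by omega)
  have hc2 := hT2.card
  rw [Reading, hcnt] at hrep
  refine Spec.mono_inv (I := Box x₀ x₁ y₀ y₁ K) (.mk (by omega)) hR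
    (triangleEnd_spec (j := P.tiles.card) (fun u v hv => ?_) hrep.home
      (fun v h2 h3 => hrep.above_home v h2 h3) (by omega) (by omega) (by omega)
      fun t3 U3 T3 ht3 c3 h3 h4 => ?_)
  · exact hrep.mem_high u v (by push_cast; omega)
  intro t1 U1 ht1
  refine ⟨rfl, ⟨fun u v => ?_, ?_⟩, ?_, fun k hk u hu hu' => .inr (.inr (.inl ?_))⟩
  · have := hrep.congr_high (T' := T3) (high' := fun _ _ => False)
      (fun u v hv => h3 u v (by push_cast at hv; omega))
      (fun u v hv => iff_of_false (h4 u v (by push_cast at hv; omega)) id)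
    rw [this]
    simp only [Layers, ite_self]
  · show T3.card = _
    omega
  · rw [hm]
    clear * - ht0 ht1 ht2 ht3 hz2 hz'
    generalize P.bitmap.length * (5 * z) = q at *
    omega
  · exact hU2 k (by simp) (by omega) u hu hu'

end
end TileRobot

/-! ### Simulating and normalizing on the strip. -/

namespace TileRobot
open Mach Turing

/-- A step changes only the pixel it starts from. In contrapositive form, a tile that has appeared
proves a visit. -/
theorem Mach.Trace.frame {α : Type} {m : GMach α} {q : m.Q} {w w' : World Pixel (Finset Pixel)}
    {tr : List (World Pixel (Finset Pixel))} {a : α} (h : Trace m q w tr a w') {p : Pixel}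
    (hp : ∀ x ∈ tr, x.pos ≠ p) : p ∈ w'.mem ↔ p ∈ w.mem := by
  induction h with
  | done => rfl
  | @step q w q' s d tr a w' _ _ ih =>
    rw [ih fun x hx => hp x (List.mem_cons_of_mem _ hx)]
    have : p ≠ w.pos := fun h => hp w (List.mem_cons_self ..) h.symm
    cases s <;> simp [World.act, Arena.set, this]

/-- Pixels that are not visited are not changed. -/
theorem Mach.Spec.frame {α : Type} {I : World Pixel (Finset Pixel) → Prop} {m : GMach α}
    {w : World Pixel (Finset Pixel)} {Post : α → World Pixel (Finset Pixel) → ℕ → Set Pixel → Prop}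
    (h : Spec I m w Post) : Spec I m w fun a w' t U => Post a w' t U ∧
      ∀ p, p ∉ U → (p ∈ w'.mem ↔ p ∈ w.mem) := fun hw => by
  obtain ⟨tr, a, w', h1, h2, h3, h4⟩ := h hw
  exact ⟨tr, a, w', h1, h2, h3, h4, fun p hp => h1.frame fun x hx e => hp ⟨x, hx, e⟩⟩

theorem Rep.card_eq_wt {S : Type} {code : S → ℕ} (hm : ∀ s, code s < m) {Y : ℤ} {T : Finset Pixel}
    {f : ℤ → Option S} (h : Rep code m Y T f fun _ _ => False) : T.card = wt f := by
  rw [(h.card_eq_add hm).2, Finset.card_eq_zero.2, Nat.add_zero]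
  refine Finset.filter_eq_empty_iff.2 ?_
  rintro ⟨u, v⟩ huv hv
  have := (h u v).1 huv
  rwa [if_neg hv] at this

section Simulate
universe u v
variable {n k : ℕ} {Γ : Type u} {Λ : Type v} [Inhabited Γ] [Inhabited Λ] {M : TM0.Machine Γ Λ}
  {e : Γ ≃ Fin n} {eΛ : Λ ≃ Fin k} {letter : Option Bool → Γ} {ls : Option Bool → Fin n}
  {P P' : Polyomino} {T : Finset Pixel} {l r : ℤ} {τ K : ℕ}
  {I : World Pixel (Finset Pixel) → Prop}

/-- The digits on the tape after reading `P`. -/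
def digits (n : ℕ) (P : Polyomino) : List (Option (Sym n)) :=
  P.width.bits.map bit ++ some .sep :: P.height.bits.map bit

theorem length_digits_le : (digits n P).length ≤ P.width + P.height + 1 := by
  have h1 := length_bits_le P.width
  have h2 := length_bits_le P.height
  simp [digits]; omega

theorem counters_eq : counters n P.width 0 P.height = digits n P ++ [some .lend] := by
  rw [counters_pos _ _ _ P.height_pos, digits]; simp

theorem letterOf_bit (b : Bool) : letterOf ls (bit b) = ls (some b) := by
  cases b <;> rfl

/-- The counters grow to the left with the least significant digit next to home, so from left to
right the tape shows height, width and bitmap, with the most significant bits first. The symbols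
`sep` and `home` are read as blank letters and separate the three parts. -/
theorem map_letterOf_tape (hls : ∀ b, ls b = e (letter b)) :
    ((digits n P).reverse ++ some (.home : Sym n) :: P.bitmap.map bit).map (letterOf ls) =
      (P.encode.map letter).map e := by
  simp only [digits, List.reverse_append, List.reverse_cons, List.map_append, List.map_reverse,
    List.map_cons, Polyomino.encode, Polyomino.binary,
    List.append_assoc, List.cons_append, List.nil_append, List.map_map, Function.comp_def, letterOf_bit,
    show letterOf ls (some (.sep : Sym n)) = ls none from rfl,
    show letterOf ls (some (.home : Sym n)) = ls none from rfl, hls]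

theorem ne_end_of_mem_bits {bs : List Bool} {a : Option (Sym n)} (ha : a ∈ bs.map bit) :
    a ≠ some .lend ∧ a ≠ some .rend := by
  obtain ⟨b, -, rfl⟩ := List.mem_map.1 ha
  cases b <;> simp [bit]

theorem length_encode (n : ℕ) (P : Polyomino) :
    P.encode.length = (digits n P).length + P.bitmap.length + 1 := by
  simp [Polyomino.encode, Polyomino.binary, digits]; omega

/-- The tape after reading `P`. -/
def inputTape (n : ℕ) (P : Polyomino) : ℤ → Option (Sym n) :=
  (tw (P.xMax + 2) (digits n P ++ [some .lend]) (some .home :: (P.bitmap.map bit ++ [some .rend]))).mem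

/-- The column of the first letter. -/
def origin (n : ℕ) (P : Polyomino) : ℤ := P.xMax + 2 - (digits n P).length

theorem Inscribed.card_eq (h : Inscribed n P T) : T.card = wt (inputTape n P) := by
  have := h.rep.card_eq_wt Sym.code_lt
  rwa [counters_eq] at this

/-- The strip represents the Turing machine after it has halted. -/
structure Simulated (M : TM0.Machine Γ Λ) (e : Γ ≃ Fin n) (letter : Option Bool → Γ)
    (ls : Option Bool → Fin n) (P : Polyomino) (τ : ℕ) (p : Pixel) (T : Finset Pixel)
    (f : ℤ → Option (Sym n)) (a b : ℤ) : Prop where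
  inv : SimInv M (P.encode.map letter) e ls (inputTape n P) (origin n P) τ f a b
  pos : p = (origin n P + (conf M (P.encode.map letter) τ).2, P.yMax + 2)
  bounds : a < (conf M (P.encode.map letter) τ).2 ∧ (conf M (P.encode.map letter) τ).2 < b
  rep : Rep Sym.code (n + 5) (P.yMax + 2) T f fun _ _ => False
  card : T.card ≤ wt (inputTape n P) + tmAdditionalSpace M (P.encode.map letter) τ + 2

theorem simulateOnStrip_spec (hT : Inscribed n P T) (hls : ∀ b, ls b = e (letter b))
    (hblank : letter none = default)
    (hhalt : tmStep M (conf M (P.encode.map letter) τ) = none)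
    (hrun : ∀ i < τ, tmStep M (conf M (P.encode.map letter) i) ≠ none)
    (hl : l + P.width + P.height + tmAdditionalSpace M (P.encode.map letter) τ + 1 ≤ P.xMax)
    (hr : P.xMax + P.bitmap.length + tmAdditionalSpace M (P.encode.map letter) τ + 5 ≤ r)
    (hK : P.tiles.card + P.width + P.height + tmAdditionalSpace M (P.encode.map letter) τ +
      n + 20 ≤ K)
    (hS : ∀ w, Box l r (P.yMax + 2 - 1) (P.yMax + 2 + (n + 5 : ℕ)) K w → I w) :
    Spec I (onStrip (simulate ls (transFun M e eΛ) (eΛ default)))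
      ⟨(P.xMax + 2, P.yMax + 2), T⟩ fun _ w t _ =>
        t ≤ (2 * (n + 5) + 3) * (5 * τ + P.width + P.height + 10) ∧
        ∃ f a b, Simulated M e letter ls P τ w.pos w.mem f a b := by
  have hD := length_digits_le (n := n) (P := P)
  have hc := cnt_counters_le (n := n) (w := P.width) (i := 0) (j := P.height) (by omega)
  have hcard := hT.card
  have hwt := hT.card_eq
  have hx : ((digits n P).length + P.bitmap.length + 1 : ℤ) = (P.encode.map letter).length := by
    rw [List.length_map, length_encode n]; push_cast; ring
  have hrep := hT.rep
  rw [counters_eq] at hrep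
  have hsim := simulate_spec (M := M) (x := P.encode.map letter) (eΛ := eΛ) (f₀ := inputTape n P)
    (T := τ) (c := P.xMax + 2) (o := origin n P) (ls := ls) (e := e) (by rw [hls, hblank])
    (map_letterOf_tape (P := P) hls) (by
      intro a ha
      simp only [digits, List.mem_append, List.mem_cons] at ha
      rcases ha with ha | rfl | ha
      exacts [ne_end_of_mem_bits ha, by simp, ne_end_of_mem_bits ha])
    (fun a ha => ne_end_of_mem_bits ha) rfl rfl hhalt hrun
  have ho : origin n P = P.xMax + 2 - (digits n P).length := rfl
  generalize hs : tmAdditionalSpace M (P.encode.map letter) τ = s at *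
  have hbox : ∀ w, Box (origin n P - s - 2) (origin n P + (P.encode.map letter).length + s + 2)
      (P.yMax + 2 - 1) (P.yMax + 2 + (n + 5 : ℕ)) K w →
      Box l r (P.yMax + 2 - 1) (P.yMax + 2 + (n + 5 : ℕ)) K w := by
    rintro w ⟨h1, h2, h3, h4, h5⟩
    exact ⟨by omega, by omega, h3, h4, h5⟩
  refine Spec.mono_inv (I := Box (origin n P - s - 2)
    (origin n P + (P.encode.map letter).length + s + 2)
    (P.yMax + 2 - 1) (P.yMax + 2 + (n + 5 : ℕ)) K) (.mk (by push_cast; omega))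
    (fun w hw => hS w (hbox w hw)) ?_
  refine (compile_spec Sym.code_lt Sym.code_injective (by omega) _ hsim hrep
    ⟨by show _ ≤ P.xMax + 2; omega, by show P.xMax + 2 ≤ _; omega, by
      show wt (inputTape n P) ≤ _; omega⟩ (by omega)).mono ?_
  rintro _ ⟨p, T'⟩ t U - ⟨w', t', U', ⟨ht', hp', a, b, hinv, hab⟩, hbx, rfl, h1, h2, h3⟩
  refine ⟨h3.trans (Nat.mul_le_mul_left _ (by omega)), w'.mem, a, b, hinv, ?_, hab, h1, ?_⟩
  · show (w'.pos, _) = _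
    rw [hp']
  · have h5 := hinv.wt_le le_rfl (by
      unfold inputTape; exact (tw_finite_wt _ _ _).1)
    rw [h1.card_eq_wt Sym.code_lt]
    exact h5

/-- The additional cells of the Turing machine correspond to changed pixels. -/
theorem Simulated.exists_pixel {p : Pixel} {f : ℤ → Option (Sym n)} {a b j : ℤ}
    (h : Simulated M e letter ls P τ p T f a b)
    (hj : j ∈ additionalCells M (P.encode.map letter) τ) :
    ∃ v, P.yMax + 2 ≤ v ∧ (origin n P + j, v) ∈ T := by
  have hab : a < j ∧ j < b := by
    obtain ⟨⟨i, hi, rfl⟩, -⟩ := mem_additionalCells.1 hj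
    rcases hi.lt_or_eq with hi | rfl
    · exact h.inv.visited i hi
    · exact h.bounds
  -- An additional cell is outside the input or has been changed, which excludes the unflagged case
  -- of the invariant.
  have hg : ∃ g, f (origin n P + j) = some (.sym g) := by
    rcases h.inv.flag j hab.1 hab.2 with h1 | ⟨-, h1, h2, h3⟩
    · exact h1.1
    · exfalso
      rcases (mem_additionalCells.1 hj).2 with h4 | ⟨i, hi, h4⟩
      · exact h4 ⟨h1, h2⟩
      · exact h4 (h3 i hi)
  obtain ⟨g, hg⟩ := hg
  have := Sym.code_lt (.sym g : Sym n)
  refine ⟨P.yMax + 2 + (Sym.sym g).code, by omega, ?_⟩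
  rw [h.rep, if_pos (by push_cast; omega)]
  exact ⟨_, hg, rfl⟩

/-- The tape that describes `P`, in the form that is used for building it. -/
def Ready (n : ℕ) (P : Polyomino) (Y z : ℤ) (T : Finset Pixel) : Prop :=
  Rep (Sym.code (n := n)) (n + 5) Y T (tw z (P.width.bits.map bit ++ [some .lend])
    (some .home :: (P.bitmap.map bit ++ [some .rend]))).mem fun _ _ => False

/-- The sweep stays between the end marks and never needs more tiles than are present, so the
present weight `wt f` of the tape serves as its budget. -/
theorem normalizeOnStrip_spec (hletter : letter.Injective) {p : Pixel} {f : ℤ → Option (Sym n)}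
    {a b : ℤ} (h : Simulated M e letter ls P τ p T f a b) (hls : ∀ b, ls b = e (letter b))
    (hblank : letter none = default) {c : ℤ}
    (hy : ∀ j, cell (conf M (P.encode.map letter) τ) (c + j) =
      cell (tmInit (P'.encode.map letter) : TMConfig Γ Λ) j)
    (hl : l + P.width + P.height + tmAdditionalSpace M (P.encode.map letter) τ + 1 ≤ P.xMax)
    (hr : P.xMax + P.bitmap.length + tmAdditionalSpace M (P.encode.map letter) τ + 5 ≤ r)
    (hK : P.tiles.card + P.width + P.height + tmAdditionalSpace M (P.encode.map letter) τ +
      n + 20 ≤ K)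
    (hS : ∀ w, Box l r (P.yMax + 2 - 1) (P.yMax + 2 + (n + 5 : ℕ)) K w → I w) :
    Spec I (onStrip (normalize fun a => Function.invFun letter (e.symm a)))
      ⟨p, T⟩ fun _ w t _ =>
        t ≤ (2 * (n + 5) + 3) * (3 * (P.encode.length +
          2 * tmAdditionalSpace M (P.encode.map letter) τ + 5)) ∧
        ∃ z, l + 2 ≤ z ∧ z + P'.bitmap.length + 1 ≤ r ∧ w.pos = (z, P.yMax + 2) ∧
          Ready n P' (P.yMax + 2) z w.mem := by
  have hD := length_digits_le (n := n) (P := P)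
  have hx : ((digits n P).length + P.bitmap.length + 1 : ℤ) = P.encode.length := by
    rw [length_encode n]; push_cast; ring
  have ho : origin n P = P.xMax + 2 - (digits n P).length := rfl
  have h1 := h.inv.neg_le le_rfl
  have h2 := h.inv.le le_rfl
  have hwt : wt (inputTape n P) ≤ P.tiles.card + P.width + P.height + 4 := by
    have hc : cnt (digits n P) ≤ _ := (cnt_le_length _).trans hD
    unfold inputTape
    rw [(tw_finite_wt _ _ _).2]
    simp only [cnt_append, cnt_some, cnt_nil, P.cnt_bitmap n]
    omega
  have hcard := h.card
  have hb := h.bounds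
  have hneg := h.inv.lneg
  rw [List.length_map] at h2
  have hrep := h.rep
  have hfw := hrep.card_eq_wt Sym.code_lt
  have hn := h.inv.normalize (p := (conf M (P.encode.map letter) τ).2) hletter hblank hls hb hy
    (lo := l) (hi := r) (K := wt f) (by omega) (by omega) le_rfl
  rw [h.pos]
  refine Spec.mono_inv (I := Box l r (P.yMax + 2 - 1) (P.yMax + 2 + (n + 5 : ℕ)) K)
    (.mk (by push_cast; omega)) hS ?_
  refine (compile_spec Sym.code_lt Sym.code_injective (by omega) _ hn hrep
    ⟨by show _ ≤ origin n P + _; omega, by show origin n P + _ ≤ _; omega, le_rfl⟩ (by omega)).mono ?_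
  rintro _ ⟨q, T'⟩ t U - ⟨w', t', U', ⟨ht', z, hz1, hz2, rfl⟩, hbx, rfl, h3, h4, h5⟩
  refine ⟨h5.trans (Nat.mul_le_mul_left _ ?_), z, by omega, by omega, rfl, h3⟩
  omega

end Simulate
end TileRobot

namespace TileRobot
open Mach

/-! ### Building a polyomino from its description -/

/-- Put the pointer above the home pixel, and the marker to its left. -/
def buildStart (n : ℕ) : GMach Unit := do
  walk .up (n + 5)
  act true .left
  act true .right
  walk .down (n + 5)

/-- Shift the marker to the left. -/
def shiftMarker (n : ℕ) : GMach Unit := do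
  walk .up (n + 5)
  seek id .left
  act false .left
  act true .right
  seek id .right
  walk .down (n + 5)

/-- Shift the marker to the left by the width, and erase the width. -/
noncomputable def placeMarker (n : ℕ) : GMach Unit := do
  iter (fun _ : Unit => do
    let b ← onStrip (decFirst (n := n))
    match b with
    | true => do
      shiftMarker n
      mv .up
      let s ← look
      pure (.inl ((), s, .down))
    | false => pure (.inr ())) ()
  onStrip (clearLeft (n := n))

/-- Go to the next pixel of the polyomino. -/
def gotoPixel (fresh : Bool) : GMach Unit := do
  seek id .up
  seek id .left
  match fresh with
  | true => do
    act false .up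
    act true .down
    mv .right
  | false => pure ()

/-- Write a pixel, mark the next one, and go home. The result tells whether a row is complete. -/
def writePixel (b : Bool) : GMach Bool := do
  act b .right
  let last ← look
  match last with
  | true => do
    act false .up
    act true .down
    seek id .down
    pure true
  | false => do
    -- The pebble is placed with a detour: `seek` moves at least once, and starting it to the right
    -- of the pebble could miss an adjacent pointer.
    act true .up
    mv .down
    seek id .right
    seek id .down
    pure false

/-- Write the bits of the tape, last bit first. -/
noncomputable def buildLoop (n : ℕ) (fresh : Bool) : GMach Unit :=
  iter (fun fresh : Bool => do
    let b ← onStrip (popBit (n := n))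
    match b with
    | none => pure (.inr ())
    | some b => do
      gotoPixel fresh
      let c ← writePixel b
      again c) fresh

/-- Remove the home mark, the pointer and the marker. -/
def buildEnd : GMach Unit := do
  act false .up
  seek id .up
  act false .left
  seek id .left
  act false .up

/-! ### Correctness of the single building moves. -/

section
variable {n : ℕ} {T : Finset Pixel} {x₀ x₁ y₀ y₁ : ℤ} {K : ℕ} {X Y : ℤ}

theorem buildStart_spec {Post : Unit → World Pixel (Finset Pixel) → ℕ → Set Pixel → Prop}
    (hT : ∀ u v, Y + n + 5 ≤ v → (u, v) ∉ T)
    (hx : x₀ ≤ X - 1 ∧ X ≤ x₁) (hy : y₀ ≤ Y ∧ Y + n + 5 ≤ y₁) (hK : T.card + 2 ≤ K)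
    (h : ∀ U T', T'.card = T.card + 2 → (∀ u v, v < Y + n + 5 → ((u, v) ∈ T' ↔ (u, v) ∈ T)) →
      (∀ u v, Y + n + 5 ≤ v → ((u, v) ∈ T' ↔
        u = X ∧ v = Y + n + 5 ∨ u = X - 1 - (0 : ℕ) ∧ v = Y + n + 5)) →
      Post () ⟨(X, Y), T'⟩ (2 * n + 12) U) :
    Spec (Box x₀ x₁ y₀ y₁ K) (buildStart n) ⟨(X, Y), T⟩ Post := by
  refine .bind (walk_up_spec (n + 5) (by omega) (by omega) (by omega) fun U => ?_)
  refine .bind (.putLeft (by grind) rfl fun T1 h1 c1 => ⟨.mk (by omega), ?_⟩)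
  refine .bind (.putRight (x' := X) (by grind) (by ring) fun T2 h2 c2 => ⟨.mk (by omega), ?_⟩)
  refine walk_down_spec (n + 5) (by omega) (by omega) (by omega) fun U' => ?_
  rw [show Y + ((n + 5 : ℕ) : ℤ) - ((n + 5 : ℕ) : ℤ) = Y by ring]
  rw [show n + 5 + (1 + (1 + (n + 5))) = 2 * n + 12 by ring]
  exact h _ T2 (by omega) (by grind) (by push_cast at *; grind)

theorem shiftMarker_spec {k : ℕ} {Post : Unit → World Pixel (Finset Pixel) → ℕ → Set Pixel → Prop}
    (hT : ∀ u v, Y + n + 5 ≤ v → ((u, v) ∈ T ↔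
        u = X ∧ v = Y + n + 5 ∨ u = X - 1 - k ∧ v = Y + n + 5))
    (hx : x₀ ≤ X - 2 - k ∧ X ≤ x₁) (hy : y₀ ≤ Y ∧ Y + n + 5 ≤ y₁) (hK : T.card ≤ K)
    (h : ∀ t U T', t ≤ 2 * n + 2 * k + 15 → T'.card = T.card →
      (∀ u v, v < Y + n + 5 → ((u, v) ∈ T' ↔ (u, v) ∈ T)) →
      (∀ u v, Y + n + 5 ≤ v → ((u, v) ∈ T' ↔
        u = X ∧ v = Y + n + 5 ∨ u = X - 1 - (k + 1 : ℕ) ∧ v = Y + n + 5)) →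
      Post () ⟨(X, Y), T'⟩ t U) :
    Spec (Box x₀ x₁ y₀ y₁ K) (shiftMarker n) ⟨(X, Y), T⟩ Post := by
  refine .bind (walk_up_spec (n + 5) (by omega) (by omega) (by omega) fun U => ?_)
  refine .bind (.seekLeft (X - 1 - k) (by omega) (by push_cast; grind) (by push_cast; grind)
    (fun u hu hu' => .mk (by omega)) ?_)
  refine .bind (.eraseLeft (by push_cast; grind) rfl fun T1 h1 c1 => ⟨.mk (by omega), ?_⟩)
  refine .bind (.putRight (x' := X - 1 - k) (by push_cast at *; grind) (by ring)
    fun T2 h2 c2 => ⟨.mk (by omega), ?_⟩)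
  refine .bind (.seekRight X (by omega) (by push_cast at *; grind) (by push_cast at *; grind)
    (fun u hu hu' => .mk (by omega)) ?_)
  refine walk_down_spec (n + 5) (by omega) (by omega) (by omega) fun U' => ?_
  rw [show Y + ((n + 5 : ℕ) : ℤ) - ((n + 5 : ℕ) : ℤ) = Y by ring]
  refine h _ _ T2 ?_ (by omega) (by push_cast at *; grind) (by push_cast at *; grind)
  omega

/-- The pixels above the strip while row `j` of `Q` is built from pixel `i` on. -/
def Built (Q : ℤ → ℤ → Prop) (X V : ℤ) (w i j : ℕ) (u v : ℤ) : Prop :=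
  u = X ∧ v = V + j ∨ Q u v ∧ (v < V + j ∨ v = V + j ∧ u < X - w + i) ∨
  u = X - 1 - w ∧ (i = 0 ∧ v = V + j ∨ 0 < i ∧ v = V + j + 1) ∨
  0 < i ∧ u = X - w + i ∧ v = V + j

/-- In the row of the pointer, the first tile to the left is the marker if the row is fresh, and
otherwise the pebble on the pixel to be written. In a fresh row the marker is moved up at once,
ready for the next row. -/
theorem gotoPixel_spec {Q : ℤ → ℤ → Prop} {w i j : ℕ} {V : ℤ}
    {Post : Unit → World Pixel (Finset Pixel) → ℕ → Set Pixel → Prop}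
    (hQ : ∀ u v, Q u v → X - w ≤ u ∧ u < X ∧ V ≤ v) (hi : i < w)
    (hT : ∀ u v, V ≤ v → ((u, v) ∈ T ↔ Built Q X V w i j u v))
    (hc : ∀ v, Y < v → v < V → (X, v) ∉ T) (hV : Y < V)
    (hx : x₀ ≤ X - 1 - w ∧ X ≤ x₁) (hy : y₀ ≤ Y ∧ V + j + 1 ≤ y₁) (hK : T.card ≤ K)
    (h : ∀ (t : ℕ) U T', (t : ℤ) ≤ V - Y + j + w + 5 →
      T'.card = T.card → (∀ u v, v < V → ((u, v) ∈ T' ↔ (u, v) ∈ T)) →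
      (∀ u v, V ≤ v → ((u, v) ∈ T' ↔ u = X ∧ v = V + j ∨
        Q u v ∧ (v < V + j ∨ v = V + j ∧ u < X - w + i) ∨
        u = X - 1 - w ∧ v = V + j + 1 ∨ 0 < i ∧ u = X - w + i ∧ v = V + j)) →
      Post () ⟨(X - w + i, V + j), T'⟩ t U) :
    Spec (Box x₀ x₁ y₀ y₁ K) (gotoPixel (decide (i = 0))) ⟨(X, Y), T⟩ Post := by
  unfold Built at hT
  refine .bind (.seekUp (V + j) (by omega) (by grind) (by grind)
    (fun u hu hu' => .mk (by omega)) ?_)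
  rcases Nat.eq_zero_or_pos i with rfl | hi0
  · refine .bind (.seekLeft (X - 1 - w) (by omega) (by grind) (by grind)
      (fun u hu hu' => .mk (by omega)) ?_)
    refine .bind (.eraseUp (by grind) rfl fun T1 h1 c1 => ⟨.mk (by omega), ?_⟩)
    refine .bind (.putDown (y' := V + j) (by grind) (by ring) fun T2 h2 c2 => ⟨.mk (by omega), ?_⟩)
    refine .moveRight (x' := X - w + (0 : ℕ)) (by push_cast; ring) (.mk (by omega)) ?_
    refine h _ _ T2 ?_ (by omega) (by grind) ?_
    · omega
    · push_cast; grind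
  · rw [decide_eq_false hi0.ne']
    refine .bind (.seekLeft (X - w + i) (by omega) (by grind) (by grind)
      (fun u hu hu' => .mk (by omega)) (.pure ?_))
    refine h _ _ T ?_ rfl (by simp) (by grind)
    omega

theorem writePixel_spec {Q : ℤ → ℤ → Prop} {w i j : ℕ} {V : ℤ} {b : Bool}
    {Post : Bool → World Pixel (Finset Pixel) → ℕ → Set Pixel → Prop}
    (hQ : ∀ u v, Q u v → X - w ≤ u ∧ u < X ∧ V ≤ v) (hi : i < w)
    (hb : b = true ↔ Q (X - w + i) (V + j))
    (hT : ∀ u v, V ≤ v → ((u, v) ∈ T ↔ u = X ∧ v = V + j ∨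
        Q u v ∧ (v < V + j ∨ v = V + j ∧ u < X - w + i) ∨
        u = X - 1 - w ∧ v = V + j + 1 ∨ 0 < i ∧ u = X - w + i ∧ v = V + j))
    (hX : (X, Y) ∈ T) (hc : ∀ v, Y < v → v < V → (X, v) ∉ T) (hV : Y < V)
    (hx : x₀ ≤ X - 1 - w ∧ X ≤ x₁) (hy : y₀ ≤ Y ∧ V + j + 1 ≤ y₁) (hK : T.card + 2 ≤ K)
    (h : ∀ (t : ℕ) U T', (t : ℤ) ≤ V - Y + j + w + 5 →
      T'.card + (if i = 0 then 0 else 1) = T.card + b.toNat + (if i + 1 = w then 0 else 1) →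
      (∀ u v, v < V → ((u, v) ∈ T' ↔ (u, v) ∈ T)) →
      (∀ u v, V ≤ v → ((u, v) ∈ T' ↔
        if i + 1 = w then Built Q X V w 0 (j + 1) u v else Built Q X V w (i + 1) j u v)) →
      Post (decide (i + 1 = w)) ⟨(X, Y), T'⟩ t U) :
    Spec (Box x₀ x₁ y₀ y₁ K) (writePixel b) ⟨(X - w + i, V + j), T⟩ Post := by
  -- The pixel carries the pebble unless `i = 0`. Writing `b` thus fills or keeps an empty pixel, or
  -- keeps or erases the pebble, which explains the case distinction in the tile count.
  have step : ∀ {Post : Unit → World Pixel (Finset Pixel) → ℕ → Set Pixel → Prop},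
      (∀ T', T'.card + (if i = 0 then 0 else 1) = T.card + b.toNat →
        (∀ u v, v < V → ((u, v) ∈ T' ↔ (u, v) ∈ T)) →
        (∀ u v, V ≤ v → ((u, v) ∈ T' ↔ u = X ∧ v = V + j ∨
          Q u v ∧ (v < V + j ∨ v = V + j ∧ u < X - w + i + 1) ∨
          u = X - 1 - w ∧ v = V + j + 1)) →
        Post () ⟨(X - w + i + 1, V + j), T'⟩ 1 {(X - w + i, V + j)}) →
      Spec (Box x₀ x₁ y₀ y₁ K) (Mach.act b .right : GMach Unit) ⟨(X - w + i, V + j), T⟩ Post := by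
    intro Post hp
    rcases Nat.eq_zero_or_pos i with rfl | hi0
    · simp only [if_true, CharP.cast_eq_zero, add_zero] at *
      cases b with
      | true =>
        refine .putRight (by grind) rfl fun T1 h1 c1 => ⟨.mk (by omega), hp T1 ?_ ?_ ?_⟩
        · simpa using c1
        · grind
        · grind
      | false =>
        refine .keep (by simp; grind) (.mk (by omega)) (hp T (by simp) (by simp) ?_)
        grind
    · simp only [hi0.ne', if_false] at *
      cases b with
      | true =>
        refine .keep (by simp; grind) (.mk (by omega)) (hp T (by simp) (by simp) ?_)
        grind
      | false =>
        refine .eraseRight (by grind) rfl fun T1 h1 c1 => ⟨.mk (by omega), hp T1 ?_ ?_ ?_⟩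
        · simpa using c1
        · grind
        · grind
  refine .bind (step fun T1 c1 k1 h1 => ?_)
  have hb1 := Bool.toNat_le b
  clear step
  have hcard : T1.card ≤ T.card + 1 := by split_ifs at c1 <;> omega
  have hX1 : (X, Y) ∈ T1 := (k1 _ _ hV).2 hX
  have hc1 : ∀ v, Y < v → v < V → (X, v) ∉ T1 := fun v h2 h3 h4 => hc v h2 h3 ((k1 _ _ h3).1 h4)
  clear hT hX hc hb
  by_cases hiw : i + 1 = w
  · rw [if_pos hiw, decide_eq_true hiw] at h
    simp only [if_pos hiw] at h
    refine .bind (.lookTrue (by grind) ?_)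
    rw [show X - w + i + 1 = X by omega] at *
    refine .bind (.eraseUp (by grind) rfl fun T2 h2 c2 => ⟨.mk (by omega), ?_⟩)
    refine .bind (.putDown (y' := V + j) (by grind) (by ring) fun T3 h3 c3 => ⟨.mk (by omega), ?_⟩)
    refine .bind (.seekDown Y (by omega) (by grind) (by grind)
      (fun u hu hu' => .mk (by omega)) (.pure ?_))
    refine h _ _ T3 ?_ (by omega) (by grind) ?_
    · omega
    · unfold Built; push_cast; grind
  · rw [if_neg hiw, decide_eq_false hiw] at h
    simp only [if_neg hiw] at h
    refine .bind (.lookFalse (by grind) ?_)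
    refine .bind (.putUp (by grind) rfl fun T2 h2 c2 => ⟨.mk (by omega), ?_⟩)
    refine .bind (.moveDown (y' := V + j) (by ring) (.mk (by omega)) ?_)
    refine .bind (.seekRight X (by omega) (by grind) (by grind)
      (fun u hu hu' => .mk (by omega)) ?_)
    refine .bind (.seekDown Y (by omega) (by grind) (by grind)
      (fun u hu hu' => .mk (by omega)) (.pure ?_))
    refine h _ _ T2 ?_ (by omega) (by grind) ?_
    · omega
    · unfold Built; push_cast; grind

/-- The row after the last one is fresh: it contains only pointer and marker, and these and the home
tile are all that has to go. -/
theorem buildEnd_spec {Q : ℤ → ℤ → Prop} {w h : ℕ} {V : ℤ}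
    {Post : Unit → World Pixel (Finset Pixel) → ℕ → Set Pixel → Prop}
    (hQ : ∀ u v, Q u v → X - w ≤ u ∧ u < X ∧ V ≤ v ∧ v < V + h)
    (hT : ∀ u v, V ≤ v → ((u, v) ∈ T ↔ Built Q X V w 0 h u v))
    (hT' : ∀ u v, v < V → ((u, v) ∈ T ↔ u = X ∧ v = Y)) (hV : Y + 1 < V)
    (hx : x₀ ≤ X - 1 - w ∧ X ≤ x₁) (hy : y₀ ≤ Y ∧ V + h + 1 ≤ y₁) (hw : 0 < w) (hK : T.card ≤ K)
    (hp : ∀ (t : ℕ) U p T', (t : ℤ) ≤ V - Y + h + w + 5 → (∀ u v, (u, v) ∈ T' ↔ Q u v) →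
      Post () ⟨p, T'⟩ t U) :
    Spec (Box x₀ x₁ y₀ y₁ K) buildEnd ⟨(X, Y), T⟩ Post := by
  unfold Built at hT
  refine .bind (.eraseUp (by grind) rfl fun T1 h1 c1 => ⟨.mk (by omega), ?_⟩)
  refine .bind (.seekUp (V + h) (by omega) (by grind) (by grind)
    (fun u hu hu' => .mk (by omega)) ?_)
  refine .bind (.eraseLeft (by grind) rfl fun T2 h2 c2 => ⟨.mk (by omega), ?_⟩)
  refine .bind (.seekLeft (X - 1 - w) (by omega) (by grind) (by grind)
    (fun u hu hu' => .mk (by omega)) ?_)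
  refine .eraseUp (by grind) rfl fun T3 h3 c3 => ⟨.mk (by omega), ?_⟩
  refine hp _ _ _ T3 ?_ ?_
  · omega
  · grind

end

/-- A tape machine that starts and ends at the home pixel, with an unspecified result. -/
theorem onStrip_exists_spec {n : ℕ} {α ι : Type} {p : SMach n α} {X X' Y l r : ℤ} {Kt K τ : ℕ}
    {I : World Pixel (Finset Pixel) → Prop} {val : ι → α → Prop}
    {D R : List (Option (Sym n))} {D' R' : ι → List (Option (Sym n))} {T : Finset Pixel}
    {G : ℤ → ℤ → Prop} {Post : α → World Pixel (Finset Pixel) → ℕ → Set Pixel → Prop}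
    (hp : Spec (TBox l r Kt) p (tw X D R) fun b w t _ =>
      t ≤ τ ∧ ∃ i, val i b ∧ w = tw X' (D' i) (R' i))
    (hT : Rep Sym.code (n + 5) Y T (tw X D R).mem G) (hX : l ≤ X ∧ X ≤ r)
    (hKt : cnt D + cnt R ≤ Kt) (hK : Kt + T.card + (n + 5) ≤ K + (cnt D + cnt R))
    (hS : ∀ w, Box l r (Y - 1) (Y + (n + 5 : ℕ)) K w → I w)
    (h : ∀ i a t U T', t ≤ (2 * (n + 5) + 3) * (τ + 1) → val i a →
      Rep Sym.code (n + 5) Y T' (tw X' (D' i) (R' i)).mem G →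
      T'.card + (cnt D + cnt R) = T.card + (cnt (D' i) + cnt (R' i)) → Post a ⟨(X', Y), T'⟩ t U) :
    Spec I (onStrip p) ⟨(X, Y), T⟩ Post := by
  have e := (tw_finite_wt X D R).2
  refine Spec.mono_inv (I := Box l r (Y - 1) (Y + (n + 5 : ℕ)) K) (.mk (by push_cast; omega)) hS ?_
  refine (compile_spec Sym.code_lt Sym.code_injective (by omega) p (c := X)
    (f := (tw X D R).mem) hp hT ⟨hX.1, hX.2, by simpa only [e] using hKt⟩ (by rw [e]; exact hK)).mono ?_
  rintro b ⟨q, T'⟩ t U - ⟨w', t', U', ⟨ht, i, hi, rfl⟩, -, rfl, h1, h2, h3⟩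
  rw [e, (tw_finite_wt X' (D' i) (R' i)).2] at h2
  exact h i _ _ _ _ (h3.trans (Nat.mul_le_mul_left _ (by omega))) hi h1 h2

section
variable {n : ℕ} {X Y l r : ℤ} {K : ℕ} {I : World Pixel (Finset Pixel) → Prop}
  {R : List (Option (Sym n))}

theorem decFirstOnStrip_spec {T : Finset Pixel} {G : ℤ → ℤ → Prop} (ds : List Bool)
    {Post : Bool → World Pixel (Finset Pixel) → ℕ → Set Pixel → Prop}
    (hT : Rep Sym.code (n + 5) Y T (tw X (ds.map bit ++ [some .lend]) (some .home :: R)).mem G)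
    (hl : l + ds.length + 2 ≤ X) (hr : X ≤ r)
    (hK : T.card + ds.length + n + 10 ≤ K + cnt (ds.map bit : List (Option (Sym n))))
    (hS : ∀ w, Box l r (Y - 1) (Y + (n + 5 : ℕ)) K w → I w)
    (h : ∀ b ds' t U T', t ≤ (2 * (n + 5) + 3) * (2 * ds.length + 6) → ds'.length = ds.length →
      (if b = true then bitsVal ds' + 1 = bitsVal ds else bitsVal ds = 0) →
      Rep Sym.code (n + 5) Y T' (tw X (ds'.map bit ++ [some .lend]) (some .home :: R)).mem G →
      T'.card + cnt (ds.map bit : List (Option (Sym n))) =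
        T.card + cnt (ds'.map bit : List (Option (Sym n))) → Post b ⟨(X, Y), T'⟩ t U) :
    Spec I (onStrip (decFirst (n := n))) ⟨(X, Y), T⟩ Post := by
  have hle := cnt_map_bit_le (n := n) ds
  refine onStrip_exists_spec (X' := X) (Kt := ds.length + cnt R + 2) (K := K) (l := l) (r := r)
    (val := fun (ds' : List Bool) b => ds'.length = ds.length ∧
        (if b = true then bitsVal ds' + 1 = bitsVal ds else bitsVal ds = 0))
    (D' := fun ds' => ds'.map bit ++ [some .lend]) (R' := fun _ => some .home :: R)
    (decFirst_spec ds hl hr le_rfl fun b ds' t _ h1 h2 h3 => ⟨h1, ds', ⟨h2, h3⟩, rfl⟩)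
    hT ⟨?_, hr⟩ ?_ ?_ hS fun ds' b t U T' ht hv h1 h2 => h b ds' t U T' ht hv.1 hv.2 h1 ?_
  · omega
  · simp only [cnt_append, cnt_some, cnt_nil]; omega
  · simp only [cnt_append, cnt_some, cnt_nil]; omega
  · simp only [cnt_append, cnt_some, cnt_nil] at h2; omega

/-- The marker `k` pixels left of the pointer, above the strip. -/
def Marker (X Y : ℤ) (n k : ℕ) : ℤ → ℤ → Prop :=
  Layers Y (fun _ _ => False) fun u v =>
    u = X ∧ v = Y + n + 5 ∨ u = X - 1 - k ∧ v = Y + n + 5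

/-- Each successful decrement shifts the marker by one, so the value `q` of the counter and the
displacement `k` of the marker always add up to the width. -/
theorem placeMarkerLoop_spec {w z : ℕ} (q : ℕ) {k : ℕ} {T : Finset Pixel} (ds : List Bool)
    (hq : bitsVal ds = q) (hk : k + q = w)
    (hT : Rep Sym.code (n + 5) Y T (tw X (ds.map bit ++ [some .lend]) (some .home :: R)).mem
      (Marker X Y n k))
    (hl : l + ds.length + w + 2 ≤ X) (hr : X ≤ r)
    (hK : T.card + ds.length + n + 10 ≤ K + cnt (ds.map bit : List (Option (Sym n))))
    (hS : ∀ w, Box l r (Y - 1) (Y + (n + 5 : ℕ)) K w → I w)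
    (hz : (2 * (n + 5) + 3) * (2 * ds.length + 6) + 2 * n + 2 * w + 17 ≤ z) :
    Spec I (Mach.iter (fun _ : Unit => do
      let b ← onStrip (decFirst (n := n))
      match b with
      | true => do
        shiftMarker n
        mv .up
        let s ← look
        pure (.inl ((), s, .down))
      | false => pure (.inr ())) () : GMach Unit) ⟨(X, Y), T⟩ fun _ w' t _ =>
      w'.pos = (X, Y) ∧ t ≤ (q + 1) * z ∧ ∃ ds' : List Bool, ds'.length = ds.length ∧
        Rep Sym.code (n + 5) Y w'.mem (tw X (ds'.map bit ++ [some .lend]) (some .home :: R)).mem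
          (Marker X Y n w) ∧
        w'.mem.card + cnt (ds.map bit : List (Option (Sym n))) =
          T.card + cnt (ds'.map bit : List (Option (Sym n))) := by
  have hle := cnt_map_bit_le (n := n) ds
  induction q generalizing k T ds with
  | zero =>
    refine Spec.iter (.bind (decFirstOnStrip_spec ds hT (by omega) hr hK hS
      fun b ds' t U T' ht h1 h2 h3 h4 => ?_))
    obtain rfl : b = false := by
      cases b with
      | false => rfl
      | true => rw [if_pos rfl] at h2; omega
    refine .pure ⟨rfl, ?_, ds', h1, ?_, h4⟩
    · simp only [Nat.zero_add, Nat.one_mul, Nat.add_zero]; clear * - ht hz; omega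
    · obtain rfl : k = w := by omega
      exact h3
  | succ q ih =>
    refine Spec.iter (.bind (decFirstOnStrip_spec ds hT (by omega) hr hK hS
      fun b ds' t U T' ht h1 h2 h3 h4 => ?_))
    obtain rfl : b = true := by
      cases b with
      | true => rfl
      | false => rw [if_neg (by simp)] at h2; omega
    rw [if_pos rfl] at h2
    have hle' := cnt_map_bit_le (n := n) ds'
    have hT2 := h3.mem_high
    refine .bind (Spec.mono_inv (I := Box l r (Y - 1) (Y + (n + 5 : ℕ)) K)
      (.mk (by push_cast; omega)) hS (shiftMarker_spec (k := k)
      (fun u v hv => hT2 u v (by push_cast; omega)) (by omega) (by push_cast; omega) (by omega)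
      fun t' U' T'' ht' c hlow hhigh => ?_))
    refine .bind (.moveUp rfl (hS _ (.mk (by push_cast; omega))) (.bind (.lookDecide (.pure ?_))))
    dsimp only
    rw [act_decide_down]
    refine ⟨hS _ (.mk (by push_cast; omega)), ?_⟩
    refine (ih (k := k + 1) ds' (by omega) (by omega)
      (h3.congr_high (fun u v hv => hlow u v (by push_cast at hv; omega))
        (fun u v hv => hhigh u v (by push_cast at hv; omega))) (by omega) (by omega)
      (by rw [h1]; exact hz) hle').mono ?_
    rintro _ w' t'' U'' - ⟨p1, p2, ds'', p3, p4, p5⟩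
    refine ⟨p1, ?_, ds'', by omega, p4, by omega⟩
    have e : (q + 1 + 1) * z = (q + 1) * z + z := by ring
    rw [e]
    generalize (q + 1) * z = y at *
    clear * - ht ht' hz p2 hk
    omega

end

section
variable {n : ℕ} {P : Polyomino} {X Y l r : ℤ} {K z : ℕ} {I : World Pixel (Finset Pixel) → Prop}

theorem placeMarker_spec {R : List (Option (Sym n))} {T : Finset Pixel} {w : ℕ}
    (hT : Rep Sym.code (n + 5) Y T (tw X (w.bits.map bit ++ [some .lend]) (some .home :: R)).mem
      (Marker X Y n 0))
    (hl : l + w.bits.length + w + 2 ≤ X) (hr : X ≤ r)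
    (hK : T.card + 2 * w.bits.length + n + 10 ≤ K)
    (hS : ∀ w, Box l r (Y - 1) (Y + (n + 5 : ℕ)) K w → I w)
    (hz : (2 * (n + 5) + 3) * (2 * w.bits.length + 6) + 2 * n + 2 * w + 17 ≤ z) :
    Spec I (placeMarker n) ⟨(X, Y), T⟩ fun _ w' t _ =>
      w'.pos = (X, Y) ∧ t ≤ (w + 2) * z ∧
        Rep Sym.code (n + 5) Y w'.mem (tw X [] (some .home :: R)).mem (Marker X Y n w) ∧
        w'.mem.card + cnt (w.bits.map bit : List (Option (Sym n))) + 1 = T.card := by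
  have hle := cnt_map_bit_le (n := n) w.bits
  refine .bind ((placeMarkerLoop_spec w w.bits (bitsVal_bits w) (by omega) hT hl hr (by omega)
    hS hz).mono ?_)
  rintro _ ⟨p, T'⟩ t U - ⟨rfl, ht, ds, h1, h2, h3⟩
  have hle' := cnt_map_bit_le (n := n) ds
  dsimp only at h3
  refine onStrip_spec (X' := X) (D' := []) (R' := some .home :: R) (Kt := ds.length + cnt R + 2)
    (a := ()) (τ := 2 * ds.length + 2)
    (clearLeft_spec (l := l) (r := r) ds (by omega) hr le_rfl fun U => ⟨rfl, rfl, le_rfl⟩) h2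
    (by omega) ?_ ?_ hS fun t' U' T'' ht' h4 h5 => ⟨rfl, ?_, h4, ?_⟩
  · simp only [cnt_append, cnt_some, cnt_nil]; omega
  · simp only [cnt_append, cnt_some, cnt_nil]; omega
  · have e : (w + 2) * z = (w + 1) * z + z := by ring
    have e' : (2 * (n + 5) + 3) * (2 * ds.length + 2 + 1) ≤
      (2 * (n + 5) + 3) * (2 * w.bits.length + 6) := Nat.mul_le_mul_left _ (by omega)
    rw [e]
    generalize (w + 1) * z = y at *
    clear * - ht ht' hz e'
    omega
  · simp only [cnt_append, cnt_some, cnt_nil] at h5; dsimp only; omega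

/-- The translate of `P` whose lower left corner is `(X - P.width, V)`. -/
def Target (P : Polyomino) (X V : ℤ) (u v : ℤ) : Prop :=
  (u - (X - P.width) + P.xMin, v - V + P.yMin) ∈ P.tiles

theorem Target.bounds {V u v : ℤ} (h : Target P X V u v) :
    X - P.width ≤ u ∧ u < X ∧ V ≤ v ∧ v < V + P.height := by
  have h1 := P.le_of_mem h
  have h2 := P.width_eq
  have h3 := P.height_eq
  omega

/-- The state before pixel `i` of row `j`, counted from below, is written. -/
structure BuildState (n : ℕ) (P : Polyomino) (X Y : ℤ) (c i j : ℕ) (T : Finset Pixel) : Prop where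
  rep : Rep (Sym.code (n := n)) (n + 5) Y T (tw X [] (some .home ::
    ((P.bitmap.take (P.bitmap.length - (j * P.width + i))).map bit ++ [some .rend]))).mem
    (Layers Y (fun _ _ => False)
      (Built (Target P X (Y + n + 5)) X (Y + n + 5) P.width i j))
  -- The constant `c` stands for the tiles of `P`, partly built and partly ones on the tape,
  -- together with `home`, right end mark, pointer and marker. The pebble is present only inside a
  -- row.
  card : T.card = c + if i = 0 then 0 else 1
  lt_width : i < P.width
  le_height : j ≤ P.height

/-- Induction on the number `q` of bits on the tape. The last bit of the bitmap belongs to the lower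
left corner of the box, so popping bits builds rows from below, each from left to right. -/
theorem buildLoop_spec {c : ℕ} (hl : l ≤ X) (hr : X + P.bitmap.length + 2 ≤ r)
    (hK : c + n + 20 ≤ K)
    (hS : ∀ w, Box l r (Y - 1) (Y + (n + 5 : ℕ)) K w → I w)
    (hB : ∀ w, Box (X - 1 - P.width) X Y (Y + n + 5 + P.height + 1) K w → I w)
    (hz : (2 * (n + 5) + 3) * (2 * P.bitmap.length + 7) + 2 * (n + P.width + P.height + 12) ≤ z)
    (q : ℕ) {i j : ℕ} {T : Finset Pixel} (hq : q + (j * P.width + i) = P.bitmap.length)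
    (h : BuildState n P X Y c i j T) :
    Spec I (buildLoop n (decide (i = 0))) ⟨(X, Y), T⟩ fun _ w t _ =>
      w.pos = (X, Y) ∧ t ≤ (q + 1) * z ∧ w.mem.card + 1 = c ∧
      Rep (Sym.code (n := n)) (n + 5) Y w.mem (tw X [] [some .home]).mem (Layers Y (fun _ _ => False)
        (Built (Target P X (Y + n + 5)) X (Y + n + 5) P.width 0 P.height)) := by
  have hw := P.width_eq
  have hh := P.height_eq
  induction q generalizing i j T with
  | zero =>
    have h1 := h.lt_width
    have hrep := h.rep
    have hcard := h.card
    obtain rfl : j = P.height := by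
      by_contra hj
      have := Nat.mul_le_mul_right P.width (Nat.succ_le_of_lt (lt_of_le_of_ne h.le_height hj))
      rw [P.length_bitmap] at hq
      rw [Nat.succ_mul] at this
      omega
    obtain rfl : i = 0 := by rw [P.length_bitmap] at hq; omega
    rw [show P.bitmap.length - (P.height * P.width + 0) = 0 by omega] at hrep
    simp only [List.take_zero, List.map_nil, List.nil_append] at hrep
    rw [if_pos rfl] at hcard
    refine Spec.iter (.bind (onStrip_spec (X' := X) (D' := []) (R' := [some .home]) (Kt := 2)
      (a := none) (τ := 2) (K := K) (l := l) (r := r)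
      (popBit_nil_spec hl (by omega) (by simp) fun U => ⟨rfl, rfl, le_rfl⟩)
      hrep (by omega) ?_ ?_ hS fun t' U' T'' ht' h4 h5 => .pure ⟨rfl, ?_, ?_, h4⟩))
    · simp only [cnt_some, cnt_nil]; omega
    · simp only [cnt_some, cnt_nil]; omega
    · have e' : (2 * (n + 5) + 3) * (2 + 1) ≤
        (2 * (n + 5) + 3) * (2 * P.bitmap.length + 7) := Nat.mul_le_mul_left _ (by omega)
      clear * - ht' e' hz
      omega
    · simp only [cnt_some, cnt_nil] at h5; dsimp only; omega
  | succ q ih =>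
    have h1 := h.lt_width
    have hrep := h.rep
    have hcard := h.card
    have hj : j < P.height := by
      by_contra hj
      have := Nat.mul_le_mul_right P.width (not_lt.1 hj)
      rw [P.length_bitmap] at hq
      omega
    -- The indices `i'` and `j'` describe the same pixel counted from the right and from the top, as
    -- the bitmap does.
    obtain ⟨i', hi'⟩ : ∃ i', P.width = i + 1 + i' := ⟨P.width - (i + 1), by omega⟩
    obtain ⟨j', hj'⟩ : ∃ j', P.height = j + 1 + j' := ⟨P.height - (j + 1), by omega⟩
    have hidx : j' * P.width + i' = q := by
      have e : P.height * P.width = j * P.width + P.width + j' * P.width := by rw [hj']; ring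
      rw [P.length_bitmap] at hq
      omega
    have htake := P.take_bitmap (i := i') (j := j') (by omega) (by omega)
    rw [hidx, show P.xMax - (i' : ℤ) = P.xMin + i by omega,
      show P.yMax - (j' : ℤ) = P.yMin + j by omega] at htake
    rw [show P.bitmap.length - (j * P.width + i) = q + 1 by omega, ← htake] at hrep
    have hlen : (P.bitmap.take q).length = q := by simp; omega
    have hsize := cnt_map_bit_append n (P.bitmap.take q) (decide ((P.xMin + (i : ℤ), P.yMin + (j : ℤ)) ∈ P.tiles))
    have hbit := Bool.toNat_le (decide ((P.xMin + (i : ℤ), P.yMin + (j : ℤ)) ∈ P.tiles))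
    have hb : decide ((P.xMin + (i : ℤ), P.yMin + (j : ℤ)) ∈ P.tiles) = true ↔
        Target P X (Y + n + 5) (X - P.width + i) (Y + n + 5 + j) := by
      rw [decide_eq_true_iff, Target]
      ring_nf
    generalize decide ((P.xMin + (i : ℤ), P.yMin + (j : ℤ)) ∈ P.tiles) = b at *
    have hT1 : T.card ≤ c + 1 := by split_ifs at hcard <;> omega
    refine Spec.iter (.bind (onStrip_spec (X' := X) (D' := [])
      (R' := some .home :: ((P.bitmap.take q).map bit ++ [some .rend]))
      (Kt := cnt ((P.bitmap.take q).map bit : List (Option (Sym n))) + 3)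
      (a := some b) (τ := 2 * q + 6) (K := K) (l := l) (r := r)
      (popBit_spec b (P.bitmap.take q) hl (by omega) (by simp only [cnt_nil]; omega)
        fun U => ⟨rfl, rfl, by omega⟩)
      hrep (by omega) ?_ ?_ hS fun t U T1 ht h3 h4 => ?_))
    · simp only [cnt_append, cnt_some, cnt_nil]; omega
    · simp only [cnt_append, cnt_some, cnt_nil]; omega
    · simp only [cnt_append, cnt_some, cnt_nil] at h4
      have hV1 := h3.mem_high
      have hV2 := h3.above_home
      have hbound : ∀ u v, Target P X (Y + n + 5) u v → X - P.width ≤ u ∧ u < X ∧ Y + n + 5 ≤ v :=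
        fun u v h => ⟨h.bounds.1, h.bounds.2.1, h.bounds.2.2.1⟩
      refine .bind (Spec.mono_inv (I := Box (X - 1 - P.width) X Y (Y + n + 5 + P.height + 1) K)
        (.mk (by omega)) hB (gotoPixel_spec (i := i) (j := j) (V := Y + n + 5) hbound h1
        (fun u v hv => hV1 u v (by push_cast; omega)) (fun v h5 h6 => hV2 v h5 (by omega)) (by omega)
        (by omega) (by omega) (by omega) fun t1 U1 T2 ht1 c2 hlow2 hhigh2 => ?_))
      have home2 : (X, Y) ∈ T2 := (hlow2 X Y (by omega)).2 h3.home
      have hV2' : ∀ v, Y < v → v < Y + n + 5 → (X, v) ∉ T2 := fun v h5 h6 h7 =>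
        hV2 v h5 (by omega) ((hlow2 X v h6).1 h7)
      refine .bind (Spec.mono_inv (I := Box (X - 1 - P.width) X Y (Y + n + 5 + P.height + 1) K)
        (.mk (by omega)) hB (writePixel_spec (i := i) (j := j) (V := Y + n + 5) hbound h1
        hb hhigh2 home2 hV2' (by omega) (by omega) (by omega) (by omega)
        fun t2 U2 T3 ht2 c3 hlow3 hhigh3 => ?_))
      have next : ∀ i₁ j₁ : ℕ, j₁ * P.width + i₁ = j * P.width + i + 1 → i₁ < P.width →
          j₁ ≤ P.height → T3.card = c + (if i₁ = 0 then 0 else 1) →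
          (∀ u v, Y + n + 5 ≤ v → ((u, v) ∈ T3 ↔
            Built (Target P X (Y + n + 5)) X (Y + n + 5) P.width i₁ j₁ u v)) →
          BuildState n P X Y c i₁ j₁ T3 := by
        intro i₁ j₁ e h5 h6 h7 h8
        refine ⟨?_, h7, h5, h6⟩
        rw [e, show P.bitmap.length - (j * P.width + i + 1) = q by omega]
        refine h3.congr_high (fun u v hv => ?_) fun u v hv => h8 u v (by push_cast at hv; omega)
        rw [hlow3 u v (by push_cast at hv; omega), hlow2 u v (by push_cast at hv; omega)]
      have hT3 : T3.card ≤ c + 1 := by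
        clear * - c3 c2 h4 hsize hcard; split_ifs at * <;> omega
      -- The next pixel, which may begin a new row; the loop variable `fresh` tells which case
      -- holds.
      obtain ⟨i₁, j₁, e1, e2, h5⟩ : ∃ i₁ j₁, decide (i + 1 = P.width) = decide (i₁ = 0) ∧
          j₁ * P.width + i₁ = j * P.width + i + 1 ∧ BuildState n P X Y c i₁ j₁ T3 := by
        by_cases hiw : i + 1 = P.width
        · exact ⟨0, j + 1, by simp [hiw], by rw [Nat.succ_mul]; omega,
            next 0 (j + 1) (by rw [Nat.succ_mul]; omega) P.width_pos hj
              (by clear * - c3 c2 h4 hsize hcard hiw; split_ifs at * <;> omega)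
              (fun u v hv => by rw [hhigh3 u v hv, if_pos hiw])⟩
        · exact ⟨i + 1, j, by simp [hiw], by ring,
            next (i + 1) j (by ring) (by omega) hj.le
              (by clear * - c3 c2 h4 hsize hcard hiw; split_ifs at * <;> omega)
              (fun u v hv => by rw [hhigh3 u v hv, if_neg hiw])⟩
      refine again_spec (hB _ (.mk (by omega))) fun U3 => ?_
      dsimp only
      rw [act_decide_down, e1]
      refine ⟨hB _ (.mk (by omega)), (ih (by omega) h5).mono ?_⟩
      rintro _ w'' t₃ U₃ - ⟨p1, p2, p3, p4⟩
      refine ⟨p1, ?_, p3, p4⟩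
      have e : (q + 1 + 1) * z = (q + 1) * z + z := by ring
      have e' : (2 * (n + 5) + 3) * (2 * q + 6 + 1) ≤
        (2 * (n + 5) + 3) * (2 * P.bitmap.length + 7) := Nat.mul_le_mul_left _ (by omega)
      rw [e]
      generalize (q + 1) * z = y at *
      clear * - ht ht1 ht2 hz p2 e' h1 hj
      omega

end

/-- Build the polyomino that is described on the tape. -/
noncomputable def build (n : ℕ) : GMach Unit := do
  buildStart n
  placeMarker n
  buildLoop n true
  buildEnd

section
variable {n : ℕ} {P : Polyomino} {X Y l r : ℤ} {K z : ℕ} {I : World Pixel (Finset Pixel) → Prop}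

theorem Target.isTranslate {V : ℤ} {T : Finset Pixel} (h : ∀ u v, (u, v) ∈ T ↔ Target P X V u v) :
    P.IsTranslate T := by
  refine ⟨(X - P.width - P.xMin, V - P.yMin), ?_⟩
  ext ⟨u, v⟩
  rw [h, Finset.mem_image]
  constructor
  · intro h
    refine ⟨_, h, ?_⟩
    ext <;> simp
  · rintro ⟨⟨a, b⟩, h1, h2⟩
    obtain ⟨rfl, rfl⟩ := Prod.mk.inj h2
    rw [Target]
    convert h1 using 2 <;> simp <;> ring

theorem Rep.mem_tape_home {T : Finset Pixel} {high : ℤ → ℤ → Prop}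
    (h : Rep (Sym.code (n := n)) (n + 5) Y T (tw X [] [some .home]).mem
      (Layers Y (fun _ _ => False) high)) (u v : ℤ) (hv : v < Y + n + 5) :
    (u, v) ∈ T ↔ u = X ∧ v = Y := by
  by_cases hY : v < Y
  · rw [h.mem_low u v hY]
    simp only [false_iff]
    omega
  · rw [h, if_pos (by push_cast; omega)]
    constructor
    · rintro ⟨s, hs, rfl⟩
      have hu : u = X := by
        by_contra hu
        simp only [tw] at hs
        split_ifs at hs with h1
        · simp at hs
        · rw [show (u - X).toNat = (u - X).toNat - 1 + 1 by omega] at hs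
          simp at hs
      subst hu
      have := tw_mem_add u [] [some (.home : Sym n)] 0
      rw [show u + ((0 : ℕ) : ℤ) = u by simp, hs] at this
      obtain rfl : s = .home := by simpa using this
      simp [Sym.code]
    · rintro ⟨rfl, rfl⟩
      have := tw_mem_add u [] [some (.home : Sym n)] 0
      rw [show u + ((0 : ℕ) : ℤ) = u by simp] at this
      exact ⟨.home, by simpa using this, by simp [Sym.code]⟩

/-- The height is not needed: the tape running empty ends the construction. Of the digits only the
width is used, and it is erased before the first pixel is written. -/
theorem build_spec {T : Finset Pixel} (hT : Ready n P Y X T)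
    (hl : l + 2 * P.width + 2 ≤ X) (hr : X + P.bitmap.length + 2 ≤ r)
    (hK : P.tiles.card + 3 * P.width + n + 30 ≤ K)
    (hS : ∀ w, Box l r (Y - 1) (Y + (n + 5 : ℕ)) K w → I w)
    (hB : ∀ w, Box (X - 1 - P.width) X Y (Y + n + 5 + P.height + 1) K w → I w)
    (hz : (2 * (n + 5) + 3) * (2 * P.bitmap.length + 7) + 2 * (n + P.width + P.height + 12) ≤ z) :
    Spec I (build n) ⟨(X, Y), T⟩ fun _ w t _ =>
      P.IsTranslate w.mem ∧ t ≤ (P.bitmap.length + P.width + 4) * z := by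
  have hbits : P.width.bits.length ≤ P.width := length_bits_le _
  have hcnt := P.cnt_bitmap n
  have hle := cnt_map_bit_le (n := n) P.width.bits
  have hlen : P.width ≤ P.bitmap.length := by
    rw [P.length_bitmap]; exact Nat.le_mul_of_pos_left _ P.height_pos
  have hcard := (show Rep _ _ _ _ _ _ from hT).card_eq_wt Sym.code_lt
  rw [(tw_finite_wt _ _ _).2] at hcard
  simp only [cnt_append, cnt_some, cnt_nil, hcnt] at hcard
  have hT' : Rep (Sym.code (n := n)) (n + 5) Y T (tw X (P.width.bits.map bit ++ [some .lend])
      (some .home :: (P.bitmap.map bit ++ [some .rend]))).mem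
      (Layers Y (fun _ _ => False) fun _ _ => False) := by
    have e : Layers Y (fun _ _ => False) (fun _ _ => False) = fun _ _ => False := by
      funext u v; simp [Layers]
    rw [e]; exact hT
  have hV := hT'.mem_high
  refine .bind (Spec.mono_inv (I := Box l r (Y - 1) (Y + (n + 5 : ℕ)) K)
    (.mk (by push_cast; omega)) hS (buildStart_spec
      (fun u v hv => by rw [hV u v (by push_cast; omega)]; exact not_false)
      (by omega) (by push_cast; omega) (by omega) fun U T1 c1 hlow1 hhigh1 => ?_))
  have h1 : Rep (Sym.code (n := n)) (n + 5) Y T1 (tw X (P.width.bits.map bit ++ [some .lend])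
      (some .home :: (P.bitmap.map bit ++ [some .rend]))).mem (Marker X Y n 0) :=
    hT'.congr_high (fun u v hv => hlow1 u v (by push_cast at hv; omega))
      fun u v hv => hhigh1 u v (by push_cast at hv; omega)
  have hz' : (2 * (n + 5) + 3) * (2 * P.width.bits.length + 6) + 2 * n + 2 * P.width + 17 ≤ z := by
    have e' : (2 * (n + 5) + 3) * (2 * P.width.bits.length + 6) ≤
      (2 * (n + 5) + 3) * (2 * P.bitmap.length + 7) := Nat.mul_le_mul_left _ (by omega)
    clear * - e' hz
    omega
  refine .bind ((placeMarker_spec h1 (by omega) (by omega) (by omega) hS hz').mono ?_)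
  rintro _ ⟨p, T2⟩ t2 U2 - ⟨rfl, ht2, h2, c2⟩
  dsimp only at c2 h2 ⊢
  -- With the width erased, the strip and its surroundings contain just the bitmap, `home`, the
  -- right end mark, pointer and marker.
  have hst : BuildState n P X Y (P.tiles.card + 4) 0 0 T2 := by
    refine ⟨?_, by rw [if_pos rfl]; omega, P.width_pos, by omega⟩
    rw [show P.bitmap.length - (0 * P.width + 0) = P.bitmap.length by omega, List.take_length]
    refine h2.congr_high (fun u v hv => Iff.rfl) fun u v hv => ?_
    rw [h2.mem_high u v hv]
    unfold Built
    have hb : ∀ {u v}, Target P X (Y + n + 5) u v → X - P.width ≤ u ∧ Y + n + 5 ≤ v :=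
      fun h => ⟨h.bounds.1, h.bounds.2.2.1⟩
    push_cast
    grind
  refine .bind ((buildLoop_spec (by omega) hr (by omega) hS hB hz P.bitmap.length (by omega)
    hst).mono ?_)
  rintro _ ⟨p, T3⟩ t3 U3 - ⟨rfl, ht3, c3, h3⟩
  dsimp only at c3 h3 ⊢
  have hV3 := h3.mem_high
  refine Spec.mono_inv (I := Box (X - 1 - P.width) X Y (Y + n + 5 + P.height + 1) K)
    (.mk (by omega)) hB (buildEnd_spec (w := P.width) (h := P.height) (V := Y + n + 5)
      (fun u v h => h.bounds) (fun u v hv => hV3 u v (by push_cast; omega)) h3.mem_tape_home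
      (by omega) (by omega) (by omega) P.width_pos (by omega)
      fun t U p T4 ht4 h4 => ⟨Target.isTranslate h4, ?_⟩)
  have e : (P.bitmap.length + P.width + 4) * z = (P.width + 2) * z + ((P.bitmap.length + 1) * z + z) := by
    ring
  have e' : n ≤ (2 * (n + 5) + 3) * (2 * P.bitmap.length + 7) :=
    (show n ≤ (2 * (n + 5) + 3) by omega).trans (Nat.le_mul_of_pos_right _ (by omega))
  rw [e]
  generalize (P.width + 2) * z = a at *
  generalize (P.bitmap.length + 1) * z = b at *
  generalize (2 * (n + 5) + 3) * (2 * P.bitmap.length + 7) = c at *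
  clear * - ht2 ht3 ht4 hz e'
  omega

end

/-! ### From finite controls to robots. -/

section
variable {σ : Type*} {step : σ → Option σ} {a b : σ} {t : ℕ}

theorem runFor_succ_of_step (h : step a = some b) (t : ℕ) :
    runFor step a (t + 1) = runFor step b t := by
  rw [runFor, Function.iterate_succ_apply, h]; rfl

theorem HaltsIn.of_step (h : step a = some b) (ht : HaltsIn step b t) :
    HaltsIn step a (t + 1) := by
  refine ⟨?_, ?_⟩
  · show step (runFor step a (t + 1)) = none
    rw [runFor_succ_of_step h]; exact ht.1
  · rintro (_ | s) hs
    · have : step a = none := hs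
      rw [h] at this; cases this
    · have : step (runFor step a (s + 1)) = none := hs
      rw [runFor_succ_of_step h] at this
      exact Nat.succ_le_succ (ht.2 this)

end

/-- The robot of a finite control. -/
def Mach.toRobot {α : Type} (m : GMach α) : Robot m.Q where
  start := m.start
  δ q s := match m.δ q s with
    | .inl _ => none
    | .inr x => some x

/-- Returning a value becomes termination, and the steps correspond one to one. Both directions
between times and worlds are needed: one for upper bounds on tiles and space, the other to know that
certain pixels are visited. -/
theorem Mach.Trace.robot {α : Type} {m : GMach α} {q : m.Q} {w w' : World Pixel (Finset Pixel)}
    {tr : List (World Pixel (Finset Pixel))} {a : α} (h : Trace m q w tr a w') :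
    HaltsIn m.toRobot.step ⟨q, w.pos, w.mem⟩ tr.length ∧
    (runFor m.toRobot.step ⟨q, w.pos, w.mem⟩ tr.length).tiles = w'.mem ∧
    (∀ i ≤ tr.length, ∃ x ∈ tr ++ [w'],
      (runFor m.toRobot.step ⟨q, w.pos, w.mem⟩ i).pos = x.pos ∧
      (runFor m.toRobot.step ⟨q, w.pos, w.mem⟩ i).tiles = x.mem) ∧
    ∀ x ∈ tr, ∃ i ≤ tr.length, (runFor m.toRobot.step ⟨q, w.pos, w.mem⟩ i).pos = x.pos := by
  induction h with
  | @done q w a h =>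
    have hs : m.toRobot.step ⟨q, w.pos, w.mem⟩ = none := by
      have h' : m.δ q (decide (w.pos ∈ w.mem)) = .inl a := h
      simp [Robot.step, toRobot, h']
    refine ⟨⟨hs, fun i _ => Nat.zero_le i⟩, rfl, ?_, by simp⟩
    rintro i hi
    obtain rfl : i = 0 := by simpa using hi
    exact ⟨w, by simp, rfl, rfl⟩
  | @step q w q' s d tr a w' h _ ih =>
    have hs : m.toRobot.step ⟨q, w.pos, w.mem⟩ = some ⟨q', (w.act s d).pos, (w.act s d).mem⟩ := by
      have h' : m.δ q (decide (w.pos ∈ w.mem)) = .inr (q', s, d) := h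
      simp only [Robot.step, toRobot, h', Option.map_some]
      rfl
    obtain ⟨h1, h2, h3, h4⟩ := ih
    refine ⟨h1.of_step hs, ?_, ?_, ?_⟩
    · rw [List.length_cons, runFor_succ_of_step hs]; exact h2
    · rintro (_ | i) hi
      · exact ⟨w, by simp, rfl, rfl⟩
      · obtain ⟨x, hx, h5⟩ := h3 i (by simpa using hi)
        rw [runFor_succ_of_step hs]
        exact ⟨x, by simp only [List.cons_append, List.mem_cons]; exact .inr hx, h5⟩
    · intro x hx
      rcases List.mem_cons.1 hx with rfl | hx
      · exact ⟨0, Nat.zero_le _, rfl⟩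
      · obtain ⟨i, hi, h5⟩ := h4 x hx
        exact ⟨i + 1, by simpa using hi, by rw [runFor_succ_of_step hs]; exact h5⟩

end TileRobot

/-! ### The complete robot and its resources. -/

namespace TileRobot
open Mach Turing

section Transform

universe u v
variable {n k : ℕ} {Γ : Type u} {Λ : Type v} [Inhabited Γ] [Inhabited Λ] {M : TM0.Machine Γ Λ}
  {letter : Option Bool → Γ} {e : Γ ≃ Fin n} {eΛ : Λ ≃ Fin k} {P P' : Polyomino} {τ : ℕ}

/-- Read the polyomino and simulate the Turing machine. -/
noncomputable def compute (M : TM0.Machine Γ Λ) (letter : Option Bool → Γ) (e : Γ ≃ Fin n)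
    (eΛ : Λ ≃ Fin k) : GMach Unit := do
  growBox
  readAll n
  onStrip (simulate (fun b => e (letter b)) (transFun M e eΛ) (eΛ default))

/-- Transform a polyomino as the Turing machine transforms its description. -/
noncomputable def transform (M : TM0.Machine Γ Λ) (letter : Option Bool → Γ) (e : Γ ≃ Fin n)
    (eΛ : Λ ≃ Fin k) : GMach Unit := do
  (do compute M letter e eΛ
      onStrip (normalize fun a => Function.invFun letter (e.symm a)))
  build n

/-- The surroundings of `P`, and a strip above `P` of width `O(|P|² + s)`. -/
def Workspace (n s K : ℕ) (P : Polyomino) (w : World Pixel (Finset Pixel)) : Prop :=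
  Box (P.xMax - P.tiles.card - 6) (P.xMax + P.tiles.card + 10) (P.yMax - P.tiles.card - 6)
    (P.yMax + n + P.tiles.card + 14) K w ∨
  Box (P.xMax - 4 * P.tiles.card - s - 7) (P.xMax + (P.tiles.card ^ 2 : ℕ) + s + 6)
    (P.yMax + 2 - 1) (P.yMax + 2 + (n + 5 : ℕ)) K w

theorem Polyomino.width_le_card (P : Polyomino) : P.width ≤ P.tiles.card :=
  P.width_le.trans P.boundary_le

theorem Polyomino.height_le_card (P : Polyomino) : P.height ≤ P.tiles.card :=
  P.height_le.trans P.boundary_le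

theorem Polyomino.length_bitmap_le (P : Polyomino) : P.bitmap.length ≤ P.tiles.card ^ 2 := by
  rw [P.length_bitmap, sq]
  exact Nat.mul_le_mul P.height_le_card P.width_le_card

theorem compute_spec {K : ℕ} {s : Pixel} (hs : s ∈ P.tiles) (hblank : letter none = default)
    (hhalt : tmStep M (conf M (P.encode.map letter) τ) = none)
    (hrun : ∀ i < τ, tmStep M (conf M (P.encode.map letter) i) ≠ none)
    (hK : P.tiles.card + P.width + P.height + tmAdditionalSpace M (P.encode.map letter) τ +
      n + 50 ≤ K) :
    Spec (Workspace n (tmAdditionalSpace M (P.encode.map letter) τ) K P)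
      (compute M letter e eΛ) ⟨s, P.tiles⟩ fun _ w t U =>
        t ≤ (400 * n + 8000) * (P.tiles.card ^ 4 + τ) ∧
        (∃ f a b, Simulated M e letter (fun b => e (letter b)) P τ w.pos w.mem f a b) ∧
        ∀ k : ℕ, k < P.tiles.card → ∀ u, P.xMax + 2 ≤ u → u ≤ P.xMax + 2 + k →
          (u, P.yMax + 2 + n + 5 + k) ∈ U := by
  have hw := P.width_eq
  have hh := P.height_eq
  have hw' := P.width_le_card
  have hh' := P.height_le_card
  have hL := P.length_bitmap_le
  have hN : 0 < P.tiles.card := P.nonempty.card_pos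
  have hN2 : P.tiles.card ≤ P.tiles.card ^ 2 := Nat.le_self_pow (by norm_num) _
  have hb := P.le_of_mem (u := s.1) (v := s.2) hs
  generalize hS : tmAdditionalSpace M (P.encode.map letter) τ = S at *
  -- The tape work for one pixel is linear in the length of the tape, hence quadratic in the number
  -- of tiles.
  have hz : (2 * (n + 5) + 3) * (2 * P.bitmap.length + 2 * P.width + 2 * P.height + 8) ≤
      (30 * n + 254) * P.tiles.card ^ 2 := by
    refine (Nat.mul_le_mul_left _ (show _ ≤ 14 * P.tiles.card ^ 2 by omega)).trans ?_
    nlinarith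
  have hz' : 2 * n + 4 * P.bitmap.length + 4 * (P.width + P.height) + 60 ≤
      (30 * n + 254) * P.tiles.card ^ 2 := by nlinarith
  have hg := growBox_spec (K := K) (P := P) (x₀ := P.xMax - P.tiles.card - 6)
    (x₁ := P.xMax + P.tiles.card + 10) (y₀ := P.yMax - P.tiles.card - 6)
    (y₁ := P.yMax + n + P.tiles.card + 14) (by omega) (by omega) (by omega) hs
  refine .bind ((Spec.mono_inv (I := Box _ _ _ _ K) (.mk (by omega)) (fun w hw => .inl hw)
    hg).mono ?_)
  rintro _ ⟨p, T1⟩ t1 U1 - ⟨rfl, hO, ht1⟩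
  refine .bind ((readAll_spec (l := P.xMax - 4 * P.tiles.card - S - 7)
    (r := P.xMax + (P.tiles.card ^ 2 : ℕ) + S + 6) hO (by omega) (by omega) (by omega) (by omega)
    (by omega) (fun w hw => .inl hw) (fun w hw => .inr hw) hz hz').mono ?_)
  rintro _ ⟨p, T2⟩ t2 U2 - ⟨rfl, hT2, ht2, hU2⟩
  refine (simulateOnStrip_spec (l := P.xMax - 4 * P.tiles.card - S - 7)
    (r := P.xMax + (P.tiles.card ^ 2 : ℕ) + S + 6) (K := K) hT2 (fun _ => rfl) hblank hhalt hrun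
    (by omega) (by omega) (by omega) (fun w hw => .inr hw)).mono ?_
  rintro _ ⟨p, T3⟩ t3 U3 - ⟨ht3, h3⟩
  refine ⟨?_, h3, fun k hk u hu hu' => .inr (.inl (hU2 k hk u hu hu'))⟩
  clear * - ht1 ht2 ht3 hw' hh' hL hN hN2
  generalize P.tiles.card = N at *
  have e1 : (9 * (P.width + P.height) + 12) * (17 * (P.width + P.height + 4) + 60) ≤
    (30 * N) * (162 * N) := Nat.mul_le_mul (by omega) (by omega)
  -- The dominating term: quadratically many pixels with quadratic cost each.
  have e2 : (P.bitmap.length + 1) * (5 * ((30 * n + 254) * N ^ 2)) ≤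
    (2 * N ^ 2) * (5 * ((30 * n + 254) * N ^ 2)) := Nat.mul_le_mul_right _ (by omega)
  have e3 : (2 * (n + 5) + 3) * (5 * τ + P.width + P.height + 10) ≤
    (2 * (n + 5) + 3) * (5 * τ + 12 * N ^ 2) := Nat.mul_le_mul_left _ (by omega)
  have e4 : N ^ 2 ≤ N ^ 4 := Nat.pow_le_pow_right hN (by norm_num)
  have e5 : n * N ^ 2 ≤ n * N ^ 4 := Nat.mul_le_mul_left _ e4
  nlinarith

/-- The pixels in which a polyomino is built. -/
def Site (n K : ℕ) (P : Polyomino) (X Y : ℤ) (w : World Pixel (Finset Pixel)) : Prop :=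
  Box (X - 1 - P.width) X Y (Y + n + 5 + P.height + 1) K w

/-- Each step of the Turing machine reaches at most one new cell. Thus time that is linear in the
additional space, as for normalizing, is covered by the running time of the machine. -/
theorem tmAdditionalSpace_le (x : List Γ) : tmAdditionalSpace M x τ ≤ τ + 1 := by
  refine (Finset.card_le_card (t := (Finset.range (τ + 1)).image fun i => (conf M x i).2)
    fun j hj => ?_).trans (Finset.card_image_le.trans (Finset.card_range _).le)
  obtain ⟨⟨i, hi, rfl⟩, -⟩ := mem_additionalCells.1 hj
  exact Finset.mem_image_of_mem _ (Finset.mem_range.2 (by omega))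

/-- All resources of one run. The last two clauses are the witnesses for the lower bound on space:
the triangle, and for each additional cell a visited pixel of its column above the box. -/
theorem transform_trace {K : ℕ} {s : Pixel} (hs : s ∈ P.tiles) (hcard : P'.tiles.card = P.tiles.card)
    (hletter : letter.Injective) (hblank : letter none = default)
    (htrans : TransformsIn M (P.encode.map letter) (P'.encode.map letter) τ)
    (hK : P.tiles.card + P.width + P.height + 3 * P'.width +
      tmAdditionalSpace M (P.encode.map letter) τ + n + 50 ≤ K) :
    ∃ tr w', Trace (transform M letter e eΛ) (transform M letter e eΛ).start ⟨s, P.tiles⟩ tr () w' ∧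
      P'.IsTranslate w'.mem ∧ tr.length ≤ (700 * n + 10000) * (P.tiles.card ^ 4 + τ) ∧
      (∃ z, ∀ x ∈ tr ++ [w'], Workspace n (tmAdditionalSpace M (P.encode.map letter) τ) K P x ∨
        Site n K P' z (P.yMax + 2) x) ∧
      (∀ k : ℕ, k < P.tiles.card → ∀ u, P.xMax + 2 ≤ u → u ≤ P.xMax + 2 + k →
        ∃ x ∈ tr, x.pos = (u, P.yMax + 2 + n + 5 + k)) ∧
      ∀ j ∈ additionalCells M (P.encode.map letter) τ,
        ∃ x ∈ tr, x.pos.1 = origin n P + j ∧ P.yMax < x.pos.2 := by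
  obtain ⟨⟨hhalt, hleast⟩, c, hy⟩ := htrans
  have hrun : ∀ i < τ, tmStep M (conf M (P.encode.map letter) i) ≠ none := fun i hi h =>
    absurd (hleast h) (by omega)
  have hw := P.width_eq
  have hh := P.height_eq
  have hw' := P.width_le_card
  have hh' := P.height_le_card
  have hw2 := P'.width_le_card
  have hh2 := P'.height_le_card
  have hL := P.length_bitmap_le
  have hL2 := P'.length_bitmap_le
  have hN : 0 < P.tiles.card := P.nonempty.card_pos
  have hN2 : P.tiles.card ≤ P.tiles.card ^ 2 := Nat.le_self_pow (by norm_num) _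
  have hb := P.le_of_mem (u := s.1) (v := s.2) hs
  have hτ := tmAdditionalSpace_le (M := M) (τ := τ) (P.encode.map letter)
  rw [hcard] at hw2 hh2 hL2
  have hdig := length_digits_le (n := n) (P := P)
  have henc := length_encode n P
  generalize hS : tmAdditionalSpace M (P.encode.map letter) τ = S at *
  have first : Spec (Workspace n S K P) (do
      compute M letter e eΛ
      onStrip (normalize fun a => Function.invFun letter (e.symm a))) ⟨s, P.tiles⟩ fun _ w t U =>
        t ≤ (400 * n + 8000) * (P.tiles.card ^ 4 + τ) +
          (2 * (n + 5) + 3) * (3 * (P.encode.length + 2 * S + 5)) ∧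
        (∃ z, P.xMax - 4 * P.tiles.card - S - 7 + 2 * P'.width + 2 ≤ z ∧
          z + P'.bitmap.length + 2 ≤ P.xMax + (P.tiles.card ^ 2 : ℕ) + S + 6 ∧
          w.pos = (z, P.yMax + 2) ∧ Ready n P' (P.yMax + 2) z w.mem) ∧
        (∀ k : ℕ, k < P.tiles.card → ∀ u, P.xMax + 2 ≤ u → u ≤ P.xMax + 2 + k →
          (u, P.yMax + 2 + n + 5 + k) ∈ U) ∧
        ∀ j ∈ additionalCells M (P.encode.map letter) τ,
          ∃ v, P.yMax < v ∧ (origin n P + j, v) ∈ U := by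
    have hc := compute_spec (K := K) (e := e) (eΛ := eΛ) hs hblank hhalt hrun
      (by rw [hS]; omega)
    rw [hS] at hc
    refine .bind (hc.frame.mono ?_)
    rintro _ ⟨p, T1⟩ t1 U1 - ⟨⟨ht1, ⟨f, a, b, hsim⟩, htri⟩, hframe⟩
    have hn := normalizeOnStrip_spec (P' := P') (K := K) (c := c)
      (I := Workspace n S K P) (l := P.xMax - 2 * P.tiles.card - S - 7)
      (r := P.xMax + (P.tiles.card ^ 2 : ℕ) + S + 5) hletter hsim (fun _ => rfl) hblank hy
      (by omega) (by omega) (by omega) (by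
        rintro w ⟨h1, h2, h3⟩
        exact .inr ⟨by omega, by omega, h3⟩)
    rw [hS] at hn
    refine hn.mono ?_
    rintro _ ⟨p, T2⟩ t2 U2 - ⟨ht2, z, hz1, hz2, hp, hready⟩
    refine ⟨by omega, ⟨z, by omega, by omega, hp, hready⟩,
      fun k hk u hu hu' => .inl (htri k hk u hu hu'), fun j hj => ?_⟩
    -- The additional cell shows a tile in the strip. No tile was there at the start, so by the
    -- frame property the pixel has been visited.
    obtain ⟨v, hv, hv'⟩ := hsim.exists_pixel hj
    refine ⟨v, by omega, .inl ?_⟩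
    by_contra hU
    have := P.le_of_mem ((hframe _ hU).1 hv')
    omega
  obtain ⟨tr1, _, ⟨p, T1⟩, h1, hI1, hI1', ht1, ⟨z, hz1, hz2, hp, hready⟩, htri, hcells⟩ :=
    first (.inl (Box.mk (x := s.1) (y := s.2) (by omega)))
  obtain rfl : p = (z, P.yMax + 2) := hp
  have hz : (2 * (n + 5) + 3) * (2 * P'.bitmap.length + 7) +
      2 * (n + P'.width + P'.height + 12) ≤ (20 * n + 145) * P.tiles.card ^ 2 := by
    have e1 : (2 * (n + 5) + 3) * (2 * P'.bitmap.length + 7) ≤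
      (2 * (n + 5) + 3) * (9 * P.tiles.card ^ 2) := Nat.mul_le_mul_left _ (by omega)
    nlinarith
  have hTcard : T1.card ≤ K := by
    rcases hI1' with h | h
    exacts [h.2.2.2.2, h.2.2.2.2]
  obtain ⟨tr2, _, w2, h2, hI2, hI2', htr, ht2⟩ := build_spec (K := K)
    (I := fun w => Workspace n S K P w ∨ Site n K P' z (P.yMax + 2) w)
    (l := P.xMax - 4 * P.tiles.card - S - 7) (r := P.xMax + (P.tiles.card ^ 2 : ℕ) + S + 6)
    hready hz1 hz2 (by omega) (fun w hw => .inl (.inr hw)) (fun w hw => .inr hw) hz (.inl hI1')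
  refine ⟨tr1 ++ tr2, w2, h1.bind h2, htr, ?_, ⟨z, ?_⟩, ?_, ?_⟩
  · rw [List.length_append]
    have e1 : (P'.bitmap.length + P'.width + 4) * ((20 * n + 145) * P.tiles.card ^ 2) ≤
      (6 * P.tiles.card ^ 2) * ((20 * n + 145) * P.tiles.card ^ 2) :=
      Nat.mul_le_mul_right _ (by omega)
    -- Here `S ≤ τ + 1` turns the time for normalizing into a multiple of N² and τ.
    have e2 : (2 * (n + 5) + 3) * (3 * (P.encode.length + 2 * S + 5)) ≤
      (2 * (n + 5) + 3) * (36 * P.tiles.card ^ 2 + 6 * τ) := Nat.mul_le_mul_left _ (by omega)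
    have e4 : P.tiles.card ^ 2 ≤ P.tiles.card ^ 4 := Nat.pow_le_pow_right hN (by norm_num)
    have e5 : n * P.tiles.card ^ 2 ≤ n * P.tiles.card ^ 4 := Nat.mul_le_mul_left _ e4
    clear * - e1 e2 e4 e5 ht1 ht2
    generalize P.tiles.card = N at *
    nlinarith
  · intro x hx
    rw [List.append_assoc, List.mem_append, List.mem_append, List.mem_singleton] at hx
    rcases hx with hx | hx | rfl
    exacts [.inl (hI1 x hx), hI2 x hx, hI2']
  · intro k hk u hu hu'
    obtain ⟨x, hx, h⟩ := htri k hk u hu hu'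
    exact ⟨x, List.mem_append_left _ hx, h⟩
  · intro j hj
    obtain ⟨v, hv, x, hx, h⟩ := hcells j hj
    exact ⟨x, List.mem_append_left _ hx, by rw [h], by rw [h]; exact hv⟩

end Transform

theorem card_pixel_Icc (a b c d : ℤ) :
    (Finset.Icc a b ×ˢ Finset.Icc c d : Finset Pixel).card =
      (b + 1 - a).toNat * (d + 1 - c).toNat := by
  rw [Finset.card_product, Int.card_Icc, Int.card_Icc]

/-- The pixels of the workspace and of the site. -/
theorem card_visited_le {n S K : ℕ} {P P' : Polyomino} (hcard : P'.tiles.card = P.tiles.card)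
    {X : ℤ} {A : Finset Pixel} (hA : ∀ p ∈ A, ∃ x : World Pixel (Finset Pixel), p = x.pos ∧
      (Workspace n S K P x ∨ Site n K P' X (P.yMax + 2) x)) :
    A.card ≤ (1000 * n + 20000) * (P.tiles.card ^ 2 + S) := by
  have hw2 := P'.width_le_card
  have hh2 := P'.height_le_card
  have hN : 0 < P.tiles.card := P.nonempty.card_pos
  have hN2 : P.tiles.card ≤ P.tiles.card ^ 2 := Nat.le_self_pow (by norm_num) _
  rw [hcard] at hw2 hh2
  unfold Workspace Site at hA
  generalize P.tiles.card = N at *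
  have hsub : A ⊆ (Finset.Icc (P.xMax - N - 6) (P.xMax + N + 10) ×ˢ
        Finset.Icc (P.yMax - N - 6) (P.yMax + n + N + 14)) ∪
      (Finset.Icc (P.xMax - 4 * N - S - 7) (P.xMax + (N ^ 2 : ℕ) + S + 6) ×ˢ
        Finset.Icc (P.yMax + 2 - 1) (P.yMax + 2 + (n + 5 : ℕ))) ∪
      (Finset.Icc (X - 1 - P'.width) X ×ˢ
        Finset.Icc (P.yMax + 2) (P.yMax + 2 + n + 5 + P'.height + 1)) := by
    intro p hp
    obtain ⟨x, rfl, h⟩ := hA p hp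
    simp only [Finset.mem_union, Finset.mem_product, Finset.mem_Icc]
    rcases h with (⟨h1, h2, h3, h4, -⟩ | ⟨h1, h2, h3, h4, -⟩) | ⟨h1, h2, h3, h4, -⟩
    exacts [.inl (.inl ⟨⟨h1, h2⟩, h3, h4⟩), .inl (.inr ⟨⟨h1, h2⟩, h3, h4⟩), .inr ⟨⟨h1, h2⟩, h3, h4⟩]
  refine (Finset.card_le_card hsub).trans ((Finset.card_union_le _ _).trans
    ((Nat.add_le_add_right (Finset.card_union_le _ _) _).trans ?_))
  rw [card_pixel_Icc, card_pixel_Icc, card_pixel_Icc]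
  have e1 : (P.xMax + N + 10 + 1 - (P.xMax - N - 6)).toNat *
      (P.yMax + n + N + 14 + 1 - (P.yMax - N - 6)).toNat ≤ (19 * N) * ((n + 23) * N) :=
    Nat.mul_le_mul (by omega) (by
      have : n + 2 * N + 21 ≤ (n + 23) * N := by nlinarith
      omega)
  have e2 : (P.xMax + (N ^ 2 : ℕ) + S + 6 + 1 - (P.xMax - 4 * N - S - 7)).toNat *
      (P.yMax + 2 + (n + 5 : ℕ) + 1 - (P.yMax + 2 - 1)).toNat ≤
      (19 * N ^ 2 + 2 * S) * (n + 7) := Nat.mul_le_mul (by omega) (by omega)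
  have e3 : (X + 1 - (X - 1 - P'.width)).toNat *
      (P.yMax + 2 + n + 5 + P'.height + 1 + 1 - (P.yMax + 2)).toNat ≤ (3 * N) * ((n + 8) * N) :=
    Nat.mul_le_mul (by omega) (by
      have : n + N + 7 ≤ (n + 8) * N := by nlinarith
      omega)
  refine (Nat.add_le_add (Nat.add_le_add e1 e2) e3).trans ?_
  nlinarith [Nat.zero_le (n * S), Nat.zero_le (n * N ^ 2)]

/-- A set of pixels that contains a triangle has quadratic size. -/
theorem sq_le_card_of_triangle {N : ℕ} {x y : ℤ} {A : Finset Pixel}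
    (h : ∀ k : ℕ, k < N → ∀ u, x ≤ u → u ≤ x + k → (u, y + k) ∈ A) : N ^ 2 ≤ 2 * A.card := by
  have h1 : (((Finset.range N).sigma fun k => Finset.range (k + 1)).image
      fun q => ((x + q.2, y + q.1) : Pixel)) ⊆ A := by
    intro p hp
    obtain ⟨⟨k, i⟩, hq, rfl⟩ := Finset.mem_image.1 hp
    simp only [Finset.mem_sigma, Finset.mem_range] at hq
    exact h k hq.1 _ (by dsimp only; omega) (by dsimp only; omega)
  have h2 := Finset.card_le_card h1
  rw [Finset.card_image_of_injective, Finset.card_sigma] at h2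
  · simp only [Finset.card_range] at h2
    have h3 : N ^ 2 ≤ 2 * ∑ k ∈ Finset.range N, (k + 1) := by
      clear * -
      induction N with
      | zero => simp
      | succ N ih => rw [Finset.sum_range_succ]; nlinarith
    omega
  · rintro ⟨k, i⟩ ⟨k', i'⟩ h
    simp only [Prod.mk.injEq] at h
    obtain rfl : k = k' := by omega
    obtain rfl : i = i' := by omega
    rfl

end TileRobot

open TileRobot
theorem mainTheorem2 {Γ Λ : Type*} [Inhabited Γ] [Finite Γ] [Inhabited Λ] [Finite Λ]
    (M : Turing.TM0.Machine Γ Λ)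
    (letter : Option Bool → Γ) (hletter : Function.Injective letter)
    (hblank : letter none = default) :
    ∃ (Q : Type) (_ : Finite Q) (R : Robot Q) (C : ℕ),
      ∀ (N : ℕ) (P₁ P₂ : Polyomino), P₁.tiles.card = N → P₂.tiles.card = N →
      ∀ T : ℕ, TransformsIn M (P₁.encode.map letter) (P₂.encode.map letter) T →
      ∀ s ∈ P₁.tiles, ∃ t : ℕ,
        HaltsIn R.step (R.init P₁ s) t ∧
        P₂.IsTranslate (R.config P₁ s t).tiles ∧
        R.auxiliaryTiles P₁ s t ≤
          C * (P₁.boundary.card + P₂.boundary.card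
            + tmAdditionalSpace M (P₁.encode.map letter) T) ∧
        t ≤ C * (N ^ 4 + T) ∧
        R.additionalSpace P₁ s t ≤
          C * (N ^ 2 + tmAdditionalSpace M (P₁.encode.map letter) T) ∧
        N ^ 2 + tmAdditionalSpace M (P₁.encode.map letter) T ≤
          C * R.additionalSpace P₁ s t := by
  obtain ⟨n, ⟨e⟩⟩ := Finite.exists_equiv_fin Γ
  obtain ⟨k, ⟨eΛ⟩⟩ := Finite.exists_equiv_fin Λ
  -- One constant for all bounds; it depends on `M` only through the number `n` of letters.
  refine ⟨_, (transform M letter e eΛ).fin, (transform M letter e eΛ).toRobot, 1000 * n + 20000, ?_⟩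
  rintro N P P' rfl hcard τ htrans s hs
  have hw := P.width_le
  have hh := P.height_le
  have hw2 := P'.width_le
  have hpos := P.width_pos
  obtain ⟨tr, w', htr, h1, h2, ⟨z, h3⟩, h4, h5⟩ :=
    transform_trace (e := e) (eΛ := eΛ) hs hcard hletter hblank htrans le_rfl
  obtain ⟨r1, r2, r3, r4⟩ := htr.robot
  refine ⟨tr.length, r1, ?_, ?_, ?_, ?_, ?_⟩
  · exact (congrArg P'.IsTranslate r2).mpr h1
  · have hK : ((Finset.range (tr.length + 1)).sup fun i =>
        ((transform M letter e eΛ).toRobot.config P s i).tiles.card) ≤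
        P.tiles.card + P.width + P.height + 3 * P'.width +
          tmAdditionalSpace M (P.encode.map letter) τ + n + 50 := by
      refine Finset.sup_le fun i hi => ?_
      obtain ⟨x, hx, -, e2⟩ := r3 i (by simpa [Nat.lt_succ_iff] using hi)
      refine (congrArg Finset.card e2).trans_le ?_
      rcases h3 x hx with (h | h) | h
      exacts [h.2.2.2.2, h.2.2.2.2, h.2.2.2.2]
    unfold Robot.auxiliaryTiles
    generalize tmAdditionalSpace M (P.encode.map letter) τ = S at *
    -- The boundary is not empty, so terms depending only on the alphabet are absorbed.
    have e3 : n * 1 ≤ n * (P.boundary.card + P'.boundary.card + S) :=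
      Nat.mul_le_mul_left _ (by omega)
    have e4 : (1000 * n + 20000) * (P.boundary.card + P'.boundary.card + S) =
      1000 * (n * (P.boundary.card + P'.boundary.card + S)) +
        20000 * (P.boundary.card + P'.boundary.card + S) := by ring
    rw [e4]
    generalize n * (P.boundary.card + P'.boundary.card + S) = m at *
    omega
  · exact h2.trans (Nat.mul_le_mul_right _ (by omega))
  · refine card_visited_le (X := z) (K := P.tiles.card + P.width + P.height + 3 * P'.width +
      tmAdditionalSpace M (P.encode.map letter) τ + n + 50) hcard fun p hp => ?_
    obtain ⟨i, hi, rfl⟩ := Finset.mem_image.1 (Finset.mem_sdiff.1 hp).1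
    obtain ⟨x, hx, e1, -⟩ := r3 i (by simpa [Nat.lt_succ_iff] using hi)
    exact ⟨x, e1, h3 x hx⟩
  -- Every visited pixel above the top row of the box counts as additional space.
  · have hmem : ∀ p : Pixel, P.yMax < p.2 → (∃ x ∈ tr, x.pos = p) →
        p ∈ ((Finset.range (tr.length + 1)).image fun i =>
          ((transform M letter e eΛ).toRobot.config P s i).pos) \ P.box := by
      rintro p hp ⟨x, hx, rfl⟩
      obtain ⟨i, hi, e1⟩ := r4 x hx
      refine Finset.mem_sdiff.2 ⟨Finset.mem_image.2 ⟨i, by simpa [Nat.lt_succ_iff] using hi, e1⟩, ?_⟩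
      intro hbox
      have := (Finset.mem_Icc.1 hbox).2.2
      dsimp only at this
      omega
    have e1 := sq_le_card_of_triangle (N := P.tiles.card) (x := P.xMax + 2)
      (y := P.yMax + 2 + n + 5) fun k hk u hu hu' =>
        hmem (u, P.yMax + 2 + n + 5 + k) (by dsimp only; omega) (h4 k hk u hu hu')
    -- Projecting the visited pixels outside the box to their columns reaches every additional cell.
    have e2 : tmAdditionalSpace M (P.encode.map letter) τ ≤
        (transform M letter e eΛ).toRobot.additionalSpace P s tr.length := by
      refine (Finset.card_le_card (t := Finset.image (fun p : Pixel => p.1 - origin n P)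
        (((Finset.range (tr.length + 1)).image fun i =>
          ((transform M letter e eΛ).toRobot.config P s i).pos) \ P.box)) fun j hj => ?_).trans
        Finset.card_image_le
      obtain ⟨x, hx, hx1, hx2⟩ := h5 j hj
      exact Finset.mem_image.2 ⟨x.pos, hmem _ hx2 ⟨x, hx, rfl⟩, by omega⟩
    change _ ≤ 2 * (transform M letter e eΛ).toRobot.additionalSpace P s tr.length at e1
    -- The triangle needs a factor 2 and the additional cells a factor 1.
    have e3 : 3 * (transform M letter e eΛ).toRobot.additionalSpace P s tr.length ≤
      (1000 * n + 20000) * (transform M letter e eΛ).toRobot.additionalSpace P s tr.length :=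
      Nat.mul_le_mul_right _ (by omega)
    omega
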